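/- **Proposition 1.5.** *Conventions.* Let $X$ be a complex manifold, $\mathcal O_X$, $\Theta_X$, $\mathcal D_X$ its sheaves of holomorphic functions, vector fields and differential operators, $n\ge 0$, and let $M_1^\bullet,\dots,M_n^\bullet$ be bounded complexes of right $\mathcal D_X$-modules. Write $pr_i:X^n\to X$ for the projections. * For complexes of sheaves of $\mathbf C$-modules $K_i^\bullet$ on $X$, ${}_{\mathbf C}\boxtimes_{i}K_i^\bullet$ is the complex on $X^n$ with components $\bigoplus_{p_1+\dots+p_n=j}pr_1^{-1}K_1^{p_1}\otimes_{\mathbf C}\cdots\otimes_{\mathbf C}pr_n^{-1}K_n^{p_n}$ and differential $\sum_i(-1)^{p_1+\cdots+p_{i-1}}d_i$. For complexes of right $\mathcal D_X$-modules, ${}_{\mathcal O}\boxtimes_i M_i^\bullet$ is the complex of right $\mathcal D_{X^n}$-modules defined in the same way from the external products of $\mathcal D$-modules, i.e. from the scalar extension of ${}_{\mathbf C}\boxtimes_i M_i^{p_i}$ from ${}_{\mathbf C}\boxtimes_i\mathcal O_X$ to $\mathcal O_{X^n}$ (equivalently, from ${}_{\mathbf C}\boxtimes_i\mathcal D_X$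 to $\mathcal D_{X^n}$). * For a right $\mathcal D_Y$-module $M$ on a complex manifold $Y$, $\mathrm{DR}_Y(M)$ has the component $M\otimes_{\mathcal O}\bigwedge^{k}\Theta_Y$ in degree $-k$ and the differential $$\delta(m\otimes\xi_1\wedge\cdots\wedge\xi_k)=\sum_i(-1)^{i-1}m\xi_i\otimes\xi_1\wedge\cdots\widehat{\xi_i}\cdots\wedge\xi_k+\sum_{i<j}(-1)^{i+j}m\otimes[\xi_i,\xi_j]\wedge\xi_1\wedge\cdots\widehat{\xi_i}\cdots\widehat{\xi_j}\cdots\wedge\xi_k .$$ For a complex $M^\bullet$, $\mathrm{DR}_Y(M^\bullet)$ is the total complex of the $M^p\otimes\bigwedge^k\Theta_Y$ (total degree $p-k$) with differential $d+(-1)^p\delta$. * $\sigma\in\mathfrak S_n$ acts on $X^n$ by $(\sigma x)_i=x_{\sigma^{-1}(i)}$, and $\sigma_*$ is the direct image (of sheaves, and of $\mathcal D$-modules) under this biholomorphic map. *Statement.* 1. There is a unique morphism of complexes $c_M:{}_{\mathbf C}\boxtimes_{i=1}^n\mathrm{DR}_X(M_i^\bullet)\to\mathrm{DR}_{X^n}({}_{\mathcal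 O}\boxtimes_{i=1}^nM_i^\bullet)$ such that, for local sections $m_i\in M_i^{p_i}$ and decomposable $\eta_i=\xi_{i,1}\wedge\cdots\wedge\xi_{i,k_i}\in\bigwedge^{-q_i}\Theta_X$, $q_i=-k_i$, $$\boxtimes_i(m_i\otimes\eta_i)\mapsto(-1)^{\sum_{i>j}p_iq_j}\,(\boxtimes_i m_i)\otimes(pr_1^*\eta_1\wedge\cdots\wedge pr_n^*\eta_n).$$ 2. For every $\sigma\in\mathfrak S_n$ there are unique isomorphisms of complexes $$\sigma^\#:{}_{\mathbf C}\boxtimes_iK_i^\bullet\xrightarrow{\ \sim\ }\sigma_*\bigl({}_{\mathbf C}\boxtimes_iK_{\sigma(i)}^\bullet\bigr)\ \text{ for } K_i^\bullet=\mathrm{DR}_X(M_i^\bullet),\qquad \sigma^\#:{}_{\mathcal O}\boxtimes_iM_i^\bullet\xrightarrow{\ \sim\ }\sigma_*\bigl({}_{\mathcal O}\boxtimes_iM_{\sigma(i)}^\bullet\bigr)$$ such that for local sections $m_i$ of degree $p_i$ $$\boxtimes_im_i\mapsto(-1)^{\nu}\,\sigma_*\bigl(\boxtimes_im_{\sigma(i)}\bigr),\qquad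 \nu=\sum_{i<j,\ \sigma(j)<\sigma(i)}p_{\sigma(i)}p_{\sigma(j)} .$$ Moreover, for $N^\bullet={}_{\mathcal O}\boxtimes_iM^\bullet_{\sigma(i)}$ there is a unique isomorphism of complexes $e:\mathrm{DR}_{X^n}(\sigma_*N^\bullet)\xrightarrow{\sim}\sigma_*\mathrm{DR}_{X^n}(N^\bullet)$ given on local sections by $\sigma_*m\otimes v_1\wedge\cdots\wedge v_k\mapsto\sigma_*(m\otimes\sigma^*v_1\wedge\cdots\wedge\sigma^*v_k)$, where $\sigma^*v$ is the vector field corresponding to $v$ under $\sigma$. 3. With these morphisms the diagram $$\begin{matrix}{}_{\mathbf C}\boxtimes_i\mathrm{DR}_X(M_i^\bullet)&\xrightarrow{\ \sigma^\#\ }&\sigma_*\bigl({}_{\mathbf C}\boxtimes_i\mathrm{DR}_X(M_{\sigma(i)}^\bullet)\bigr)\\ {\scriptstyle c_M}\big\downarrow&&\big\downarrow{\scriptstyle e^{-1}\circ\,\sigma_*(c_{M_{\sigma}})}\\ \mathrm{DR}_{X^n}\bigl({}_{\mathcal O}\boxtimes_iM_i^\bullet\bigr)&\xrightarrow{\mathrm{DR}(\sigma^\#)}&\mathrm{DR}_{X^n}\bigl(\sigma_*({}_{\mathcal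 O}\boxtimes_iM_{\sigma(i)}^\bullet)\bigr)\end{matrix}$$ commutes, where $c_{M_\sigma}$ is the morphism of 1. for the family $(M_{\sigma(i)}^\bullet)_i$. -/

import Mathlib

open CategoryTheory Limits TopologicalSpace Opposite
open scoped Manifold ContDiff TensorProduct

set_option linter.unusedSectionVars false
set_option linter.unusedSimpArgs false

namespace DRSym
noncomputable section

universe u v w

section Algebra

variable {A L M : Type*} [CommRing A] [Algebra ℂ A] [LieRing L] [LieAlgebra ℂ L] [Module A L]
  [IsScalarTower ℂ A L] [LieRingModule L A] [LieRinehartRing A L]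
  [AddCommGroup M] [Module ℂ M] [Module A M] [IsScalarTower ℂ A M]

/-- A right action of vector fields `L` on an `A`-module `M`, written `m ξ = act ξ m`, as it is
induced by a right module structure over differential operators: `m [ξ, η] = (m ξ) η - (m η) ξ`,
`m (a ξ) = (m a) ξ` and `(m ξ) a = (m a) ξ + m (ξ a)`. -/
structure RightAction (A L M : Type*) [CommRing A] [Algebra ℂ A] [LieRing L] [LieAlgebra ℂ L]
    [Module A L] [LieRingModule L A] [AddCommGroup M] [Module ℂ M] [Module A M] where
  act : L →ₗ[ℂ] M →ₗ[ℂ] M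
  act_lie (x y : L) (m : M) : act ⁅x, y⁆ m = act y (act x m) - act x (act y m)
  act_smul (a : A) (x : L) (m : M) : act (a • x) m = act x (a • m)
  smul_act (a : A) (x : L) (m : M) : a • act x m = act x (a • m) + ⁅x, a⁆ • m

variable (A L M) in
/-- `M ⊗ ⋀ᵏ L` over `A`. -/
abbrev Polyvec (k : ℕ) : Type _ := M ⊗[A] (⋀[A]^k L)

variable (A) in
/-- `m ⊗ (v₁ ∧ ⋯ ∧ vₖ)`. -/
def pv {k : ℕ} (m : M) (v : Fin k → L) : Polyvec A L M k := m ⊗ₜ exteriorPower.ιMulti A k v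

lemma pv_induction {k : ℕ} {p : Polyvec A L M k → Prop} (t : Polyvec A L M k) (h0 : p 0)
    (h1 : ∀ m v, p (pv A m v)) (h2 : ∀ s t, p s → p t → p (s + t)) : p t := by
  induction t using TensorProduct.induction_on with
  | zero => exact h0
  | add s t hs ht => exact h2 s t hs ht
  | tmul m η =>
    have hη : η ∈ Submodule.span A (Set.range (exteriorPower.ιMulti A k (M := L))) := by
      rw [exteriorPower.ιMulti_span]; trivial
    induction hη using Submodule.span_induction generalizing m with
    | mem x hx => obtain ⟨v, rfl⟩ := hx; exact h1 m v
    | zero => simpa using h0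
    | add x y _ _ hx hy => rw [TensorProduct.tmul_add]; exact h2 _ _ (hx m) (hy m)
    | smul a x _ hx => rw [← TensorProduct.smul_tmul]; exact hx (a • m)

variable (A L M) in
/-- `v ↦ (m ↦ m ⊗ (v₁ ∧ ⋯ ∧ vₖ))`. -/
def pvAlt (k : ℕ) : L [⋀^Fin k]→ₗ[ℂ] (M →ₗ[ℂ] Polyvec A L M k) where
  toFun v :=
    { toFun := fun m => pv A m v
      map_add' := fun _ _ => TensorProduct.add_tmul _ _ _
      map_smul' := fun _ _ => (TensorProduct.smul_tmul' _ _ _).symm }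
  map_update_add' v i x y := by
    ext m; simp [pv, AlternatingMap.map_update_add, TensorProduct.tmul_add]
  map_update_smul' v i c x := by
    ext m
    have : c • x = (algebraMap ℂ A c) • x := by rw [algebraMap_smul]
    simp only [pv, this, AlternatingMap.map_update_smul, LinearMap.coe_mk, AddHom.coe_mk,
      LinearMap.smul_apply]
    rw [← TensorProduct.smul_tmul, algebraMap_smul, TensorProduct.smul_tmul']
  map_eq_zero_of_eq' v i j h hij := by
    ext m
    simp [pv, (exteriorPower.ιMulti A k).map_eq_zero_of_eq v h hij]

@[simp] lemma pvAlt_apply {k : ℕ} (v : Fin k → L) (m : M) : pvAlt A L M k v m = pv A m v := rfl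

/-- `m ⊗ η ↦ m ⊗ (x ∧ η)`. -/
def wedgeL (k : ℕ) (x : L) : Polyvec A L M k →ₗ[ℂ] Polyvec A L M (k + 1) :=
  (LinearMap.lTensor M (exteriorPower.alternatingMapLinearEquiv
    ((exteriorPower.ιMulti A (k + 1)).curryLeft x))).restrictScalars ℂ

@[simp] lemma wedgeL_pv {k : ℕ} (x : L) (m : M) (v : Fin k → L) :
    wedgeL k x (pv A m v) = pv A m (Fin.cons x v : Fin (k + 1) → L) := by
  simp [wedgeL, pv]; rfl

/-- The alternating map
`v ↦ (m ↦ ∑ᵢ (-1)ⁱ m vᵢ ⊗ v₀ ∧ ⋯ v̂ᵢ ⋯ ∧ vₖ + ∑_{i < j} (-1)ⁱ⁺ʲ m ⊗ [vᵢ, vⱼ] ∧ v₀ ∧ ⋯ v̂ᵢ ⋯ v̂ⱼ ⋯ ∧ vₖ)`.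
The second sum is half of a sum over all ordered pairs `i ≠ j`. -/
def koszulAlt (ρ : RightAction A L M) :
    ∀ k : ℕ, L [⋀^Fin (k + 1)]→ₗ[ℂ] (M →ₗ[ℂ] Polyvec A L M k)
  | 0 => actAlt ρ 0
  | k + 1 => actAlt ρ (k + 1) - (2⁻¹ : ℂ) • bracketAlt A L M k
  where
  /-- `v ↦ (m ↦ ∑ᵢ (-1)ⁱ m vᵢ ⊗ v₀ ∧ ⋯ v̂ᵢ ⋯ ∧ vₖ)` -/
  actAlt (ρ : RightAction A L M) (k : ℕ) : L [⋀^Fin (k + 1)]→ₗ[ℂ] (M →ₗ[ℂ] Polyvec A L M k) :=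
    AlternatingMap.alternatizeUncurryFin
      { toFun := fun x => (LinearMap.lcomp ℂ _ (ρ.act x)).compAlternatingMap (pvAlt A L M k)
        map_add' := fun x y => by ext v m; simp [pv, TensorProduct.add_tmul]
        map_smul' := fun c x => by ext v m; simp }
  /-- `v ↦ (m ↦ ∑ᵢ (-1)ⁱ ∑ⱼ (-1)ʲ m ⊗ [vᵢ, wⱼ] ∧ w₀ ∧ ⋯ ŵⱼ ⋯ ∧ wₖ)`, where `w` is `v` without
  its entry `vᵢ` -/
  bracketAlt (A L M : Type _) [CommRing A] [Algebra ℂ A] [LieRing L] [LieAlgebra ℂ L] [Module A L]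
      [IsScalarTower ℂ A L] [AddCommGroup M] [Module ℂ M] [Module A M] [IsScalarTower ℂ A M]
      (k : ℕ) : L [⋀^Fin (k + 2)]→ₗ[ℂ] (M →ₗ[ℂ] Polyvec A L M (k + 1)) :=
    AlternatingMap.alternatizeUncurryFin (AlternatingMap.alternatizeUncurryFinLM ∘ₗ
      { toFun := fun x => (pvAlt A L M (k + 1)).curryLeft ∘ₗ
          (LieModule.toEnd ℂ L L x : L →ₗ[ℂ] L)
        map_add' := fun x y => by ext z v m; simp
        map_smul' := fun c x => by ext z v m; simp })

lemma removeNth_succ_cons {k : ℕ} (x : L) (v : Fin (k + 1) → L) (i : Fin (k + 1)) :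
    Fin.removeNth i.succ (Fin.cons x v : Fin (k + 2) → L)
      = (Fin.cons x (i.removeNth v) : Fin (k + 1) → L) :=
  Fin.cons_comp_succ_succAbove ..

lemma removeNth_zero_cons {k : ℕ} (x : L) (v : Fin k → L) :
    Fin.removeNth 0 (Fin.cons x v : Fin (k + 1) → L) = v := by
  ext; simp [Fin.removeNth_apply]

lemma actAlt_cons (ρ : RightAction A L M) (k : ℕ) (x : L) (v : Fin (k + 1) → L) (m : M) :
    koszulAlt.actAlt ρ (k + 1) (Fin.cons x v : Fin (k + 2) → L) m =
      pv A (ρ.act x m) v - wedgeL k x (koszulAlt.actAlt ρ k v m) := by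
  simp only [koszulAlt.actAlt, AlternatingMap.alternatizeUncurryFin_apply]
  rw [Fin.sum_univ_succ]
  simp [removeNth_succ_cons, removeNth_zero_cons, pow_succ, sub_eq_add_neg]

lemma pv_cons_removeNth {k : ℕ} (z : L) (m : M) (v : Fin (k + 1) → L) (j : Fin (k + 1)) :
    (-1 : ℤ) ^ (j : ℕ) • pv A m (Fin.cons z (j.removeNth v) : Fin (k + 1) → L) =
      pv A m (Function.update v j z) := by
  have := (pvAlt A L M (k + 1)).map_insertNth j z (j.removeNth v)
  rw [Fin.insertNth_removeNth] at this
  have := congr($this m)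
  simp only [pvAlt_apply, LinearMap.smul_apply] at this
  rw [this]; rfl

lemma pv_cons_cons {k : ℕ} (x y : L) (m : M) (v : Fin k → L) :
    pv A m (Fin.cons x (Fin.cons y v : Fin (k + 1) → L) : Fin (k + 2) → L) =
      - pv A m (Fin.cons y (Fin.cons x v : Fin (k + 1) → L) : Fin (k + 2) → L) := by
  have := (pvAlt A L M (k + 2)).map_swap (Fin.cons y (Fin.cons x v : Fin (k + 1) → L))
    (i := 0) (j := 1) (by simp)
  have h2 : (Fin.cons y (Fin.cons x v : Fin (k + 1) → L) : Fin (k + 2) → L) ∘ Equiv.swap 0 1 =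
      Fin.cons x (Fin.cons y v : Fin (k + 1) → L) := by
    ext i
    refine Fin.cases ?_ (fun i => Fin.cases ?_ (fun i => ?_) i) i
    · simp
    · simp
    · rw [Function.comp_apply, Equiv.swap_apply_of_ne_of_ne (Fin.succ_ne_zero _)
        (fun h => Fin.succ_ne_zero i (Fin.succ_injective _ (h.trans Fin.succ_zero_eq_one.symm)))]
      rfl
  rw [h2] at this
  simpa using congr($this m)

lemma pv_cons_neg {k : ℕ} (x : L) (m : M) (v : Fin k → L) :
    pv A m (Fin.cons (-x) v : Fin (k + 1) → L) = - pv A m (Fin.cons x v : Fin (k + 1) → L) := by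
  have h := (pvAlt A L M (k + 1)).map_update_neg (Fin.cons x v : Fin (k + 1) → L) 0 x
  simpa using DFunLike.congr_fun h m

lemma bracketAlt_apply (k : ℕ) (v : Fin (k + 2) → L) (m : M) :
    koszulAlt.bracketAlt A L M k v m = ∑ i : Fin (k + 2), (-1 : ℤ) ^ (i : ℕ) •
      ∑ j : Fin (k + 1), (-1 : ℤ) ^ (j : ℕ) •
      pv A m (Fin.cons ⁅v i, i.removeNth v j⁆ (j.removeNth (i.removeNth v)) : Fin (k + 1) → L) := by
  simp only [koszulAlt.bracketAlt, AlternatingMap.alternatizeUncurryFin_apply]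
  simp [AlternatingMap.alternatizeUncurryFin_apply]
  rfl

lemma bracketAlt_zero_cons (x : L) (v : Fin 1 → L) (m : M) :
    koszulAlt.bracketAlt A L M 0 (Fin.cons x v : Fin 2 → L) m =
      (2 : ℂ) • ∑ j, pv A m (Function.update v j ⁅x, v j⁆) := by
  have e (j : Fin 1) := (pv_cons_removeNth (A := A) ⁅x, v j⁆ m v j).symm
  rw [bracketAlt_apply, Fin.sum_univ_succ]
  simp only [e, Fin.val_zero, pow_zero, one_smul, Fin.cons_zero, removeNth_zero_cons,
    Fin.val_succ, Fin.cons_succ, removeNth_succ_cons, Finset.univ_unique, Finset.sum_singleton,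
    Fin.default_eq_zero, two_smul ℂ]
  congr 1
  · simp
  · rw [Fin.sum_univ_succ]
    simp [removeNth_zero_cons, ← pv_cons_neg]

lemma bracketAlt_cons (k : ℕ) (x : L) (v : Fin (k + 2) → L) (m : M) :
    koszulAlt.bracketAlt A L M (k + 1) (Fin.cons x v : Fin (k + 3) → L) m =
      (2 : ℂ) • ∑ j, pv A m (Function.update v j ⁅x, v j⁆)
        - wedgeL (k + 1) x (koszulAlt.bracketAlt A L M k v m) := by
  have e (j : Fin (k + 2)) := (pv_cons_removeNth (A := A) ⁅x, v j⁆ m v j).symm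
  rw [bracketAlt_apply, Fin.sum_univ_succ]
  simp only [e, Fin.val_zero, pow_zero, one_smul, Fin.cons_zero, removeNth_zero_cons,
    Fin.val_succ, Fin.cons_succ, removeNth_succ_cons, two_smul ℂ, add_sub_assoc]
  congr 1
  have h (i : Fin (k + 2)) : ∑ j : Fin (k + 2), (-1 : ℤ) ^ (j : ℕ) • pv A m
      (Fin.cons ⁅v i, (Fin.cons x (i.removeNth v) : Fin (k + 2) → L) j⁆
        (j.removeNth (Fin.cons x (i.removeNth v) : Fin (k + 2) → L)) : Fin (k + 2) → L) =
      - pv A m (Fin.cons ⁅x, v i⁆ (i.removeNth v) : Fin (k + 2) → L)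
      + wedgeL (k + 1) x (∑ j : Fin (k + 1), (-1 : ℤ) ^ (j : ℕ) • pv A m
        (Fin.cons ⁅v i, i.removeNth v j⁆ (j.removeNth (i.removeNth v)) : Fin (k + 1) → L)) := by
    rw [Fin.sum_univ_succ, map_sum]
    congr 1
    · rw [← pv_cons_neg, lie_skew]
      simp [removeNth_zero_cons]
    · refine Finset.sum_congr rfl fun j _ => ?_
      rw [map_zsmul, wedgeL_pv, pv_cons_cons]
      simp [removeNth_succ_cons, pow_succ]
  simp only [h, bracketAlt_apply, map_sum, map_zsmul, smul_add, Finset.sum_add_distrib, pow_succ]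
  rw [sub_eq_add_neg]
  congr 1
  · simp only [mul_neg, mul_one, smul_neg, neg_smul, neg_neg]
  · simp

lemma koszulAlt_cons (ρ : RightAction A L M) (k : ℕ) (x : L) (v : Fin (k + 1) → L) (m : M) :
    koszulAlt ρ (k + 1) (Fin.cons x v : Fin (k + 2) → L) m =
      pv A (ρ.act x m) v - ∑ j, pv A m (Function.update v j ⁅x, v j⁆)
        - wedgeL k x (koszulAlt ρ k v m) := by
  cases k with
  | zero =>
    simp only [koszulAlt, AlternatingMap.sub_apply, AlternatingMap.smul_apply,
      LinearMap.sub_apply, LinearMap.smul_apply, actAlt_cons, bracketAlt_zero_cons]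
    rw [inv_smul_smul₀ two_ne_zero]
    abel
  | succ k =>
    simp only [koszulAlt, AlternatingMap.sub_apply, AlternatingMap.smul_apply,
      LinearMap.sub_apply, LinearMap.smul_apply, actAlt_cons, bracketAlt_cons, smul_sub, map_sub,
      map_smul]
    rw [inv_smul_smul₀ two_ne_zero]
    abel

lemma koszulAlt_zero_cons (ρ : RightAction A L M) (x : L) (v : Fin 0 → L) (m : M) :
    koszulAlt ρ 0 (Fin.cons x v : Fin 1 → L) m = pv A (ρ.act x m) v := by
  simp [koszulAlt, koszulAlt.actAlt, AlternatingMap.alternatizeUncurryFin_apply,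
    removeNth_zero_cons]

lemma pv_smul {k : ℕ} (a : A) (m : M) (v : Fin k → L) : pv A (a • m) v = a • pv A m v :=
  (TensorProduct.smul_tmul' _ _ _).symm

lemma pv_update_smul {k : ℕ} (a : A) (m : M) (v : Fin k → L) (i : Fin k) (x : L) :
    pv A m (Function.update v i (a • x)) = a • pv A m (Function.update v i x) := by
  simp [pv, AlternatingMap.map_update_smul]

lemma pv_update_add {k : ℕ} (m : M) (v : Fin k → L) (i : Fin k) (x y : L) :
    pv A m (Function.update v i (x + y)) =
      pv A m (Function.update v i x) + pv A m (Function.update v i y) := by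
  simp [pv, AlternatingMap.map_update_add, TensorProduct.tmul_add]

lemma wedgeL_smul {k : ℕ} (a : A) (x : L) (t : Polyvec A L M k) :
    wedgeL k x (a • t) = a • wedgeL k x t := by
  simp [wedgeL]

lemma wedgeL_smul_left {k : ℕ} (a : A) (x : L) (t : Polyvec A L M k) :
    wedgeL k (a • x) t = a • wedgeL k x t := by
  induction t using pv_induction with
  | h0 => simp
  | h2 s t hs ht => simp [hs, ht]
  | h1 m v =>
    have := pv_update_smul a m (Fin.cons x v : Fin (k + 1) → L) 0 x
    simpa using this

/-- The defect of linearity of the Koszul differential in `m`. -/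
lemma koszulAlt_smul (ρ : RightAction A L M) (k : ℕ) (a : A) (v : Fin (k + 1) → L) (m : M) :
    koszulAlt ρ k v (a • m) = a • koszulAlt ρ k v m -
      ∑ j : Fin (k + 1), (-1 : ℤ) ^ (j : ℕ) • pv A (⁅v j, a⁆ • m) (j.removeNth v) := by
  have h : ∀ m, koszulAlt.actAlt ρ k v m =
      ∑ j : Fin (k + 1), (-1 : ℤ) ^ (j : ℕ) • pv A (ρ.act (v j) m) (j.removeNth v) := by
    intro m; simp [koszulAlt.actAlt, AlternatingMap.alternatizeUncurryFin_apply]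
  have h1 : koszulAlt.actAlt ρ k v (a • m) = a • koszulAlt.actAlt ρ k v m -
      ∑ j : Fin (k + 1), (-1 : ℤ) ^ (j : ℕ) • pv A (⁅v j, a⁆ • m) (j.removeNth v) := by
    rw [h, h, Finset.smul_sum, ← Finset.sum_sub_distrib]
    refine Finset.sum_congr rfl fun j _ => ?_
    rw [smul_comm a, ← smul_sub, ← pv_smul, ρ.smul_act]
    simp [pv, TensorProduct.add_tmul]
  cases k with
  | zero => exact h1
  | succ k =>
    simp only [koszulAlt, AlternatingMap.sub_apply, AlternatingMap.smul_apply,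
      LinearMap.sub_apply, LinearMap.smul_apply, h1, bracketAlt_apply, pv_smul]
    simp only [← smul_comm a, ← Finset.smul_sum, smul_sub]
    abel

lemma koszulAlt_cons_smul (ρ : RightAction A L M) (k : ℕ) (a : A) (x : L) (v : Fin k → L) (m : M) :
    koszulAlt ρ k (Fin.cons (a • x) v : Fin (k + 1) → L) m =
      koszulAlt ρ k (Fin.cons x v : Fin (k + 1) → L) (a • m) := by
  cases k with
  | zero => simp [koszulAlt_zero_cons, ρ.act_smul]
  | succ k =>
    have hb (y : L) : ⁅a • x, y⁆ = a • ⁅x, y⁆ - ⁅y, a⁆ • x := by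
      rw [← lie_skew, LieRinehartRing.leibniz_smul_right, ← lie_skew x y, smul_neg]; abel
    have e (j : Fin (k + 1)) := pv_cons_removeNth (A := A) x (⁅v j, a⁆ • m) v j
    simp only [pv_smul] at e
    have hs (y z : L) (j : Fin (k + 1)) : pv A m (Function.update v j (y - z)) =
      pv A m (Function.update v j y) - pv A m (Function.update v j z) := by
      rw [eq_sub_iff_add_eq, ← pv_update_add, sub_add_cancel]
    rw [koszulAlt_cons, koszulAlt_cons]
    simp only [koszulAlt_smul, ρ.act_smul, hb, wedgeL_smul_left, hs,
      pv_update_smul, Finset.sum_sub_distrib, map_sub, map_sum, map_zsmul, wedgeL_pv, e, pv_smul,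
      wedgeL_smul, ← Finset.smul_sum]
    abel

/-- `M → P` with `A` acting through `M`. -/
def DomHom (A M P : Type*) [CommRing A] [Algebra ℂ A] [AddCommGroup M] [Module ℂ M] [Module A M]
    [IsScalarTower ℂ A M] [AddCommGroup P] [Module ℂ P] : Type _ := M →ₗ[ℂ] P

/-- The underlying map of an element of `DomHom A M P`. -/
def DomHom.eval {P : Type*} [AddCommGroup P] [Module ℂ P] (f : DomHom A M P) : M →ₗ[ℂ] P := f

section
variable {P : Type*} [AddCommGroup P] [Module ℂ P]
instance : AddCommGroup (DomHom A M P) := inferInstanceAs (AddCommGroup (M →ₗ[ℂ] P))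
instance : Module A (DomHom A M P) where
  smul a f := LinearMap.comp (DomHom.eval f) (Algebra.lsmul ℂ ℂ M a : M →ₗ[ℂ] M)
  one_smul f := by apply LinearMap.ext; intro m; exact congrArg f.eval (one_smul A m)
  mul_smul a b f := by
    apply LinearMap.ext; intro m
    exact congrArg f.eval ((mul_comm a b ▸ mul_smul b a m))
  smul_zero a := by apply LinearMap.ext; intro m; rfl
  smul_add a f g := by apply LinearMap.ext; intro m; rfl
  add_smul a b f := by
    apply LinearMap.ext; intro m
    exact (congrArg f.eval (add_smul a b m)).trans (LinearMap.map_add f.eval _ _)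
  zero_smul f := by
    apply LinearMap.ext; intro m
    exact (congrArg f.eval (zero_smul A m)).trans (LinearMap.map_zero f.eval)
end

/-- The Koszul differential `M ⊗ ⋀ᵏ⁺¹ L → M ⊗ ⋀ᵏ L` as a function of the polyvector field. -/
def koszulLift (ρ : RightAction A L M) (k : ℕ) :
    (⋀[A]^(k + 1) L) →ₗ[A] DomHom A M (Polyvec A L M k) :=
  exteriorPower.alternatingMapLinearEquiv
    { toFun := fun v => koszulAlt ρ k v
      map_update_add' := fun {dec} v i x y => by
        obtain rfl : dec = instDecidableEqFin (k + 1) := Subsingleton.elim _ _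
        exact (koszulAlt ρ k).map_update_add v i x y
      map_update_smul' := fun {dec} v i a x => by
        obtain rfl : dec = instDecidableEqFin (k + 1) := Subsingleton.elim _ _
        have key (w : Fin (k + 1) → L) (y : L) (m : M) : koszulAlt ρ k (Function.update w 0 (a • y)) m =
            koszulAlt ρ k (Function.update w 0 y) (a • m) := by
          have hw (z : L) : Function.update w 0 z = (Fin.cons z (Fin.tail w) : Fin (k + 1) → L) := by
            conv_lhs => rw [← Fin.cons_self_tail w, Fin.update_cons_zero]
          rw [hw, hw, koszulAlt_cons_smul]
        apply LinearMap.ext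
        intro m
        change _ = koszulAlt ρ k (Function.update v i x) (a • m)
        by_cases hi : i = 0
        · subst hi; exact key v x m
        · have hc (z : L) : koszulAlt ρ k (Function.update v i z) =
              - koszulAlt ρ k (Function.update (v ∘ Equiv.swap i 0) 0 z) := by
            rw [← (koszulAlt ρ k).map_swap _ hi]
            rw [Function.update_comp_equiv, Function.comp_assoc]
            simp [← Equiv.Perm.coe_mul]
          rw [hc, hc, LinearMap.neg_apply, key, LinearMap.neg_apply]
      map_eq_zero_of_eq' := fun v i j h hij => (koszulAlt ρ k).map_eq_zero_of_eq v h hij }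

/-- The differential of the de Rham complex of a right module,
`m ⊗ v₀ ∧ ⋯ ∧ vₖ ↦ ∑ᵢ (-1)ⁱ m vᵢ ⊗ v₀ ∧ ⋯ v̂ᵢ ⋯ ∧ vₖ
  + ∑_{i < j} (-1)ⁱ⁺ʲ m ⊗ [vᵢ, vⱼ] ∧ v₀ ∧ ⋯ v̂ᵢ ⋯ v̂ⱼ ⋯ ∧ vₖ`. -/
def koszul (ρ : RightAction A L M) (k : ℕ) : Polyvec A L M (k + 1) →ₗ[ℂ] Polyvec A L M k :=
  let f : Polyvec A L M (k + 1) →+ Polyvec A L M k :=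
    TensorProduct.liftAddHom
      { toFun := fun m =>
          { toFun := fun η => (koszulLift ρ k η).eval m
            map_zero' := by rw [map_zero]; rfl
            map_add' := fun η θ => by rw [map_add]; rfl }
        map_zero' := by ext η; exact LinearMap.map_zero _
        map_add' := fun m n => by ext η; exact LinearMap.map_add _ _ _ }
      (fun a m η => by
        change _ = (koszulLift ρ k (a • η)).eval m
        rw [LinearMap.map_smul]; rfl)
  { f with
    map_smul' := fun c t => by
      induction t using TensorProduct.induction_on with
      | zero => simp
      | add s t hs ht =>
        rw [smul_add]
        exact ((f.map_add _ _).trans (congrArg₂ (· + ·) hs ht)).trans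
          ((smul_add _ _ _).symm.trans (congrArg (c • ·) (f.map_add s t).symm))
      | tmul m η =>
        rw [TensorProduct.smul_tmul']
        exact LinearMap.map_smul (koszulLift ρ k η).eval c m }

@[simp] lemma koszul_pv (ρ : RightAction A L M) (k : ℕ) (m : M) (v : Fin (k + 1) → L) :
    koszul ρ k (pv A m v) = koszulAlt ρ k v m := by
  change (koszulLift ρ k (exteriorPower.ιMulti A (k + 1) v)).eval m = _
  rw [koszulLift, exteriorPower.alternatingMapLinearEquiv_apply_ιMulti]
  rfl

lemma koszul_wedge_pv (ρ : RightAction A L M) (k : ℕ) (x : L) (m : M) (v : Fin (k + 1) → L) :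
    koszul ρ (k + 1) (wedgeL (k + 1) x (pv A m v)) + wedgeL k x (koszul ρ k (pv A m v)) =
      pv A (ρ.act x m) v - ∑ j, pv A m (Function.update v j ⁅x, v j⁆) := by
  rw [wedgeL_pv, koszul_pv, koszul_pv, koszulAlt_cons]; abel

/-- The Lie derivative on `M ⊗ ⋀ᵏ L`. -/
def lieD (ρ : RightAction A L M) (x : L) : ∀ k, Polyvec A L M k →ₗ[ℂ] Polyvec A L M k
  | 0 => koszul ρ 0 ∘ₗ wedgeL 0 x
  | k + 1 => koszul ρ (k + 1) ∘ₗ wedgeL (k + 1) x + wedgeL k x ∘ₗ koszul ρ k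

lemma lieD_pv (ρ : RightAction A L M) (x : L) (k : ℕ) (m : M) (v : Fin k → L) :
    lieD ρ x k (pv A m v) = pv A (ρ.act x m) v - ∑ j, pv A m (Function.update v j ⁅x, v j⁆) := by
  cases k with
  | zero => simp [lieD, koszulAlt_zero_cons]
  | succ k => exact koszul_wedge_pv ρ k x m v

lemma lieD_wedge (ρ : RightAction A L M) (x y : L) (k : ℕ) (t : Polyvec A L M k) :
    lieD ρ x (k + 1) (wedgeL k y t) = wedgeL k y (lieD ρ x k t) - wedgeL k ⁅x, y⁆ t := by
  induction t using pv_induction with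
  | h0 => simp
  | h2 s t hs ht => simp only [map_add, hs, ht]; abel
  | h1 m v =>
    simp only [wedgeL_pv, lieD_pv, map_sub, map_sum]
    rw [Fin.sum_univ_succ]
    simp only [Fin.cons_zero, Fin.update_cons_zero, Fin.cons_succ, ← Fin.cons_update]
    abel

lemma polyvec_induction {p : ∀ k, Polyvec A L M k → Prop}
    (h0 : ∀ m, p 0 (pv A m ![])) (hw : ∀ k x t, p k t → p (k + 1) (wedgeL k x t))
    (hz : ∀ k, p k 0) (ha : ∀ k s t, p k s → p k t → p k (s + t)) (k : ℕ)
    (t : Polyvec A L M k) : p k t := by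
  induction t using pv_induction with
  | h0 => exact hz k
  | h2 s t hs ht => exact ha k s t hs ht
  | h1 m v =>
    induction k with
    | zero => rw [Subsingleton.elim v ![]]; exact h0 m
    | succ k ih =>
      have := hw k (v 0) _ (ih (Fin.tail v))
      rwa [wedgeL_pv, Fin.cons_self_tail] at this

lemma wedgeL_sub {k : ℕ} (x y : L) (t : Polyvec A L M k) :
    wedgeL k (x - y) t = wedgeL k x t - wedgeL k y t := by
  induction t using pv_induction with
  | h0 => simp
  | h2 s t hs ht => simp only [map_add, hs, ht]; abel
  | h1 m v =>
    have := pv_update_add (A := A) m (Fin.cons x v : Fin (k + 1) → L) 0 (x - y) y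
    simp only [Fin.update_cons_zero, sub_add_cancel] at this
    simp [this]

lemma lieD_lieD (ρ : RightAction A L M) (x y : L) (k : ℕ) (t : Polyvec A L M k) :
    lieD ρ ⁅x, y⁆ k t = lieD ρ y k (lieD ρ x k t) - lieD ρ x k (lieD ρ y k t) := by
  refine polyvec_induction
    (p := fun k t => lieD ρ ⁅x, y⁆ k t = lieD ρ y k (lieD ρ x k t) - lieD ρ x k (lieD ρ y k t))
    (fun m => ?_) (fun k z t h => ?_) (fun k => by simp) (fun k s t hs ht => ?_) k t
  · simp only [lieD_pv, Finset.univ_eq_empty, Finset.sum_empty, sub_zero, ρ.act_lie]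
    rw [pv, TensorProduct.sub_tmul]; rfl
  · simp only [lieD_wedge, map_sub, h, lie_lie, wedgeL_sub]
    abel
  · simp only [map_add, hs, ht]; abel

lemma koszul_wedge_zero (ρ : RightAction A L M) (x : L) (t : Polyvec A L M 0) :
    koszul ρ 0 (wedgeL 0 x t) = lieD ρ x 0 t := rfl

lemma koszul_wedge (ρ : RightAction A L M) (x : L) (k : ℕ) (t : Polyvec A L M (k + 1)) :
    koszul ρ (k + 1) (wedgeL (k + 1) x t) = lieD ρ x (k + 1) t - wedgeL k x (koszul ρ k t) := by
  simp [lieD]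

lemma koszul_lieD (ρ : RightAction A L M) (x : L) (k : ℕ) (t : Polyvec A L M (k + 1)) :
    koszul ρ k (lieD ρ x (k + 1) t) = lieD ρ x k (koszul ρ k t) := by
  let p : ∀ k, Polyvec A L M k → Prop
    | 0, _ => True
    | k + 1, t => koszul ρ k (lieD ρ x (k + 1) t) = lieD ρ x k (koszul ρ k t)
  refine polyvec_induction (p := p) (fun _ => trivial) (fun k y t h => ?_) (fun k => ?_)
    (fun k s t hs ht => ?_) (k + 1) t
  · cases k with
    | zero =>
      simp only [p, lieD_wedge, map_sub, koszul_wedge_zero, lieD_lieD]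
      abel
    | succ k =>
      simp only [p] at h
      simp only [p, lieD_wedge, map_sub, koszul_wedge, lieD_lieD, h]
      abel
  · cases k <;> simp [p]
  · cases k with
    | zero => trivial
    | succ k => simp only [p] at hs ht ⊢; simp only [map_add, hs, ht]

lemma koszul_koszul (ρ : RightAction A L M) (k : ℕ) (t : Polyvec A L M (k + 2)) :
    koszul ρ k (koszul ρ (k + 1) t) = 0 := by
  let p : ∀ k, Polyvec A L M k → Prop
    | k + 2, t => koszul ρ k (koszul ρ (k + 1) t) = 0
    | _, _ => True
  refine polyvec_induction (p := p) (fun _ => trivial) (fun k y t h => ?_) (fun k => ?_)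
    (fun k s t hs ht => ?_) (k + 2) t
  · match k with
    | 0 => trivial
    | 1 => simp [p, koszul_wedge, koszul_lieD, koszul_wedge_zero]
    | k + 2 =>
      simp only [p] at h
      simp [p, koszul_wedge, koszul_lieD, h]
  · match k with
    | 0 => trivial
    | 1 => trivial
    | k + 2 => simp [p]
  · match k with
    | 0 => trivial
    | 1 => trivial
    | k + 2 => simp only [p] at hs ht ⊢; simp only [map_add, hs, ht, add_zero]

end Algebra

section AlgebraMap

variable {A L M A' L' M' : Type*}
  [CommRing A] [Algebra ℂ A] [LieRing L] [LieAlgebra ℂ L] [Module A L]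
  [IsScalarTower ℂ A L] [LieRingModule L A] [LieRinehartRing A L]
  [CommRing A'] [Algebra ℂ A'] [LieRing L'] [LieAlgebra ℂ L'] [Module A' L']
  [IsScalarTower ℂ A' L'] [LieRingModule L' A'] [LieRinehartRing A' L']
  [AddCommGroup M'] [Module ℂ M'] [Module A' M'] [IsScalarTower ℂ A' M']
  {σ : A →ₐ[ℂ] A'}
  [AddCommGroup M] [Module ℂ M] [Module A M] [IsScalarTower ℂ A M]

/-- `⋀ᵏ g` for a semilinear map `g`. -/
def extMap (g : L →ₛₗ[σ.toRingHom] L') (k : ℕ) : (⋀[A]^k L) →ₛₗ[σ.toRingHom] (⋀[A']^k L') :=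
  letI : Module A (⋀[A']^k L') := Module.compHom _ σ.toRingHom
  let f : (⋀[A]^k L) →ₗ[A] (⋀[A']^k L') := exteriorPower.alternatingMapLinearEquiv
    { toFun := fun v => exteriorPower.ιMulti A' k (g ∘ v)
      map_update_add' := fun {dec} v i x y => by
        simp only [Function.comp_update, map_add, AlternatingMap.map_update_add]
      map_update_smul' := fun {dec} v i a x => by
        simp only [Function.comp_update, LinearMap.map_smulₛₗ, AlternatingMap.map_update_smul]
        rfl
      map_eq_zero_of_eq' := fun v i j h hij =>
        (exteriorPower.ιMulti A' k).map_eq_zero_of_eq _ (congrArg g h) hij }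
  { toFun := f, map_add' := f.map_add, map_smul' := f.map_smul }

lemma extMap_ιMulti (g : L →ₛₗ[σ.toRingHom] L') (k : ℕ) (v : Fin k → L) :
    extMap g k (exteriorPower.ιMulti A k v) = exteriorPower.ιMulti A' k (g ∘ v) := by
  letI : Module A (⋀[A']^k L') := Module.compHom _ σ.toRingHom
  exact exteriorPower.alternatingMapLinearEquiv_apply_ιMulti _ v

/-- `h ⊗ ⋀ᵏ g` for semilinear maps `h` and `g`. -/
def polyvecMap (h : M →ₛₗ[σ.toRingHom] M') (g : L →ₛₗ[σ.toRingHom] L') (k : ℕ) :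
    Polyvec A L M k →ₗ[ℂ] Polyvec A' L' M' k :=
  { TensorProduct.map h (extMap g k) with
    map_smul' := fun c t => by
      have e : c • t = algebraMap ℂ A c • t := (algebraMap_smul A c t).symm
      change TensorProduct.map h (extMap g k) (c • t) = c • TensorProduct.map h (extMap g k) t
      rw [e, LinearMap.map_smulₛₗ, ← algebraMap_smul A' c]
      congr 1
      exact σ.commutes c }

@[simp] lemma polyvecMap_pv (h : M →ₛₗ[σ.toRingHom] M') (g : L →ₛₗ[σ.toRingHom] L') (k : ℕ)
    (m : M) (v : Fin k → L) : polyvecMap h g k (pv A m v) = pv A' (h m) (g ∘ v) := by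
  change TensorProduct.map h (extMap g k) (_ ⊗ₜ _) = _
  rw [TensorProduct.map_tmul, extMap_ιMulti]; rfl

lemma polyvecMap_wedge (h : M →ₛₗ[σ.toRingHom] M') (g : L →ₛₗ[σ.toRingHom] L') (k : ℕ)
    (x : L) (t : Polyvec A L M k) :
    polyvecMap h g (k + 1) (wedgeL k x t) = wedgeL k (g x) (polyvecMap h g k t) := by
  induction t using pv_induction with
  | h0 => simp
  | h2 s t hs ht => simp only [map_add, hs, ht]
  | h1 m v => simp [Fin.comp_cons]

lemma polyvecMap_koszul (ρ : RightAction A L M) (ρ' : RightAction A' L' M')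
    (h : M →ₛₗ[σ.toRingHom] M') (g : L →ₛₗ[σ.toRingHom] L')
    (hg : ∀ x y, g ⁅x, y⁆ = ⁅g x, g y⁆) (hh : ∀ x m, h (ρ.act x m) = ρ'.act (g x) (h m))
    (k : ℕ) (t : Polyvec A L M (k + 1)) :
    polyvecMap h g k (koszul ρ k t) = koszul ρ' k (polyvecMap h g (k + 1) t) := by
  induction t using pv_induction with
  | h0 => simp
  | h2 s t hs ht => simp only [map_add, hs, ht]
  | h1 m v =>
    rw [koszul_pv, polyvecMap_pv, koszul_pv]
    induction k with
    | zero =>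
      rw [← Fin.cons_self_tail v, Fin.comp_cons, koszulAlt_zero_cons, koszulAlt_zero_cons,
        polyvecMap_pv, hh]
    | succ k ih =>
      rw [← Fin.cons_self_tail v, Fin.comp_cons, koszulAlt_cons, koszulAlt_cons]
      simp only [map_sub, map_sum, polyvecMap_wedge, ih, polyvecMap_pv, hh, Function.comp_update,
        hg, Function.comp_apply]

end AlgebraMap

section Operators

variable {E : Type v} [NormedAddCommGroup E] [NormedSpace ℂ E] {H : Type w} [TopologicalSpace H]
  (I : ModelWithCorners ℂ E H) {Y : Type u} [TopologicalSpace Y] [ChartedSpace H Y]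

/-- The algebra `𝒪(U)` of holomorphic functions on the open set `U`, as a subalgebra of all
functions. -/
def holoAlg (U : Opens Y) : Subalgebra ℂ (U → ℂ) where
  carrier := {f | ∃ g : Y → ℂ, ContMDiffOn I 𝓘(ℂ, ℂ) ω g U ∧ ∀ x : U, f x = g x}
  mul_mem' := by
    rintro f₁ f₂ ⟨g₁, h₁, e₁⟩ ⟨g₂, h₂, e₂⟩
    exact ⟨g₁ * g₂, h₁.mul h₂, fun x => by simp [e₁, e₂]⟩
  add_mem' := by
    rintro f₁ f₂ ⟨g₁, h₁, e₁⟩ ⟨g₂, h₂, e₂⟩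
    exact ⟨g₁ + g₂, h₁.add h₂, fun x => by simp [e₁, e₂]⟩
  algebraMap_mem' c := ⟨fun _ => c, contMDiffOn_const, fun _ => rfl⟩

/-- The algebra `𝒪(U)` of holomorphic functions on the open set `U`. -/
def Holo (U : Opens Y) : Type u := holoAlg I U

instance (U : Opens Y) : CommRing (Holo I U) := inferInstanceAs (CommRing (holoAlg I U))
instance (U : Opens Y) : Algebra ℂ (Holo I U) := inferInstanceAs (Algebra ℂ (holoAlg I U))

variable {I}

instance (U : Opens Y) : CoeFun (Holo I U) (fun _ => U → ℂ) := ⟨fun f => f.1⟩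

@[ext] lemma holo_ext {U : Opens Y} {f g : Holo I U} (h : ∀ x : U, f x = g x) : f = g :=
  Subtype.ext (funext h)

/-- Pull-back of holomorphic functions along a holomorphic map. -/
def holoComap {E' : Type*} [NormedAddCommGroup E'] [NormedSpace ℂ E'] {H' : Type*}
    [TopologicalSpace H'] {I' : ModelWithCorners ℂ E' H'} {Y' : Type*} [TopologicalSpace Y']
    [ChartedSpace H' Y'] (φ : Y → Y') (hφ : ContMDiff I I' ω φ) {U : Opens Y} {U' : Opens Y'}
    (h : ∀ y ∈ U, φ y ∈ U') : Holo I' U' →ₐ[ℂ] Holo I U where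
  toFun f := ⟨fun x => f ⟨φ x, h x x.2⟩, by
    obtain ⟨g, hg, e⟩ := f.2
    exact ⟨g ∘ φ, hg.comp hφ.contMDiffOn h, fun x => e _⟩⟩
  map_one' := rfl
  map_mul' _ _ := rfl
  map_zero' := rfl
  map_add' _ _ := rfl
  commutes' _ := rfl

/-- Restriction of holomorphic functions. -/
abbrev holoRes {U V : Opens Y} (h : V ≤ U) : Holo I U →ₐ[ℂ] Holo I V :=
  holoComap (fun y => y) contMDiff_id h

variable (I) in
/-- `End_ℂ(𝒪)(U)` as a subalgebra, see `Op`. -/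
def opAlg (U : Opens Y) : Subalgebra ℂ (∀ V : {V : Opens Y // V ≤ U}, Module.End ℂ (Holo I V.1)) where
  carrier := {P | ∀ (V W : {V : Opens Y // V ≤ U}) (h : W.1 ≤ V.1) (f : Holo I V.1),
    holoRes h (P V f) = P W (holoRes h f)}
  mul_mem' hP hQ V W h f := by
    simp only [Pi.mul_apply, Module.End.mul_apply]; rw [hP V W h, hQ V W h]
  add_mem' hP hQ V W h f := by
    simp only [Pi.add_apply, LinearMap.add_apply, map_add]; rw [hP V W h, hQ V W h]
  algebraMap_mem' c V W h f := rfl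

variable (I) in
/-- `End_ℂ(𝒪)(U)`: the `ℂ`-linear endomorphisms of the sheaf of holomorphic functions on `U`, i.e.
families of endomorphisms of `𝒪(V)`, `V ⊆ U` open, compatible with restrictions. -/
def Op (U : Opens Y) : Type u := opAlg I U

instance (U : Opens Y) : Semiring (Op I U) := inferInstanceAs (Semiring (opAlg I U))
instance (U : Opens Y) : Algebra ℂ (Op I U) := inferInstanceAs (Algebra ℂ (opAlg I U))
instance (U : Opens Y) : Ring (Op I U) := Algebra.semiringToRing ℂ

/-- The action of an operator on `U` on the functions on an open subset `V`. -/
def Op.app {U : Opens Y} (P : Op I U) {V : Opens Y} (h : V ≤ U) : Holo I V →ₗ[ℂ] Holo I V :=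
  P.1 ⟨V, h⟩

lemma Op.res_app {U : Opens Y} (P : Op I U) {V W : Opens Y} (h : V ≤ U) (h' : W ≤ V)
    (f : Holo I V) : holoRes h' (P.app h f) = P.app (h'.trans h) (holoRes h' f) :=
  P.2 ⟨V, h⟩ ⟨W, h'.trans h⟩ h' f

@[ext] lemma Op.ext {U : Opens Y} {P Q : Op I U}
    (h : ∀ (V : Opens Y) (hV : V ≤ U) (f : Holo I V), P.app hV f = Q.app hV f) : P = Q :=
  Subtype.ext (funext fun V => LinearMap.ext (h V.1 V.2))

section
variable {U V : Opens Y} (h : V ≤ U) (P Q : Op I U) (f : Holo I V)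
@[simp] lemma Op.mul_app : (P * Q).app h f = P.app h (Q.app h f) := rfl
@[simp] lemma Op.one_app : (1 : Op I U).app h f = f := rfl
@[simp] lemma Op.add_app : (P + Q).app h f = P.app h f + Q.app h f := rfl
@[simp] lemma Op.neg_app : (-P).app h f = -P.app h f := by
  change (-1 : ℂ) • P.app h f = _; simp
@[simp] lemma Op.zero_app : (0 : Op I U).app h f = 0 := rfl
@[simp] lemma Op.sub_app : (P - Q).app h f = P.app h f - Q.app h f := by
  rw [sub_eq_add_neg, Op.add_app, Op.neg_app, sub_eq_add_neg]
@[simp] lemma Op.smul_app (c : ℂ) : (c • P).app h f = c • P.app h f := rfl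
end

/-- Restriction of operators. -/
def opRes {U U' : Opens Y} (h : U' ≤ U) : Op I U →ₐ[ℂ] Op I U' where
  toFun P := ⟨fun V => P.1 ⟨V.1, V.2.trans h⟩, fun V W hVW f => P.2 ⟨V.1, _⟩ ⟨W.1, _⟩ hVW f⟩
  map_one' := rfl
  map_mul' _ _ := rfl
  map_zero' := rfl
  map_add' _ _ := rfl
  commutes' _ := rfl

/-- Multiplication operators. -/
def mulOp (U : Opens Y) : Holo I U →ₐ[ℂ] Op I U where
  toFun f := ⟨fun V => Algebra.lmul ℂ (Holo I V.1) (holoRes V.2 f), fun V W h g => by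
    simp only [Algebra.coe_lmul_eq_mul, LinearMap.mul_apply', map_mul]; rfl⟩
  map_one' := by ext1; exact one_mul _
  map_mul' f g := by ext1 V h k; exact mul_assoc (holoRes h f) (holoRes h g) k
  map_zero' := by ext1; exact zero_mul _
  map_add' f g := by ext1 V h k; exact add_mul (holoRes h f) (holoRes h g) k
  commutes' c := by ext1 V h k; exact (Algebra.smul_def c k).symm

@[simp] lemma mulOp_app {U V : Opens Y} (f : Holo I U) (h : V ≤ U) (g : Holo I V) :
    (mulOp U f).app h g = holoRes h f * g := rfl

/-- The commutator bracket. -/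
instance (U : Opens Y) : LieRing (Op I U) := LieRing.ofAssociativeRing
instance (U : Opens Y) : LieAlgebra ℂ (Op I U) := LieAlgebra.ofAssociativeAlgebra

lemma Op.lie_def {U : Opens Y} (P Q : Op I U) : ⁅P, Q⁆ = P * Q - Q * P := rfl

variable (I) in
/-- The derivations of the sheaf `𝒪` on `U`, as a Lie subalgebra. -/
def vfAlg (U : Opens Y) : LieSubalgebra ℂ (Op I U) where
  carrier := {P | ∀ (V : Opens Y) (h : V ≤ U) (f g : Holo I V),
    P.app h (f * g) = f * P.app h g + g * P.app h f}
  add_mem' {P Q} hP hQ V h f g := by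
    rw [Op.add_app, hP, hQ, Op.add_app, Op.add_app]; ring
  zero_mem' V h f g := by simp
  smul_mem' c P hP V h f g := by
    rw [Op.smul_app, hP]; simp [smul_add]
  lie_mem' {P Q} hP hQ V h f g := by
    replace hP : ∀ f g, P.app h (f * g) = f * P.app h g + g * P.app h f := hP V h
    replace hQ : ∀ f g, Q.app h (f * g) = f * Q.app h g + g * Q.app h f := hQ V h
    simp only [Op.lie_def, Op.sub_app, Op.mul_app, hP, hQ, map_add]
    ring

variable (I) in
/-- The holomorphic vector fields `Θ(U)`: the derivations of the sheaf `𝒪` on `U`. -/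
def VF (U : Opens Y) : Type u := vfAlg I U

instance (U : Opens Y) : LieRing (VF I U) := inferInstanceAs (LieRing (vfAlg I U))
instance (U : Opens Y) : LieAlgebra ℂ (VF I U) := inferInstanceAs (LieAlgebra ℂ (vfAlg I U))

lemma VF.app_mul {U V : Opens Y} (ξ : VF I U) (h : V ≤ U) (f g : Holo I V) :
    Op.app ξ.1 h (f * g) = f * Op.app ξ.1 h g + g * Op.app ξ.1 h f := ξ.2 V h f g

lemma VF.lie_coe {U : Opens Y} (ξ η : VF I U) : (⁅ξ, η⁆ : VF I U).1 = ξ.1 * η.1 - η.1 * ξ.1 := rfl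

instance (U : Opens Y) : Module (Holo I U) (VF I U) where
  smul f ξ := ⟨mulOp U f * ξ.1, fun V h g k => by
    rw [Op.mul_app, VF.app_mul]; simp only [mulOp_app, Op.mul_app]; ring⟩
  one_smul ξ := Subtype.ext (by change mulOp U 1 * ξ.1 = ξ.1; rw [map_one, one_mul])
  mul_smul f g ξ := Subtype.ext (by
    change mulOp U (f * g) * ξ.1 = mulOp U f * (mulOp U g * ξ.1); rw [map_mul, mul_assoc])
  smul_zero f := Subtype.ext (mul_zero (mulOp U f))
  smul_add f ξ η := Subtype.ext (mul_add (mulOp U f) ξ.1 η.1)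
  add_smul f g ξ := Subtype.ext (by
    change mulOp U (f + g) * ξ.1 = mulOp U f * ξ.1 + mulOp U g * ξ.1; rw [map_add, add_mul])
  zero_smul ξ := Subtype.ext (by change mulOp U 0 * ξ.1 = 0; rw [map_zero, zero_mul])

lemma VF.smul_coe {U : Opens Y} (f : Holo I U) (ξ : VF I U) : (f • ξ).1 = mulOp U f * ξ.1 := rfl

instance (U : Opens Y) : IsScalarTower ℂ (Holo I U) (VF I U) where
  smul_assoc c f ξ := Subtype.ext (by
    change mulOp U (c • f) * ξ.1 = c • (mulOp U f * ξ.1); rw [map_smul, smul_mul_assoc])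

/-- A vector field on `U` acts on `𝒪(U)`. -/
instance (U : Opens Y) : LieRingModule (VF I U) (Holo I U) where
  bracket ξ f := Op.app ξ.1 le_rfl f
  add_lie _ _ _ := rfl
  lie_add ξ f g := map_add (Op.app ξ.1 le_rfl) f g
  leibniz_lie ξ η f := by
    change Op.app ξ.1 _ (Op.app η.1 _ f) = Op.app (⁅ξ, η⁆ : VF I U).1 _ f + _
    rw [VF.lie_coe, Op.sub_app, Op.mul_app, Op.mul_app, sub_add_cancel]

lemma VF.lie_def {U : Opens Y} (ξ : VF I U) (f : Holo I U) : ⁅ξ, f⁆ = Op.app ξ.1 le_rfl f := rfl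

lemma VF.mul_mulOp {U : Opens Y} (ξ : VF I U) (f : Holo I U) :
    ξ.1 * mulOp U f = mulOp U f * ξ.1 + mulOp U ⁅ξ, f⁆ := by
  ext1 V h g
  rw [Op.mul_app, mulOp_app, VF.app_mul, Op.add_app, Op.mul_app, mulOp_app, mulOp_app, VF.lie_def,
    Op.res_app]
  ring

instance (U : Opens Y) : LieRinehartRing (Holo I U) (VF I U) where
  lie_smul_eq_mul' f g ξ := by
    apply holo_ext; intro x; rfl
  leibniz_mul_right' ξ f g := by
    simp only [VF.lie_def, VF.app_mul, smul_eq_mul]; ring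
  leibniz_smul_right' ξ η f := Subtype.ext (by
    change ξ.1 * (mulOp U f * η.1) - (mulOp U f * η.1) * ξ.1 =
      mulOp U f * (ξ.1 * η.1 - η.1 * ξ.1) + mulOp U ⁅ξ, f⁆ * η.1
    rw [← mul_assoc, VF.mul_mulOp]; noncomm_ring)

variable (I) in
/-- The subalgebra of `End_ℂ(𝒪)(U)` generated by `𝒪(U)` and `Θ(U)`. -/
def diffOpAlg (U : Opens Y) : Subalgebra ℂ (Op I U) :=
  Algebra.adjoin ℂ (Set.range (mulOp U) ∪ (vfAlg I U : Set (Op I U)))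

variable (I) in
/-- The algebra of differential operators on `U` generated by `𝒪(U)` and `Θ(U)`. The sheaf `𝒟` is
the sheaf associated to `U ↦ DiffOp I U`. -/
def DiffOp (U : Opens Y) : Type u := diffOpAlg I U

instance (U : Opens Y) : Ring (DiffOp I U) := inferInstanceAs (Ring (diffOpAlg I U))
instance (U : Opens Y) : Algebra ℂ (DiffOp I U) := inferInstanceAs (Algebra ℂ (diffOpAlg I U))

/-- `𝒪(U) → 𝒟(U)`. -/
def holoToD (U : Opens Y) : Holo I U →ₐ[ℂ] DiffOp I U :=
  (mulOp U).codRestrict (diffOpAlg I U) fun f => Algebra.subset_adjoin (Or.inl ⟨f, rfl⟩)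

/-- `Θ(U) → 𝒟(U)`. -/
def vfToD (U : Opens Y) : VF I U →ₗ[ℂ] DiffOp I U where
  toFun ξ := ⟨ξ.1, Algebra.subset_adjoin (Or.inr ξ.2)⟩
  map_add' _ _ := rfl
  map_smul' _ _ := rfl

/-- Restriction of vector fields. -/
def vfRes {U V : Opens Y} (h : V ≤ U) :
    VF I U →ₛₗ[(holoRes (I := I) h : Holo I U →ₐ[ℂ] Holo I V).toRingHom] VF I V where
  toFun ξ := ⟨opRes h ξ.1, fun W hW f g => ξ.2 W (hW.trans h) f g⟩
  map_add' _ _ := rfl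
  map_smul' _ _ := rfl

/-- A morphism of algebras of operators which preserves functions and vector fields preserves
differential operators. -/
def diffOpMap {E' : Type*} [NormedAddCommGroup E'] [NormedSpace ℂ E'] {H' : Type*}
    [TopologicalSpace H'] {I' : ModelWithCorners ℂ E' H'} {Y' : Type*} [TopologicalSpace Y']
    [ChartedSpace H' Y'] {U : Opens Y} {U' : Opens Y'} (φ : Op I U →ₐ[ℂ] Op I' U')
    (h₁ : ∀ f, ∃ g, φ (mulOp U f) = mulOp U' g) (h₂ : ∀ ξ ∈ vfAlg I U, φ ξ ∈ vfAlg I' U') :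
    DiffOp I U →ₐ[ℂ] DiffOp I' U' :=
  (φ.comp (diffOpAlg I U).val).codRestrict (diffOpAlg I' U') fun P => by
    have : diffOpAlg I U ≤ (diffOpAlg I' U').comap φ := by
      refine Algebra.adjoin_le ?_
      rintro _ (⟨f, rfl⟩ | hξ)
      · obtain ⟨g, hg⟩ := h₁ f
        exact Algebra.subset_adjoin (Or.inl ⟨g, hg.symm⟩)
      · exact Algebra.subset_adjoin (Or.inr (h₂ _ hξ))
    exact this P.2

/-- Restriction of differential operators. -/
def diffOpRes {U V : Opens Y} (h : V ≤ U) : DiffOp I U →ₐ[ℂ] DiffOp I V :=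
  diffOpMap (opRes h) (fun f => ⟨holoRes h f, rfl⟩) (fun ξ hξ => (vfRes h ⟨ξ, hξ⟩).2)

end Operators

section MultiTotal

variable {C : Type*} [Category C] [Preadditive C] {D : Type*} [Category D] [Preadditive D]
  [HasCoproducts.{0} D] {n : ℕ}

/-- The map `K^p → K^q` of multigraded pieces (i.e. of the families of the `Kₗ^{pₗ}` and of the
`Kₗ^{qₗ}`) which is the differential in the `i`-th entry and the identity in the other ones;
to be used for `q = p + eᵢ`. -/
def slotD (K : Fin n → CochainComplex C ℤ) (i : Fin n) (p q : Fin n → ℤ) :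
    (fun l => (K l).X (p l) : Fin n → C) ⟶ (fun l => (K l).X (q l)) :=
  fun l => if l = i then (K l).d (p l) (q l) else
    if h : p l = q l then ((K l).XIsoOfEq h).hom else 0

lemma slotD_self (K : Fin n → CochainComplex C ℤ) (i : Fin n) (p q : Fin n → ℤ) :
    slotD K i p q i = (K i).d (p i) (q i) := if_pos rfl

lemma slotD_ne (K : Fin n → CochainComplex C ℤ) {i l : Fin n} (p q : Fin n → ℤ) (h : l ≠ i)
    (e : p l = q l) : slotD K i p q l = ((K l).XIsoOfEq e).hom := by
  rw [slotD, if_neg h, dif_pos e]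

/-- The Koszul sign `(-1)^{p₁ + ⋯ + p_{i-1}}`. -/
def koszulSign (p : Fin n → ℤ) (i : Fin n) : ℤˣ := Int.negOnePow (∑ l ∈ Finset.Iio i, p l)

/-- The index `p + eᵢ`. -/
def bump (p : Fin n → ℤ) (i : Fin n) : Fin n → ℤ := p + Pi.single i 1

lemma sum_bump (p : Fin n → ℤ) (i : Fin n) : ∑ l, bump p i l = ∑ l, p l + 1 := by
  simp [bump, Finset.sum_add_distrib]

lemma bump_comm (p : Fin n → ℤ) (i k : Fin n) : bump (bump p i) k = bump (bump p k) i := by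
  simp only [bump]; abel

lemma bump_self (p : Fin n → ℤ) (i : Fin n) : bump p i i = p i + 1 := by simp [bump]

lemma bump_ne (p : Fin n → ℤ) {i l : Fin n} (h : l ≠ i) : bump p i l = p l := by simp [bump, h]

lemma d_XIso (K : CochainComplex C ℤ) {a a' b b' : ℤ} (ha : a = a') (hb : b = b') :
    K.d a b ≫ (K.XIsoOfEq hb).hom = (K.XIsoOfEq ha).hom ≫ K.d a' b' := by
  subst ha hb; simp

lemma slotD_comm (K : Fin n → CochainComplex C ℤ) {i k : Fin n} (h : i ≠ k)
    (p : Fin n → ℤ) (r : Fin n → ℤ) (hr : bump (bump p i) k = r) :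
    slotD K i p (bump p i) ≫ slotD K k (bump p i) r =
      slotD K k p (bump p k) ≫ slotD K i (bump p k) r := by
  funext l
  have h1 : r = bump (bump p k) i := by rw [← hr, bump_comm]
  change slotD K i p (bump p i) l ≫ slotD K k (bump p i) r l =
    slotD K k p (bump p k) l ≫ slotD K i (bump p k) r l
  by_cases hi : l = i
  · subst hi
    rw [slotD_self, slotD_self, slotD_ne K _ _ h (by rw [← hr, bump_ne _ h]),
      slotD_ne K _ _ h (bump_ne _ h).symm, d_XIso]
  · by_cases hk : l = k
    · subst hk
      rw [slotD_self, slotD_self, slotD_ne K (bump p l) r hi (by rw [h1, bump_ne _ hi]),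
        slotD_ne K p (bump p i) hi (bump_ne _ hi).symm, d_XIso]
    · rw [slotD_ne K p (bump p i) hi (bump_ne _ hi).symm,
        slotD_ne K p (bump p k) hk (bump_ne _ hk).symm,
        slotD_ne K _ _ hk (by rw [← hr, bump_ne _ hk]),
        slotD_ne K _ _ hi (by rw [h1, bump_ne _ hi])]
      simp

lemma koszulSign_comm (p : Fin n → ℤ) {i k : Fin n} (h : i ≠ k) :
    koszulSign p i * koszulSign (bump p i) k = - (koszulSign p k * koszulSign (bump p k) i) := by
  have key (a b : Fin n) : koszulSign (bump p a) b =
      if a < b then - koszulSign p b else koszulSign p b := by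
    have : ∑ l ∈ Finset.Iio b, bump p a l = ∑ l ∈ Finset.Iio b, p l + if a < b then 1 else 0 := by
      simp [bump, Finset.sum_add_distrib, Finset.sum_pi_single]
    rw [koszulSign, this]
    split_ifs <;> simp [koszulSign, Int.negOnePow_add]
  rw [key, key]
  rcases lt_or_gt_of_ne h with h | h <;> simp [h, h.not_gt, mul_comm]

variable (F : (Fin n → C) ⥤ D)

/-- The total complex of the multicomplex `F(K₁, …, Kₙ)`, where the functor `F` is compatible with
zero in each variable. Its component of degree `j` is the direct sum of the `F(K₁^{p₁}, …, Kₙ^{pₙ})`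
with `p₁ + ⋯ + pₙ = j`, and its differential is `∑ᵢ (-1)^{p₁ + ⋯ + p_{i-1}} dᵢ`. -/
def multiTotal (hF : ∀ ⦃A B : Fin n → C⦄ (f : A ⟶ B) (i : Fin n), f i = 0 → F.map f = 0)
    (K : Fin n → CochainComplex C ℤ) : CochainComplex D ℤ where
  X j := ∐ fun p : {p : Fin n → ℤ // ∑ i, p i = j} => F.obj (fun i => (K i).X (p.1 i))
  d j j' := Sigma.desc fun p => if h : j + 1 = j' then
      ∑ i, (koszulSign p.1 i : ℤ) • (F.map (slotD K i p.1 (bump p.1 i)) ≫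
        Sigma.ι (fun q : {q : Fin n → ℤ // ∑ i, q i = j'} => F.obj (fun i => (K i).X (q.1 i)))
          ⟨bump p.1 i, by rw [sum_bump, p.2, h]⟩)
    else 0
  shape j j' h := by
    apply Sigma.hom_ext
    intro p
    rw [Sigma.ι_desc, dif_neg (show ¬ j + 1 = j' from h), comp_zero]
  d_comp_d' := by
    rintro j _ _ rfl rfl
    apply Sigma.hom_ext
    intro p
    rw [comp_zero, ← Category.assoc, Sigma.ι_desc, dif_pos rfl, Preadditive.sum_comp]
    simp only [Preadditive.zsmul_comp, Category.assoc, Sigma.ι_desc, ↓reduceDIte,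
      Preadditive.comp_sum, Preadditive.comp_zsmul, Finset.smul_sum, smul_smul]
    simp only [← Category.assoc, ← F.map_comp]
    rw [← Finset.sum_product']
    refine Finset.sum_involution (fun x _ => (x.2, x.1)) ?_ ?_ (fun _ _ => by simp)
      (fun _ _ => rfl)
    · rintro ⟨i, k⟩ -
      by_cases h : i = k
      · subst h
        rw [hF _ i]
        · simp
        · change slotD K i _ _ i ≫ slotD K i _ _ i = 0
          rw [slotD_self, slotD_self, HomologicalComplex.d_comp_d]
      · have hs := koszulSign_comm p.1 h
        have hs' : (koszulSign p.1 i : ℤ) * koszulSign (bump p.1 i) k =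
          - (koszulSign p.1 k * koszulSign (bump p.1 k) i : ℤ) := by exact_mod_cast congrArg Units.val hs
        simp only [hs', neg_smul]
        rw [neg_add_eq_zero]
        congr 1
        have key : ∀ (q r : {q : Fin n → ℤ // ∑ i, q i = j + 1 + 1}) (e : q = r)
            (_ : bump (bump p.1 i) k = q.1) (_ : bump (bump p.1 k) i = r.1),
            F.map (slotD K k p.1 (bump p.1 k) ≫ slotD K i (bump p.1 k) r.1) ≫
              Sigma.ι (fun q : {q : Fin n → ℤ // ∑ i, q i = j + 1 + 1} =>
                F.obj (fun i => (K i).X (q.1 i))) r =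
            F.map (slotD K i p.1 (bump p.1 i) ≫ slotD K k (bump p.1 i) q.1) ≫
              Sigma.ι (fun q : {q : Fin n → ℤ // ∑ i, q i = j + 1 + 1} =>
                F.obj (fun i => (K i).X (q.1 i))) q := by
          rintro q _ rfl h1 h2
          rw [slotD_comm K h p.1 _ h1]
        refine Eq.symm <| key ⟨bump (bump p.1 i) k, by rw [sum_bump, sum_bump, p.2]⟩
          ⟨bump (bump p.1 k) i, by rw [sum_bump, sum_bump, p.2]⟩
          (Subtype.ext (bump_comm _ _ _)) rfl rfl
    · rintro ⟨i, k⟩ - h1 h2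
      obtain rfl : i = k := (congrArg Prod.snd h2)
      refine h1 ?_
      rw [hF _ i]
      · simp
      · change slotD K i _ _ i ≫ slotD K i _ _ i = 0
        rw [slotD_self, slotD_self, HomologicalComplex.d_comp_d]

/-- The inclusion of `F(K₁^{p₁}, …, Kₙ^{pₙ})` into the total complex. -/
def multiι (hF : ∀ ⦃A B : Fin n → C⦄ (f : A ⟶ B) (i : Fin n), f i = 0 → F.map f = 0)
    (K : Fin n → CochainComplex C ℤ) (p : Fin n → ℤ) (j : ℤ) (hp : ∑ i, p i = j) :
    F.obj (fun i => (K i).X (p i)) ⟶ (multiTotal F hF K).X j :=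
  Sigma.ι (fun p : {p : Fin n → ℤ // ∑ i, p i = j} => F.obj (fun i => (K i).X (p.1 i))) ⟨p, hp⟩

end MultiTotal

lemma polyvec_hom_ext {A L M T : Type*} [CommRing A] [Algebra ℂ A] [LieRing L] [LieAlgebra ℂ L]
    [Module A L] [IsScalarTower ℂ A L] [LieRingModule L A] [LieRinehartRing A L] [AddCommGroup M]
    [Module ℂ M] [Module A M] [IsScalarTower ℂ A M] [AddCommGroup T] [Module ℂ T] {k : ℕ} {f g : Polyvec A L M k →ₗ[ℂ] T}
    (h : ∀ m v, f (pv A m v) = g (pv A m v)) : f = g := by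
  ext t
  induction t using pv_induction with
  | h0 => simp
  | h1 m v => exact h m v
  | h2 s t hs ht => rw [map_add, map_add, hs, ht]

section Sheaves

instance : PreservesFilteredColimits (forget (ModuleCat.{u} ℂ)) := by
  have h : forget (ModuleCat.{u} ℂ) =
    forget₂ (ModuleCat.{u} ℂ) AddCommGrpCat ⋙ forget AddCommGrpCat := rfl
  rw [h]
  have : PreservesFilteredColimits (forget₂ (ModuleCat.{u} ℂ) AddCommGrpCat) :=
    ⟨fun J _ _ => inferInstance⟩
  infer_instance

/-- Sheaves of `ℂ`-modules on `Y`. -/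
abbrev ModSheaf (Y : Type u) [TopologicalSpace Y] : Type (u + 1) :=
  Sheaf (Opens.grothendieckTopology Y) (ModuleCat.{u} ℂ)

instance (Y : Type u) [TopologicalSpace Y] :
    HasSheafify (Opens.grothendieckTopology Y) (ModuleCat.{u} ℂ) := inferInstance

instance (Y : Type u) [TopologicalSpace Y] : HasCoproducts.{0} (ModSheaf Y) :=
  have : HasColimitsOfSize.{0, 0} (ModuleCat.{u} ℂ) := hasColimitsOfSizeShrink.{0, 0, u, u} _
  fun _ => Sheaf.instHasColimitsOfShape

instance (Y : Type u) [TopologicalSpace Y] : Preadditive (ModSheaf Y) := inferInstance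
instance (Y : Type u) [TopologicalSpace Y] : HasFiniteCoproducts (ModSheaf Y) := inferInstance
instance (Y : Type u) [TopologicalSpace Y] : HasZeroObject (ModSheaf Y) := inferInstance
instance (Y : Type u) [TopologicalSpace Y] :
  (presheafToSheaf (Opens.grothendieckTopology Y) (ModuleCat.{u} ℂ)).Additive := inferInstance

end Sheaves

section DModules

variable {E : Type v} [NormedAddCommGroup E] [NormedSpace ℂ E] {H : Type w} [TopologicalSpace H]
  (I : ModelWithCorners ℂ E H) (Y : Type u) [TopologicalSpace Y] [ChartedSpace H Y]

/-- The presheaf of rings `U ↦ (DiffOp I U)ᵒᵖ` (opposite rings), whose modules are right modules. -/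
def preD : (Opens Y)ᵒᵖ ⥤ RingCat.{u} where
  obj U := RingCat.of (DiffOp I U.unop)ᵐᵒᵖ
  map f := RingCat.ofHom (diffOpRes f.unop.le).toRingHom.op
  map_id _ := rfl
  map_comp _ _ := rfl

/-- The opposite of the sheaf `𝒟` of differential operators. -/
def shD : Sheaf (Opens.grothendieckTopology Y) RingCat.{u} :=
  (presheafToSheaf (Opens.grothendieckTopology Y) RingCat.{u}).obj (preD I Y)

/-- The canonical map to the associated sheaf. -/
def toShD : preD I Y ⟶ (shD I Y).obj := toSheafify (Opens.grothendieckTopology Y) (preD I Y)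

instance : Presheaf.IsLocallyInjective (Opens.grothendieckTopology Y) (toShD I Y) :=
  inferInstanceAs (Presheaf.IsLocallyInjective (Opens.grothendieckTopology Y)
    (toSheafify (Opens.grothendieckTopology Y) (preD I Y)))

instance : Presheaf.IsLocallySurjective (Opens.grothendieckTopology Y) (toShD I Y) :=
  inferInstanceAs (Presheaf.IsLocallySurjective (Opens.grothendieckTopology Y)
    (toSheafify (Opens.grothendieckTopology Y) (preD I Y)))

/-- The category of right `𝒟`-modules on `Y`. -/
abbrev RightDMod : Type (u + 1) := SheafOfModules.{u} (shD I Y)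

instance : HasCoproducts.{0} (RightDMod I Y) := fun _ => inferInstance

/-- A right `𝒟`-module, considered as a presheaf of right modules over `U ↦ DiffOp I U`. -/
def toPre : RightDMod I Y ⥤ PresheafOfModules.{u} (preD I Y) :=
  SheafOfModules.forget _ ⋙ PresheafOfModules.restrictScalars (toShD I Y)

instance : (toPre I Y).Additive := by unfold toPre; infer_instance

variable {I Y}

/-- Sections over `U`. -/
def Sec (P : PresheafOfModules.{u} (preD I Y)) (U : Opens Y) : Type u := P.obj (op U)

section
variable (P : PresheafOfModules.{u} (preD I Y)) (U : Opens Y)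

instance : AddCommGroup (Sec P U) := inferInstanceAs (AddCommGroup (P.obj (op U)))
instance : Module (DiffOp I U)ᵐᵒᵖ (Sec P U) :=
  inferInstanceAs (Module ((preD I Y).obj (op U)) (P.obj (op U)))

/-- `𝒪(U)` as a subring of the opposite of the ring of differential operators. -/
def holoToDop : Holo I U →+* (DiffOp I U)ᵐᵒᵖ :=
  (holoToD U).toRingHom.toOpposite fun f g => by
    change holoToD U f * holoToD U g = holoToD U g * holoToD U f
    rw [← map_mul, mul_comm, map_mul]

instance : Module (Holo I U) (Sec P U) := Module.compHom _ (holoToDop U)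
instance : Module ℂ (Sec P U) := Module.compHom _ (algebraMap ℂ (DiffOp I U)ᵐᵒᵖ)

variable {P U}

lemma holo_smul_def (f : Holo I U) (m : Sec P U) : f • m = MulOpposite.op (holoToD U f) • m := rfl
lemma complex_smul_def (c : ℂ) (m : Sec P U) :
  c • m = MulOpposite.op (algebraMap ℂ (DiffOp I U) c) • m := rfl

instance : IsScalarTower ℂ (Holo I U) (Sec P U) where
  smul_assoc c f m := by
    rw [holo_smul_def, holo_smul_def, complex_smul_def, smul_smul, ← MulOpposite.op_mul,
      map_smul, Algebra.smul_def, Algebra.commutes]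

variable (P U) in
/-- The right action of vector fields on a right `𝒟`-module. -/
def secAction : RightAction (Holo I U) (VF I U) (Sec P U) where
  act :=
    { toFun := fun ξ =>
        { toFun := fun m => MulOpposite.op (vfToD U ξ) • m
          map_add' := smul_add _
          map_smul' := fun c m => by
            simp only [complex_smul_def, smul_smul, ← MulOpposite.op_mul, Algebra.commutes,
              RingHom.id_apply] }
      map_add' := fun ξ η => by
        ext m
        exact (congrArg (fun t => MulOpposite.op t • m) (map_add (vfToD U) ξ η)).trans
          (add_smul (MulOpposite.op (vfToD U ξ)) (MulOpposite.op (vfToD U η)) m)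
      map_smul' := fun c ξ => by
        ext m
        change MulOpposite.op (vfToD U (c • ξ)) • m = c • (MulOpposite.op (vfToD U ξ) • m)
        rw [complex_smul_def, smul_smul, ← MulOpposite.op_mul, map_smul, Algebra.smul_def,
          Algebra.commutes] }
  act_lie ξ η m := by
    change MulOpposite.op (vfToD U ξ * vfToD U η - vfToD U η * vfToD U ξ) • m =
      MulOpposite.op (vfToD U η) • (MulOpposite.op (vfToD U ξ) • m) -
      MulOpposite.op (vfToD U ξ) • (MulOpposite.op (vfToD U η) • m)
    rw [smul_smul, smul_smul, ← MulOpposite.op_mul, ← MulOpposite.op_mul, MulOpposite.op_sub,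
      sub_smul]
  act_smul f ξ m := by
    change MulOpposite.op (holoToD U f * vfToD U ξ) • m =
      MulOpposite.op (vfToD U ξ) • (MulOpposite.op (holoToD U f) • m)
    rw [smul_smul, ← MulOpposite.op_mul]
  smul_act f ξ m := by
    have e : vfToD U ξ * holoToD U f = holoToD U f * vfToD U ξ + holoToD U ⁅ξ, f⁆ :=
      Subtype.ext (VF.mul_mulOp ξ f)
    change MulOpposite.op (holoToD U f) • (MulOpposite.op (vfToD U ξ) • m) =
      MulOpposite.op (vfToD U ξ) • (MulOpposite.op (holoToD U f) • m) +
      MulOpposite.op (holoToD U ⁅ξ, f⁆) • m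
    rw [smul_smul, smul_smul, ← MulOpposite.op_mul, ← MulOpposite.op_mul, e, MulOpposite.op_add,
      add_smul]

end

/-- Restriction of sections. -/
def secRes (P : PresheafOfModules.{u} (preD I Y)) {U V : Opens Y} (h : V ≤ U) :
    Sec P U →ₛₗ[(holoRes (I := I) h : Holo I U →ₐ[ℂ] Holo I V).toRingHom] Sec P V where
  toFun m := (P.map (homOfLE h).op).hom m
  map_add' m n := map_add (P.map (homOfLE h).op).hom m n
  map_smul' f m := (P.map (homOfLE h).op).hom.map_smul (MulOpposite.op (holoToD U f)) m

lemma secRes_smul (P : PresheafOfModules.{u} (preD I Y)) {U V : Opens Y} (h : V ≤ U)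
    (T : DiffOp I U) (m : Sec P U) : secRes P h (MulOpposite.op T • m) =
      MulOpposite.op (diffOpRes h T) • secRes P h m :=
  (P.map (homOfLE h).op).hom.map_smul (MulOpposite.op T) m

lemma secRes_refl (P : PresheafOfModules.{u} (preD I Y)) {U : Opens Y} (h : U ≤ U) (m : Sec P U) :
    secRes P h m = m := congr($(P.presheaf.map_id (op U)) m)

lemma secRes_trans (P : PresheafOfModules.{u} (preD I Y)) {U V W : Opens Y} (h : V ≤ U)
    (h' : W ≤ V) (m : Sec P U) : secRes P h' (secRes P h m) = secRes P (h'.trans h) m :=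
  (congr($(P.presheaf.map_comp (homOfLE h).op (homOfLE h').op) m)).symm

/-- The map on sections induced by a morphism. -/
def secMap {P Q : PresheafOfModules.{u} (preD I Y)} (f : P ⟶ Q) (U : Opens Y) :
    Sec P U →ₗ[(DiffOp I U)ᵐᵒᵖ] Sec Q U := (f.app (op U)).hom

section DeRham

variable (I Y)

/-- The presheaf `U ↦ P(U) ⊗ ⋀ᵏ Θ(U)` over `𝒪(U)`. -/
def preDR (P : PresheafOfModules.{u} (preD I Y)) (k : ℕ) : (Opens Y)ᵒᵖ ⥤ ModuleCat.{u} ℂ where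
  obj U := ModuleCat.of ℂ (Polyvec (Holo I U.unop) (VF I U.unop) (Sec P U.unop) k)
  map f := ModuleCat.ofHom (polyvecMap (secRes P f.unop.le) (vfRes f.unop.le) k)
  map_id U := by
    refine ModuleCat.hom_ext (polyvec_hom_ext fun m v => ?_)
    exact (polyvecMap_pv _ _ _ _ _).trans (congrArg (pv _ · v) (secRes_refl P _ m))
  map_comp f g := by
    refine ModuleCat.hom_ext (polyvec_hom_ext fun m v => ?_)
    change polyvecMap (secRes P (g.unop.le.trans f.unop.le)) (vfRes _) k (pv _ m v) =
        polyvecMap (secRes P g.unop.le) (vfRes _) k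
          (polyvecMap (secRes P f.unop.le) (vfRes f.unop.le) k (pv _ m v))
    rw [polyvecMap_pv, polyvecMap_pv, polyvecMap_pv, secRes_trans]
    rfl

/-- The de Rham complex of a presheaf of right modules over `U ↦ DiffOp I U`, before sheafification;
its component of degree `-k` is `preDR P k`. -/
def preDRComplex (P : PresheafOfModules.{u} (preD I Y)) :
    ChainComplex ((Opens Y)ᵒᵖ ⥤ ModuleCat.{u} ℂ) ℕ :=
  ChainComplex.of (preDR I Y P)
    (fun k =>
      { app := fun U => ModuleCat.ofHom (koszul (secAction P U.unop) k)
        naturality := fun U V f => by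
          ext t
          exact (polyvecMap_koszul _ _ _ _ (fun _ _ => rfl)
            (fun ξ m => secRes_smul P f.unop.le (vfToD _ ξ) m) k t).symm })
    (fun k => by
      ext U t
      exact koszul_koszul _ _ _)

variable {I Y} in
/-- The map on sections induced by a morphism, as an `𝒪(U)`-linear map. -/
def secMapO {P Q : PresheafOfModules.{u} (preD I Y)} (f : P ⟶ Q) (U : Opens Y) :
    Sec P U →ₛₗ[(AlgHom.id ℂ (Holo I U)).toRingHom] Sec Q U where
  toFun := secMap f U
  map_add' := map_add (secMap f U)
  map_smul' a m := (secMap f U).map_smul (MulOpposite.op (holoToD _ a)) m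

variable {I Y} in
/-- The identity of `Θ(U)`. -/
def vfId (U : Opens Y) : VF I U →ₛₗ[(AlgHom.id ℂ (Holo I U)).toRingHom] VF I U where
  toFun ξ := ξ
  map_add' _ _ := rfl
  map_smul' _ _ := rfl

/-- The functoriality of `preDR`. -/
def preDRMap {P Q : PresheafOfModules.{u} (preD I Y)} (f : P ⟶ Q) (k : ℕ) :
    preDR I Y P k ⟶ preDR I Y Q k where
  app U := ModuleCat.ofHom (polyvecMap (secMapO f U.unop) (vfId U.unop) k)
  naturality U V g := by
    refine ModuleCat.hom_ext (polyvec_hom_ext fun m v => ?_)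
    change polyvecMap (secMapO f V.unop) (vfId V.unop) k
        (polyvecMap (secRes P g.unop.le) (vfRes g.unop.le) k (pv _ m v)) =
      polyvecMap (secRes Q g.unop.le) (vfRes g.unop.le) k (polyvecMap (secMapO f U.unop)
        (vfId U.unop) k (pv _ m v))
    rw [polyvecMap_pv, polyvecMap_pv, polyvecMap_pv, polyvecMap_pv]
    exact congrArg (pv _ · _) (PresheafOfModules.naturality_apply f g m)

lemma preDRMap_pv {P Q : PresheafOfModules.{u} (preD I Y)} (f : P ⟶ Q) (k : ℕ) (U : (Opens Y)ᵒᵖ)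
    (m : Sec P U.unop) (v : Fin k → VF I U.unop) :
    ((preDRMap I Y f k).app U).hom (pv (Holo I U.unop) m v) =
      pv (Holo I U.unop) (secMap f U.unop m) v := polyvecMap_pv _ _ _ _ _

/-- The functor `preDRComplex`. -/
def preDRFunctor : PresheafOfModules.{u} (preD I Y) ⥤
    ChainComplex ((Opens Y)ᵒᵖ ⥤ ModuleCat.{u} ℂ) ℕ where
  obj P := preDRComplex I Y P
  map {P Q} f :=
    { f := preDRMap I Y f
      comm' := by
        rintro _ k rfl
        simp only [preDRComplex, ChainComplex.of_d]
        ext U t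
        exact (polyvecMap_koszul _ _ _ _ (fun _ _ => rfl)
          (fun ξ m => (secMap f U.unop).map_smul (MulOpposite.op (vfToD _ ξ)) m) k t).symm }
  map_id P := by
    ext k U : 4
    refine polyvec_hom_ext fun m v => ?_
    exact preDRMap_pv _ _ _ _ _ _ _
  map_comp f g := by
    ext k U : 4
    refine polyvec_hom_ext fun m v => ?_
    refine (preDRMap_pv _ _ _ _ _ _ _).trans ?_
    refine Eq.trans ?_ (congrArg ((preDRMap I Y g k).app U).hom
        (preDRMap_pv I Y f k U m v)).symm
    exact (preDRMap_pv I Y g k U _ v).symm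

instance : (preDRFunctor I Y).PreservesZeroMorphisms where
  map_zero P Q := by
    ext k U : 4
    refine polyvec_hom_ext fun m v => ?_
    exact (preDRMap_pv I Y (0 : P ⟶ Q) k U m v).trans (TensorProduct.zero_tmul _ _)

/-- The de Rham complex of a right `𝒟`-module `M`. Its component of degree `-k` is the sheaf
`M ⊗ ⋀ᵏ Θ`, and its differential is given by `koszul`. -/
def deRham : RightDMod I Y ⥤ ChainComplex (ModSheaf Y) ℕ :=
  toPre I Y ⋙ preDRFunctor I Y ⋙
    (presheafToSheaf (Opens.grothendieckTopology Y) (ModuleCat.{u} ℂ)).mapHomologicalComplex _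

instance : (deRham I Y).PreservesZeroMorphisms := by unfold deRham; infer_instance

/-- In the total complex of a double complex with degrees `p` and `-k`, the total degree is `p - k`
and the differential is `d + (-1)ᵖ δ`. -/
instance : TotalComplexShape (ComplexShape.up ℤ) (ComplexShape.down ℕ) (ComplexShape.up ℤ) where
  π x := x.1 - x.2
  ε₁ _ := 1
  ε₂ x := Int.negOnePow x.1
  rel₁ := by rintro p _ rfl k; change _ + 1 = _; ring
  rel₂ := by rintro p k _ rfl; change _ + 1 = _; push_cast; ring
  ε₂_ε₁ := by
    rintro p _ k _ rfl rfl
    simp [Int.negOnePow_succ]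

/-- The de Rham functor on complexes of right `𝒟`-modules. -/
def DR : CochainComplex (RightDMod I Y) ℤ ⥤ CochainComplex (ModSheaf Y) ℤ :=
  (deRham I Y).mapHomologicalComplex (ComplexShape.up ℤ) ⋙
    HomologicalComplex₂.totalFunctor (ModSheaf Y) (ComplexShape.up ℤ) (ComplexShape.down ℕ)
      (ComplexShape.up ℤ)

end DeRham

end DModules

section ExternalC

variable {X : Type u} [TopologicalSpace X] {n : ℕ}

/-- The image of an open subset of `Xⁿ` under the `i`-th projection. -/
def prImage (i : Fin n) (U : Opens (Fin n → X)) : Opens X :=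
  ⟨(fun x => x i) '' (U : Set (Fin n → X)), isOpenMap_eval i _ U.2⟩

lemma prImage_mono (i : Fin n) {U V : Opens (Fin n → X)} (h : V ≤ U) :
    prImage i V ≤ prImage i U := Set.image_mono h

/-- The presheaf `U ↦ E₁(pr₁ U) ⊗ ⋯ ⊗ Eₙ(prₙ U)`. Note that `E(prᵢ U)` is the value on `U` of the
presheaf inverse image of `E` under `prᵢ`. -/
def preBoxC (E : Fin n → ModSheaf X) : (Opens (Fin n → X))ᵒᵖ ⥤ ModuleCat.{u} ℂ where
  obj U := ModuleCat.of ℂ (⨂[ℂ] i, (E i).obj.obj (op (prImage i U.unop)))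
  map f := ModuleCat.ofHom (PiTensorProduct.map fun i =>
    ((E i).obj.map (homOfLE (prImage_mono i f.unop.le)).op).hom)
  map_id U := by
    ext t
    change PiTensorProduct.map (fun i => ((E i).obj.map (𝟙 _)).hom) (PiTensorProduct.tprod ℂ t) = _
    simp
  map_comp f g := by
    ext t
    change PiTensorProduct.map (fun i => ((E i).obj.map ((homOfLE (prImage_mono i f.unop.le)).op ≫
      (homOfLE (prImage_mono i g.unop.le)).op)).hom) (PiTensorProduct.tprod ℂ t) = _
    simp

/-- The functoriality of `preBoxC`. -/
def preBoxCMap {E E' : Fin n → ModSheaf X} (f : E ⟶ E') : preBoxC E ⟶ preBoxC E' where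
  app U := ModuleCat.ofHom (PiTensorProduct.map fun i =>
    ((f i).hom.app (op (prImage i U.unop))).hom)
  naturality U V g := by
    refine ModuleCat.hom_ext (PiTensorProduct.ext (MultilinearMap.ext fun t => ?_))
    change PiTensorProduct.map (fun i => ((f i).hom.app _).hom) (PiTensorProduct.map (fun i =>
      ((E i).obj.map _).hom) (PiTensorProduct.tprod ℂ t)) = PiTensorProduct.map (fun i =>
      ((E' i).obj.map _).hom) (PiTensorProduct.map (fun i => ((f i).hom.app _).hom)
      (PiTensorProduct.tprod ℂ t))
    simp only [PiTensorProduct.map_tprod]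
    congr 1
    funext i
    exact congr($((f i).hom.naturality (homOfLE (prImage_mono i g.unop.le)).op) (t i))

/-- The `n`-fold external product `E₁ ⊠ ⋯ ⊠ Eₙ` over `ℂ` of sheaves of `ℂ`-modules on `X`. -/
def boxCFunctor (X : Type u) [TopologicalSpace X] (n : ℕ) :
    (Fin n → ModSheaf X) ⥤ ModSheaf (Fin n → X) where
  obj E := (presheafToSheaf _ _).obj (preBoxC E)
  map f := (presheafToSheaf _ _).map (preBoxCMap f)
  map_id E := by
    rw [← CategoryTheory.Functor.map_id]
    congr 1
    ext U : 2
    refine ModuleCat.hom_ext (PiTensorProduct.ext (MultilinearMap.ext fun t => ?_))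
    change PiTensorProduct.map (fun i => LinearMap.id) (PiTensorProduct.tprod ℂ t) =
      PiTensorProduct.tprod ℂ t
    simp
  map_comp f g := by
    rw [← CategoryTheory.Functor.map_comp]
    congr 1
    ext U : 2
    refine ModuleCat.hom_ext (PiTensorProduct.ext (MultilinearMap.ext fun t => ?_))
    change PiTensorProduct.map (fun i => ((g i).hom.app _).hom ∘ₗ ((f i).hom.app _).hom)
      (PiTensorProduct.tprod ℂ t) = PiTensorProduct.map (fun i => ((g i).hom.app _).hom)
        (PiTensorProduct.map (fun i => ((f i).hom.app _).hom) (PiTensorProduct.tprod ℂ t))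
    simp

lemma boxCFunctor_map_zero ⦃E E' : Fin n → ModSheaf X⦄ (f : E ⟶ E') (i : Fin n) (h : f i = 0) :
    (boxCFunctor X n).map f = 0 := by
  have e : preBoxCMap f = 0 := by
    ext U : 2
    refine ModuleCat.hom_ext (PiTensorProduct.ext (MultilinearMap.ext fun t => ?_))
    change PiTensorProduct.map (fun i => ((f i).hom.app _).hom) (PiTensorProduct.tprod ℂ t) = 0
    rw [PiTensorProduct.map_tprod]
    refine (PiTensorProduct.tprod ℂ).map_coord_zero i ?_
    rw [h]; rfl
  change (presheafToSheaf _ _).map (preBoxCMap f) = 0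
  rw [e, CategoryTheory.Functor.map_zero]

/-- The `n`-fold external product over `ℂ` of complexes of sheaves on `X`. -/
def boxC (K : Fin n → CochainComplex (ModSheaf X) ℤ) : CochainComplex (ModSheaf (Fin n → X)) ℤ :=
  multiTotal (boxCFunctor X n) boxCFunctor_map_zero K

end ExternalC

section ExternalO

variable {E : Type v} [NormedAddCommGroup E] [NormedSpace ℂ E] {H : Type w} [TopologicalSpace H]
  (I : ModelWithCorners ℂ E H) (X : Type u) [TopologicalSpace X] [ChartedSpace H X] {n : ℕ}

/-- The model with corners of `Xⁿ`. -/
abbrev powModel (n : ℕ) : ModelWithCorners ℂ (Fin n → E) (ModelPi fun _ : Fin n => H) :=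
  ModelWithCorners.pi fun _ => I

variable {I X}

/-- The differential operator `Q` on `U ⊆ Xⁿ` acts as the differential operator `P` on `W ⊆ X` in
the `i`-th variable, i.e. `Q` is the image of `P` under `prᵢ⁻¹ 𝒟_X → 𝒟_{Xⁿ}`: the value at `x` of
`Q f` is the value at `xᵢ` of `P g` for the function `g` on an open neighbourhood of `xᵢ`
which is obtained from `f` by fixing the variables `xⱼ` with `j ≠ i`. -/
def IsLift (i : Fin n) {W : Opens X} (P : DiffOp I W) {U : Opens (Fin n → X)}
    (Q : DiffOp (powModel I n) U) : Prop :=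
  ∀ (V : Opens (Fin n → X)) (hV : V ≤ U) (f : Holo (powModel I n) V) (x : V)
    (W' : Opens X) (hW' : W' ≤ W) (hx : x.1 i ∈ W') (g : Holo I W')
    (_ : ∀ y : W', ∃ h : Function.update x.1 i y.1 ∈ V, g y = f ⟨Function.update x.1 i y.1, h⟩),
    Op.app Q.1 hV f x = Op.app P.1 hW' g ⟨x.1 i, hx⟩

lemma IsLift.res {i : Fin n} {W : Opens X} {P : DiffOp I W} {U : Opens (Fin n → X)}
    {Q : DiffOp (powModel I n) U} (h : IsLift i P Q) {W' : Opens X} (hW : W' ≤ W)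
    {U' : Opens (Fin n → X)} (hU : U' ≤ U) : IsLift i (diffOpRes hW P) (diffOpRes hU Q) :=
  fun V hV f x W'' hW'' hx g hg => h V (hV.trans hU) f x W'' (hW''.trans hW) hx g hg

variable (P : Fin n → PresheafOfModules.{u} (preD I X))

/-- The families of sections `mᵢ` of `Pᵢ` on `prᵢ U`. -/
abbrev SecFam (U : Opens (Fin n → X)) : Type u := ∀ i, Sec (P i) (prImage i U)

/-- The relations between the generators `⊠ mᵢ` of the right module `BoxO P U`. -/
inductive BoxRel (U : Opens (Fin n → X)) :
    (SecFam P U →₀ (DiffOp (powModel I n) U)ᵐᵒᵖ) → Prop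
  | add (m : SecFam P U) (i : Fin n) (a b : Sec (P i) (prImage i U)) :
      BoxRel U (Finsupp.single (Function.update m i (a + b)) 1 -
        Finsupp.single (Function.update m i a) 1 - Finsupp.single (Function.update m i b) 1)
  | act (m : SecFam P U) (i : Fin n) (T : DiffOp I (prImage i U)) (S : DiffOp (powModel I n) U)
      (h : IsLift i T S) :
      BoxRel U (Finsupp.single (Function.update m i (MulOpposite.op T • m i)) 1 -
        Finsupp.single m (MulOpposite.op S))

/-- The sections of the presheaf underlying the external product of right `𝒟`-modules: the right
module over the ring `𝒟_{Xⁿ}(U)` of differential operators with the generators `⊠ mᵢ`, for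
`mᵢ ∈ Pᵢ(prᵢ U)`, which are additive in each `mᵢ` and satisfy
`m₁ ⊠ ⋯ ⊠ mᵢ T ⊠ ⋯ ⊠ mₙ = (m₁ ⊠ ⋯ ⊠ mₙ) T` for `T ∈ 𝒟_X(prᵢ U)`; in other words, the scalar
extension of `⨂ᵢ Pᵢ(prᵢ U)` from `⨂ᵢ 𝒟_X(prᵢ U)` to `𝒟_{Xⁿ}(U)`. -/
def BoxO (U : Opens (Fin n → X)) : Type u :=
  (SecFam P U →₀ (DiffOp (powModel I n) U)ᵐᵒᵖ) ⧸
    Submodule.span (DiffOp (powModel I n) U)ᵐᵒᵖ {r | BoxRel P U r}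

instance (U : Opens (Fin n → X)) : AddCommGroup (BoxO P U) :=
  inferInstanceAs (AddCommGroup ((SecFam P U →₀ (DiffOp (powModel I n) U)ᵐᵒᵖ) ⧸
    Submodule.span (DiffOp (powModel I n) U)ᵐᵒᵖ {r | BoxRel P U r}))

instance (U : Opens (Fin n → X)) : Module (DiffOp (powModel I n) U)ᵐᵒᵖ (BoxO P U) :=
  inferInstanceAs (Module (DiffOp (powModel I n) U)ᵐᵒᵖ
    ((SecFam P U →₀ (DiffOp (powModel I n) U)ᵐᵒᵖ) ⧸
    Submodule.span (DiffOp (powModel I n) U)ᵐᵒᵖ {r | BoxRel P U r}))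

variable {P}

/-- The section `m₁ ⊠ ⋯ ⊠ mₙ`. -/
def boxGen {U : Opens (Fin n → X)} (m : SecFam P U) : BoxO P U :=
  Submodule.Quotient.mk (Finsupp.single m 1)

lemma boxGen_add {U : Opens (Fin n → X)} (m : SecFam P U) (i : Fin n)
    (a b : Sec (P i) (prImage i U)) : boxGen (Function.update m i (a + b)) =
      boxGen (Function.update m i a) + boxGen (Function.update m i b) := by
  have := (Submodule.Quotient.mk_eq_zero _).2 (Submodule.subset_span (BoxRel.add m i a b) :
    _ ∈ Submodule.span (DiffOp (powModel I n) U)ᵐᵒᵖ {r | BoxRel P U r})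
  rw [Submodule.Quotient.mk_sub, Submodule.Quotient.mk_sub, sub_sub, sub_eq_zero] at this
  exact this

lemma boxGen_act {U : Opens (Fin n → X)} (m : SecFam P U) (i : Fin n)
    (T : DiffOp I (prImage i U)) (T' : DiffOp (powModel I n) U) (h : IsLift i T T') :
    boxGen (Function.update m i (MulOpposite.op T • m i)) = MulOpposite.op T' • boxGen m := by
  have := (Submodule.Quotient.mk_eq_zero _).2 (Submodule.subset_span (BoxRel.act m i T T' h) :
    _ ∈ Submodule.span (DiffOp (powModel I n) U)ᵐᵒᵖ {r | BoxRel P U r})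
  rw [Submodule.Quotient.mk_sub, sub_eq_zero] at this
  refine this.trans ?_
  rw [← mul_one (MulOpposite.op T'), ← smul_eq_mul, ← Finsupp.smul_single]
  rw [smul_eq_mul, mul_one]
  rfl

/-- A map on the generators which is compatible with the relations extends to the module. -/
def boxDesc {U : Opens (Fin n → X)} {N : Type*} [AddCommGroup N]
    [Module (DiffOp (powModel I n) U)ᵐᵒᵖ N] (b : SecFam P U → N)
    (hadd : ∀ (m : SecFam P U) (i : Fin n) (a a' : Sec (P i) (prImage i U)), b (Function.update m i (a + a')) =
      b (Function.update m i a) + b (Function.update m i a'))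
    (hact : ∀ (m : SecFam P U) (i : Fin n) (T : DiffOp I (prImage i U))
      (T' : DiffOp (powModel I n) U), IsLift i T T' →
      b (Function.update m i (MulOpposite.op T • m i)) = MulOpposite.op T' • b m) :
    BoxO P U →ₗ[(DiffOp (powModel I n) U)ᵐᵒᵖ] N :=
  Submodule.liftQ _ (Finsupp.linearCombination _ b) <| by
    rw [Submodule.span_le]
    rintro _ (⟨m, i, a, a'⟩ | ⟨m, i, T, T', h⟩)
    · simp [hadd]
    · simp [hact _ _ _ _ h]

lemma boxDesc_gen {U : Opens (Fin n → X)} {N : Type*} [AddCommGroup N]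
    [Module (DiffOp (powModel I n) U)ᵐᵒᵖ N] (b : SecFam P U → N) (h₁) (h₂) (m : SecFam P U) :
    boxDesc b h₁ h₂ (boxGen m) = b m := by
  refine (Submodule.liftQ_apply _ _ _).trans ?_
  rw [Finsupp.linearCombination_single, one_smul]

lemma box_induction {U : Opens (Fin n → X)} {p : BoxO P U → Prop} (t : BoxO P U)
    (hg : ∀ (T : DiffOp (powModel I n) U) m, p (MulOpposite.op T • boxGen m))
    (h0 : p 0) (ha : ∀ s t, p s → p t → p (s + t)) : p t := by
  obtain ⟨t, rfl⟩ := Submodule.Quotient.mk_surjective _ t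
  induction t using Finsupp.induction_linear with
  | zero => exact h0
  | add s t hs ht => exact ha _ _ hs ht
  | single m T =>
    have e : (Submodule.Quotient.mk (Finsupp.single m T) : BoxO P U) =
        MulOpposite.op T.unop • boxGen m := by
      change _ = Submodule.Quotient.mk (T • Finsupp.single m 1)
      rw [Finsupp.smul_single, smul_eq_mul, mul_one]
    exact e ▸ hg T.unop m

/-- Restriction of sections. -/
def boxRes (P : Fin n → PresheafOfModules.{u} (preD I X)) {U V : Opens (Fin n → X)} (h : V ≤ U) :
    BoxO P U →ₛₗ[(diffOpRes (I := powModel I n) h).toRingHom.op] BoxO P V :=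
  letI : Module (DiffOp (powModel I n) U)ᵐᵒᵖ (BoxO P V) :=
    Module.compHom _ (diffOpRes (I := powModel I n) h).toRingHom.op
  let f : BoxO P U →ₗ[(DiffOp (powModel I n) U)ᵐᵒᵖ] BoxO P V :=
    boxDesc (fun m => boxGen fun i => secRes (P i) (prImage_mono i h) (m i))
      (fun m i a a' => by
        simp only [Function.apply_update (fun i => secRes (P i) (prImage_mono i h)), map_add,
          boxGen_add])
      (fun m i T T' hT => by
        simp only [Function.apply_update (fun i => secRes (P i) (prImage_mono i h)), secRes_smul]
        exact boxGen_act (fun i => secRes (P i) (prImage_mono i h) (m i)) i _ _ (hT.res _ h))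
  { toFun := f, map_add' := f.map_add, map_smul' := f.map_smul }

lemma boxRes_gen {U V : Opens (Fin n → X)} (h : V ≤ U) (m : SecFam P U) :
    boxRes P h (boxGen m) = boxGen fun i => secRes (P i) (prImage_mono i h) (m i) := by
  let _ : Module (DiffOp (powModel I n) U)ᵐᵒᵖ (BoxO P V) :=
    Module.compHom _ (diffOpRes (I := powModel I n) h).toRingHom.op
  refine (Finsupp.linearCombination_single (DiffOp (powModel I n) U)ᵐᵒᵖ
    (v := fun m : SecFam P U => boxGen fun i => secRes (P i) (prImage_mono i h) (m i)) 1 m).trans ?_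
  exact one_smul _ _

lemma boxRes_smul_gen {U V : Opens (Fin n → X)} (h : V ≤ U) (T : DiffOp (powModel I n) U)
    (m : SecFam P U) : boxRes P h (MulOpposite.op T • boxGen m) =
      MulOpposite.op (diffOpRes h T) • boxGen fun i => secRes (P i) (prImage_mono i h) (m i) := by
  rw [LinearMap.map_smulₛₗ, boxRes_gen]; rfl

lemma boxRes_refl {U : Opens (Fin n → X)} (h : U ≤ U) (t : BoxO P U) : boxRes P h t = t := by
  induction t using box_induction with
  | hg T m => simp only [boxRes_smul_gen, secRes_refl]; rfl
  | h0 => exact map_zero _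
  | ha s t hs ht => rw [map_add, hs, ht]

lemma boxRes_trans {U V W : Opens (Fin n → X)} (h : V ≤ U) (h' : W ≤ V) (t : BoxO P U) :
    boxRes P (h'.trans h) t = boxRes P h' (boxRes P h t) := by
  induction t using box_induction with
  | hg T m => simp only [boxRes_smul_gen, secRes_trans]; rfl
  | h0 => simp only [map_zero]
  | ha s t hs ht => simp only [map_add, hs, ht]

variable (P) in
/-- The presheaf `U ↦ BoxO P U`. -/
def preBoxO : PresheafOfModules.{u} (preD (powModel I n) (Fin n → X)) :=
  letI F : (Opens (Fin n → X))ᵒᵖ ⥤ Ab.{u} :=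
    { obj := fun U => AddCommGrpCat.of (BoxO P U.unop)
      map := fun f => AddCommGrpCat.ofHom (boxRes P f.unop.le).toAddMonoidHom
      map_id := fun U => by
        ext t; exact boxRes_refl _ t
      map_comp := fun f g => by
        ext t; exact boxRes_trans f.unop.le g.unop.le t }
  letI (U : (Opens (Fin n → X))ᵒᵖ) : Module ((preD (powModel I n) (Fin n → X)).obj U) (F.obj U) :=
    inferInstanceAs (Module (DiffOp (powModel I n) U.unop)ᵐᵒᵖ (BoxO P U.unop))
  PresheafOfModules.ofPresheaf F fun U V f r m => (boxRes P f.unop.le).map_smul' r m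

/-- The functoriality of `BoxO`. -/
def boxMap {P Q : Fin n → PresheafOfModules.{u} (preD I X)} (f : P ⟶ Q)
    (U : Opens (Fin n → X)) : BoxO P U →ₗ[(DiffOp (powModel I n) U)ᵐᵒᵖ] BoxO Q U :=
  boxDesc (fun m => boxGen fun i => secMap (f i) (prImage i U) (m i))
    (fun m i a a' => by
      simp only [Function.apply_update (fun i => secMap (f i) (prImage i U)), map_add, boxGen_add])
    (fun m i T T' hT => by
      simp only [Function.apply_update (fun i => secMap (f i) (prImage i U)), map_smul]
      exact boxGen_act (fun i => secMap (f i) (prImage i U) (m i)) i _ _ hT)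

lemma boxMap_smul_gen {P Q : Fin n → PresheafOfModules.{u} (preD I X)} (f : P ⟶ Q)
    (U : Opens (Fin n → X)) (T : DiffOp (powModel I n) U) (m : SecFam P U) :
    boxMap f U (MulOpposite.op T • boxGen m) =
      MulOpposite.op T • boxGen fun i => secMap (f i) (prImage i U) (m i) := by
  rw [map_smul, boxMap, boxDesc_gen]

/-- The functoriality of `preBoxO`. -/
def preBoxOMap {P Q : Fin n → PresheafOfModules.{u} (preD I X)} (f : P ⟶ Q) :
    preBoxO P ⟶ preBoxO Q :=
  PresheafOfModules.homMk
    { app := fun U => AddCommGrpCat.ofHom (boxMap f U.unop).toAddMonoidHom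
      naturality := fun U V g => by
        ext t
        change boxMap f V.unop (boxRes P g.unop.le t) = boxRes Q g.unop.le (boxMap f U.unop t)
        induction t using box_induction with
        | hg T m =>
          rw [boxRes_smul_gen, boxMap_smul_gen, boxMap_smul_gen, boxRes_smul_gen]
          refine congrArg (fun m => MulOpposite.op (diffOpRes g.unop.le T) • boxGen m) ?_
          funext i
          exact PresheafOfModules.naturality_apply (f i) _ (m i)
        | h0 => simp only [map_zero]
        | ha s t hs ht => simp only [map_add, hs, ht] }
    fun U r t => (boxMap f U.unop).map_smul r t

/-- The functor `preBoxO`. -/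
def preBoxOFunctor (I : ModelWithCorners ℂ E H) (X : Type u) [TopologicalSpace X]
    [ChartedSpace H X] (n : ℕ) : (Fin n → PresheafOfModules.{u} (preD I X)) ⥤
      PresheafOfModules.{u} (preD (powModel I n) (Fin n → X)) where
  obj P := preBoxO P
  map f := preBoxOMap f
  map_id P := by
    ext U t
    change boxMap _ U.unop t = t
    induction t using box_induction with
    | hg T m => exact boxMap_smul_gen _ _ _ _
    | h0 => simp only [map_zero]
    | ha s t hs ht => simp only [map_add, hs, ht]
  map_comp f g := by
    ext U t
    change boxMap _ U.unop t = boxMap _ U.unop (boxMap _ U.unop t)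
    induction t using box_induction with
    | hg T m => rw [boxMap_smul_gen, boxMap_smul_gen, boxMap_smul_gen]; rfl
    | h0 => simp only [map_zero]
    | ha s t hs ht => simp only [map_add, hs, ht]

/-- The `n`-fold external product `M₁ ⊠ ⋯ ⊠ Mₙ` of right `𝒟`-modules on `X`, a right `𝒟`-module
on `Xⁿ`. -/
def boxOFunctor (I : ModelWithCorners ℂ E H) (X : Type u) [TopologicalSpace X] [ChartedSpace H X]
    (n : ℕ) : (Fin n → RightDMod I X) ⥤ RightDMod (powModel I n) (Fin n → X) :=
  Functor.pi (fun _ => toPre I X) ⋙ preBoxOFunctor I X n ⋙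
    PresheafOfModules.sheafification (toShD (powModel I n) (Fin n → X))

lemma boxGen_zero {U : Opens (Fin n → X)} (m : SecFam P U) (i : Fin n) (h : m i = 0) :
    boxGen m = 0 := by
  have := boxGen_add m i 0 0
  rw [add_zero, left_eq_add, ← h, Function.update_eq_self] at this
  exact this

lemma boxOFunctor_map_zero ⦃M N : Fin n → RightDMod I X⦄ (f : M ⟶ N) (i : Fin n) (h : f i = 0) :
    (boxOFunctor I X n).map f = 0 := by
  have e : (preBoxOFunctor I X n).map ((Functor.pi (fun _ => toPre I X)).map f) = 0 := by
    ext U t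
    change boxMap _ U.unop t = 0
    induction t using box_induction with
    | hg T m =>
      rw [boxMap_smul_gen, boxGen_zero _ i, smul_zero]
      change secMap ((toPre I X).map (f i)) _ (m i) = 0
      rw [h, CategoryTheory.Functor.map_zero]
      rfl
    | h0 => simp only [map_zero]
    | ha s t hs ht => simp only [map_add, hs, ht, add_zero]
  have := CategoryTheory.Functor.preservesZeroMorphisms_of_isLeftAdjoint
    (PresheafOfModules.sheafification (toShD (powModel I n) (Fin n → X)))
  exact (congrArg (PresheafOfModules.sheafification (toShD (powModel I n) (Fin n → X))).map e).trans
    (CategoryTheory.Functor.map_zero _ _ _)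

/-- The `n`-fold external product of complexes of right `𝒟`-modules on `X`. -/
def boxO (M : Fin n → CochainComplex (RightDMod I X) ℤ) :
    CochainComplex (RightDMod (powModel I n) (Fin n → X)) ℤ :=
  multiTotal (boxOFunctor I X n) boxOFunctor_map_zero M

end ExternalO

section Push

variable {E : Type v} [NormedAddCommGroup E] [NormedSpace ℂ E] {H : Type w} [TopologicalSpace H]
  {I : ModelWithCorners ℂ E H} {Y : Type u} [TopologicalSpace Y] [ChartedSpace H Y]

/-- The preimage functor on open subsets. -/
def preim (Φ : Y ≃ₜ Y) : Opens Y ⥤ Opens Y := Opens.map (TopCat.ofHom ⟨Φ, Φ.continuous⟩)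

instance (Φ : Y ≃ₜ Y) : Functor.IsContinuous (preim Φ) (Opens.grothendieckTopology Y)
    (Opens.grothendieckTopology Y) :=
  let f : TopCat.of Y ⟶ TopCat.of Y := TopCat.ofHom ⟨Φ, Φ.continuous⟩
  Functor.isContinuous_of_coverPreserving (compatiblePreserving_opens_map f)
    (coverPreserving_opens_map f)

/-- The direct image of sheaves under `Φ`. -/
def pushC (Φ : Y ≃ₜ Y) : ModSheaf Y ⥤ ModSheaf Y :=
  (preim Φ).sheafPushforwardContinuous (ModuleCat.{u} ℂ) (Opens.grothendieckTopology Y)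
    (Opens.grothendieckTopology Y)

instance (Φ : Y ≃ₜ Y) : (pushC Φ).PreservesZeroMorphisms where
  map_zero _ _ := rfl

variable (Φ : Y ≃ₘ^ω⟮I, I⟯ Y)

/-- `f ↦ f ∘ Φ`, from functions on `Φ(V)` to functions on `V`. -/
def comapFwd (V : Opens Y) : Holo I ((preim Φ.symm.toHomeomorph).obj V) →ₐ[ℂ] Holo I V :=
  holoComap Φ Φ.contMDiff fun y hy => by change Φ.symm (Φ y) ∈ V; simpa using hy

/-- `f ↦ f ∘ Φ⁻¹`, from functions on `V` to functions on `Φ(V)`. -/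
def comapBwd (V : Opens Y) : Holo I V →ₐ[ℂ] Holo I ((preim Φ.symm.toHomeomorph).obj V) :=
  holoComap Φ.symm Φ.symm.contMDiff fun _ hy => hy

lemma comapFwd_comapBwd (V : Opens Y) (f : Holo I V) : comapFwd Φ V (comapBwd Φ V f) = f := by
  ext x
  change f ⟨Φ.symm (Φ x), _⟩ = f x
  exact congrArg f.1 (Subtype.ext (Φ.symm_apply_apply x.1))

lemma comapBwd_comapFwd (V : Opens Y) (f : Holo I ((preim Φ.symm.toHomeomorph).obj V)) :
    comapBwd Φ V (comapFwd Φ V f) = f := by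
  ext x
  change f ⟨Φ (Φ.symm x), _⟩ = f x
  exact congrArg f.1 (Subtype.ext (Φ.apply_symm_apply x.1))

lemma preim_symm_le {U V : Opens Y} (h : V ≤ (preim Φ.toHomeomorph).obj U) :
    (preim Φ.symm.toHomeomorph).obj V ≤ U := fun y hy => by
  have : Φ (Φ.symm y) ∈ U := h hy
  rwa [Φ.apply_symm_apply] at this

/-- The transport of operators from `U` to `Φ⁻¹(U)`, `P ↦ (f ↦ P(f ∘ Φ⁻¹) ∘ Φ)`. -/
def pullOp (U : Opens Y) : Op I U →ₐ[ℂ] Op I ((preim Φ.toHomeomorph).obj U) where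
  toFun P := ⟨fun V => (comapFwd Φ V.1).toLinearMap ∘ₗ P.app (preim_symm_le Φ V.2) ∘ₗ
      (comapBwd Φ V.1).toLinearMap,
    fun V W h f => congrArg (comapFwd Φ W.1) (P.res_app (preim_symm_le Φ V.2)
      ((preim Φ.symm.toHomeomorph).monotone h) (comapBwd Φ V.1 f))⟩
  map_one' := by ext1 V h f; exact comapFwd_comapBwd Φ V f
  map_mul' P Q := by
    ext1 V h f
    exact congrArg (fun t => comapFwd Φ V (P.app (preim_symm_le Φ h) t))
      (comapBwd_comapFwd Φ V _).symm
  map_zero' := by ext1 V h f; exact map_zero (comapFwd Φ V)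
  map_add' P Q := by ext1 V h f; exact map_add (comapFwd Φ V) _ _
  commutes' c := by
    ext1 V h f
    exact (congrArg (comapFwd Φ V) (map_smul (comapBwd Φ V) c f).symm).trans
      (comapFwd_comapBwd Φ V _)

lemma pullOp_app (U : Opens Y) (P : Op I U) {V : Opens Y} (h : V ≤ (preim Φ.toHomeomorph).obj U)
    (f : Holo I V) : (pullOp Φ U P).app h f =
      comapFwd Φ V (P.app (preim_symm_le Φ h) (comapBwd Φ V f)) := rfl

/-- The transport of vector fields from `U` to `Φ⁻¹(U)`. -/
def pullVF (U : Opens Y) (ξ : VF I U) : VF I ((preim Φ.toHomeomorph).obj U) :=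
  ⟨pullOp Φ U ξ.1, fun V h f g => by
    rw [pullOp_app, map_mul, VF.app_mul, map_add, map_mul, map_mul, comapFwd_comapBwd,
      comapFwd_comapBwd]; rfl⟩

/-- The transport of differential operators from `U` to `Φ⁻¹(U)`. -/
def pullD (U : Opens Y) : DiffOp I U →ₐ[ℂ] DiffOp I ((preim Φ.toHomeomorph).obj U) :=
  diffOpMap (pullOp Φ U)
    (fun f => ⟨holoComap Φ Φ.contMDiff (fun _ hy => hy) f, by
      ext1 V h g
      rw [pullOp_app, mulOp_app, mulOp_app, map_mul, comapFwd_comapBwd]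
      rfl⟩)
    (fun ξ hξ => (pullVF Φ U ⟨ξ, hξ⟩).2)

/-- The transport of differential operators as a map of presheaves. -/
def prePullD : preD I Y ⟶ (preim Φ.toHomeomorph).op ⋙ preD I Y where
  app U := RingCat.ofHom (pullD Φ U.unop).toRingHom.op
  naturality U V f := rfl

/-- The transport of differential operators as a map of sheaves `𝒟 → Φ_* 𝒟` (for the opposite
rings). -/
def pullShD : shD I Y ⟶ ((preim Φ.toHomeomorph).sheafPushforwardContinuous RingCat.{u}
    (Opens.grothendieckTopology Y) (Opens.grothendieckTopology Y)).obj (shD I Y) :=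
  ⟨sheafifyLift (Opens.grothendieckTopology Y)
    (prePullD Φ ≫ Functor.whiskerLeft (preim Φ.toHomeomorph).op (toShD I Y))
    ((((preim Φ.toHomeomorph).sheafPushforwardContinuous RingCat.{u}
    (Opens.grothendieckTopology Y) (Opens.grothendieckTopology Y)).obj (shD I Y)).property)⟩

/-- The direct image of right `𝒟`-modules under the biholomorphic map `Φ`. -/
def pushD : RightDMod I Y ⥤ RightDMod I Y := SheafOfModules.pushforward (pullShD Φ)

instance : (pushD Φ).PreservesZeroMorphisms where
  map_zero _ _ := rfl

end Push

section Perm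

variable {E : Type v} [NormedAddCommGroup E] [NormedSpace ℂ E] {H : Type w} [TopologicalSpace H]
  (I : ModelWithCorners ℂ E H) (X : Type u) [TopologicalSpace X] [ChartedSpace H X] {n : ℕ}

/-- The action of `σ` on `Xⁿ`, `(σ x)ᵢ = x_{σ⁻¹(i)}`. -/
def permHomeo (σ : Equiv.Perm (Fin n)) : (Fin n → X) ≃ₜ (Fin n → X) where
  toFun x i := x (σ⁻¹ i)
  invFun x i := x (σ i)
  left_inv x := by ext i; simp
  right_inv x := by ext i; simp
  continuous_toFun := by fun_prop
  continuous_invFun := by fun_prop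

lemma contMDiff_perm (e : Fin n → Fin n) :
    ContMDiff (powModel I n) (powModel I n) ω (fun (x : Fin n → X) i => x (e i)) := by
  intro x
  rw [contMDiffAt_iff]
  refine ⟨(by fun_prop : Continuous fun (x : Fin n → X) i => x (e i)).continuousAt, ?_⟩
  have : ContDiffWithinAt ℂ ω (fun (v : Fin n → E) i => v (e i)) (Set.range (powModel I n))
      (extChartAt (powModel I n) x x) := by
    refine ContDiff.contDiffWithinAt ?_
    fun_prop
  refine this.congr_of_eventuallyEq_of_mem ?_ (Set.mem_range_self _)
  filter_upwards [extChartAt_target_mem_nhdsWithin (I := powModel I n) x] with v hv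
  funext i
  change extChartAt I (x (e i)) ((extChartAt I (x (e i))).symm (v (e i))) = v (e i)
  refine (extChartAt I (x (e i))).right_inv ?_
  rw [extChartAt_target] at hv ⊢
  refine ⟨hv.1 (e i) (Set.mem_univ _), ?_⟩
  obtain ⟨w, hw⟩ := hv.2
  exact ⟨w (e i), congrFun hw (e i)⟩

/-- The action of `σ` on `Xⁿ`, `(σ x)ᵢ = x_{σ⁻¹(i)}`, as a biholomorphic map. -/
def permDiffeo (σ : Equiv.Perm (Fin n)) :
    (Fin n → X) ≃ₘ^ω⟮powModel I n, powModel I n⟯ (Fin n → X) where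
  toEquiv := (permHomeo X σ).toEquiv
  contMDiff_toFun := contMDiff_perm I X _
  contMDiff_invFun := contMDiff_perm I X _

end Perm

section Sections

variable {E : Type v} [NormedAddCommGroup E] [NormedSpace ℂ E] {H : Type w} [TopologicalSpace H]
  {I : ModelWithCorners ℂ E H}

/-- Sections over `U` of a sheaf of `ℂ`-modules. -/
abbrev SecC {Y : Type u} [TopologicalSpace Y] (F : ModSheaf Y) (U : Opens Y) : Type u :=
  F.obj.obj (op U)

/-- The map on sections over `U` induced by a morphism of sheaves. -/
abbrev mapC {Y : Type u} [TopologicalSpace Y] {F G : ModSheaf Y} (f : F ⟶ G) (U : Opens Y) :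
    SecC F U →ₗ[ℂ] SecC G U := (f.hom.app (op U)).hom

/-- The section of the associated sheaf which is given by a section of a presheaf. -/
abbrev toShC {Y : Type u} [TopologicalSpace Y] (F : (Opens Y)ᵒᵖ ⥤ ModuleCat.{u} ℂ) (U : Opens Y) :
    F.obj (op U) →ₗ[ℂ]
      SecC ((presheafToSheaf (Opens.grothendieckTopology Y) (ModuleCat.{u} ℂ)).obj F) U :=
  ((toSheafify (Opens.grothendieckTopology Y) F).app (op U)).hom

/-- Sections over `U` of a right `𝒟`-module. -/
abbrev SecD {Y : Type u} [TopologicalSpace Y] [ChartedSpace H Y] (M : RightDMod I Y)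
    (U : Opens Y) : Type u := Sec ((toPre I Y).obj M) U

/-- The map on sections over `U` induced by a morphism of right `𝒟`-modules. -/
abbrev mapD {Y : Type u} [TopologicalSpace Y] [ChartedSpace H Y] {M N : RightDMod I Y} (f : M ⟶ N)
    (U : Opens Y) : SecD M U →ₗ[(DiffOp I U)ᵐᵒᵖ] SecD N U := secMap ((toPre I Y).map f) U

/-- The section `m ⊗ (v₁ ∧ ⋯ ∧ vₖ)` of `Mᵖ ⊗ ⋀ᵏ Θ ⊆ DR(M)ʲ`, where `j = p - k`. -/
def drSec {Y : Type u} [TopologicalSpace Y] [ChartedSpace H Y]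
    (M : CochainComplex (RightDMod I Y) ℤ) (p : ℤ) (k : ℕ) (j : ℤ) (h : p - k = j) {U : Opens Y}
    (m : SecD (M.X p) U) (v : Fin k → VF I U) : SecC (((DR I Y).obj M).X j) U :=
  mapC (HomologicalComplex₂.ιTotal (((deRham I Y).mapHomologicalComplex (ComplexShape.up ℤ)).obj M)
    (ComplexShape.up ℤ) p k j h) U
    (toShC (preDR I Y ((toPre I Y).obj (M.X p)) k) U (pv (Holo I U) m v))

variable {X : Type u} [TopologicalSpace X] {n : ℕ}

lemma prImage_le {U : Opens (Fin n → X)} {V : Fin n → Opens X} (hV : ∀ x ∈ U, ∀ i, x i ∈ V i)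
    (i : Fin n) : prImage i U ≤ V i := by
  rintro _ ⟨x, hx, rfl⟩; exact hV x hx i

/-- The section `s₁ ⊠ ⋯ ⊠ sₙ` over `U ⊆ V₁ × ⋯ × Vₙ` of `K₁^{p₁} ⊠ ⋯ ⊠ Kₙ^{pₙ}`, where `sᵢ` is a
section over `Vᵢ` of `Kᵢ^{pᵢ}`. -/
def boxCSec (K : Fin n → CochainComplex (ModSheaf X) ℤ) (p : Fin n → ℤ) (j : ℤ) (h : ∑ i, p i = j)
    {U : Opens (Fin n → X)} {V : Fin n → Opens X} (hV : ∀ x ∈ U, ∀ i, x i ∈ V i)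
    (s : ∀ i, SecC ((K i).X (p i)) (V i)) : SecC ((boxC K).X j) U :=
  mapC (multiι (boxCFunctor X n) boxCFunctor_map_zero K p j h) U
    (toShC (preBoxC fun i => (K i).X (p i)) U (PiTensorProduct.tprod ℂ fun i =>
      (((K i).X (p i)).obj.map (homOfLE (prImage_le hV i)).op).hom (s i)))

variable [ChartedSpace H X]

/-- The section `m₁ ⊠ ⋯ ⊠ mₙ` over `U ⊆ V₁ × ⋯ × Vₙ` of the external product
`M₁^{p₁} ⊠ ⋯ ⊠ Mₙ^{pₙ}` of right `𝒟`-modules, where `mᵢ` is a section over `Vᵢ` of `Mᵢ^{pᵢ}`. -/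
def boxOSec (M : Fin n → CochainComplex (RightDMod I X) ℤ) (p : Fin n → ℤ) (j : ℤ)
    (h : ∑ i, p i = j) {U : Opens (Fin n → X)} {V : Fin n → Opens X}
    (hV : ∀ x ∈ U, ∀ i, x i ∈ V i) (m : ∀ i, SecD ((M i).X (p i)) (V i)) :
    SecD ((boxO M).X j) U :=
  mapD (multiι (boxOFunctor I X n) boxOFunctor_map_zero M p j h) U
    (secMap ((PresheafOfModules.sheafificationAdjunction (toShD (powModel I n) (Fin n → X))).unit.app
      (preBoxO fun i => (toPre I X).obj ((M i).X (p i)))) U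
      (boxGen fun i => secRes ((toPre I X).obj ((M i).X (p i))) (prImage_le hV i) (m i)))

/-- The canonical morphism `⊠_ℂ DR(Mᵢ) → DR(⊠_𝒪 Mᵢ)`: it is given by
`⊠ (mᵢ ⊗ ηᵢ) ↦ (-1)^ν (⊠ mᵢ) ⊗ (pr₁* η₁ ∧ ⋯ ∧ prₙ* ηₙ)` with `ν = ∑_{i > j} pᵢ qⱼ`, for
`mᵢ ∈ Mᵢ^{pᵢ}` and `ηᵢ = ξᵢ₁ ∧ ⋯ ∧ ξᵢ_{kᵢ}` of degree `qᵢ = -kᵢ`. Here `ξ'ᵢₐ` is the vector field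
`prᵢ* ξᵢₐ` which acts as `ξᵢₐ` in the `i`-th variable. -/
def IsCanonical (M : Fin n → CochainComplex (RightDMod I X) ℤ)
    (c : boxC (fun i => (DR I X).obj (M i)) ⟶ (DR (powModel I n) (Fin n → X)).obj (boxO M)) : Prop :=
  ∀ (p : Fin n → ℤ) (k : Fin n → ℕ) (U : Opens (Fin n → X)) (V : Fin n → Opens X)
    (hV : ∀ x ∈ U, ∀ i, x i ∈ V i) (m : ∀ i, SecD ((M i).X (p i)) (V i))
    (ξ : ∀ i, Fin (k i) → VF I (V i)) (ξ' : ∀ i, Fin (k i) → VF (powModel I n) U)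
    (_ : ∀ i a, IsLift i (vfToD (V i) (ξ i a)) (vfToD U (ξ' i a))),
    mapC (c.f (∑ i, (p i - k i))) U
      (boxCSec (fun i => (DR I X).obj (M i)) (fun i => p i - k i) _ rfl hV
        (fun i => drSec (M i) (p i) (k i) _ rfl (m i) (ξ i))) =
    (Int.negOnePow (∑ i, ∑ j ∈ Finset.Iio i, p i * k j) : ℤ) •
      drSec (boxO M) (∑ i, p i) (∑ i, k i) _ (by simp) (boxOSec M p _ rfl hV m)
        (fun a => ξ' (finSigmaFinEquiv.symm a).1 (finSigmaFinEquiv.symm a).2)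

variable (I X) in
/-- The direct image `σ_*` of complexes of sheaves on `Xⁿ`. -/
abbrev permPushC (σ : Equiv.Perm (Fin n)) :
    CochainComplex (ModSheaf (Fin n → X)) ℤ ⥤ CochainComplex (ModSheaf (Fin n → X)) ℤ :=
  (pushC (permDiffeo I X σ).toHomeomorph).mapHomologicalComplex (ComplexShape.up ℤ)

variable (I X) in
/-- The direct image `σ_*` of complexes of right `𝒟`-modules on `Xⁿ`. -/
abbrev permPushD (σ : Equiv.Perm (Fin n)) :
    CochainComplex (RightDMod (powModel I n) (Fin n → X)) ℤ ⥤
      CochainComplex (RightDMod (powModel I n) (Fin n → X)) ℤ :=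
  (pushD (permDiffeo I X σ)).mapHomologicalComplex (ComplexShape.up ℤ)

variable (I) in
/-- `σ⁻¹(U)` for an open subset `U` of `Xⁿ`. -/
abbrev permPreim (σ : Equiv.Perm (Fin n)) (U : Opens (Fin n → X)) : Opens (Fin n → X) :=
  (preim (permDiffeo I X σ).toHomeomorph).obj U

lemma permPreim_le {σ : Equiv.Perm (Fin n)} {U : Opens (Fin n → X)} {V : Fin n → Opens X}
    (hV : ∀ x ∈ U, ∀ i, x i ∈ V i) : ∀ x ∈ permPreim I σ U, ∀ i, x i ∈ V (σ i) := by
  intro x hx i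
  have : x (σ⁻¹ (σ i)) ∈ V (σ i) := hV _ hx (σ i)
  simpa using this

/-- The Koszul sign of the reordering `m₁, …, mₙ ↦ m_{σ(1)}, …, m_{σ(n)}` of elements of degrees
`p₁, …, pₙ`: the sign of the permutation of the elements of odd degree. -/
def permSign (σ : Equiv.Perm (Fin n)) (p : Fin n → ℤ) : ℤˣ :=
  Int.negOnePow (∑ i, ∑ j ∈ Finset.Ioi i with σ j < σ i, p (σ i) * p (σ j))

/-- The canonical isomorphism `σ^# : ⊠_ℂ Kᵢ ≅ σ_*(⊠_ℂ K_{σ(i)})` given by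
`⊠ mᵢ ↦ ± σ_*(⊠ m_{σ(i)})` with the Koszul sign. -/
def IsSharpC (σ : Equiv.Perm (Fin n)) (K : Fin n → CochainComplex (ModSheaf X) ℤ)
    (s : boxC K ≅ (permPushC I X σ).obj (boxC fun i => K (σ i))) : Prop :=
  ∀ (p : Fin n → ℤ) (j : ℤ) (h : ∑ i, p i = j) (U : Opens (Fin n → X)) (V : Fin n → Opens X)
    (hV : ∀ x ∈ U, ∀ i, x i ∈ V i) (m : ∀ i, SecC ((K i).X (p i)) (V i)),
    mapC (s.hom.f j) U (boxCSec K p j h hV m) = (permSign σ p : ℤ) •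
      (boxCSec (fun i => K (σ i)) (fun i => p (σ i)) j ((Equiv.sum_comp σ p).trans h)
        (permPreim_le hV) (fun i => m (σ i)) : SecC _ (permPreim I σ U))

/-- A section of `M` over `Φ⁻¹(U)` as a section of `Φ_* M` over `U`. -/
def toPushSec {Y : Type u} [TopologicalSpace Y] [ChartedSpace H Y] (Φ : Y ≃ₘ^ω⟮I, I⟯ Y)
    (M : RightDMod I Y) {U : Opens Y} (m : SecD M ((preim Φ.toHomeomorph).obj U)) :
    SecD ((pushD Φ).obj M) U := m

/-- The canonical isomorphism `σ^# : ⊠_𝒪 Mᵢ ≅ σ_*(⊠_𝒪 M_{σ(i)})` given by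
`⊠ mᵢ ↦ ± σ_*(⊠ m_{σ(i)})` with the Koszul sign. -/
def IsSharpO (σ : Equiv.Perm (Fin n)) (M : Fin n → CochainComplex (RightDMod I X) ℤ)
    (t : boxO M ≅ (permPushD I X σ).obj (boxO fun i => M (σ i))) : Prop :=
  ∀ (p : Fin n → ℤ) (j : ℤ) (h : ∑ i, p i = j) (U : Opens (Fin n → X)) (V : Fin n → Opens X)
    (hV : ∀ x ∈ U, ∀ i, x i ∈ V i) (m : ∀ i, SecD ((M i).X (p i)) (V i)),
    mapD (t.hom.f j) U (boxOSec M p j h hV m) = (permSign σ p : ℤ) •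
      toPushSec (permDiffeo I X σ) ((boxO fun i => M (σ i)).X j)
        (boxOSec (fun i => M (σ i)) (fun i => p (σ i)) j ((Equiv.sum_comp σ p).trans h)
          (permPreim_le hV) (fun i => m (σ i)))

/-- The canonical isomorphism `DR(Φ_* N) ≅ Φ_* DR(N)` for a biholomorphic map `Φ`: it is given by
`m ⊗ (v₁ ∧ ⋯ ∧ vₖ) ↦ m ⊗ (v'₁ ∧ ⋯ ∧ v'ₖ)`, where `v'` is the vector field on `Φ⁻¹(U)` which
corresponds to the vector field `v` on `U`. -/
def IsComm {Y : Type u} [TopologicalSpace Y] [ChartedSpace H Y] (Φ : Y ≃ₘ^ω⟮I, I⟯ Y)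
    (N : CochainComplex (RightDMod I Y) ℤ)
    (e : (DR I Y).obj (((pushD Φ).mapHomologicalComplex _).obj N) ≅
      ((pushC Φ.toHomeomorph).mapHomologicalComplex _).obj ((DR I Y).obj N)) : Prop :=
  ∀ (p : ℤ) (k : ℕ) (j : ℤ) (h : p - k = j) (U : Opens Y)
    (m : SecD (N.X p) ((preim Φ.toHomeomorph).obj U)) (v : Fin k → VF I U),
    mapC (e.hom.f j) U (drSec (((pushD Φ).mapHomologicalComplex _).obj N) p k j h
      (toPushSec Φ (N.X p) m) v) =
    (drSec N p k j h m (fun a => pullVF Φ U (v a)) :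
      SecC _ ((preim Φ.toHomeomorph).obj U))

end Sections

end

end DRSym

/-! Every morphism in the statement is determined by what it does on small pieces, and on these
pieces the proof is multilinear algebra plus bookkeeping of signs.

Pieces. Since `M i` is bounded above, `DR(M i)` in degree `q` is the finite direct sum over `k` of
`M^{q+k} ⊗ ⋀ᵏ Θ` (`isFiniteSum_drι`). The external product over `ℂ` is additive in each variable, so
`⊠ DR(M i)^{q i}` is a finite direct sum of the sheaves `⊠ (M i^{p i} ⊗ ⋀^{k i} Θ)` with `p - k =
q`. Each of these is the sheaf associated to a presheaf whose sections are generated by decomposable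
elements. This gives uniqueness of `c_M` and turns existence into the construction of one map
`boxDR` per piece.

The map on a piece. It is the wedge product `⊠ (mᵢ ⊗ ηᵢ) ↦ (⊠ mᵢ) ⊗ (pr₁* η₁ ∧ ⋯ ∧ prₙ* ηₙ)`. It
needs the lifts `prᵢ* ξ` of vector fields: applying a derivation `ξ` in the `i`-th variable gives a
holomorphic function of all variables because Hadamard's lemma expresses `ξ` in coordinates
(`VF.app_eq_sum`, `contMDiffOn_liftFun`). Lifts are unique, respect brackets, and lifts in different
variables commute (`liftVF_lie_of_ne`). The product is defined on decomposables and extended one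
variable at a time (`exists_multilinear_of_span`). Its compatibility with the Koszul differential is
a graded Leibniz rule, deduced from Cartan's formula `δ(x ∧ t) = L_x t - x ∧ δ t`
(`koszulAll_boxMul`).

Morphism of complexes. The differential of `DR` splits into `d` and `±δ`. The first part commutes
with `boxDR` by naturality, the second by the Leibniz rule, and the sign `(-1)^{∑_{i>j} pᵢ qⱼ}` is
correct because of `crossSign_bump` and `crossSign_update`.

Permutations. Reordering tensor factors, or generators of the external product of `𝒟`-modules, is
bijective already on sections of presheaves, and so is the transport of polyvector fields along a
biholomorphic map. Local bijectivity survives sheafification and direct image. Direct image under a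
homeomorphism is an equivalence, so it commutes with the direct sums in the total complexes
(`exists_sharp`, `exists_totalIso`). The Koszul sign of `σ^#` is compatible with the differentials
by `koszulSign_permSign`.

The diagram. On a piece both composites are signs times the same morphism `boxDRPermι`. Besides the
signs of `σ^#` and `c`, reordering the blocks of vector fields contributes the Koszul sign of the
degrees `k` (`wedgeList_perm`, `boxCPerm_boxDR`), and the two total signs agree by
`crossSign_permSign`. -/

namespace DRSym
noncomputable section

universe u v w

/-! ### Multilinear maps prescribed on generators -/

section MultilinearLift

variable {ι : Type*} [Fintype ι] [hι : DecidableEq ι] {N : ι → Type*} [∀ i, AddCommGroup (N i)]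
  [∀ i, Module ℂ (N i)] {G : Type*} [AddCommGroup G] [Module ℂ G] {S : ι → Type*}

/-- A multilinear map which vanishes on families of generators vanishes. -/
lemma multilinear_eq_zero_of_span (g : ∀ i, S i → N i)
    (hg : ∀ i, Submodule.span ℂ (Set.range (g i)) = ⊤) (f : MultilinearMap ℂ N G)
    (h : ∀ s : ∀ i, S i, f (fun i => g i (s i)) = 0) (t : ∀ i, N i) : f t = 0 := by
  -- Induction on the set of entries not yet known to be generators; each step spends the span
  -- hypothesis on one entry.
  have key : ∀ (s : Finset ι) (t : ∀ i, N i), (∀ i ∉ s, t i ∈ Set.range (g i)) → f t = 0 := by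
    intro s
    induction s using Finset.induction_on with
    | empty =>
      intro t ht
      choose s hs using fun i => ht i (Finset.notMem_empty i)
      rw [← h s]
      exact congrArg f (funext fun i => (hs i).symm)
    | insert a s ha ih =>
      intro t ht
      have : ∀ x ∈ Submodule.span ℂ (Set.range (g a)), f (Function.update t a x) = 0 := by
        intro x hx
        induction hx using Submodule.span_induction with
        | mem x hx =>
          refine ih _ fun i hi => ?_
          by_cases hia : i = a
          · subst hia; simpa using hx
          · rw [Function.update_of_ne hia]
            exact ht i (by simp [hia, hi])
        | zero => exact f.map_coord_zero a (by simp)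
        | add x y _ _ hx hy => rw [f.map_update_add, hx, hy, add_zero]
        | smul c x _ hx => rw [f.map_update_smul, hx, smul_zero]
      simpa using this (t a) (by rw [hg]; trivial)
  exact key Finset.univ t (fun i hi => absurd (Finset.mem_univ i) hi)

/-- Multilinear maps are determined by their values on families of generators. -/
lemma multilinear_ext_of_span (g : ∀ i, S i → N i)
    (hg : ∀ i, Submodule.span ℂ (Set.range (g i)) = ⊤) {f f' : MultilinearMap ℂ N G}
    (h : ∀ s : ∀ i, S i, f (fun i => g i (s i)) = f' (fun i => g i (s i))) : f = f' := by
  ext t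
  exact sub_eq_zero.1 (multilinear_eq_zero_of_span g hg (f - f') (fun s => by simp [h s]) t)

/-- A function on families of generators which extends linearly in each variable extends to a
multilinear map. -/
lemma exists_multilinear_of_span (g : ∀ i, S i → N i)
    (hg : ∀ i, Submodule.span ℂ (Set.range (g i)) = ⊤) (b : (∀ i, S i) → G)
    (hb : ∀ (i : ι) (s : ∀ i, S i), ∃ φ : N i →ₗ[ℂ] G, ∀ x, φ (g i x) = b (Function.update s i x)) :
    ∃ B : MultilinearMap ℂ N G, ∀ s, B (fun i => g i (s i)) = b s := by
  classical
  -- On free modules the extension is unconditional. The rest of the proof shows that `F` descends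
  -- along the surjections `c i` onto `N i`.
  let F : MultilinearMap ℂ (fun i => S i →₀ ℂ) G :=
    (MultilinearMap.fromDFinsuppEquiv S ℂ (M := fun _ _ => ℂ)
      (fun s => (MultilinearMap.mkPiRing ℂ ι (b s) : MultilinearMap ℂ (fun _ : ι => ℂ) G))
      ).compLinearMap (fun i => (finsuppLequivDFinsupp ℂ).toLinearMap)
  have hF (s : ∀ i, S i) : F (fun i => Finsupp.single (s i) 1) = b s := by
    simp only [F, MultilinearMap.compLinearMap_apply, LinearEquiv.coe_coe,
      finsuppLequivDFinsupp_apply_apply, Finsupp.toDFinsupp_single]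
    refine (MultilinearMap.fromDFinsuppEquiv_single _ _ _).trans ?_
    simp
  let c (i : ι) : (S i →₀ ℂ) →ₗ[ℂ] N i := Finsupp.linearCombination ℂ (g i)
  have hc (i : ι) : Function.Surjective (c i) := by
    rw [← LinearMap.range_eq_top, Finsupp.range_linearCombination, hg]
  have hs (i : ι) : Submodule.span ℂ (Set.range fun x : S i => Finsupp.single x (1 : ℂ)) = ⊤ :=
    (Finsupp.basisSingleOne (R := ℂ) (ι := S i)).span_eq ▸ by congr 1
  -- `F` vanishes if one of the arguments is in the kernel of `c`
  have hker (i : ι) (p : ∀ i, S i →₀ ℂ) (x : S i →₀ ℂ) (hx : c i x = 0) :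
      F (Function.update p i x) = 0 := by
    have h2 : (∀ s : ∀ i, S i, F (Function.update (fun i => Finsupp.single (s i) 1) i x) = 0) := by
      intro s
      obtain ⟨φ, hφ⟩ := hb i s
      -- With the other entries at basis elements, `hb` says that `F` factors through `c i` in the
      -- `i`-th entry.
      have : F.toLinearMap (fun i => Finsupp.single (s i) 1) i = φ ∘ₗ c i := by
        ext y
        have := hF (Function.update s i y)
        simp only [LinearMap.coe_comp, Function.comp_apply, Finsupp.lsingle_apply,
          MultilinearMap.toLinearMap_apply, c, Finsupp.linearCombination_single, one_smul, hφ,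
          ← this]
        congr 1
        funext j
        by_cases hj : j = i
        · subst hj; simp
        · simp [hj]
      have := LinearMap.congr_fun this x
      simpa [hx] using this
    have hp : ∀ (s : Finset ι) (p : ∀ i, S i →₀ ℂ),
        (∀ j ∉ s, p j ∈ Set.range fun y : S j => Finsupp.single y (1 : ℂ)) → i ∉ s →
        (F (Function.update p i x)) = 0 := by
      intro s
      induction s using Finset.induction_on with
      | empty =>
        intro p hp _
        choose s hs using fun j => hp j (Finset.notMem_empty j)
        rw [← h2 s]
        congr 2
        funext j; exact (hs j).symm
      | insert a s ha ih =>
        intro p hp hi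
        have hia : a ≠ i := fun h => hi (h ▸ Finset.mem_insert_self _ _)
        have : ∀ y ∈ Submodule.span ℂ (Set.range fun z : S a => Finsupp.single z (1 : ℂ)),
            F (Function.update (Function.update p i x) a y) = 0 := by
          intro y hy
          induction hy using Submodule.span_induction with
          | mem y hy =>
            rw [Function.update_comm hia.symm]
            refine ih _ (fun j hj => ?_) (fun h => hi (Finset.mem_insert_of_mem h))
            by_cases hja : j = a
            · subst hja; simpa using hy
            · rw [Function.update_of_ne hja]
              exact hp j (by simp [hja, hj])
          | zero => exact F.map_coord_zero a (by simp)
          | add x y _ _ hx hy => rw [F.map_update_add, hx, hy, add_zero]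
          | smul c x _ hx => rw [F.map_update_smul, hx, smul_zero]
        have := this (p a) (by rw [hs]; trivial)
        rwa [Function.update_comm hia.symm, Function.update_eq_self] at this
    obtain ⟨q, hq⟩ := Finsupp.mem_span_range_iff_exists_finsupp.1
      (show x ∈ Submodule.span ℂ (Set.range fun z : S i => Finsupp.single z (1 : ℂ)) by
        rw [hs]; trivial)
    -- The entry of `p` at `i` is overwritten anyway, but `hp` wants a basis element there. If `S i`
    -- is empty there is none, and then `x = 0`.
    by_cases hne : Nonempty (S i)
    · have := hp (Finset.univ.erase i) (Function.update p i (Finsupp.single hne.some 1))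
        (fun j hj => by
          obtain rfl : j = i := by simpa using hj
          simp) (by simp)
      simpa using this
    · have : x = 0 := by ext y; exact (hne ⟨y⟩).elim
      exact F.map_coord_zero i (by simp [this])
  -- `F` depends only on the images under the `c i`: replace the entries one at a time.
  have hcongr (p p' : ∀ i, S i →₀ ℂ) (h : ∀ i, c i (p i) = c i (p' i)) : F p = F p' := by
    have : ∀ s : Finset ι, F (fun i => if i ∈ s then p i else p' i) = F p' := by
      intro s
      induction s using Finset.induction_on with
      | empty => simp
      | insert a s ha ih =>
        rw [← ih, ← sub_eq_zero]
        have e1 : (fun i => if i ∈ insert a s then p i else p' i) =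
            Function.update (fun i => if i ∈ s then p i else p' i) a (p a) := by
          funext j; by_cases hj : j = a
          · subst hj; simp
          · simp [hj]
        have e2 : (fun i => if i ∈ s then p i else p' i) =
            Function.update (fun i => if i ∈ s then p i else p' i) a (p' a) := by
          funext j; by_cases hj : j = a
          · subst hj; simp [ha]
          · simp [hj]
        rw [e1]
        nth_rw 2 [e2]
        rw [← F.map_update_sub]
        exact hker _ _ _ (by rw [map_sub, h, sub_self])
    simpa using this Finset.univ
  -- A section of `c i` which is merely set-theoretic; the composite with `F` is nevertheless linear
  -- in each entry, by `hcongr`.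
  let r (i : ι) : N i → (S i →₀ ℂ) := Function.surjInv (hc i)
  have hr (i : ι) (x : N i) : c i (r i x) = x := Function.surjInv_eq (hc i) x
  refine ⟨{ toFun := fun t => F fun i => r i (t i), map_update_add' := ?_, map_update_smul' := ?_ },
    fun s => ?_⟩
  · intro dec t i x y
    obtain rfl : dec = hι := Subsingleton.elim _ _
    have e (z : N i) : (fun j => r j (Function.update t i z j)) =
        Function.update (fun j => r j (t j)) i (r i z) := by
      funext j; by_cases hj : j = i
      · subst hj; simp
      · simp [hj]
    rw [e, e, e, ← F.map_update_add]
    refine hcongr _ _ fun j => ?_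
    by_cases hj : j = i
    · subst hj; simp [hr]
    · simp [hj]
  · intro dec t i a x
    obtain rfl : dec = hι := Subsingleton.elim _ _
    have e (z : N i) : (fun j => r j (Function.update t i z j)) =
        Function.update (fun j => r j (t j)) i (r i z) := by
      funext j; by_cases hj : j = i
      · subst hj; simp
      · simp [hj]
    rw [e, e, ← F.map_update_smul]
    refine hcongr _ _ fun j => ?_
    by_cases hj : j = i
    · subst hj; simp [hr]
    · simp [hj]
  · refine (hcongr _ (fun i => Finsupp.single (s i) 1) fun i => ?_).trans (hF s)
    simp [hr, c]

end MultilinearLift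

/-! ### Exterior multiplication, Koszul differential and Lie derivative in all degrees at once -/

section PolyAll

variable {A L M : Type*} [CommRing A] [Algebra ℂ A] [LieRing L] [LieAlgebra ℂ L] [Module A L]
  [IsScalarTower ℂ A L] [LieRingModule L A] [LieRinehartRing A L]
  [AddCommGroup M] [Module ℂ M] [Module A M] [IsScalarTower ℂ A M]

variable (A L M) in
/-- The product over all `k` of the modules `M ⊗ ⋀ᵏ L`. -/
abbrev PolyAll : Type _ := ∀ k, Polyvec A L M k

lemma wedgeL_add {k : ℕ} (x y : L) (t : Polyvec A L M k) :
    wedgeL k (x + y) t = wedgeL k x t + wedgeL k y t := by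
  rw [← sub_eq_iff_eq_add, ← wedgeL_sub, add_sub_cancel_right]

lemma wedgeL_wedgeL_self {k : ℕ} (x : L) (t : Polyvec A L M k) :
    wedgeL (k + 1) x (wedgeL k x t) = 0 := by
  induction t using pv_induction with
  | h0 => simp
  | h2 s t hs ht => simp only [map_add, hs, ht, add_zero]
  | h1 m v =>
    rw [wedgeL_pv, wedgeL_pv, pv, (exteriorPower.ιMulti A (k + 1 + 1)).map_eq_zero_of_eq _
      (i := 0) (j := 1) (by simp) (by simp), TensorProduct.tmul_zero]

/-- The exterior multiplication `t ↦ x ∧ t` in all degrees. -/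
def wedgeAll : L →ₗ[A] Module.End A (PolyAll A L M) where
  toFun x :=
    { toFun := fun t k => match k with
        | 0 => 0
        | k + 1 => wedgeL k x (t k)
      map_add' := fun s t => by
        ext1 k; cases k
        · exact (add_zero _).symm
        · exact map_add (wedgeL _ x) _ _
      map_smul' := fun a t => by
        ext1 k; cases k
        · exact (smul_zero a).symm
        · exact wedgeL_smul a x _ }
  map_add' x y := by
    ext1 t; ext1 k; cases k
    · exact (add_zero _).symm
    · exact wedgeL_add x y _
  map_smul' a x := by
    ext1 t; ext1 k; cases k
    · exact (smul_zero a : a • (0 : Polyvec A L M 0) = 0).symm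
    · exact wedgeL_smul_left a x _

@[simp] lemma wedgeAll_zero (x : L) (t : PolyAll A L M) : wedgeAll x t 0 = 0 := rfl
@[simp] lemma wedgeAll_succ (x : L) (t : PolyAll A L M) (k : ℕ) :
    wedgeAll x t (k + 1) = wedgeL k x (t k) := rfl

/-- The relation needed to extend `wedgeAll` to the exterior algebra; polarized, it gives the
anticommutation behind all block signs. -/
lemma wedgeAll_mul_self (x : L) : (wedgeAll x * wedgeAll x : Module.End A (PolyAll A L M)) = 0 := by
  ext1 t; ext1 k
  match k with
  | 0 => rfl
  | 1 => exact map_zero (wedgeL 0 x)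
  | k + 2 => exact wedgeL_wedgeL_self x (t k)

lemma wedgeAll_single (x : L) (k : ℕ) (t : Polyvec A L M k) :
    wedgeAll x (Pi.single k t : PolyAll A L M) = Pi.single (k + 1) (wedgeL k x t) := by
  ext1 j
  cases j with
  | zero => simp
  | succ j =>
    rw [wedgeAll_succ]
    by_cases h : j = k
    · subst h; simp
    · rw [Pi.single_eq_of_ne h, Pi.single_eq_of_ne (by omega), map_zero]

/-- The Koszul differential in all degrees. -/
def koszulAll (ρ : RightAction A L M) : PolyAll A L M →ₗ[ℂ] PolyAll A L M where
  toFun t k := koszul ρ k (t (k + 1))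
  map_add' s t := by ext1 k; exact map_add (koszul ρ k) _ _
  map_smul' c t := by ext1 k; exact map_smul (koszul ρ k) _ _

/-- The Lie derivative in all degrees. -/
def lieAll (ρ : RightAction A L M) (x : L) : PolyAll A L M →ₗ[ℂ] PolyAll A L M where
  toFun t k := lieD ρ x k (t k)
  map_add' s t := by ext1 k; exact map_add (lieD ρ x k) _ _
  map_smul' c t := by ext1 k; exact map_smul (lieD ρ x k) _ _

/-- Cartan's formula. It is the definition of `lieD` in each degree; in degree `0` the subtracted
term is zero because `wedgeAll` has no component there. -/
lemma koszulAll_wedgeAll (ρ : RightAction A L M) (x : L) (t : PolyAll A L M) :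
    koszulAll ρ (wedgeAll x t) = lieAll ρ x t - wedgeAll x (koszulAll ρ t) := by
  ext1 k
  cases k with
  | zero => exact (sub_zero _).symm
  | succ k => exact koszul_wedge ρ x k _

lemma lieAll_wedgeAll (ρ : RightAction A L M) (x y : L) (t : PolyAll A L M) :
    lieAll ρ x (wedgeAll y t) = wedgeAll y (lieAll ρ x t) - wedgeAll ⁅x, y⁆ t := by
  ext1 k
  cases k with
  | zero => exact (map_zero (lieD ρ x 0)).trans (sub_zero _).symm
  | succ k => exact lieD_wedge ρ x y k _

variable (A L) in
/-- An element of `M` in degree `0`. -/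
def embZero : M →ₗ[ℂ] PolyAll A L M where
  toFun m := Pi.single 0 (pv A m ![])
  map_add' m m' := by rw [← Pi.single_add, pv, TensorProduct.add_tmul]; rfl
  map_smul' c m := by
    rw [RingHom.id_apply, ← Pi.single_smul, pv, ← TensorProduct.smul_tmul']; rfl

lemma embZero_smul (a : A) (m : M) : embZero A L (a • m) = a • embZero A L m := by
  change Pi.single 0 (pv A (a • m) ![]) = a • Pi.single 0 (pv A m ![])
  rw [← Pi.single_smul, pv_smul]

lemma koszulAll_embZero (ρ : RightAction A L M) (m : M) : koszulAll ρ (embZero A L m) = 0 := by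
  ext1 k
  change koszul ρ k ((Pi.single 0 (pv A m ![]) : PolyAll A L M) (k + 1)) = 0
  rw [Pi.single_eq_of_ne (by omega), map_zero]

lemma lieAll_embZero (ρ : RightAction A L M) (x : L) (m : M) :
    lieAll ρ x (embZero A L m) = embZero A L (ρ.act x m) := by
  ext1 k
  change lieD ρ x k ((Pi.single 0 (pv A m ![]) : PolyAll A L M) k) =
    (Pi.single 0 (pv A (ρ.act x m) ![]) : PolyAll A L M) k
  cases k with
  | zero => rw [Pi.single_eq_same, Pi.single_eq_same, lieD_pv]; simp
  | succ k => rw [Pi.single_eq_of_ne (by omega), Pi.single_eq_of_ne (by omega), map_zero]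

/-- The exterior multiplication `t ↦ x₁ ∧ ⋯ ∧ xᵣ ∧ t` in all degrees. -/
def wedgeList (l : List L) : Module.End A (PolyAll A L M) := (l.map wedgeAll).prod

@[simp] lemma wedgeList_nil (t : PolyAll A L M) : wedgeList ([] : List L) t = t := rfl

@[simp] lemma wedgeList_cons (x : L) (l : List L) (t : PolyAll A L M) :
    wedgeList (x :: l) t = wedgeAll x (wedgeList l t) := by
  simp [wedgeList]

lemma wedgeList_append (l l' : List L) (t : PolyAll A L M) :
    wedgeList (l ++ l') t = wedgeList l (wedgeList l' t) := by
  simp [wedgeList]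

/-- Polyvector fields are handled as lists of vector fields, for which concatenation of blocks needs
no arithmetic of `Fin` types; this translates back to decomposable elements. -/
lemma wedgeList_ofFn (m : M) {k : ℕ} (v : Fin k → L) :
    wedgeList (List.ofFn v) (embZero A L m) = Pi.single k (pv A m v) := by
  induction k with
  | zero => rw [Subsingleton.elim v ![]]; rfl
  | succ k ih =>
    rw [List.ofFn_succ, wedgeList_cons, ih, wedgeAll_single, wedgeL_pv]
    congr 2
    exact Fin.cons_self_tail v

lemma wedgeList_embZero_of_ne (m : M) (l : List L) {k : ℕ} (h : k ≠ l.length) :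
    wedgeList l (embZero A L m) k = 0 := by
  rw [← List.ofFn_get l, wedgeList_ofFn, Pi.single_eq_of_ne h]

/-- The action of polyvector fields by exterior multiplication. -/
def extAct : ExteriorAlgebra A L →ₐ[A] Module.End A (PolyAll A L M) :=
  ExteriorAlgebra.lift A ⟨wedgeAll, wedgeAll_mul_self⟩

lemma extAct_ιMulti {k : ℕ} (v : Fin k → L) (t : PolyAll A L M) :
    extAct (exteriorPower.ιMulti A k v : ExteriorAlgebra A L) t = wedgeList (List.ofFn v) t := by
  rw [exteriorPower.ιMulti_apply_coe, ExteriorAlgebra.ιMulti_apply, map_list_prod, List.map_ofFn,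
    wedgeList, List.map_ofFn]
  congr 3
  funext i
  exact ExteriorAlgebra.lift_ι_apply A _ _ _

end PolyAll

/-! ### Koszul differential of one block of vector fields wedged onto an element that may itself
have positive degree -/

section SlotMap

variable {A L M A₁ L₁ M₁ : Type*} [CommRing A] [Algebra ℂ A] [LieRing L] [LieAlgebra ℂ L]
  [Module A L] [IsScalarTower ℂ A L] [LieRingModule L A] [LieRinehartRing A L]
  [AddCommGroup M] [Module ℂ M] [Module A M] [IsScalarTower ℂ A M]
  [CommRing A₁] [Algebra ℂ A₁] [LieRing L₁] [LieAlgebra ℂ L₁]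
  [Module A₁ L₁] [IsScalarTower ℂ A₁ L₁] [LieRingModule L₁ A₁] [LieRinehartRing A₁ L₁]
  [AddCommGroup M₁] [Module ℂ M₁] [Module A₁ M₁] [IsScalarTower ℂ A₁ M₁]
  {σ : A₁ →ₐ[ℂ] A} (g : L₁ →ₛₗ[σ.toRingHom] L) (f : M₁ →ₗ[ℂ] PolyAll A L M)
  (hf : ∀ a m, f (a • m) = σ a • f m)

/-- The map `m ⊗ x₁ ∧ ⋯ ∧ xₖ ↦ g(x₁) ∧ ⋯ ∧ g(xₖ) ∧ f(m)`. -/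
def slotMap (k : ℕ) : Polyvec A₁ L₁ M₁ k →ₗ[ℂ] PolyAll A L M :=
  let F : Polyvec A₁ L₁ M₁ k →+ PolyAll A L M := TensorProduct.liftAddHom
    { toFun := fun m =>
        { toFun := fun η => extAct (extMap g k η : ExteriorAlgebra A L) (f m)
          map_zero' := by rw [LinearMap.map_zero, Submodule.coe_zero, map_zero]; rfl
          map_add' := fun η θ => by rw [LinearMap.map_add, Submodule.coe_add, map_add]; rfl }
      map_zero' := by ext η; simp
      map_add' := fun m n => by ext η; simp }
    (fun a m η => by
      change extAct (extMap g k η : ExteriorAlgebra A L) (f (a • m)) =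
        extAct (extMap g k (a • η) : ExteriorAlgebra A L) (f m)
      rw [hf, map_smul, LinearMap.map_smulₛₗ, SetLike.val_smul, map_smul]; rfl)
  { F with
    map_smul' := fun c t => by
      induction t using TensorProduct.induction_on with
      | zero => simp
      | add s t hs ht =>
        rw [smul_add]
        exact ((F.map_add _ _).trans (congrArg₂ (· + ·) hs ht)).trans
          ((smul_add _ _ _).symm.trans (congrArg (c • ·) (F.map_add s t).symm))
      | tmul m η =>
        rw [TensorProduct.smul_tmul']
        change extAct (extMap g k η : ExteriorAlgebra A L) (f (c • m)) =
          c • extAct (extMap g k η : ExteriorAlgebra A L) (f m)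
        rw [map_smul, ← algebraMap_smul A c (f m), map_smul, algebraMap_smul] }

lemma slotMap_pv {k : ℕ} (m : M₁) (v : Fin k → L₁) :
    slotMap g f hf k (pv A₁ m v) = wedgeList (List.ofFn (g ∘ v)) (f m) := by
  change extAct (extMap g k (exteriorPower.ιMulti A₁ k v) : ExteriorAlgebra A L) (f m) = _
  rw [extMap_ιMulti, extAct_ιMulti]

lemma slotMap_wedgeL {k : ℕ} (x : L₁) (t : Polyvec A₁ L₁ M₁ k) :
    slotMap g f hf (k + 1) (wedgeL k x t) = wedgeAll (g x) (slotMap g f hf k t) := by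
  induction t using pv_induction with
  | h0 => simp
  | h2 s t hs ht => simp only [map_add, hs, ht]
  | h1 m v => rw [wedgeL_pv, slotMap_pv, slotMap_pv, Fin.comp_cons, List.ofFn_cons, wedgeList_cons]

variable (ρ₁ : RightAction A₁ L₁ M₁) (ρ : RightAction A L M) (hg : ∀ x y, g ⁅x, y⁆ = ⁅g x, g y⁆)
  (hρ : ∀ x m, f (ρ₁.act x m) = lieAll ρ (g x) (f m))

-- Both sides commute with exterior multiplication by the same rule (`lieD_wedge`,
-- `lieAll_wedgeAll`), so the claim reduces to degree `0`, where it is `hρ`.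
include hg hρ in
lemma slotMap_lieD (x : L₁) (k : ℕ) (t : Polyvec A₁ L₁ M₁ k) :
    slotMap g f hf k (lieD ρ₁ x k t) = lieAll ρ (g x) (slotMap g f hf k t) := by
  refine polyvec_induction (p := fun k t => slotMap g f hf k (lieD ρ₁ x k t) =
    lieAll ρ (g x) (slotMap g f hf k t)) (fun m => ?_) (fun k y t h => ?_) (fun k => by simp)
    (fun k s t hs ht => ?_) k t
  · rw [lieD_pv]; simp [slotMap_pv, hρ]
  · rw [lieD_wedge, map_sub, slotMap_wedgeL, slotMap_wedgeL, slotMap_wedgeL, lieAll_wedgeAll, h, hg]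
  · simp only [map_add, hs, ht]

include hg hρ in
/-- The Koszul differential of `g(x₁) ∧ ⋯ ∧ g(xₖ) ∧ f(m)`. -/
lemma koszulAll_wedgeList (m : M₁) (l : List L₁) :
    koszulAll ρ (wedgeList (l.map g) (f m)) =
      slotMap g f hf (l.length - 1)
        (koszulAll ρ₁ (wedgeList l (embZero A₁ L₁ m)) (l.length - 1)) +
      (-1 : ℤ) ^ l.length • wedgeList (l.map g) (koszulAll ρ (f m)) := by
  -- The wedge product is itself a value of `slotMap`; hence the Lie derivative produced by Cartan's
  -- formula can be moved inside by `slotMap_lieD`.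
  have hw (l : List L₁) : slotMap g f hf l.length (wedgeList l (embZero A₁ L₁ m) l.length) =
      wedgeList (l.map g) (f m) := by
    have e : List.ofFn l.get = l := List.ofFn_get l
    have this {k : ℕ} (v : Fin k → L₁) (r : ℕ) (h : r = k) : slotMap g f hf r
        ((Pi.single k (pv A₁ m v) : PolyAll A₁ L₁ M₁) r) =
          wedgeList ((List.ofFn v).map g) (f m) := by
      subst h
      rw [Pi.single_eq_same, slotMap_pv, List.map_ofFn]
    have h2 := this l.get l.length rfl
    rwa [← wedgeList_ofFn, e] at h2
  induction l with
  | nil => simp [koszulAll_embZero]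
  | cons x l ih =>
    rw [List.map_cons, wedgeList_cons, koszulAll_wedgeAll, ih, wedgeList_cons, koszulAll_wedgeAll,
      ← hw, ← slotMap_lieD g f hf ρ₁ ρ hg hρ, List.length_cons, Nat.add_sub_cancel,
      Pi.sub_apply, map_sub]
    -- For the empty list the truncated degree `l.length - 1` is again `0`; both sides vanish there
    -- because the Koszul differential kills `embZero`.
    have e : slotMap g f hf l.length
        (wedgeAll x (koszulAll ρ₁ (wedgeList l (embZero A₁ L₁ m))) l.length) = wedgeAll (g x)
        (slotMap g f hf (l.length - 1)
          (koszulAll ρ₁ (wedgeList l (embZero A₁ L₁ m)) (l.length - 1))) := by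
      cases l with
      | nil => simp [koszulAll_embZero]
      | cons y l => exact slotMap_wedgeL g f hf x _
    rw [e, map_add, map_zsmul, wedgeList_cons, pow_succ]
    simp only [mul_neg, mul_one, neg_smul]
    rw [sub_add_eq_sub_sub, sub_eq_add_neg]
    rfl

end SlotMap

/-! ### Koszul signs of reordered blocks, by insertion sort -/

section BlockSign

/-- The number of inversions of a list, with weights. -/
def invWeight {ι : Type*} [LinearOrder ι] (k : ι → ℕ) : List ι → ℕ
  | [] => 0
  | x :: l => ((l.filter (· < x)).map fun y => k x * k y).sum + invWeight k l

/-- On its way to its place in the sorted list, `x` passes exactly the smaller entries, and each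
passage costs its commutation sign. -/
lemma prod_orderedInsert_of_graded {ι : Type*} [LinearOrder ι] {R : Type*} [Ring R] (k : ι → ℕ)
    (w : ι → R) (hw : ∀ i j, i ≠ j → w i * w j = (-1 : ℤ) ^ (k i * k j) • (w j * w i)) (x : ι)
    (l : List ι) (hl : l.Pairwise (· ≤ ·)) (hx : x ∉ l) : w x * (l.map w).prod =
      (-1 : ℤ) ^ ((l.filter (· < x)).map fun y => k x * k y).sum •
        ((l.orderedInsert (· ≤ ·) x).map w).prod := by
  induction l with
  | nil => simp
  | cons y l ih =>
    rw [List.mem_cons, not_or] at hx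
    rw [List.pairwise_cons] at hl
    rcases lt_or_gt_of_ne hx.1 with h | h
    · have hf : (y :: l).filter (· < x) = [] := by
        rw [List.filter_eq_nil_iff]
        intro z hz
        rcases List.mem_cons.1 hz with rfl | hz
        · simpa using h.le
        · simpa using h.le.trans (hl.1 z hz)
      rw [hf, List.orderedInsert_cons_of_le _ _ h.le]
      simp
    · rw [List.filter_cons_of_pos (by simpa using h), List.orderedInsert, if_neg (not_le.2 h),
        List.map_cons, List.map_cons, List.map_cons, List.prod_cons, List.prod_cons, List.sum_cons,
        ← mul_assoc, hw x y hx.1, smul_mul_assoc, mul_assoc, ih hl.2 hx.2, pow_add, mul_smul,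
        mul_smul_comm]

/-- Insertion sort produces one commutation sign per inversion, and `invWeight` follows the same
recursion. Sorting does not change which entries are smaller than the inserted one. -/
lemma prod_eq_of_graded {ι : Type*} [LinearOrder ι] {R : Type*} [Ring R] (k : ι → ℕ)
    (w : ι → R) (hw : ∀ i j, i ≠ j → w i * w j = (-1 : ℤ) ^ (k i * k j) • (w j * w i))
    (l : List ι) (hl : l.Nodup) : (l.map w).prod =
      (-1 : ℤ) ^ (invWeight k l) • ((l.insertionSort (· ≤ ·)).map w).prod := by
  induction l with
  | nil => simp [invWeight]
  | cons x l ih =>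
    rw [List.nodup_cons] at hl
    have h := prod_orderedInsert_of_graded k w hw x (l.insertionSort (· ≤ ·))
      (List.pairwise_insertionSort _ l) (by simpa using hl.1)
    have e : ((List.filter (· < x) (l.insertionSort (· ≤ ·))).map fun y => k x * k y).sum =
        ((l.filter (· < x)).map fun y => k x * k y).sum :=
      (((List.perm_insertionSort _ l).filter _).map _).sum_eq
    rw [e] at h
    rw [List.map_cons, List.prod_cons, ih hl.2, List.insertionSort_cons, invWeight, pow_add,
      mul_smul_comm, h, smul_smul, mul_comm]

/-- Single vector fields anticommute by polarizing `x ∧ x = 0`; moving every entry of one block past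
every entry of the other gives the product of the lengths. -/
lemma wedgeList_graded {A L M : Type*} [CommRing A] [Algebra ℂ A] [LieRing L] [LieAlgebra ℂ L]
    [Module A L] [IsScalarTower ℂ A L] [LieRingModule L A] [LieRinehartRing A L]
    [AddCommGroup M] [Module ℂ M] [Module A M] [IsScalarTower ℂ A M] (l l' : List L) :
    (wedgeList l * wedgeList l' : Module.End A (PolyAll A L M)) =
      (-1 : ℤ) ^ (l.length * l'.length) • (wedgeList l' * wedgeList l) := by
  have hc (x : L) (l : List L) : (wedgeList (x :: l) : Module.End A (PolyAll A L M)) =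
      wedgeAll x * wedgeList l := by simp [wedgeList]
  have h1 (x y : L) : (wedgeAll x * wedgeAll y : Module.End A (PolyAll A L M)) =
      (-1 : ℤ) • (wedgeAll y * wedgeAll x) := by
    have := wedgeAll_mul_self (A := A) (M := M) (x + y)
    rw [map_add, mul_add, add_mul, add_mul, wedgeAll_mul_self, wedgeAll_mul_self, zero_add,
      add_zero] at this
    rw [neg_smul, one_smul]
    exact eq_neg_of_add_eq_zero_right this
  have h2 (x : L) (l : List L) : (wedgeAll x * wedgeList l : Module.End A (PolyAll A L M)) =
      (-1 : ℤ) ^ l.length • (wedgeList l * wedgeAll x) := by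
    induction l with
    | nil => simp [wedgeList]
    | cons y l ih =>
      rw [hc, ← mul_assoc, h1, smul_mul_assoc, mul_assoc, ih, mul_smul_comm, smul_smul,
        List.length_cons, pow_succ', mul_assoc]
  induction l with
  | nil => simp [wedgeList]
  | cons x l ih =>
    rw [hc, mul_assoc, ih, mul_smul_comm, ← mul_assoc, h2, smul_mul_assoc, smul_smul,
      List.length_cons, mul_assoc, ← pow_add]
    congr 2
    ring

/-- Along an increasing list the order of positions is the order of the indices, so the recursively
counted inversions of the values of `σ` are the pairs in the definition of `permSign`. -/
lemma invWeight_map_perm {n : ℕ} (k : Fin n → ℕ) (σ : Equiv.Perm (Fin n)) :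
    ((-1 : ℤˣ) ^ invWeight k ((List.finRange n).map σ)) = permSign σ (fun i => (k i : ℤ)) := by
  have h (l : List (Fin n)) (hl : l.Pairwise (· < ·)) : invWeight k (l.map σ) =
      ∑ i ∈ l.toFinset, ∑ j ∈ l.toFinset with i < j ∧ σ j < σ i, k (σ i) * k (σ j) := by
    induction l with
    | nil => simp [invWeight]
    | cons x l ih =>
      rw [List.pairwise_cons] at hl
      have hx : x ∉ l.toFinset := fun h => lt_irrefl x (hl.1 x (by simpa using h))
      rw [List.map_cons, invWeight, ih hl.2, List.toFinset_cons, Finset.sum_insert hx]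
      congr 1
      · rw [List.filter_map, List.map_map]
        have hn : l.Nodup := hl.2.imp (fun h => h.ne)
        rw [← List.sum_toFinset _ (hn.filter _)]
        refine Finset.sum_congr ?_ (fun _ _ => rfl)
        ext j
        simp only [List.mem_toFinset, List.mem_filter, Function.comp_apply, decide_eq_true_eq,
          Finset.mem_filter, Finset.mem_insert]
        constructor
        · rintro ⟨h1, h2⟩; exact ⟨Or.inr h1, hl.1 j h1, h2⟩
        · rintro ⟨rfl | h1, h2, h3⟩
          · exact absurd h2 (lt_irrefl _)
          · exact ⟨h1, h3⟩
      · refine Finset.sum_congr rfl fun i hi => Finset.sum_congr ?_ (fun _ _ => rfl)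
        ext j
        simp only [Finset.mem_filter, Finset.mem_insert]
        constructor
        · rintro ⟨h1, h2⟩; exact ⟨Or.inr h1, h2⟩
        · rintro ⟨rfl | h1, h2⟩
          · exact absurd (h2.1.trans (hl.1 i (by simpa using hi))) (lt_irrefl _)
          · exact ⟨h1, h2⟩
  rw [h _ (List.sortedLT_finRange n).pairwise, permSign, Int.negOnePow_def, ← zpow_natCast]
  congr 1
  push_cast
  refine Finset.sum_congr (by ext; simp) fun i _ => Finset.sum_congr ?_ (fun _ _ => rfl)
  ext j; simp

lemma insertionSort_map_perm {n : ℕ} (σ : Equiv.Perm (Fin n)) :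
    ((List.finRange n).map σ).insertionSort (· ≤ ·) = List.finRange n := by
  refine List.Perm.eq_of_pairwise (le := (· ≤ ·)) (fun a b _ _ => le_antisymm)
    (List.pairwise_insertionSort _ _) ?_ ?_
  · exact (List.sortedLT_finRange n).pairwise.imp le_of_lt
  · refine (List.perm_insertionSort _ _).trans ?_
    exact (List.perm_ext_iff_of_nodup ((List.nodup_finRange n).map σ.injective)
      (List.nodup_finRange n)).2 (fun a => by simpa using ⟨σ.symm a, by simp⟩)

/-- The sign of a permutation of blocks of vector fields. -/
lemma wedgeList_perm {A L M : Type*} [CommRing A] [Algebra ℂ A] [LieRing L] [LieAlgebra ℂ L]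
    [Module A L] [IsScalarTower ℂ A L] [LieRingModule L A] [LieRinehartRing A L]
    [AddCommGroup M] [Module ℂ M] [Module A M] [IsScalarTower ℂ A M] {n : ℕ}
    (b : Fin n → List L) (σ : Equiv.Perm (Fin n)) (t : PolyAll A L M) :
    wedgeList ((List.finRange n).map fun i => b (σ i)).flatten t =
      (permSign σ (fun i => ((b i).length : ℤ)) : ℤ) •
        wedgeList ((List.finRange n).map b).flatten t := by
  have h (l : List (List L)) : (wedgeList l.flatten : Module.End A (PolyAll A L M)) =
      (l.map wedgeList).prod := by
    induction l with
    | nil => rfl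
    | cons x l ih =>
      ext1 t
      rw [List.flatten_cons, wedgeList_append, ih, List.map_cons, List.prod_cons]; rfl
  have h2 := prod_eq_of_graded (fun i => (b i).length)
    (fun i => (wedgeList (b i) : Module.End A (PolyAll A L M)))
    (fun i j _ => wedgeList_graded _ _) ((List.finRange n).map σ)
    ((List.nodup_finRange n).map σ.injective)
  rw [insertionSort_map_perm, List.map_map] at h2
  have h3 := congrArg (fun f => f t) h2
  rw [h, h, List.map_map, List.map_map, ← invWeight_map_perm]
  refine h3.trans ?_
  push_cast
  rfl

/-- The enumeration by `finSigmaFinEquiv`, in which the formula for the canonical morphism is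
stated, is concatenation of the blocks in order. -/
lemma ofFn_finSigmaFinEquiv {α : Type*} {n : ℕ} {k : Fin n → ℕ} (f : ∀ i, Fin (k i) → α) :
    List.ofFn (fun a => f (finSigmaFinEquiv.symm a).1 (finSigmaFinEquiv.symm a).2) =
      ((List.finRange n).map fun i => List.ofFn (f i)).flatten := by
  induction n with
  | zero => simp
  | succ n ih =>
    have e := Fin.sum_univ_castSucc k
    have h1 (a : Fin (∑ i : Fin n, k i.castSucc)) :
        finSigmaFinEquiv.symm (Fin.cast e.symm (Fin.castAdd (k (Fin.last n)) a)) =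
          (⟨(finSigmaFinEquiv.symm a).1.castSucc, (finSigmaFinEquiv.symm a).2⟩ :
            (i : Fin (n + 1)) × Fin (k i)) := by
      rw [Equiv.symm_apply_eq]
      ext
      have h := finSigmaFinEquiv_apply (finSigmaFinEquiv.symm a)
      rw [Equiv.apply_symm_apply] at h
      rw [finSigmaFinEquiv_apply]
      simp only [Fin.val_cast, Fin.val_castAdd]
      exact h
    have h2 (a : Fin (k (Fin.last n))) :
        finSigmaFinEquiv.symm (Fin.cast e.symm (Fin.natAdd _ a)) =
          (⟨Fin.last n, a⟩ : (i : Fin (n + 1)) × Fin (k i)) := by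
      rw [Equiv.symm_apply_eq]
      ext
      rw [finSigmaFinEquiv_apply]
      simp only [Fin.val_cast, Fin.val_natAdd]
      rfl
    rw [List.ofFn_congr e, List.ofFn_add, List.finRange_succ_last, List.map_append,
      List.flatten_append]
    congr 1
    · rw [List.map_map]
      refine Eq.trans ?_ (ih fun i => f i.castSucc)
      congr 1
      funext a
      exact congrArg (fun s : (i : Fin (n + 1)) × Fin (k i) => f s.1 s.2) (h1 a)
    · simp only [List.map_cons, List.map_nil, List.flatten_cons, List.flatten_nil,
        List.append_nil]
      congr 1
      funext a
      exact congrArg (fun s : (i : Fin (n + 1)) × Fin (k i) => f s.1 s.2) (h2 a)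

end BlockSign

/-! ### Wedge product of polyvector fields in independent variables, and its Leibniz rule -/

section BoxDatum

variable {n : ℕ} (A' L' M' : Fin n → Type*) (A L B : Type*)
  [∀ i, CommRing (A' i)] [∀ i, Algebra ℂ (A' i)] [∀ i, LieRing (L' i)] [∀ i, LieAlgebra ℂ (L' i)]
  [∀ i, Module (A' i) (L' i)] [∀ i, IsScalarTower ℂ (A' i) (L' i)]
  [∀ i, LieRingModule (L' i) (A' i)] [∀ i, LieRinehartRing (A' i) (L' i)]
  [∀ i, AddCommGroup (M' i)] [∀ i, Module ℂ (M' i)] [∀ i, Module (A' i) (M' i)]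
  [∀ i, IsScalarTower ℂ (A' i) (M' i)]
  [CommRing A] [Algebra ℂ A] [LieRing L] [LieAlgebra ℂ L]
  [Module A L] [IsScalarTower ℂ A L] [LieRingModule L A] [LieRinehartRing A L]
  [AddCommGroup B] [Module ℂ B] [Module A B] [IsScalarTower ℂ A B]

/-- The data from which the wedge product of elements of `M' i ⊗ ⋀ L' i` in `B ⊗ ⋀ L` is
formed. -/
structure BoxDatum where
  ρ' : ∀ i, RightAction (A' i) (L' i) (M' i)
  ρ : RightAction A L B
  a : ∀ i, A' i →ₐ[ℂ] A
  l : ∀ i, L' i →ₛₗ[(a i).toRingHom] L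
  l_lie : ∀ i x y, l i ⁅x, y⁆ = ⁅l i x, l i y⁆
  l_lie_ne : ∀ i j, i ≠ j → ∀ x y, ⁅l i x, l j y⁆ = 0
  b : MultilinearMap ℂ M' B
  b_smul : ∀ i (f : A' i) (m : ∀ i, M' i), b (Function.update m i (f • m i)) = a i f • b m
  b_act : ∀ i (x : L' i) (m : ∀ i, M' i),
    b (Function.update m i ((ρ' i).act x (m i))) = ρ.act (l i x) (b m)

namespace BoxDatum

variable {A' L' M' A L B} (D : BoxDatum A' L' M' A L B)

/-- Multiplication with the blocks of vector fields `v i`, where `i` runs through a list. -/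
def blockOp (is : List (Fin n)) (v : ∀ i, List (L' i)) : Module.End A (PolyAll A L B) :=
  (is.map fun i => wedgeList ((v i).map (D.l i))).prod

@[simp] lemma blockOp_nil (v : ∀ i, List (L' i)) (t : PolyAll A L B) : D.blockOp [] v t = t := rfl

@[simp] lemma blockOp_cons (i : Fin n) (is : List (Fin n)) (v : ∀ i, List (L' i))
    (t : PolyAll A L B) :
    D.blockOp (i :: is) v t = wedgeList ((v i).map (D.l i)) (D.blockOp is v t) := by
  simp [blockOp]

lemma blockOp_eq (is : List (Fin n)) (v : ∀ i, List (L' i)) :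
    D.blockOp is v = wedgeList ((is.map fun i => (v i).map (D.l i)).flatten) := by
  ext1 t
  induction is with
  | nil => rfl
  | cons i is ih => rw [blockOp_cons, List.map_cons, List.flatten_cons, wedgeList_append, ih]

lemma blockOp_update {i : Fin n} {is : List (Fin n)} (hi : i ∉ is) (v : ∀ i, List (L' i))
    (w : List (L' i)) : D.blockOp is (Function.update v i w) = D.blockOp is v := by
  simp only [blockOp]
  congr 1
  refine List.map_congr_left fun j hj => ?_
  rw [Function.update_of_ne (ne_of_mem_of_not_mem hj hi)]

/-- The blocks different from the `i`-th one, as a function of the `i`-th entry in `M'`. -/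
def base (is : List (Fin n)) (v : ∀ i, List (L' i)) (m : ∀ i, M' i) (i : Fin n) :
    M' i →ₗ[ℂ] PolyAll A L B :=
  (D.blockOp is v).restrictScalars ℂ ∘ₗ embZero A L ∘ₗ D.b.toLinearMap m i

lemma base_apply (is : List (Fin n)) (v : ∀ i, List (L' i)) (m : ∀ i, M' i) (i : Fin n)
    (m' : M' i) : D.base is v m i m' = D.blockOp is v (embZero A L (D.b (Function.update m i m'))) :=
  rfl

lemma base_smul (is : List (Fin n)) (v : ∀ i, List (L' i)) (m : ∀ i, M' i) (i : Fin n)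
    (f : A' i) (m' : M' i) : D.base is v m i (f • m') = D.a i f • D.base is v m i m' := by
  have := D.b_smul i f (Function.update m i m')
  rw [Function.update_self, Function.update_idem] at this
  rw [base_apply, this, embZero_smul, map_smul, base_apply]

lemma lieAll_wedgeList (i j : Fin n) (hij : i ≠ j) (x : L' i) (l : List (L' j))
    (t : PolyAll A L B) : lieAll D.ρ (D.l i x) (wedgeList (l.map (D.l j)) t) =
      wedgeList (l.map (D.l j)) (lieAll D.ρ (D.l i x) t) := by
  induction l with
  | nil => rfl
  | cons y l ih =>
    rw [List.map_cons, wedgeList_cons, lieAll_wedgeAll, D.l_lie_ne i j hij, ih, wedgeList_cons,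
      map_zero]
    exact sub_zero _

/-- A vector field of the `i`-th variable commutes with all other blocks, so its Lie derivative
passes through to the module, where it acts in the `i`-th entry. This is the input that
`koszulAll_wedgeList` requires, and it is why `i` must not occur in `is`. -/
lemma base_act {is : List (Fin n)} (v : ∀ i, List (L' i)) (m : ∀ i, M' i) {i : Fin n}
    (hi : i ∉ is) (x : L' i) (m' : M' i) :
    D.base is v m i ((D.ρ' i).act x m') = lieAll D.ρ (D.l i x) (D.base is v m i m') := by
  have h := D.b_act i x (Function.update m i m')
  rw [Function.update_self, Function.update_idem] at h
  rw [base_apply, base_apply, h]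
  induction is with
  | nil => exact (lieAll_embZero _ _ _).symm
  | cons j is ih =>
    rw [List.mem_cons, not_or] at hi
    rw [blockOp_cons, ih hi.2, blockOp_cons, D.lieAll_wedgeList i j hi.1]

/-- The wedge product of the blocks in a list as a function of the `i`-th block. -/
def slotAt (v : ∀ i, List (L' i)) (m : ∀ i, M' i) (i : Fin n) (k : ℕ) :
    List (Fin n) → Polyvec (A' i) (L' i) (M' i) k →ₗ[ℂ] PolyAll A L B
  -- A default value: it is only relevant for lists that contain `i`.
  | [] => 0
  | j :: is => if j = i then slotMap (D.l i) (D.base is v m i) (D.base_smul is v m i) k else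
      (wedgeList ((v j).map (D.l j)) : Module.End A (PolyAll A L B)).restrictScalars ℂ ∘ₗ
        slotAt v m i k is

lemma slotAt_pv (v : ∀ i, List (L' i)) (m : ∀ i, M' i) {i : Fin n} {k : ℕ}
    {is : List (Fin n)} (hi : i ∈ is) (hn : is.Nodup) (m' : M' i) (w : Fin k → L' i) :
    D.slotAt v m i k is (pv (A' i) m' w) =
      D.blockOp is (Function.update v i (List.ofFn w)) (embZero A L (D.b (Function.update m i m'))) := by
  induction is with
  | nil => exact absurd hi (by simp)
  | cons j is ih =>
    rw [List.nodup_cons] at hn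
    rw [slotAt, blockOp_cons]
    split_ifs with h
    · subst h
      rw [slotMap_pv, Function.update_self, List.map_ofFn, D.blockOp_update hn.1, base_apply]
    · rw [Function.update_of_ne h, ← ih ((List.mem_cons.1 hi).resolve_left (Ne.symm h)) hn.2]
      rfl

/-- The graded Leibniz rule on decomposables. Peel off the first block with `koszulAll_wedgeList`,
the remaining product playing the role of the element `f m`; the differential either hits this block
or passes it with the sign of its length. -/
lemma koszulAll_blockOp (v : ∀ i, List (L' i)) (m : ∀ i, M' i) (is : List (Fin n))
    (his : is.Pairwise (· < ·)) :
    koszulAll D.ρ (D.blockOp is v (embZero A L (D.b m))) =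
      ∑ i ∈ is.toFinset, (-1 : ℤ) ^ (∑ j ∈ is.toFinset with j < i, (v j).length) •
        D.slotAt v m i ((v i).length - 1) is
          (koszulAll (D.ρ' i) (wedgeList (v i) (embZero (A' i) (L' i) (m i))) ((v i).length - 1)) := by
  induction is with
  | nil => simpa using koszulAll_embZero _ _
  | cons i is ih =>
    rw [List.pairwise_cons] at his
    have hi : i ∉ is := fun h => lt_irrefl i (his.1 i h)
    have hb : D.blockOp is v (embZero A L (D.b m)) = D.base is v m i (m i) := by
      rw [base_apply, Function.update_eq_self]
    rw [blockOp_cons, hb, koszulAll_wedgeList (D.l i) (D.base is v m i) (D.base_smul is v m i)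
      (D.ρ' i) D.ρ (D.l_lie i) (D.base_act v m hi), ← hb, ih his.2, List.toFinset_cons,
      Finset.sum_insert (by simpa using hi)]
    -- The list is increasing: the first block has no predecessor, and each later block gains
    -- precisely this one as an additional predecessor.
    have hf : (insert i is.toFinset).filter (· < i) = ∅ := by
      rw [Finset.filter_eq_empty_iff]
      intro j hj
      rcases Finset.mem_insert.1 hj with rfl | hj
      · exact lt_irrefl _
      · exact (his.1 j (by simpa using hj)).not_gt
    congr 1
    · rw [hf, Finset.sum_empty, pow_zero, one_smul, slotAt, if_pos rfl]
    · rw [map_sum, Finset.smul_sum]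
      refine Finset.sum_congr rfl fun j hj => ?_
      have hj' : i < j := his.1 j (by simpa using hj)
      have hf : (insert i is.toFinset).filter (· < j) = insert i (is.toFinset.filter (· < j)) := by
        rw [Finset.filter_insert, if_pos hj']
      rw [map_zsmul, smul_smul, ← pow_add, hf, Finset.sum_insert (by simp [hi]), slotAt,
        if_neg hj'.ne]
      rfl

variable (k : Fin n → ℕ)

/-- On decomposables the value is prescribed; `slotAt` supplies the linear extension in one entry
while the others stay decomposable, which is what `exists_multilinear_of_span` asks for. -/
lemma exists_boxMul : ∃ Ψ : MultilinearMap ℂ (fun i => Polyvec (A' i) (L' i) (M' i) (k i))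
    (PolyAll A L B), ∀ s : ∀ i, M' i × (Fin (k i) → L' i), Ψ (fun i => pv (A' i) (s i).1 (s i).2) =
      D.blockOp (List.finRange n) (fun i => List.ofFn (s i).2) (embZero A L (D.b fun i => (s i).1)) := by
  refine exists_multilinear_of_span (S := fun i => M' i × (Fin (k i) → L' i))
    (fun i s => pv (A' i) s.1 s.2) (fun i => ?_) _ (fun i s => ?_)
  · refine Submodule.eq_top_iff'.2 fun t => ?_
    induction t using pv_induction with
    | h0 => exact Submodule.zero_mem _
    | h1 m v => exact Submodule.subset_span ⟨(m, v), rfl⟩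
    | h2 s t hs ht => exact Submodule.add_mem _ hs ht
  · refine ⟨D.slotAt (fun i => List.ofFn (s i).2) (fun i => (s i).1) i (k i) (List.finRange n),
      fun x => ?_⟩
    rw [D.slotAt_pv _ _ (List.mem_finRange i) (List.nodup_finRange n)]
    congr 1
    · congr 1
      funext j
      by_cases h : j = i
      · subst h; simp
      · simp [h]
    · congr 2
      funext j
      by_cases h : j = i
      · subst h; simp
      · simp [h]

/-- The wedge product `⨂ᵢ (M' i ⊗ ⋀ L' i) → B ⊗ ⋀ L`. -/
def boxMul : MultilinearMap ℂ (fun i => Polyvec (A' i) (L' i) (M' i) (k i)) (PolyAll A L B) :=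
  (D.exists_boxMul k).choose

lemma boxMul_pv (m : ∀ i, M' i) (v : ∀ i, Fin (k i) → L' i) :
    D.boxMul k (fun i => pv (A' i) (m i) (v i)) =
      D.blockOp (List.finRange n) (fun i => List.ofFn (v i)) (embZero A L (D.b m)) :=
  (D.exists_boxMul k).choose_spec fun i => (m i, v i)

/-- The map which is the Koszul differential in the `i`-th entry and the identity in the other
entries. -/
def stepMap (i j : Fin n) : Polyvec (A' j) (L' j) (M' j) (k j) →ₗ[ℂ]
    Polyvec (A' j) (L' j) (M' j) (Function.update k i (k i - 1) j) :=
  -- If `k i = 0`, the truncated degree `k i - 1` is `0` and this map is zero, since `koszulAll`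
  -- only reads components of positive degree.
  if j = i then LinearMap.proj (Function.update k i (k i - 1) j) ∘ₗ koszulAll (D.ρ' j) ∘ₗ
      LinearMap.single ℂ _ (k j)
    else LinearMap.proj (Function.update k i (k i - 1) j) ∘ₗ LinearMap.single ℂ _ (k j)

/-- The Koszul differential of a decomposable element is in general not decomposable, so the terms
of `koszulAll_blockOp` have to be recognized as values of `boxMul`. Both sides are additive in `t`,
hence decomposable `t` suffice. -/
lemma boxMul_of_slot (i : Fin n) (k : Fin n → ℕ) (m : ∀ i, M' i) (v : ∀ i, List (L' i))
    (hv : ∀ j ≠ i, (v j).length = k j)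
    (t : Polyvec (A' i) (L' i) (M' i) (k i)) :
    D.boxMul k (fun j => if h : j = i then h ▸ t else
      wedgeList (v j) (embZero (A' j) (L' j) (m j)) (k j)) =
      D.slotAt v m i (k i) (List.finRange n) t := by
  induction t using pv_induction with
  | h0 =>
    rw [map_zero]
    exact (D.boxMul k).map_coord_zero i (by simp)
  | h2 s t hs ht =>
    rw [map_add, ← hs, ← ht]
    have e (t : Polyvec (A' i) (L' i) (M' i) (k i)) : (fun j => if h : j = i then h ▸ t else
      wedgeList (v j) (embZero (A' j) (L' j) (m j)) (k j)) = Function.update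
        (fun j => wedgeList (v j) (embZero (A' j) (L' j) (m j)) (k j)) i t := by
      funext j
      by_cases h : j = i
      · subst h; simp
      · simp [h]
    rw [e, e, e, (D.boxMul k).map_update_add]
  | h1 m' w =>
    rw [D.slotAt_pv _ _ (List.mem_finRange i) (List.nodup_finRange n)]
    have h2 (j : Fin n) (h : j ≠ i) : ∃ w : Fin (k j) → L' j, List.ofFn w = v j := by
      rw [← hv j h]; exact ⟨_, List.ofFn_get _⟩
    have h3 (j : Fin n) : ∃ w' : Fin (k j) → L' j, List.ofFn w' =
        Function.update v i (List.ofFn w) j := by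
      by_cases h : j = i
      · subst h; exact ⟨w, by simp⟩
      · obtain ⟨w', hw⟩ := h2 j h; exact ⟨w', by simp [h, hw]⟩
    choose w' hw' using h3
    have := D.boxMul_pv k (Function.update m i m') w'
    rw [show (fun i => List.ofFn (w' i)) = Function.update v i (List.ofFn w) from funext hw'] at this
    rw [← this]
    congr 1
    funext j
    split_ifs with h
    · subst h
      have := hw' j
      rw [Function.update_self] at this
      rw [Function.update_self, List.ofFn_injective this]
    · have := hw' j
      rw [Function.update_of_ne h] at this ⊢
      rw [← this, wedgeList_ofFn, Pi.single_eq_same]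

/-- The Koszul differential of a wedge product. -/
lemma koszulAll_boxMul (t : ∀ i, Polyvec (A' i) (L' i) (M' i) (k i)) :
    koszulAll D.ρ (D.boxMul k t) = ∑ i, (-1 : ℤ) ^ (∑ j with j < i, k j) •
      D.boxMul (Function.update k i (k i - 1)) (fun j => D.stepMap k i j (t j)) := by
  have : (koszulAll D.ρ).compMultilinearMap (D.boxMul k) = ∑ i, (-1 : ℤ) ^ (∑ j with j < i, k j) •
      (D.boxMul (Function.update k i (k i - 1))).compLinearMap (fun j => D.stepMap k i j) := by
    refine multilinear_ext_of_span (S := fun i => M' i × (Fin (k i) → L' i))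
      (fun i s => pv (A' i) s.1 s.2) (fun i => ?_) (fun s => ?_)
    · refine Submodule.eq_top_iff'.2 fun t => ?_
      induction t using pv_induction with
      | h0 => exact Submodule.zero_mem _
      | h1 m v => exact Submodule.subset_span ⟨(m, v), rfl⟩
      | h2 s t hs ht => exact Submodule.add_mem _ hs ht
    · rw [LinearMap.compMultilinearMap_apply, D.boxMul_pv k (fun i => (s i).1) (fun i => (s i).2),
        D.koszulAll_blockOp _ _ _ (List.sortedLT_finRange n).pairwise, _root_.sum_apply]
      refine Finset.sum_congr (by ext; simp) fun i _ => ?_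
      rw [_root_.smul_apply, MultilinearMap.compLinearMap_apply]
      congr 1
      · congr 1
        exact Finset.sum_congr (by ext; simp) fun j _ => by simp
      -- The degrees `r` and `k'` are kept variable: the length of a list minus one and the value of
      -- the updated `k` agree only after a rewrite, which would be blocked inside the dependent
      -- types.
      · have key (r : ℕ) (k' : Fin n → ℕ) (hk' : ∀ j, j ≠ i → k' j = k j) (hr : r = k' i) :
            D.slotAt (fun i => List.ofFn (s i).2) (fun i => (s i).1) i r (List.finRange n)
              (koszulAll (D.ρ' i) (wedgeList (List.ofFn (s i).2) (embZero (A' i) (L' i) (s i).1)) r)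
            = D.boxMul k' (fun j => if j = i then
              koszulAll (D.ρ' j) (Pi.single (k j) (pv (A' j) (s j).1 (s j).2)) (k' j) else
                (Pi.single (k j) (pv (A' j) (s j).1 (s j).2) : PolyAll _ _ _) (k' j)) := by
          subst hr
          rw [← D.boxMul_of_slot i k' _ _ (fun j hj => by simp [hk' j hj])]
          congr 1
          funext j
          split_ifs with h
          · subst h
            rw [wedgeList_ofFn]
          · rw [wedgeList_ofFn]
        rw [key _ (Function.update k i (k i - 1)) (fun j hj => by simp [hj]) (by simp)]
        congr 1
        funext j
        rw [stepMap]
        split_ifs <;> rfl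
  refine (congrArg (fun f => f t) this).trans ?_
  rw [_root_.sum_apply]
  rfl

lemma boxMul_apply_of_ne (t : ∀ i, Polyvec (A' i) (L' i) (M' i) (k i)) {r : ℕ}
    (h : r ≠ ∑ i, k i) : D.boxMul k t r = 0 := by
  have : (LinearMap.proj r : PolyAll A L B →ₗ[ℂ] _).compMultilinearMap (D.boxMul k) = 0 := by
    refine multilinear_ext_of_span (S := fun i => M' i × (Fin (k i) → L' i))
      (fun i s => pv (A' i) s.1 s.2) (fun i => ?_) (fun s => ?_)
    · refine Submodule.eq_top_iff'.2 fun t => ?_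
      induction t using pv_induction with
      | h0 => exact Submodule.zero_mem _
      | h1 m v => exact Submodule.subset_span ⟨(m, v), rfl⟩
      | h2 s t hs ht => exact Submodule.add_mem _ hs ht
    · rw [LinearMap.compMultilinearMap_apply, D.boxMul_pv k (fun i => (s i).1) (fun i => (s i).2),
        blockOp_eq]
      refine wedgeList_embZero_of_ne _ _ fun h' => h ?_
      rw [h', List.length_flatten]
      simp [Function.comp_def, List.sum_ofFn, ← List.ofFn_eq_map]
  exact congrArg (fun f => f t) this

end BoxDatum

end BoxDatum

/-! ### Hadamard's lemma and derivations in coordinates -/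

section Hadamard

/-- Take for `G` the sum of the shifted power series of `f`: dropping the constant term and
splitting off one linear factor writes `f y - f x` as `G y` applied to `y - x`. Being the sum of a
power series, `G` is again analytic. -/
lemma exists_hadamard {F : Type*} [NormedAddCommGroup F] [NormedSpace ℂ F] {f : F → ℂ} {x : F}
    (hf : AnalyticAt ℂ f x) : ∃ G : F → (F →L[ℂ] ℂ), AnalyticAt ℂ G x ∧ G x = fderiv ℂ f x ∧
      ∀ᶠ y in nhds x, f y = f x + G y (y - x) := by
  obtain ⟨p, r, hp⟩ := hf
  let q := p.shift
  have hq0 : 0 < q.radius := by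
    rw [FormalMultilinearSeries.radius_shift]; exact hp.r_pos.trans_le hp.r_le
  have hq := (q.hasFPowerSeriesOnBall hq0).comp_sub x
  rw [zero_add] at hq
  have hu := hq.unshift (z := f x)
  have e : q.unshift (f x) = p := by
    funext m
    cases m with
    | zero =>
      ext v
      simp only [FormalMultilinearSeries.unshift]
      rw [hp.coeff_zero v]; rfl
    | succ m =>
      simp only [FormalMultilinearSeries.unshift, q, FormalMultilinearSeries.shift]
      exact LinearIsometryEquiv.symm_apply_apply _ (p (m + 1))
  rw [e] at hu
  have hG : AnalyticAt ℂ (fun y => q.sum (y - x)) x := hq.analyticAt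
  have hev : ∀ᶠ y in nhds x, f y = f x + q.sum (y - x) (y - x) := by
    -- The two power series expansions are compared on a ball where both converge.
    have h1 := hp.mono (r' := min r q.radius) (lt_min hp.r_pos hq0) (min_le_left _ _)
    have h2 := hu.mono (r' := min r q.radius) (lt_min hp.r_pos hq0) (min_le_right _ _)
    filter_upwards [Metric.eball_mem_nhds x (lt_min hp.r_pos hq0)] with y hy
    exact h1.unique h2 hy
  refine ⟨fun y => q.sum (y - x), hG, ?_, hev⟩
  -- In the product rule the term with the derivative of `G` is multiplied by `y - x`, which
  -- vanishes at `x`.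
  have h1 : HasFDerivAt (fun y => f x + q.sum (y - x) (y - x)) (q.sum (x - x)) x := by
    have := (hG.differentiableAt.hasFDerivAt.clm_apply
      ((hasFDerivAt_id x).sub_const x)).const_add (f x)
    refine HasFDerivAt.congr_fderiv this ?_
    ext v
    simp
  exact (h1.congr_of_eventuallyEq hev).fderiv.symm

variable {E : Type v} [NormedAddCommGroup E] [NormedSpace ℂ E] {H : Type w} [TopologicalSpace H]
  {I : ModelWithCorners ℂ E H} {Y : Type u} [TopologicalSpace Y] [ChartedSpace H Y]

lemma VF.app_algebraMap {U V : Opens Y} (ξ : VF I U) (h : V ≤ U) (c : ℂ) :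
    Op.app ξ.1 h (algebraMap ℂ (Holo I V) c) = 0 := by
  have h1 : Op.app ξ.1 h (1 : Holo I V) = 0 := by
    have := VF.app_mul ξ h 1 1
    simpa using this
  rw [Algebra.algebraMap_eq_smul_one, map_smul, h1, smul_zero]

lemma holoRes_apply {U V : Opens Y} (h : V ≤ U) (f : Holo I U) (x : V) :
    holoRes h f x = f ⟨x, h x.2⟩ := rfl

@[simp] lemma holo_add_apply {U : Opens Y} (f g : Holo I U) (x : U) : (f + g) x = f x + g x := rfl
@[simp] lemma holo_mul_apply {U : Opens Y} (f g : Holo I U) (x : U) : (f * g) x = f x * g x := rfl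
@[simp] lemma holo_zero_apply {U : Opens Y} (x : U) : (0 : Holo I U) x = 0 := rfl
@[simp] lemma holo_neg_apply {U : Opens Y} (f : Holo I U) (x : U) : (-f) x = - f x := rfl
@[simp] lemma holo_sub_apply {U : Opens Y} (f g : Holo I U) (x : U) : (f - g) x = f x - g x := by
  rw [sub_eq_add_neg, holo_add_apply, holo_neg_apply, sub_eq_add_neg]
@[simp] lemma holo_algebraMap_apply {U : Opens Y} (c : ℂ) (x : U) :
    (algebraMap ℂ (Holo I U) c) x = c := rfl
@[simp] lemma holo_sum_apply {U : Opens Y} {ι : Type*} (s : Finset ι) (f : ι → Holo I U) (x : U) :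
    (∑ i ∈ s, f i) x = ∑ i ∈ s, f i x := by
  classical
  induction s using Finset.induction_on with
  | empty => simp
  | insert a s ha ih => rw [Finset.sum_insert ha, Finset.sum_insert ha, holo_add_apply, ih]

/-- A holomorphic function on `U` from a function on the whole space. -/
def Holo.mk (U : Opens Y) (g : Y → ℂ) (hg : ContMDiffOn I 𝓘(ℂ, ℂ) ω g U) : Holo I U :=
  ⟨fun x => g x, g, hg, fun _ => rfl⟩

lemma Holo.mk_apply (U : Opens Y) (g : Y → ℂ) (hg : ContMDiffOn I 𝓘(ℂ, ℂ) ω g U) (x : U) :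
  Holo.mk U g hg x = g x := rfl

lemma holo_congr {U : Opens Y} (f : Holo I U) {x y : U} (h : (x : Y) = y) : f x = f y := by
  rw [Subtype.ext h]

lemma Op.app_res_apply {U V W : Opens Y} (P : Op I U) (h : V ≤ U) (h' : W ≤ V) (f : Holo I V)
    (x : W) : P.app (h'.trans h) (holoRes h' f) x = P.app h f ⟨x, h' x.2⟩ := by
  rw [← Op.res_app]; rfl

lemma vfToD_injective {U : Opens Y} {ξ η : VF I U} (h : vfToD U ξ = vfToD U η) : ξ = η :=
  Subtype.ext (congrArg (fun P : DiffOp I U => P.1) h)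

/-- A vector field in coordinates. -/
lemma VF.app_eq_sum {U : Opens Y} (ξ : VF I U) {N : Opens Y} (hN : N ≤ U) (f : Holo I N)
    {F : Type*} [NormedAddCommGroup F] [NormedSpace ℂ F] {ι : Type*} [Fintype ι]
    (b : Module.Basis ι ℂ F) (z : ι → Holo I N) (φ : Y → F) (y : N)
    (hφ : ContMDiffOn I 𝓘(ℂ, F) ω φ N) (hz : ∀ k y, z k y = b.repr (φ y) k)
    (f' : F → ℂ) (hf' : AnalyticAt ℂ f' (φ y))
    (hf : ∀ᶠ p in nhds (y : Y), ∀ h : p ∈ N, f ⟨p, h⟩ = f' (φ p)) :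
    Op.app ξ.1 hN f y = ∑ k, Op.app ξ.1 hN (z k) y * fderiv ℂ f' (φ y) (b k) := by
  obtain ⟨G, hG, hG0, hGe⟩ := exists_hadamard hf'
  have hφy : ContinuousAt φ y := (hφ.continuousOn).continuousAt (N.2.mem_nhds y.2)
  have hev : ∀ᶠ p in nhds (y : Y), (∀ h : p ∈ N, f ⟨p, h⟩ = f' (φ p)) ∧
      (f' (φ p) = f' (φ y) + G (φ p) (φ p - φ y)) ∧ AnalyticAt ℂ G (φ p) :=
    hf.and ((hφy.eventually hGe).and (hφy.eventually hG.eventually_analyticAt))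
  obtain ⟨T, hT, hTo, hyT⟩ := eventually_nhds_iff.1 hev
  -- Operators are compatible with restriction, so the value at `y` can be computed on the
  -- neighbourhood where the Hadamard expansion holds.
  let N' : Opens Y := ⟨T ∩ N, hTo.inter N.2⟩
  have hN' : N' ≤ N := fun p hp => hp.2
  let y' : N' := ⟨y, hyT, y.2⟩
  have hGk (k : ι) : ContMDiffOn I 𝓘(ℂ, ℂ) ω (fun p => G (φ p) (b k)) N' := by
    intro p hp
    have h1 : AnalyticAt ℂ (fun w => G w (b k)) (φ p) :=
      ((ContinuousLinearMap.apply ℂ ℂ (b k)).analyticAt _).comp (hT p hp.1).2.2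
    have h2 : ContMDiffAt 𝓘(ℂ, F) 𝓘(ℂ, ℂ) ω (fun w => G w (b k)) (φ p) :=
      h1.contDiffAt.contMDiffAt
    exact h2.comp_contMDiffWithinAt p ((hφ p hp.2).mono hN')
  let g (k : ι) : Holo I N' := Holo.mk N' _ (hGk k)
  -- The Hadamard expansion, written with the coordinate functions `z k` and the components of `G`
  -- in the basis `b`.
  have key : holoRes hN' f = algebraMap ℂ _ (f' (φ y)) +
      ∑ k, (holoRes hN' (z k) - algebraMap ℂ _ (b.repr (φ y) k)) * g k := by
    ext p
    rw [holoRes_apply, (hT p p.2.1).1, (hT p p.2.1).2.1]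
    simp only [holo_add_apply, holo_algebraMap_apply, holo_sum_apply, holo_mul_apply,
      holo_sub_apply, holoRes_apply, hz, g, Holo.mk_apply]
    congr 1
    conv_lhs => rw [← b.sum_repr (φ p - φ y), map_sum]
    refine Finset.sum_congr rfl fun k _ => ?_
    rw [map_smul, smul_eq_mul, map_sub, Finsupp.sub_apply]
  have h1 (f : Holo I N) : Op.app ξ.1 hN f y = Op.app ξ.1 (hN'.trans hN) (holoRes hN' f) y' := by
    rw [← Op.res_app]; rfl
  rw [h1, key, map_add, VF.app_algebraMap, zero_add, map_sum, holo_sum_apply]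
  -- By the Leibniz rule at `y`: the factor `z k - z k (y)` vanishes there, and the remaining factor
  -- `g k` takes the value of the `k`-th partial derivative.
  refine Finset.sum_congr rfl fun k _ => ?_
  rw [VF.app_mul, map_sub, VF.app_algebraMap, sub_zero, h1 (z k), holo_add_apply, holo_mul_apply,
    holo_mul_apply, holo_sub_apply, holoRes_apply, hz, holo_algebraMap_apply]
  simp only [y', sub_self, zero_mul, zero_add, g, Holo.mk_apply, hG0]
  rw [mul_comm]

end Hadamard

/-! ### Holomorphic maps to and from powers of a manifold -/

section Powers

variable {E : Type v} [NormedAddCommGroup E] [NormedSpace ℂ E] {H : Type w} [TopologicalSpace H]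
  {I : ModelWithCorners ℂ E H} {X : Type u} [TopologicalSpace X] [ChartedSpace H X] {n : ℕ}
  {E' : Type*} [NormedAddCommGroup E'] [NormedSpace ℂ E'] {H' : Type*}
    [TopologicalSpace H'] {I' : ModelWithCorners ℂ E' H'} {Y' : Type*} [TopologicalSpace Y']
    [ChartedSpace H' Y']

/-- The charts and the model of a power are products of those of the factors, so in charts the claim
is componentwise differentiability. -/
lemma contMDiffAt_pow_iff {f : Y' → Fin n → X} {y : Y'} :
    ContMDiffAt I' (powModel I n) ω f y ↔ ∀ l, ContMDiffAt I' I ω (fun p => f p l) y := by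
  simp only [contMDiffAt_iff]
  rw [forall_and, continuousAt_pi]
  refine and_congr Iff.rfl ?_
  exact contDiffWithinAt_pi

lemma contMDiff_pow_iff {f : Y' → Fin n → X} :
    ContMDiff I' (powModel I n) ω f ↔ ∀ l, ContMDiff I' I ω (fun p => f p l) :=
  ⟨fun h l p => contMDiffAt_pow_iff.1 (h p) l, fun h p => contMDiffAt_pow_iff.2 fun l => h l p⟩

lemma contMDiff_pr (i : Fin n) : ContMDiff (powModel I n) I ω (fun x : Fin n → X => x i) :=
  contMDiff_pow_iff.1 contMDiff_id i

lemma contMDiff_update (x : Fin n → X) (i : Fin n) :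
    ContMDiff I (powModel I n) ω (fun y : X => Function.update x i y) := by
  refine contMDiff_pow_iff.2 fun l => ?_
  by_cases h : l = i
  · subst h; simpa using! contMDiff_id
  · simpa [h] using! contMDiff_const

end Powers

/-! ### Lifting vector fields from a factor to the power -/

section Lift

variable {E : Type v} [NormedAddCommGroup E] [NormedSpace ℂ E] 
  {X : Type u} [TopologicalSpace X] [ChartedSpace E X] {n : ℕ}

/-- The model has full range, so regularity `ω` in the chart is analyticity at an interior point. -/
lemma analyticAt_of_contMDiffAt {g : (Fin n → X) → ℂ} {x₀ : Fin n → X}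
    (hg : ContMDiffAt (powModel 𝓘(ℂ, E) n) 𝓘(ℂ, ℂ) ω g x₀) :
    AnalyticAt ℂ (g ∘ (extChartAt (powModel 𝓘(ℂ, E) n) x₀).symm)
      (extChartAt (powModel 𝓘(ℂ, E) n) x₀ x₀) := by
  have h := (contMDiffAt_iff.1 hg).2
  have hr : Set.range (powModel 𝓘(ℂ, E) n) = Set.univ := by
    ext v; simp only [Set.mem_univ, iff_true]; exact ⟨v, rfl⟩
  rw [hr, contDiffWithinAt_univ] at h
  exact h.analyticAt


section Slice

/-- The points `y` such that `update x i y` belongs to `V`. -/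
def sliceOpen (V : Opens (Fin n → X)) (x : Fin n → X) (i : Fin n) : Opens X :=
  ⟨{y | Function.update x i y ∈ V}, V.2.preimage (by fun_prop)⟩

lemma mem_sliceOpen {V : Opens (Fin n → X)} {x : Fin n → X} (hx : x ∈ V) (i : Fin n) :
    x i ∈ sliceOpen V x i := by
  change Function.update x i (x i) ∈ V
  rwa [Function.update_eq_self]

/-- The function `y ↦ f (update x i y)`. -/
def slice {V : Opens (Fin n → X)} (x : Fin n → X) (i : Fin n) {N : Opens X}
    (hN : N ≤ sliceOpen V x i) : Holo (powModel 𝓘(ℂ, E) n) V →ₐ[ℂ] Holo 𝓘(ℂ, E) N :=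
  holoComap (fun y => Function.update x i y) (contMDiff_update x i) fun _ hy => hN hy

/-- The function `x ↦ ξ(f(x₁, …, x_{i-1}, -, x_{i+1}, …, xₙ))(xᵢ)`. -/
def liftFun {i : Fin n} {W : Opens X} (ξ : VF 𝓘(ℂ, E) W) {V : Opens (Fin n → X)}
    (hV : ∀ x ∈ V, x i ∈ W) (f : Holo (powModel 𝓘(ℂ, E) n) V) (x : V) : ℂ :=
  Op.app ξ.1 (inf_le_right : sliceOpen V x.1 i ⊓ W ≤ W) (slice x.1 i inf_le_left f)
    ⟨x.1 i, mem_sliceOpen x.2 i, hV x.1 x.2⟩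

/-- `ξ` commutes with restriction, so the slice may be replaced by any function on a smaller
neighbourhood of `x i` that agrees with it. In this form the construction matches the condition
`IsLift`. -/
lemma liftFun_eq {i : Fin n} {W : Opens X} (ξ : VF 𝓘(ℂ, E) W) {V : Opens (Fin n → X)}
    (hV : ∀ x ∈ V, x i ∈ W) (f : Holo (powModel 𝓘(ℂ, E) n) V) (x : V) {W' : Opens X}
    (hW' : W' ≤ W) (hx : x.1 i ∈ W') (g : Holo 𝓘(ℂ, E) W')
    (hg : ∀ y : W', ∃ h : Function.update x.1 i y.1 ∈ V, g y = f ⟨Function.update x.1 i y.1, h⟩) :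
    liftFun ξ hV f x = Op.app ξ.1 hW' g ⟨x.1 i, hx⟩ := by
  have h1 : W' ≤ sliceOpen V x.1 i ⊓ W := fun y hy => ⟨(hg ⟨y, hy⟩).1, hW' hy⟩
  have h2 : holoRes h1 (slice x.1 i inf_le_left f) = g := by
    ext y
    exact (hg y).2.symm
  rw [← h2]
  exact (Op.app_res_apply ξ.1 inf_le_right h1 _ ⟨x.1 i, hx⟩).symm

variable [FiniteDimensional ℂ E] [IsManifold 𝓘(ℂ, E) ω X]

/-- The definition proceeds slice by slice, so joint holomorphy is not evident. In coordinates the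
result is `∑ ξ(zₖ) ∂f/∂zₖ`, with coefficients depending on `x i` only and with derivatives of `f` in
the `i`-th variable, and this expression is holomorphic in all variables. -/
lemma contMDiffOn_liftFun {i : Fin n} {W : Opens X} (ξ : VF 𝓘(ℂ, E) W) {V : Opens (Fin n → X)}
    (hV : ∀ x ∈ V, x i ∈ W) (f : Holo (powModel 𝓘(ℂ, E) n) V) :
    ∃ g : (Fin n → X) → ℂ, ContMDiffOn (powModel 𝓘(ℂ, E) n) 𝓘(ℂ, ℂ) ω g V ∧
      ∀ x : V, liftFun ξ hV f x = g x := by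
  classical
  -- Extension by `0` outside `V`; regularity is only claimed on the open set `V`.
  refine ⟨fun x => if h : x ∈ V then liftFun ξ hV f ⟨x, h⟩ else 0, ?_, fun x =>
    (by beta_reduce; rw [dif_pos x.2])⟩
  intro x₀ hx₀
  refine ContMDiffAt.contMDiffWithinAt ?_
  obtain ⟨fg, hfg, hfe⟩ := f.2
  let Φ := extChartAt (powModel 𝓘(ℂ, E) n) x₀
  let φ := extChartAt 𝓘(ℂ, E) (x₀ i)
  have hΦ (l : Fin n) (x : Fin n → X) : Φ x l = extChartAt 𝓘(ℂ, E) (x₀ l) (x l) := rfl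
  let b := Module.finBasis ℂ E
  let S : Opens X := ⟨(chartAt E (x₀ i)).source, (chartAt E (x₀ i)).open_source⟩
  have hφS : ContMDiffOn 𝓘(ℂ, E) 𝓘(ℂ, E) ω φ S := contMDiffOn_extChartAt
  let z (k) : Holo 𝓘(ℂ, E) (W ⊓ S) := Holo.mk (W ⊓ S) (fun y => b.repr (φ y) k)
    (((b.coord k).toContinuousLinearMap.contMDiff.comp_contMDiffOn
      (hφS.mono (fun y hy => hy.2))))
  let a (k) := Op.app ξ.1 inf_le_left (z k)
  choose ag hag hae using fun k => (a k).2
  have han := analyticAt_of_contMDiffAt ((hfg x₀ hx₀).contMDiffAt (V.2.mem_nhds hx₀))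
  let f' : (Fin n → E) → ℂ := fg ∘ Φ.symm
  have hΦc : ContinuousAt Φ x₀ := continuousAt_extChartAt x₀
  have hS : ∀ᶠ x in nhds x₀, x ∈ V ∧ (∀ l, x l ∈ (chartAt E (x₀ l)).source) ∧
      AnalyticAt ℂ f' (Φ x) := by
    have hV₀ : ∀ᶠ x in nhds x₀, x ∈ V := V.2.mem_nhds hx₀
    refine hV₀.and (Filter.Eventually.and ?_ (hΦc.eventually han.eventually_analyticAt))
    rw [Filter.eventually_all]
    intro l
    exact (continuous_apply l).continuousAt.eventually
      ((chartAt E (x₀ l)).open_source.mem_nhds (mem_chart_source E (x₀ l)))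
  -- The coordinate expression, in the chart at `x₀`, is holomorphic near `x₀`; the remainder of the
  -- proof identifies it with `liftFun`.
  have hmain : ContMDiffAt (powModel 𝓘(ℂ, E) n) 𝓘(ℂ, ℂ) ω
      (fun x => ∑ k, ag k (x i) * fderiv ℂ f' (Φ x) (Pi.single i (b k))) x₀ := by
    have h1 : ContMDiffAt (powModel 𝓘(ℂ, E) n) 𝓘(ℂ, Fin n → E) ω Φ x₀ := contMDiffAt_extChartAt
    refine contMDiffAt_finsetSum fun k _ => ?_
    refine ContMDiffAt.mul ?_ ?_
    · exact ((hag k).contMDiffAt ((W ⊓ S).2.mem_nhds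
        ⟨hV _ hx₀, mem_chart_source E (x₀ i)⟩)).comp x₀ (contMDiff_pr i x₀)
    · have h2 : AnalyticAt ℂ (fun w => fderiv ℂ f' w (Pi.single i (b k))) (Φ x₀) :=
        ((ContinuousLinearMap.apply ℂ ℂ (Pi.single i (b k) : Fin n → E)).analyticAt _).comp
          han.fderiv
      exact h2.contDiffAt.contMDiffAt.comp x₀ h1
  refine hmain.congr_of_eventuallyEq ?_
  filter_upwards [hS] with x ⟨hxV, hxS, hxa⟩
  rw [dif_pos hxV]
  let N : Opens X := sliceOpen V x i ⊓ (W ⊓ S)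
  have hN : N ≤ W := fun y hy => hy.2.1
  have hxN : x i ∈ N := ⟨mem_sliceOpen hxV i, hV _ hxV, hxS i⟩
  have hup (w) : HasFDerivAt (Function.update (Φ x) i) _ w := hasFDerivAt_update (𝕜 := ℂ) (Φ x) w
  have hup0 : Function.update (Φ x) i (φ (x i)) = Φ x := Function.update_eq_self i (Φ x)
  have e1 : liftFun ξ hV f ⟨x, hxV⟩ = Op.app ξ.1 hN (slice x i inf_le_left f) ⟨x i, hxN⟩ :=
    liftFun_eq ξ hV f ⟨x, hxV⟩ hN hxN _ fun y => ⟨y.2.1, rfl⟩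
  have hN' : N ≤ W ⊓ S := inf_le_right
  -- The chart stays the one at `x₀` while `x` varies nearby. In it the slice through `x` is `f'`
  -- with only the `i`-th coordinate of `Φ x` moving, so its derivative is the partial derivative of
  -- `f'` by the chain rule.
  rw [e1, VF.app_eq_sum ξ hN _ b (fun k => holoRes hN' (z k)) φ ⟨x i, hxN⟩
    (hφS.mono fun y hy => hy.2.2) (fun k y => rfl)
    (fun w => f' (Function.update (Φ x) i w))]
  · refine Finset.sum_congr rfl fun k _ => ?_
    rw [Op.app_res_apply ξ.1 inf_le_left hN' (z k) ⟨x i, hxN⟩]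
    congr 1
    · exact hae k _
    · have hd : HasFDerivAt f' (fderiv ℂ f' (Φ x)) (Function.update (Φ x) i (φ (x i))) := by
        rw [hup0]
        exact hxa.differentiableAt.hasFDerivAt
      have := (hd.comp (φ (x i)) (hup (φ (x i)))).fderiv
      have h3 := congr($this (b k))
      refine h3.trans ?_
      simp only [ContinuousLinearMap.comp_apply]
      congr 1
      ext l
      by_cases h : l = i
      · subst h; simp
      · simp [h]
  · have h1 : AnalyticAt ℂ f' (Function.update (Φ x) i (φ (x i))) := by rw [hup0]; exact hxa
    have h2 : AnalyticAt ℂ (fun w => Function.update (Φ x : Fin n → E) i w) (φ (x i)) :=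
      (contDiff_update ω (Φ x : Fin n → E) i).contDiffAt.analyticAt
    exact h1.comp h2
  · have hS' : ∀ᶠ p in nhds (x i), p ∈ S := S.2.mem_nhds (hxS i)
    filter_upwards [hS'] with p hp hpN
    change f ⟨Function.update x i p, _⟩ = fg (Φ.symm (Function.update (Φ x) i (φ p)))
    have h4 : Function.update (Φ x) i (φ p) = Φ (Function.update x i p) := by
      funext l
      by_cases h : l = i
      · subst h; rw [hΦ]; simp [φ]
      · rw [hΦ]; simp [h, hΦ]
    have h5 : Function.update x i p ∈ Φ.source := ?_
    · rw [h4, Φ.left_inv h5, hfe]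
    rw [extChartAt_source (powModel 𝓘(ℂ, E) n) x₀]
    refine fun l _ => ?_
    by_cases h : l = i
    · subst h; simpa using! hp
    · simpa [h] using! hxS l

end Slice

section LiftVF

/-- Pull-back of functions along the `i`-th projection. -/
def prComap (i : Fin n) {W : Opens X} {U : Opens (Fin n → X)} (hU : ∀ x ∈ U, x i ∈ W) :
    Holo 𝓘(ℂ, E) W →ₐ[ℂ] Holo (powModel 𝓘(ℂ, E) n) U :=
  holoComap (fun x => x i) (contMDiff_pr i) hU

/-- Around every point of `U` the slice of the argument is an admissible test function, so the
condition `IsLift` prescribes all values of the operator. -/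
lemma IsLift.unique {i : Fin n} {W : Opens X} {U : Opens (Fin n → X)} (hU : ∀ x ∈ U, x i ∈ W)
    {P : DiffOp 𝓘(ℂ, E) W} {Q Q' : DiffOp (powModel 𝓘(ℂ, E) n) U} (h : IsLift i P Q)
    (h' : IsLift i P Q') : Q = Q' := by
  refine Subtype.ext (Op.ext fun V hV f => holo_ext fun x => ?_)
  have hx : x.1 i ∈ sliceOpen V x.1 i ⊓ W := ⟨mem_sliceOpen x.2 i, hU _ (hV x.2)⟩
  rw [h V hV f x _ inf_le_right hx (slice x.1 i inf_le_left f) fun y => ⟨y.2.1, rfl⟩,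
    h' V hV f x _ inf_le_right hx (slice x.1 i inf_le_left f) fun y => ⟨y.2.1, rfl⟩]

/-- All points of a slice in direction `i` have the same slice, so the function `Q' f` restricted to
it is `P' g`, and `h` applies to this pair. -/
lemma IsLift.mul {i : Fin n} {W : Opens X} {U : Opens (Fin n → X)}
    {P P' : DiffOp 𝓘(ℂ, E) W} {Q Q' : DiffOp (powModel 𝓘(ℂ, E) n) U} (h : IsLift i P Q)
    (h' : IsLift i P' Q') : IsLift i (P * P') (Q * Q') := fun V hV f x W' hW' hx g hg => by
  refine h V hV (Op.app Q'.1 hV f) x W' hW' hx (Op.app P'.1 hW' g) fun y => ?_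
  refine ⟨(hg y).1, ?_⟩
  have e (y' : X) : Function.update (Function.update x.1 i y.1) i y' = Function.update x.1 i y' :=
    Function.update_idem _ _ _
  have hy : Function.update x.1 i y.1 i = y.1 := Function.update_self _ _ _
  have := h' V hV f ⟨Function.update x.1 i y.1, (hg y).1⟩ W' hW'
    (by change Function.update x.1 i y.1 i ∈ W'; rw [hy]; exact y.2) g
    fun y' => ⟨by
        change Function.update (Function.update x.1 i y.1) i y'.1 ∈ V
        rw [e]; exact (hg y').1,
      (hg y').2.trans (holo_congr f (e y').symm)⟩
  rw [this]
  exact holo_congr _ hy.symm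

lemma IsLift.sub {i : Fin n} {W : Opens X} {U : Opens (Fin n → X)}
    {P P' : DiffOp 𝓘(ℂ, E) W} {Q Q' : DiffOp (powModel 𝓘(ℂ, E) n) U} (h : IsLift i P Q)
    (h' : IsLift i P' Q') : IsLift i (P - P') (Q - Q') := fun V hV f x W' hW' hx g hg => by
  change Op.app (Q.1 - Q'.1) hV f x = Op.app (P.1 - P'.1) hW' g _
  rw [Op.sub_app, Op.sub_app, holo_sub_apply, holo_sub_apply, h V hV f x W' hW' hx g hg,
    h' V hV f x W' hW' hx g hg]

lemma isLift_holo {i : Fin n} {W : Opens X} {U : Opens (Fin n → X)} (hU : ∀ x ∈ U, x i ∈ W)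
    (a : Holo 𝓘(ℂ, E) W) : IsLift i (holoToD W a) (holoToD U (prComap i hU a)) :=
  fun V hV f x W' hW' hx g hg => by
  change (mulOp U (prComap i hU a)).app hV f x = (mulOp W a).app hW' g _
  rw [mulOp_app, mulOp_app, holo_mul_apply, holo_mul_apply, (hg _).2]
  exact congrArg _ (holo_congr f (Function.update_eq_self i x.1).symm)

/-- The relations of `BoxO` contain additivity and the action of lifts only; homogeneity over `ℂ` of
`⊠ mᵢ` follows by lifting constants. -/
lemma isLift_algebraMap (i : Fin n) (W : Opens X) (U : Opens (Fin n → X)) (c : ℂ) :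
    IsLift i (algebraMap ℂ (DiffOp 𝓘(ℂ, E) W) c)
      (algebraMap ℂ (DiffOp (powModel 𝓘(ℂ, E) n) U) c) := fun V hV f x W' hW' hx g hg => by
  change c * f x = c * g _
  rw [(hg _).2]
  exact congrArg _ (holo_congr f (Function.update_eq_self i x.1).symm)

variable [FiniteDimensional ℂ E] [IsManifold 𝓘(ℂ, E) ω X]

/-- The vector field which acts as `ξ` in the `i`-th variable, as an operator. -/
def liftOp {i : Fin n} {W : Opens X} {U : Opens (Fin n → X)} (hU : ∀ x ∈ U, x i ∈ W)
    (ξ : VF 𝓘(ℂ, E) W) : Op (powModel 𝓘(ℂ, E) n) U :=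
  ⟨fun V =>
    { toFun := fun f => ⟨liftFun ξ (fun x hx => hU x (V.2 hx)) f, contMDiffOn_liftFun ξ _ f⟩
      map_add' := fun f g => by
        ext x
        change liftFun ξ (fun x hx => hU x (V.2 hx)) (f + g) x =
          liftFun ξ (fun x hx => hU x (V.2 hx)) f x + liftFun ξ (fun x hx => hU x (V.2 hx)) g x
        simp only [liftFun, map_add, holo_add_apply]
      map_smul' := fun c f => by
        ext x
        change liftFun ξ (fun x hx => hU x (V.2 hx)) (c • f) x =
          c • liftFun ξ (fun x hx => hU x (V.2 hx)) f x
        simp only [liftFun, map_smul]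
        rfl },
    fun V V' h f => by
      ext x
      exact liftFun_eq ξ (fun x hx => hU x (V.2 hx)) f ⟨x.1, h x.2⟩ inf_le_right ⟨mem_sliceOpen x.2 i, hU _ (V'.2 x.2)⟩ _
        fun y => ⟨h y.2.1, rfl⟩⟩

lemma liftOp_app {i : Fin n} {W : Opens X} {U : Opens (Fin n → X)} (hU : ∀ x ∈ U, x i ∈ W)
    (ξ : VF 𝓘(ℂ, E) W) {V : Opens (Fin n → X)} (hV : V ≤ U) (f : Holo (powModel 𝓘(ℂ, E) n) V)
    (x : V) : (liftOp hU ξ).app hV f x = liftFun ξ (fun x hx => hU x (hV hx)) f x := rfl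

lemma slice_self {V : Opens (Fin n → X)} {x : Fin n → X} {i : Fin n} {N : Opens X}
    (hN : N ≤ sliceOpen V x i) (f : Holo (powModel 𝓘(ℂ, E) n) V) (hx : x i ∈ N) (hx' : x ∈ V) :
    slice x i hN f ⟨x i, hx⟩ = f ⟨x, hx'⟩ :=
  holo_congr f (Function.update_eq_self _ _)

/-- The vector field which acts as `ξ` in the `i`-th variable. -/
def liftVF (i : Fin n) {W : Opens X} {U : Opens (Fin n → X)} (hU : ∀ x ∈ U, x i ∈ W) :
    VF 𝓘(ℂ, E) W →ₛₗ[(prComap (E := E) i hU).toRingHom] VF (powModel 𝓘(ℂ, E) n) U where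
  toFun ξ := ⟨liftOp hU ξ, fun V hV f g => by
    ext x
    rw [holo_add_apply, holo_mul_apply, holo_mul_apply, liftOp_app, liftOp_app, liftOp_app]
    simp only [liftFun, map_mul, VF.app_mul, holo_add_apply, holo_mul_apply]
    exact congrArg₂ _ (congrArg (· * _) (slice_self _ f _ x.2))
      (congrArg (· * _) (slice_self _ g _ x.2))⟩
  map_add' ξ η := Subtype.ext (Op.ext fun V hV f => holo_ext fun x => rfl)
  map_smul' a ξ := Subtype.ext (Op.ext fun V hV f => holo_ext fun x => rfl)

lemma isLift_liftVF {i : Fin n} {W : Opens X} {U : Opens (Fin n → X)} (hU : ∀ x ∈ U, x i ∈ W)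
    (ξ : VF 𝓘(ℂ, E) W) : IsLift i (vfToD W ξ) (vfToD U (liftVF i hU ξ)) :=
  fun _ hV f x _ hW' hx g hg => liftFun_eq ξ (fun x hx => hU x (hV hx)) f x hW' hx g hg

/-- Uniqueness of lifts: the vector fields `ξ'` allowed in `IsCanonical` are forced. Brackets,
restrictions and permutations of lifts are computed through this as well. -/
lemma IsLift.eq_liftVF {i : Fin n} {W : Opens X} {U : Opens (Fin n → X)} (hU : ∀ x ∈ U, x i ∈ W)
    {ξ : VF 𝓘(ℂ, E) W} {η : VF (powModel 𝓘(ℂ, E) n) U} (h : IsLift i (vfToD W ξ) (vfToD U η)) :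
    η = liftVF i hU ξ := vfToD_injective (h.unique hU (isLift_liftVF hU ξ))

lemma liftVF_lie (i : Fin n) {W : Opens X} {U : Opens (Fin n → X)} (hU : ∀ x ∈ U, x i ∈ W)
    (ξ η : VF 𝓘(ℂ, E) W) : liftVF i hU ⁅ξ, η⁆ = ⁅liftVF i hU ξ, liftVF i hU η⁆ := by
  have h : IsLift i (vfToD W ξ * vfToD W η - vfToD W η * vfToD W ξ)
      (vfToD U (liftVF i hU ξ) * vfToD U (liftVF i hU η) -
        vfToD U (liftVF i hU η) * vfToD U (liftVF i hU ξ)) :=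
    ((isLift_liftVF hU ξ).mul (isLift_liftVF hU η)).sub
      ((isLift_liftVF hU η).mul (isLift_liftVF hU ξ))
  exact (IsLift.eq_liftVF hU (ξ := ⁅ξ, η⁆) (η := ⁅liftVF i hU ξ, liftVF i hU η⁆) h).symm

lemma liftVF_app_prComap_self (i : Fin n) {W : Opens X} {U : Opens (Fin n → X)}
    (hU : ∀ x ∈ U, x i ∈ W) (ξ : VF 𝓘(ℂ, E) W) {V : Opens (Fin n → X)} (hV : V ≤ U) {N : Opens X}
    (hN : N ≤ W) (hVN : ∀ x ∈ V, x i ∈ N) (g : Holo 𝓘(ℂ, E) N) :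
    Op.app (liftVF i hU ξ).1 hV (prComap i hVN g) = prComap i hVN (Op.app ξ.1 hN g) := by
  ext x
  have h : sliceOpen V x.1 i ⊓ N ≤ N := inf_le_right
  refine (liftFun_eq ξ (fun x hx => hU x (hV hx)) (prComap i hVN g) x (h.trans hN)
    ⟨mem_sliceOpen x.2 i, hVN _ x.2⟩ (holoRes h g)
    fun y => ⟨y.2.1, holo_congr g
      (show y.1 = Function.update x.1 i y.1 i from (Function.update_self i y.1 x.1).symm)⟩).trans ?_
  exact Op.app_res_apply ξ.1 hN h g ⟨x.1 i, mem_sliceOpen x.2 i, hVN _ x.2⟩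

lemma liftVF_app_prComap_of_ne {i l : Fin n} (hl : l ≠ i) {W : Opens X} {U : Opens (Fin n → X)}
    (hU : ∀ x ∈ U, x i ∈ W) (ξ : VF 𝓘(ℂ, E) W) {V : Opens (Fin n → X)} (hV : V ≤ U) {N : Opens X}
    (hVN : ∀ x ∈ V, x l ∈ N) (g : Holo 𝓘(ℂ, E) N) :
    Op.app (liftVF i hU ξ).1 hV (prComap l hVN g) = 0 := by
  ext x
  refine (liftFun_eq ξ (fun x hx => hU x (hV hx)) (prComap l hVN g) x
    (inf_le_right : sliceOpen V x.1 i ⊓ W ≤ W)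
    ⟨mem_sliceOpen x.2 i, hU _ (hV x.2)⟩ (algebraMap ℂ _ (g ⟨x.1 l, hVN _ x.2⟩))
    fun y => ⟨y.2.1, ?_⟩).trans ?_
  · exact holo_congr g (Function.update_of_ne hl _ _).symm
  · rw [VF.app_algebraMap]; rfl

/-- A vector field is determined by its values on coordinate functions, and the coordinates of a
product chart are pulled back from the factors. -/
lemma VF.eq_zero_of_prComap {U : Opens (Fin n → X)} (ξ : VF (powModel 𝓘(ℂ, E) n) U)
    (h : ∀ (V : Opens (Fin n → X)) (hV : V ≤ U) (l : Fin n) (N : Opens X)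
      (hVN : ∀ x ∈ V, x l ∈ N) (g : Holo 𝓘(ℂ, E) N), Op.app ξ.1 hV (prComap l hVN g) = 0) :
    ξ = 0 := by
  classical
  refine Subtype.ext (Op.ext fun V hV f => holo_ext fun x₀ => ?_)
  let Φ := extChartAt (powModel 𝓘(ℂ, E) n) x₀.1
  obtain ⟨fg, hfg, hfe⟩ := f.2
  have han := analyticAt_of_contMDiffAt ((hfg x₀.1 x₀.2).contMDiffAt (V.2.mem_nhds x₀.2))
  let S (l : Fin n) : Opens X :=
    ⟨(chartAt E (x₀.1 l)).source, (chartAt E (x₀.1 l)).open_source⟩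
  let S' : Opens (Fin n → X) := ⟨{x | ∀ l, x l ∈ S l}, by
    have : {x : Fin n → X | ∀ l, x l ∈ S l} = Set.univ.pi fun l => (S l : Set X) := by
      ext; simp
    rw [this]
    exact isOpen_set_pi Set.finite_univ fun l _ => (S l).2⟩
  let N : Opens (Fin n → X) := V ⊓ S'
  have hNV : N ≤ V := inf_le_left
  have hx₀ : x₀.1 ∈ N := ⟨x₀.2, fun l => mem_chart_source E (x₀.1 l)⟩
  let b := Module.finBasis ℂ E
  have hφS (l) : ContMDiffOn 𝓘(ℂ, E) 𝓘(ℂ, E) ω (extChartAt 𝓘(ℂ, E) (x₀.1 l)) (S l) :=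
    contMDiffOn_extChartAt
  let z (p : (_ : Fin n) × Fin (Module.finrank ℂ E)) : Holo 𝓘(ℂ, E) (S p.1) :=
    Holo.mk (S p.1) (fun y => b.repr (extChartAt 𝓘(ℂ, E) (x₀.1 p.1) y) p.2)
    (((b.coord p.2).toContinuousLinearMap.contMDiff.comp_contMDiffOn (hφS p.1)))
  have hpr (l : Fin n) : ∀ x ∈ N, x l ∈ S l := fun x hx => hx.2 l
  rw [← Op.app_res_apply ξ.1 hV hNV f ⟨x₀.1, hx₀⟩, VF.app_eq_sum ξ (hNV.trans hV) _
    (Pi.basis fun _ => b) (fun p => prComap p.1 (hpr p.1) (z p)) Φ ⟨x₀.1, hx₀⟩ ?_ ?_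
    (fg ∘ Φ.symm) han]
  · rw [Finset.sum_eq_zero]
    · rfl
    · intro p _
      rw [h, holo_zero_apply, zero_mul]
  · have : ∀ᶠ x in nhds x₀.1, x ∈ N := N.2.mem_nhds hx₀
    filter_upwards [this] with x hx _
    have h5 : x ∈ Φ.source := by
      rw [extChartAt_source (powModel 𝓘(ℂ, E) n) x₀.1]
      exact fun l _ => hx.2 l
    change f ⟨x, _⟩ = fg (Φ.symm (Φ x))
    rw [Φ.left_inv h5, hfe]
  · have h1 (l : Fin n) : ContMDiffOn (powModel 𝓘(ℂ, E) n) 𝓘(ℂ, E) ω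
        (fun x : Fin n → X => extChartAt 𝓘(ℂ, E) (x₀.1 l) (x l)) N :=
      (hφS l).comp (contMDiff_pr l).contMDiffOn (hpr l)
    exact contMDiffOn_pi_space.2 h1
  · rintro ⟨l, k⟩ y
    simp only [Pi.basis_repr]
    rfl

/-- By `VF.eq_zero_of_prComap` it suffices to apply the bracket to functions of a single variable.
One of the two lifts kills such a function, and the other turns it into zero or into a function of
the same variable. -/
lemma liftVF_lie_of_ne {i j : Fin n} (hij : i ≠ j) {W W' : Opens X} {U : Opens (Fin n → X)}
    (hU : ∀ x ∈ U, x i ∈ W) (hU' : ∀ x ∈ U, x j ∈ W') (ξ : VF 𝓘(ℂ, E) W) (η : VF 𝓘(ℂ, E) W') :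
    ⁅liftVF i hU ξ, liftVF j hU' η⁆ = 0 := by
  refine VF.eq_zero_of_prComap _ fun V hV l N hVN g => ?_
  rw [VF.lie_coe, Op.sub_app, Op.mul_app, Op.mul_app]
  by_cases hi : l = i
  · subst hi
    rw [liftVF_app_prComap_of_ne hij hU', map_zero, zero_sub, neg_eq_zero]
    -- The domain of `g` is shrunk so that `ξ` acts on it; the pulled-back function on `V` does not
    -- change.
    have hN : N ⊓ W ≤ W := inf_le_right
    have hVN' : ∀ x ∈ V, x l ∈ N ⊓ W := fun x hx => ⟨hVN x hx, hU x (hV hx)⟩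
    have e : prComap l hVN g = prComap l hVN'
      (holoRes inf_le_left g) := rfl
    rw [e]
    exact (congrArg (Op.app (liftVF j hU' η).1 hV)
      (liftVF_app_prComap_self l hU ξ hV hN _ _)).trans (liftVF_app_prComap_of_ne hij hU' _ _ _ _)
  · rw [liftVF_app_prComap_of_ne hi hU, map_zero, sub_zero]
    by_cases hj : l = j
    · subst hj
      have hN : N ⊓ W' ≤ W' := inf_le_right
      have hVN' : ∀ x ∈ V, x l ∈ N ⊓ W' := fun x hx => ⟨hVN x hx, hU' x (hV hx)⟩
      have e : prComap l hVN g = prComap l hVN' (holoRes inf_le_left g) := rfl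
      rw [e]
      exact (congrArg (Op.app (liftVF i hU ξ).1 hV)
        (liftVF_app_prComap_self l hU' η hV hN _ _)).trans (liftVF_app_prComap_of_ne hi hU _ _ _ _)
    · rw [liftVF_app_prComap_of_ne hj hU', map_zero]

lemma vfRes_liftVF (i : Fin n) {W W' : Opens X} {U U' : Opens (Fin n → X)}
    (hU : ∀ x ∈ U, x i ∈ W) (hU' : ∀ x ∈ U', x i ∈ W') (hUU : U' ≤ U) (hWW : W' ≤ W)
    (ξ : VF 𝓘(ℂ, E) W) : vfRes hUU (liftVF i hU ξ) = liftVF i hU' (vfRes hWW ξ) :=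
  IsLift.eq_liftVF hU' ((isLift_liftVF hU ξ).res hWW hUU)

end LiftVF

end Lift

/-! ### Lifts under permutation of the variables -/

section PullLift

variable {E : Type v} [NormedAddCommGroup E] [NormedSpace ℂ E] {H : Type w} [TopologicalSpace H]
  {I : ModelWithCorners ℂ E H} {X : Type u} [TopologicalSpace X] [ChartedSpace H X] {n : ℕ}

/-- The permutation maps the slice in direction `j` through `x` to the slice in direction `σ j`
through the image of `x`, with the same parameter. -/
lemma IsLift.pullD {σ : Equiv.Perm (Fin n)} {j : Fin n} {W : Opens X} {U : Opens (Fin n → X)}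
    {P : DiffOp I W} {Q : DiffOp (powModel I n) U} (h : IsLift (σ j) P Q) :
    IsLift j P (pullD (permDiffeo I X σ) U Q) := fun V hV f x W' hW' hx g hg => by
  let Φ := permDiffeo I X σ
  have hΦ (z : Fin n → X) (l : Fin n) : Φ z l = z (σ⁻¹ l) := rfl
  have hx' : Φ x.1 (σ j) = x.1 j := by rw [hΦ]; simp
  have hup (y : X) : Function.update (Φ x.1) (σ j) y = Φ (Function.update x.1 j y) := by
    funext l
    rw [hΦ]
    by_cases hl : l = σ j
    · subst hl; simp
    · have : σ⁻¹ l ≠ j := fun h => hl (by rw [← h]; simp)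
      rw [Function.update_of_ne hl, Function.update_of_ne this, hΦ]
  have hxV : Φ x.1 ∈ (preim Φ.symm.toHomeomorph).obj V := by
    change Φ.symm (Φ x.1) ∈ V
    rw [Φ.symm_apply_apply]; exact x.2
  have := h _ (preim_symm_le Φ hV) (comapBwd Φ V f) ⟨Φ x.1, hxV⟩ W' hW'
    (by change Φ x.1 (σ j) ∈ W'; rw [hx']; exact hx) g fun y => by
      have hy : Φ.symm (Function.update (Φ x.1) (σ j) y.1) = Function.update x.1 j y.1 := by
        rw [hup, Φ.symm_apply_apply]
      refine ⟨?_, ?_⟩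
      · change Φ.symm (Function.update (Φ x.1) (σ j) y.1) ∈ V
        rw [hy]; exact (hg y).1
      · exact (hg y).2.trans (holo_congr f hy.symm)
  change Op.app Q.1 _ (comapBwd Φ V f) ⟨Φ x.1, _⟩ = _
  exact this.trans (holo_congr _ hx')

lemma IsLift.pullVF {σ : Equiv.Perm (Fin n)} {j : Fin n} {W : Opens X} {U : Opens (Fin n → X)}
    {ξ : VF I W} {ξ' : VF (powModel I n) U} (h : IsLift (σ j) (vfToD W ξ) (vfToD U ξ')) :
    IsLift j (vfToD W ξ) (vfToD _ (pullVF (permDiffeo I X σ) U ξ')) := h.pullD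

end PullLift

/-! ### Locally bijective morphisms of presheaves -/

section LocalBijective

variable {Y : Type u} [TopologicalSpace Y] {A : Type*} [Category A] {FA : A → A → Type*}
  {CA : A → Type*} [∀ S T, FunLike (FA S T) (CA S) (CA T)] [ConcreteCategory A FA]
  [(Opens.grothendieckTopology Y).WEqualsLocallyBijective A] {P Q : (Opens Y)ᵒᵖ ⥤ A}

/-- A morphism of presheaves is locally surjective and locally injective at each point. -/
structure IsLocallyBijective (φ : P ⟶ Q) : Prop where
  surj (U : Opens Y) (s : ToType (Q.obj (op U))) (x : Y) (hx : x ∈ U) :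
    ∃ (V : Opens Y) (h : V ≤ U) (_ : x ∈ V) (p : ToType (P.obj (op V))),
      φ.app (op V) p = Q.map (homOfLE h).op s
  inj (U : Opens Y) (s t : ToType (P.obj (op U))) (e : φ.app (op U) s = φ.app (op U) t) (x : Y)
    (hx : x ∈ U) : ∃ (V : Opens Y) (h : V ≤ U) (_ : x ∈ V),
      P.map (homOfLE h).op s = P.map (homOfLE h).op t

/-- Identifies the pointwise condition, convenient for checking, with the class `W` of morphisms
that become isomorphisms on associated sheaves. -/
lemma isLocallyBijective_iff (φ : P ⟶ Q) :
    IsLocallyBijective φ ↔ (Opens.grothendieckTopology Y).W φ := by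
  rw [GrothendieckTopology.W_iff_isLocallyBijective]
  constructor
  · intro h
    refine ⟨⟨fun {U} s t e x hx => ?_⟩, ⟨fun {U} s x hx => ?_⟩⟩
    · obtain ⟨V, hV, hxV, e'⟩ := h.inj U.unop s t e x hx
      exact ⟨V, homOfLE hV, e', hxV⟩
    · obtain ⟨V, hV, hxV, p, e'⟩ := h.surj U s x hx
      exact ⟨V, homOfLE hV, ⟨p, e'⟩, hxV⟩
  · rintro ⟨h1, h2⟩
    refine ⟨fun U s x hx => ?_, fun U s t e x hx => ?_⟩
    · obtain ⟨V, f, ⟨p, e⟩, hxV⟩ := Presheaf.imageSieve_mem (Opens.grothendieckTopology Y) φ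
        (U := op U) s x hx
      exact ⟨V, f.le, hxV, p, e⟩
    · obtain ⟨V, f, e, hxV⟩ := Presheaf.equalizerSieve_mem (Opens.grothendieckTopology Y) φ
        (X := op U) s t e x hx
      exact ⟨V, f.le, hxV, e⟩

lemma isLocallyBijective_toSheafify [HasWeakSheafify (Opens.grothendieckTopology Y) A]
    (P : (Opens Y)ᵒᵖ ⥤ A) : IsLocallyBijective (toSheafify (Opens.grothendieckTopology Y) P) :=
  (isLocallyBijective_iff _).2 (GrothendieckTopology.W_toSheafify _ P)

end LocalBijective

/-! ### Sections of associated sheaves -/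

section Sections

variable {Y : Type u} [TopologicalSpace Y]

/-- Restriction of sections of a presheaf. -/
abbrev preRes (P : (Opens Y)ᵒᵖ ⥤ ModuleCat.{u} ℂ) {U V : Opens Y} (h : V ≤ U) :
    P.obj (op U) →ₗ[ℂ] P.obj (op V) := (P.map (homOfLE h).op).hom

lemma preRes_refl (P : (Opens Y)ᵒᵖ ⥤ ModuleCat.{u} ℂ) {U : Opens Y} (h : U ≤ U)
    (s : P.obj (op U)) : preRes P h s = s := congr(($(P.map_id (op U))).hom s)

lemma preRes_trans (P : (Opens Y)ᵒᵖ ⥤ ModuleCat.{u} ℂ) {U V W : Opens Y} (h : V ≤ U) (h' : W ≤ V)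
    (s : P.obj (op U)) : preRes P h' (preRes P h s) = preRes P (h'.trans h) s :=
  congr(($(P.map_comp (homOfLE h).op (homOfLE h').op)).hom s).symm

lemma preRes_nat {P Q : (Opens Y)ᵒᵖ ⥤ ModuleCat.{u} ℂ} (f : P ⟶ Q) {U V : Opens Y} (h : V ≤ U)
    (s : P.obj (op U)) :
    preRes Q h ((f.app (op U)).hom s) = (f.app (op V)).hom (preRes P h s) :=
  congr(($(f.naturality (homOfLE h).op)).hom s).symm

lemma toShC_surj (P : (Opens Y)ᵒᵖ ⥤ ModuleCat.{u} ℂ) {U : Opens Y}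
    (s : SecC ((presheafToSheaf (Opens.grothendieckTopology Y) (ModuleCat.{u} ℂ)).obj P) U)
    {x : Y} (hx : x ∈ U) : ∃ (V : Opens Y) (h : V ≤ U) (_ : x ∈ V) (p : P.obj (op V)),
      toShC P V p = preRes _ h s := (isLocallyBijective_toSheafify P).surj U s x hx

lemma secC_ext (F : ModSheaf Y) {U : Opens Y} {s t : SecC F U}
    (h : ∀ x ∈ U, ∃ (V : Opens Y) (h : V ≤ U) (_ : x ∈ V), preRes F.obj h s = preRes F.obj h t) :
    s = t := by
  refine Sheaf.isSeparated F U (Presheaf.equalizerSieve (F := F.obj) (X := op U) s t)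
    (fun x hx => ?_) s t fun V f hf => hf
  obtain ⟨V, hV, hx, e⟩ := h x hx
  exact ⟨V, homOfLE hV, e, hx⟩

lemma mapC_comp {F G H : ModSheaf Y} (f : F ⟶ G) (g : G ⟶ H) (U : Opens Y) (s : SecC F U) :
    mapC (f ≫ g) U s = mapC g U (mapC f U s) := rfl

lemma mapC_toShC {P Q : (Opens Y)ᵒᵖ ⥤ ModuleCat.{u} ℂ} (f : P ⟶ Q) (U : Opens Y)
    (s : P.obj (op U)) : mapC ((presheafToSheaf (Opens.grothendieckTopology Y)
      (ModuleCat.{u} ℂ)).map f) U (toShC P U s) = toShC Q U ((f.app (op U)).hom s) :=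
  congr((($(toSheafify_naturality (Opens.grothendieckTopology Y) f)).app (op U)).hom s).symm

/-- Morphisms out of an associated sheaf are determined by their effect on the sections of the
presheaf. -/
lemma sheafify_ext {P : (Opens Y)ᵒᵖ ⥤ ModuleCat.{u} ℂ} {G : ModSheaf Y}
    {f g : (presheafToSheaf (Opens.grothendieckTopology Y) (ModuleCat.{u} ℂ)).obj P ⟶ G}
    (h : ∀ U s, mapC f U (toShC P U s) = mapC g U (toShC P U s)) : f = g := by
  refine Sheaf.hom_ext (sheafify_hom_ext _ _ _ G.property ?_)
  ext U s
  exact h U.unop s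

/-- The morphism out of an associated sheaf which is given by a morphism of presheaves. -/
def sheafifyDesc {P : (Opens Y)ᵒᵖ ⥤ ModuleCat.{u} ℂ} {G : ModSheaf Y} (f : P ⟶ G.obj) :
    (presheafToSheaf (Opens.grothendieckTopology Y) (ModuleCat.{u} ℂ)).obj P ⟶ G :=
  ⟨sheafifyLift (Opens.grothendieckTopology Y) f G.property⟩

lemma mapC_sheafifyDesc {P : (Opens Y)ᵒᵖ ⥤ ModuleCat.{u} ℂ} {G : ModSheaf Y} (f : P ⟶ G.obj)
    (U : Opens Y) (s : P.obj (op U)) :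
    mapC (sheafifyDesc f) U (toShC P U s) = (f.app (op U)).hom s :=
  congr((($(toSheafify_sheafifyLift (Opens.grothendieckTopology Y) f G.property)).app (op U)).hom s)

/-- Two out of three: `f` and the canonical map to the associated sheaf both lie in `W`, hence so
does the induced morphism, and between sheaves this means isomorphism. -/
lemma isIso_sheafifyDesc {P : (Opens Y)ᵒᵖ ⥤ ModuleCat.{u} ℂ} {G : ModSheaf Y} (f : P ⟶ G.obj)
    (hf : IsLocallyBijective f) : IsIso (sheafifyDesc f) := by
  have h1 := (isLocallyBijective_iff f).1 hf
  have h2 := GrothendieckTopology.W_toSheafify (Opens.grothendieckTopology Y) P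
  rw [← GrothendieckTopology.W_sheafToPresheaf_map_iff_isIso]
  refine MorphismProperty.of_precomp _ (W' := (Opens.grothendieckTopology Y).W) _
    ((sheafToPresheaf _ _).map (sheafifyDesc f)) h2 ?_
  refine (congrArg _ ?_).mpr h1
  exact toSheafify_sheafifyLift (Opens.grothendieckTopology Y) f G.property

end Sections

/-! ### Morphisms out of an external product over `ℂ` -/

section BoxC

variable {X : Type u} [TopologicalSpace X] {n : ℕ}

/-- The presheaf `U ↦ ∏ Pᵢ(prᵢ U)`. -/
def famPre (P : Fin n → (Opens X)ᵒᵖ ⥤ ModuleCat.{u} ℂ) : (Opens (Fin n → X))ᵒᵖ ⥤ Type u where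
  obj U := ∀ i, (P i).obj (op (prImage i U.unop))
  map f := TypeCat.ofHom fun t i => preRes (P i) (prImage_mono i f.unop.le) (t i)
  map_id U := by
    ext t i
    exact preRes_refl (P i) _ _
  map_comp f g := by
    ext t i
    exact (preRes_trans (P i) _ _ _).symm

/-- The functoriality of `famPre`. -/
def famPreMap {P Q : Fin n → (Opens X)ᵒᵖ ⥤ ModuleCat.{u} ℂ} (f : ∀ i, P i ⟶ Q i) :
    famPre P ⟶ famPre Q where
  app U := TypeCat.ofHom fun t i => ((f i).app _).hom (t i)
  naturality U V g := by
    ext t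
    funext i
    exact (preRes_nat (f i) _ _).symm

lemma exists_box_nhds {U : Opens (Fin n → X)} {x : Fin n → X} (hx : x ∈ U) (V : Fin n → Opens X)
    (hV : ∀ i, x i ∈ V i) : ∃ (U' : Opens (Fin n → X)) (_ : U' ≤ U), x ∈ U' ∧
      ∀ i, prImage i U' ≤ V i := by
  refine ⟨⟨U ∩ Set.univ.pi fun i => (V i : Set X), U.2.inter
    (isOpen_set_pi Set.finite_univ fun i _ => (V i).2)⟩, Set.inter_subset_left,
    ⟨hx, fun i _ => hV i⟩, ?_⟩
  rintro i _ ⟨y, hy, rfl⟩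
  exact hy.2 i trivial

lemma mem_prImage {U : Opens (Fin n → X)} {x : Fin n → X} (hx : x ∈ U) (i : Fin n) :
    x i ∈ prImage i U := ⟨x, hx, rfl⟩

/-- Solve the problem in each factor near `x i`. As `n` is finite, the product of the resulting
neighbourhoods is open, and its intersection with `U` works for all factors simultaneously. -/
lemma isLocallyBijective_famPreMap {P Q : Fin n → (Opens X)ᵒᵖ ⥤ ModuleCat.{u} ℂ}
    (f : ∀ i, P i ⟶ Q i) (hf : ∀ i, IsLocallyBijective (f i)) :
    IsLocallyBijective (famPreMap f) := by
  refine ⟨fun U s x hx => ?_, fun U s t e x hx => ?_⟩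
  · choose V hV hxV p hp using fun i => (hf i).surj (prImage i U) (s i) (x i) (mem_prImage hx i)
    obtain ⟨U', hU', hxU', hpr⟩ := exists_box_nhds hx V hxV
    refine ⟨U', hU', hxU', fun i => preRes (P i) (hpr i) (p i), ?_⟩
    funext i
    refine (preRes_nat (f i) (hpr i) (p i)).symm.trans ?_
    exact (congrArg (preRes (Q i) (hpr i)) (hp i)).trans (preRes_trans (Q i) _ _ _)
  · choose V hV hxV hp using fun i => (hf i).inj (prImage i U) (s i) (t i) (congrFun e i) (x i)
      (mem_prImage hx i)
    obtain ⟨U', hU', hxU', hpr⟩ := exists_box_nhds hx V hxV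
    refine ⟨U', hU', hxU', ?_⟩
    funext i
    have e' := congrArg (preRes (P i) (hpr i)) (hp i)
    exact (preRes_trans (P i) (hV i) (hpr i) (s i)).symm.trans
      (e'.trans (preRes_trans (P i) (hV i) (hpr i) (t i)))

/-- The associated sheaf. -/
abbrev shC {Y : Type u} [TopologicalSpace Y] (P : (Opens Y)ᵒᵖ ⥤ ModuleCat.{u} ℂ) : ModSheaf Y :=
  (presheafToSheaf (Opens.grothendieckTopology Y) (ModuleCat.{u} ℂ)).obj P

/-- The section `s₁ ⊠ ⋯ ⊠ sₙ`. -/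
def boxSec (A : Fin n → ModSheaf X) (U : Opens (Fin n → X))
    (s : ∀ i, SecC (A i) (prImage i U)) : SecC ((boxCFunctor X n).obj A) U :=
  toShC (preBoxC A) U (PiTensorProduct.tprod ℂ s)

lemma preRes_boxSec (A : Fin n → ModSheaf X) {U V : Opens (Fin n → X)} (h : V ≤ U)
    (s : ∀ i, SecC (A i) (prImage i U)) : preRes ((boxCFunctor X n).obj A).obj h (boxSec A U s) =
      boxSec A V fun i => preRes (A i).obj (prImage_mono i h) (s i) := by
  refine (preRes_nat (toSheafify _ (preBoxC A)) h _).trans ?_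
  refine congrArg (toShC (preBoxC A) V) ?_
  exact PiTensorProduct.map_tprod _ _

lemma mapC_boxSec {A B : Fin n → ModSheaf X} (f : A ⟶ B) (U : Opens (Fin n → X))
    (s : ∀ i, SecC (A i) (prImage i U)) : mapC ((boxCFunctor X n).map f) U (boxSec A U s) =
      boxSec B U fun i => mapC (f i) _ (s i) := by
  refine (mapC_toShC (preBoxCMap f) U _).trans ?_
  refine congrArg (toShC (preBoxC B) U) ?_
  exact PiTensorProduct.map_tprod _ _

lemma boxC_ext {A : Fin n → ModSheaf X} {G : ModSheaf (Fin n → X)}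
    {f g : (boxCFunctor X n).obj A ⟶ G}
    (h : ∀ U s, mapC f U (boxSec A U s) = mapC g U (boxSec A U s)) : f = g := by
  refine sheafify_ext fun U t => ?_
  have : mapC f U ∘ₗ toShC (preBoxC A) U = mapC g U ∘ₗ toShC (preBoxC A) U :=
    PiTensorProduct.ext (MultilinearMap.ext fun s => h U s)
  exact LinearMap.congr_fun this t

/-- Morphisms out of the external product of associated sheaves are determined by their effect on
the products of the sections of the presheaves. -/
lemma boxC_sheafify_ext {P : Fin n → (Opens X)ᵒᵖ ⥤ ModuleCat.{u} ℂ} {G : ModSheaf (Fin n → X)}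
    {f g : (boxCFunctor X n).obj (fun i => shC (P i)) ⟶ G}
    (h : ∀ U (s : ∀ i, (P i).obj (op (prImage i U))),
      mapC f U (boxSec _ U fun i => toShC (P i) _ (s i)) =
        mapC g U (boxSec _ U fun i => toShC (P i) _ (s i))) : f = g := by
  refine boxC_ext fun U s => secC_ext G fun x hx => ?_
  choose V hV hxV p hp using fun i => toShC_surj (P i) (s i) (mem_prImage hx i)
  obtain ⟨U', hU', hxU', hpr⟩ := exists_box_nhds hx V hxV
  refine ⟨U', hU', hxU', ?_⟩
  rw [preRes_nat f.hom, preRes_nat g.hom, preRes_boxSec]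
  have e : (fun i => preRes (shC (P i)).obj (prImage_mono i hU') (s i)) =
      fun i => toShC (P i) _ (preRes (P i) (hpr i) (p i)) := by
    funext i
    refine Eq.trans ?_ (preRes_nat (toSheafify _ (P i)) (hpr i) (p i))
    exact (preRes_trans _ (hV i) (hpr i) (s i)).symm.trans (congrArg _ (hp i).symm)
  exact (congrArg (fun t => mapC f U' (boxSec _ U' t)) e).trans ((h U' _).trans
    (congrArg (fun t => mapC g U' (boxSec _ U' t)) e).symm)

/-- A natural family of multilinear maps on the sections of presheaves defines a morphism on the
external product of the associated sheaves. -/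
theorem exists_boxC_desc (P : Fin n → (Opens X)ᵒᵖ ⥤ ModuleCat.{u} ℂ) (G : ModSheaf (Fin n → X))
    (β : ∀ U : Opens (Fin n → X),
      MultilinearMap ℂ (fun i => (P i).obj (op (prImage i U))) (SecC G U))
    (hβ : ∀ (U V : Opens (Fin n → X)) (h : V ≤ U) t,
      preRes G.obj h (β U t) = β V fun i => preRes (P i) (prImage_mono i h) (t i)) :
    ∃ f : (boxCFunctor X n).obj (fun i => shC (P i)) ⟶ G, ∀ U t,
      mapC f U (boxSec _ U fun i => toShC (P i) _ (t i)) = β U t := by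
  let φ := famPreMap fun i => toSheafify (Opens.grothendieckTopology X) (P i)
  have hφ : IsLocallyBijective φ := isLocallyBijective_famPreMap _
    fun i => isLocallyBijective_toSheafify (P i)
  let βT : famPre P ⟶ G.obj ⋙ forget (ModuleCat.{u} ℂ) :=
    { app := fun U => TypeCat.ofHom fun t => β U.unop t
      naturality := fun U V g => by
        ext t
        exact (hβ U.unop V.unop g.unop.le t).symm }
  -- Extend first as a map of presheaves of sets: `φ` is locally bijective and `G` is a sheaf of
  -- sets. Multilinearity is restored afterwards.
  obtain ⟨γ, hγ⟩ := ((isLocallyBijective_iff φ).1 hφ _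
    (GrothendieckTopology.HasSheafCompose.isSheaf G.obj G.property)).2 βT
  have hγ' (U : Opens (Fin n → X)) (t : ∀ i, (P i).obj (op (prImage i U))) :
      (γ.app (op U) (fun i => toShC (P i) _ (t i)) : SecC G U) = β U t :=
    congr(($hγ).app (op U) t)
  have hnat {U V : Opens (Fin n → X)} (h : V ≤ U) (s : ∀ i, SecC (shC (P i)) (prImage i U)) :
      preRes G.obj h (γ.app (op U) s : SecC G U) =
        (γ.app (op V) (fun i => preRes (shC (P i)).obj (prImage_mono i h) (s i)) : SecC G V) :=
    congr($(γ.naturality (homOfLE h).op) s).symm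
  have hloc {U : Opens (Fin n → X)} {x : Fin n → X} (hx : x ∈ U)
      (s : ∀ i, SecC (shC (P i)) (prImage i U)) :
      ∃ (V : Opens (Fin n → X)) (h : V ≤ U) (_ : x ∈ V), ∃ p : ∀ i, (P i).obj (op (prImage i V)),
        ∀ i, preRes (shC (P i)).obj (prImage_mono i h) (s i) = toShC (P i) _ (p i) := by
    obtain ⟨V, h, hx, p, e⟩ := hφ.surj U s x hx
    exact ⟨V, h, hx, p, fun i => (congrFun e i).symm⟩
  have hup {U V : Opens (Fin n → X)} (h : V ≤ U) [DecidableEq (Fin n)]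
      (s : ∀ i, SecC (shC (P i)) (prImage i U)) (i : Fin n) (a : SecC (shC (P i)) (prImage i U))
      (p : ∀ i, (P i).obj (op (prImage i V))) (q : (P i).obj (op (prImage i V)))
      (hp : ∀ j, j ≠ i → preRes (shC (P j)).obj (prImage_mono j h) (s j) = toShC (P j) _ (p j))
      (hq : preRes (shC (P i)).obj (prImage_mono i h) a = toShC (P i) _ q) :
      preRes G.obj h (γ.app (op U) (Function.update s i a) : SecC G U) =
        β V (Function.update p i q) := by
    rw [hnat h, ← hγ']
    refine congrArg (fun t => (γ.app (op V) t : SecC G V)) (funext fun j => ?_)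
    by_cases hj : j = i
    · subst hj
      rw [Function.update_self, Function.update_self, hq]
    · rw [Function.update_of_ne hj, Function.update_of_ne hj, hp j hj]
  -- For two values of the `i`-th entry, a common neighbourhood on which all sections involved come
  -- from the presheaves.
  have hloc2 {U : Opens (Fin n → X)} {x : Fin n → X} (hx : x ∈ U) [DecidableEq (Fin n)]
      (s : ∀ i, SecC (shC (P i)) (prImage i U)) (i : Fin n) (a b : SecC (shC (P i)) (prImage i U)) :
      ∃ (V : Opens (Fin n → X)) (h : V ≤ U) (_ : x ∈ V) (p : ∀ i, (P i).obj (op (prImage i V)))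
        (q r : (P i).obj (op (prImage i V))),
        (∀ j, j ≠ i → preRes (shC (P j)).obj (prImage_mono j h) (s j) = toShC (P j) _ (p j)) ∧
        preRes (shC (P i)).obj (prImage_mono i h) a = toShC (P i) _ q ∧
        preRes (shC (P i)).obj (prImage_mono i h) b = toShC (P i) _ r := by
    obtain ⟨V, h, hxV, p, hp⟩ := hloc hx (Function.update s i a)
    obtain ⟨V', h', hxV', p', hp'⟩ := hloc hxV
      fun j => preRes (shC (P j)).obj (prImage_mono j h) (Function.update s i b j)
    have e (j) : preRes (shC (P j)).obj (prImage_mono j (h'.trans h)) (Function.update s i a j) =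
        toShC (P j) _ (preRes (P j) (prImage_mono j h') (p j)) := by
      refine (preRes_trans _ (prImage_mono j h) (prImage_mono j h') _).symm.trans ?_
      rw [hp j]
      exact preRes_nat (toSheafify _ (P j)) _ _
    have e' := (preRes_trans _ (prImage_mono i h) (prImage_mono i h') _).symm.trans (hp' i)
    have e'' := e i
    rw [Function.update_self] at e' e''
    refine ⟨V', h'.trans h, hxV', fun j => preRes (P j) (prImage_mono j h') (p j), _, p' i,
      fun j hj => ?_, e'', e'⟩
    have := e j
    rwa [Function.update_of_ne hj] at this
  -- Multilinearity of `γ` is an identity of sections of the sheaf `G`, so it may be checked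
  -- locally, where `γ` is given by the multilinear map `β`.
  let γM (U : Opens (Fin n → X)) :
      MultilinearMap ℂ (fun i => SecC (shC (P i)) (prImage i U)) (SecC G U) :=
    { toFun := fun s => γ.app (op U) s
      map_update_add' := by
        intro dec s i a b
        refine secC_ext G fun x hx => ?_
        obtain ⟨V, h, hxV, p, q, r, hp, hq, hr⟩ := hloc2 hx s i a b
        refine ⟨V, h, hxV, ?_⟩
        rw [map_add, hup h s i a p q hp hq, hup h s i b p r hp hr,
          hup h s i (a + b) p (q + r) hp (by rw [map_add, map_add, hq, hr]),
          MultilinearMap.map_update_add]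
      map_update_smul' := by
        intro dec s i c a
        refine secC_ext G fun x hx => ?_
        obtain ⟨V, h, hxV, p, q, -, hp, hq, -⟩ := hloc2 hx s i a a
        refine ⟨V, h, hxV, ?_⟩
        rw [map_smul, hup h s i a p q hp hq,
          hup h s i (c • a) p (c • q) hp (by rw [map_smul, map_smul, hq]),
          MultilinearMap.map_update_smul] }
  let f₀ : preBoxC (fun i => shC (P i)) ⟶ G.obj :=
    { app := fun U => ModuleCat.ofHom (PiTensorProduct.lift (γM U.unop))
      naturality := fun U V g => by
        refine ModuleCat.hom_ext (PiTensorProduct.ext (MultilinearMap.ext fun s => ?_))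
        change PiTensorProduct.lift (γM V.unop) (PiTensorProduct.map _ (PiTensorProduct.tprod ℂ s))
          = preRes G.obj g.unop.le (PiTensorProduct.lift (γM U.unop) (PiTensorProduct.tprod ℂ s))
        rw [PiTensorProduct.map_tprod, PiTensorProduct.lift.tprod, PiTensorProduct.lift.tprod]
        exact (hnat g.unop.le s).symm }
  refine ⟨sheafifyDesc f₀, fun U t => ?_⟩
  refine (mapC_sheafifyDesc f₀ U _).trans ?_
  refine (PiTensorProduct.lift.tprod _).trans ?_
  exact hγ' U t

end BoxC

/-! ### Direct image of sheaves under a homeomorphism -/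

section Push

variable {Y : Type u} [TopologicalSpace Y]

lemma mem_preim {Φ : Y ≃ₜ Y} {U : Opens Y} {y : Y} : y ∈ (preim Φ).obj U ↔ Φ y ∈ U := Iff.rfl

/-- Every neighbourhood of `Φ.symm x` contained in the preimage of `U` is the preimage of a
neighbourhood of `x`, so the local data can be transported. -/
lemma isLocallyBijective_whisker {A : Type*} [Category A] {FA : A → A → Type*}
    {CA : A → Type*} [∀ S T, FunLike (FA S T) (CA S) (CA T)] [ConcreteCategory A FA]
    {P Q : (Opens Y)ᵒᵖ ⥤ A} (Φ : Y ≃ₜ Y) {φ : P ⟶ Q} (h : IsLocallyBijective φ) :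
    IsLocallyBijective (Functor.whiskerLeft (preim Φ).op φ) := by
  have key {U V : Opens Y} {x : Y} (hV : V ≤ (preim Φ).obj U) (hx : Φ.symm x ∈ V) :
      ∃ V' : Opens Y, V' ≤ U ∧ x ∈ V' ∧ (preim Φ).obj V' ≤ V := by
    refine ⟨(preim Φ.symm).obj V, fun y hy => ?_, hx, fun y hy => ?_⟩
    · have : Φ (Φ.symm y) ∈ U := hV hy
      rwa [Φ.apply_symm_apply] at this
    · rwa [mem_preim, mem_preim, Φ.symm_apply_apply] at hy
  have hres (P : (Opens Y)ᵒᵖ ⥤ A) {U V W : Opens Y} (h : V ≤ U) (h' : W ≤ V)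
      (s : ToType (P.obj (op U))) : P.map (homOfLE h').op (P.map (homOfLE h).op s) =
        P.map (homOfLE (h'.trans h)).op s := by
    rw [← ConcreteCategory.comp_apply, ← P.map_comp]; rfl
  refine ⟨fun U s x hx => ?_, fun U s t e x hx => ?_⟩
  · have hx' : Φ.symm x ∈ (preim Φ).obj U := by rwa [mem_preim, Φ.apply_symm_apply]
    obtain ⟨V, hV, hxV, p, hp⟩ := h.surj ((preim Φ).obj U) s (Φ.symm x) hx'
    obtain ⟨V', hV', hxV', hVV⟩ := key hV hxV
    refine ⟨V', hV', hxV', P.map (homOfLE hVV).op p, ?_⟩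
    change φ.app _ (P.map (homOfLE hVV).op p) = Q.map (homOfLE _).op s
    rw [NatTrans.naturality_apply, hp, hres]
  · have hx' : Φ.symm x ∈ (preim Φ).obj U := by rwa [mem_preim, Φ.apply_symm_apply]
    obtain ⟨V, hV, hxV, hp⟩ := h.inj ((preim Φ).obj U) s t e (Φ.symm x) hx'
    obtain ⟨V', hV', hxV', hVV⟩ := key hV hxV
    refine ⟨V', hV', hxV', ?_⟩
    have := congrArg (P.map (homOfLE hVV).op) hp
    rw [hres, hres] at this
    exact this

/-- The equivalence of categories given by the preimages under `Φ` and `Φ⁻¹`. -/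
def preimEquiv (Φ : Y ≃ₜ Y) : Opens Y ≌ Opens Y where
  functor := preim Φ
  inverse := preim Φ.symm
  unitIso := NatIso.ofComponents (fun U => eqToIso (by
    ext y; change y ∈ U ↔ Φ (Φ.symm y) ∈ U; rw [Φ.apply_symm_apply]))
  counitIso := NatIso.ofComponents (fun U => eqToIso (by
    ext y; change Φ.symm (Φ y) ∈ U ↔ y ∈ U; rw [Φ.symm_apply_apply]))

/-- The direct image under a homeomorphism is an equivalence of categories. -/
def pushCEquiv (Φ : Y ≃ₜ Y) : ModSheaf Y ≌ ModSheaf Y :=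
  CategoryTheory.Equivalence.mk (pushC Φ) (pushC Φ.symm)
    (NatIso.ofComponents
      (fun F => (ObjectProperty.fullyFaithfulι _).preimageIso
        (Functor.isoWhiskerRight (NatIso.op (preimEquiv Φ).counitIso) F.obj))
      (fun {F G} f => by
        refine Sheaf.hom_ext ?_
        ext U : 2
        exact (f.hom.naturality _).symm))
    (NatIso.ofComponents
      (fun F => (ObjectProperty.fullyFaithfulι _).preimageIso
        (Functor.isoWhiskerRight (NatIso.op (preimEquiv Φ).unitIso) F.obj))
      (fun {F G} f => by
        refine Sheaf.hom_ext ?_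
        ext U : 2
        exact (f.hom.naturality _).symm))

/-- An equivalence preserves coproducts; this is how direct images are commuted with the infinite
sums in total complexes. -/
instance (Φ : Y ≃ₜ Y) : (pushC Φ).IsEquivalence := (pushCEquiv Φ).isEquivalence_functor

end Push

/-! ### Direct image of right `𝒟`-modules as an equivalence -/

section PushD

variable {E : Type v} [NormedAddCommGroup E] [NormedSpace ℂ E] {H : Type w} [TopologicalSpace H]
  {I : ModelWithCorners ℂ E H} {Y : Type u} [TopologicalSpace Y] [ChartedSpace H Y]

lemma pullD_app (Φ : Y ≃ₘ^ω⟮I, I⟯ Y) (U : Opens Y) (P : DiffOp I U) {V : Opens Y}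
    (h : V ≤ (preim Φ.toHomeomorph).obj U) (f : Holo I V) : Op.app (pullD Φ U P).1 h f =
      comapFwd Φ V (Op.app P.1 (preim_symm_le Φ h) (comapBwd Φ V f)) := rfl

/-- As both maps are bijective, `hΦ` makes them inverse to each other, and the two conjugations
cancel. A restriction remains because the double preimage equals `U` only as a set. -/
lemma pullD_pullD (Φ Ψ : Y ≃ₘ^ω⟮I, I⟯ Y) (hΦ : ∀ y, Ψ (Φ y) = y) (U : Opens Y) (T : DiffOp I U)
    (h : (preim Φ.toHomeomorph).obj ((preim Ψ.toHomeomorph).obj U) ≤ U) :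
    pullD Φ _ (pullD Ψ U T) = diffOpRes h T := by
  have hΨ (y : Y) : Φ (Ψ y) = y := by
    rw [← Φ.apply_symm_apply (Φ (Ψ y))]
    have : Φ.symm y = Ψ y := by rw [← hΦ (Φ.symm y), Φ.apply_symm_apply]
    rw [Φ.symm_apply_apply, ← this, Φ.apply_symm_apply]
  have hsymm (y : Y) : Ψ.symm y = Φ y := by rw [← hΦ y, Ψ.symm_apply_apply, hΦ]
  have hsymm' (y : Y) : Φ.symm y = Ψ y := by rw [← hΦ (Φ.symm y), Φ.apply_symm_apply]
  refine Subtype.ext (Op.ext fun V hV f => holo_ext fun x => ?_)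
  rw [pullD_app, pullD_app]
  have hle : (preim Ψ.symm.toHomeomorph).obj ((preim Φ.symm.toHomeomorph).obj V) ≤ V := by
    intro y hy
    have : Φ.symm (Ψ.symm y) ∈ V := hy
    rwa [hsymm', ← hΨ (Ψ (Ψ.symm y)), hsymm, hΦ, hΨ] at this
  have e : comapBwd Ψ _ (comapBwd Φ V f) = holoRes hle f := by
    ext y
    refine holo_congr f ?_
    change Φ.symm (Ψ.symm y.1) = y.1
    rw [hsymm', hsymm, hΦ]
  rw [e]
  refine (Op.app_res_apply T.1 (hV.trans h) hle f ⟨Ψ (Φ x.1), _⟩).trans ?_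
  exact holo_congr (Op.app T.1 (hV.trans h) f) (hΦ x.1)

instance (Φ : Y ≃ₜ Y) : (preimEquiv Φ).functor.IsContinuous (Opens.grothendieckTopology Y)
  (Opens.grothendieckTopology Y) := inferInstanceAs ((preim Φ).IsContinuous _ _)

instance (Φ : Y ≃ₜ Y) : (preimEquiv Φ).inverse.IsContinuous (Opens.grothendieckTopology Y)
  (Opens.grothendieckTopology Y) := inferInstanceAs ((preim Φ.symm).IsContinuous _ _)

lemma toShD_pullShD (Φ : Y ≃ₘ^ω⟮I, I⟯ Y) : toShD I Y ≫ (pullShD Φ).hom =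
    prePullD Φ ≫ Functor.whiskerLeft (preim Φ.toHomeomorph).op (toShD I Y) :=
  toSheafify_sheafifyLift _ _ _

lemma pullShD_toShD (Φ : Y ≃ₘ^ω⟮I, I⟯ Y) (U : Opens Y) (T : DiffOp I U) :
    (pullShD Φ).hom.app (op U) ((toShD I Y).app (op U) (MulOpposite.op T)) =
      (toShD I Y).app (op ((preim Φ.toHomeomorph).obj U)) (MulOpposite.op (pullD Φ U T)) :=
  congr(($(toShD_pullShD Φ)).app (op U) (MulOpposite.op T))

lemma toShD_map {U V : Opens Y} (h : V ≤ U) (T : DiffOp I U) :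
    (shD I Y).obj.map (homOfLE h).op ((toShD I Y).app (op U) (MulOpposite.op T)) =
      (toShD I Y).app (op V) (MulOpposite.op (diffOpRes h T)) :=
  congr($((toShD I Y).naturality (homOfLE h).op) (MulOpposite.op T)).symm

/-- The direct image under a biholomorphic map is an equivalence of categories. -/
def pushDEquiv (Φ : Y ≃ₘ^ω⟮I, I⟯ Y) : RightDMod I Y ≌ RightDMod I Y :=
  SheafOfModules.pushforwardPushforwardEquivalence (preimEquiv Φ.toHomeomorph)
    (pullShD Φ) (pullShD Φ.symm)
    (by
      -- Both compatibilities concern maps out of the sheaf of rings `𝒟`, so they are checked on the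
      -- presheaf of differential operators, where they are `pullD_pullD`.
      refine sheafify_hom_ext _ _ _ ?_ ?_
      · exact (((preim Φ.toHomeomorph.symm).sheafPushforwardContinuous RingCat.{u}
          (Opens.grothendieckTopology Y) (Opens.grothendieckTopology Y)).obj
          (((preim Φ.toHomeomorph).sheafPushforwardContinuous RingCat.{u}
          (Opens.grothendieckTopology Y) (Opens.grothendieckTopology Y)).obj (shD I Y))).property
      · ext U T
        have hle : (preim Φ.toHomeomorph).obj ((preim Φ.symm.toHomeomorph).obj U.unop) ≤ U.unop :=
          fun y hy => by
            have : Φ.symm (Φ y) ∈ U.unop := hy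
            rwa [Φ.symm_apply_apply] at this
        have h1 := toShD_map hle (MulOpposite.unop T)
        have h2 := pullShD_toShD Φ.symm U.unop (MulOpposite.unop T)
        have h3 := pullShD_toShD Φ _ (pullD Φ.symm U.unop (MulOpposite.unop T))
        rw [pullD_pullD Φ Φ.symm Φ.symm_apply_apply U.unop _ hle] at h3
        exact h1.trans (h3.symm.trans (congrArg ((pullShD Φ).hom.app _) h2.symm)))
    (by
      refine sheafify_hom_ext _ _ _ (shD I Y).property ?_
      ext U T
      have hle : (preim Φ.symm.toHomeomorph).obj ((preim Φ.toHomeomorph).obj U.unop) ≤ U.unop :=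
        fun y hy => by
          have : Φ (Φ.symm y) ∈ U.unop := hy
          rwa [Φ.apply_symm_apply] at this
      have hle' : U.unop ≤ (preim Φ.symm.toHomeomorph).obj ((preim Φ.toHomeomorph).obj U.unop) :=
        fun y hy => by
          change Φ (Φ.symm y) ∈ U.unop
          rwa [Φ.apply_symm_apply]
      have h2 := pullShD_toShD Φ U.unop (MulOpposite.unop T)
      have h3 := pullShD_toShD Φ.symm _ (pullD Φ U.unop (MulOpposite.unop T))
      rw [pullD_pullD Φ.symm Φ Φ.apply_symm_apply U.unop _ hle] at h3
      have h1 := toShD_map hle' (diffOpRes hle (MulOpposite.unop T))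
      exact (congrArg (fun t => (shD I Y).obj.map (homOfLE hle').op
        ((pullShD Φ.symm).hom.app _ t)) h2).trans
        ((congrArg ((shD I Y).obj.map (homOfLE hle').op) h3).trans h1))

instance (Φ : Y ≃ₘ^ω⟮I, I⟯ Y) : (pushD Φ).IsEquivalence :=
  (pushDEquiv Φ).isEquivalence_functor

end PushD

/-! ### Functoriality of polyvector fields in all degrees -/

section PolyAllMap

variable {A L M A' L' M' : Type*}
  [CommRing A] [Algebra ℂ A] [LieRing L] [LieAlgebra ℂ L] [Module A L]
  [IsScalarTower ℂ A L] [LieRingModule L A] [LieRinehartRing A L]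
  [CommRing A'] [Algebra ℂ A'] [LieRing L'] [LieAlgebra ℂ L'] [Module A' L']
  [IsScalarTower ℂ A' L'] [LieRingModule L' A'] [LieRinehartRing A' L']
  [AddCommGroup M'] [Module ℂ M'] [Module A' M'] [IsScalarTower ℂ A' M']
  {σ : A →ₐ[ℂ] A'}
  [AddCommGroup M] [Module ℂ M] [Module A M] [IsScalarTower ℂ A M]
  (h : M →ₛₗ[σ.toRingHom] M') (g : L →ₛₗ[σ.toRingHom] L')

/-- The maps `polyvecMap` in all degrees. -/
def polyAllMap : PolyAll A L M →ₗ[ℂ] PolyAll A' L' M' where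
  toFun t k := polyvecMap h g k (t k)
  map_add' s t := by ext1 k; exact map_add (polyvecMap h g k) _ _
  map_smul' c t := by ext1 k; exact map_smul (polyvecMap h g k) _ _

lemma polyAllMap_wedgeAll (x : L) (t : PolyAll A L M) :
    polyAllMap h g (wedgeAll x t) = wedgeAll (g x) (polyAllMap h g t) := by
  ext1 k
  cases k with
  | zero => exact map_zero (polyvecMap h g 0)
  | succ k => exact polyvecMap_wedge h g k x (t k)

lemma polyAllMap_wedgeList (l : List L) (t : PolyAll A L M) :
    polyAllMap h g (wedgeList l t) = wedgeList (l.map g) (polyAllMap h g t) := by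
  induction l with
  | nil => rfl
  | cons x l ih => rw [wedgeList_cons, polyAllMap_wedgeAll, ih, List.map_cons, wedgeList_cons]

lemma polyAllMap_single (k : ℕ) (t : Polyvec A L M k) :
    polyAllMap h g (Pi.single k t) = Pi.single k (polyvecMap h g k t) := by
  ext1 j
  change polyvecMap h g j _ = _
  by_cases hj : j = k
  · subst hj; rw [Pi.single_eq_same, Pi.single_eq_same]
  · rw [Pi.single_eq_of_ne hj, Pi.single_eq_of_ne hj, map_zero]

lemma polyAllMap_embZero (m : M) : polyAllMap h g (embZero A L m) = embZero A' L' (h m) := by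
  change polyAllMap h g (Pi.single 0 _) = Pi.single 0 _
  rw [polyAllMap_single, polyvecMap_pv]
  congr 2
  exact Subsingleton.elim _ _

lemma span_pv (k : ℕ) :
    Submodule.span ℂ (Set.range fun s : M × (Fin k → L) => pv A s.1 s.2) = ⊤ := by
  refine Submodule.eq_top_iff'.2 fun t => ?_
  induction t using pv_induction with
  | h0 => exact zero_mem _
  | h1 m v => exact Submodule.subset_span ⟨(m, v), rfl⟩
  | h2 s t hs ht => exact add_mem hs ht

end PolyAllMap

/-! ### The wedge product on sections of presheaves over a power -/

section BoxMul

variable {E : Type v} [NormedAddCommGroup E] [NormedSpace ℂ E] [FiniteDimensional ℂ E]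
  {X : Type u} [TopologicalSpace X] [ChartedSpace E X] [IsManifold 𝓘(ℂ, E) ω X] {n : ℕ}
  (P : Fin n → PresheafOfModules.{u} (preD 𝓘(ℂ, E) X))

lemma mem_prImage_of_mem {X : Type u} [TopologicalSpace X] {n : ℕ} (U : Opens (Fin n → X))
    (i : Fin n) : ∀ x ∈ U, x i ∈ prImage i U :=
  fun _ hx => mem_prImage hx i

/-- The generator `⊠ mᵢ` as a section of the presheaf `preBoxO P`. -/
def boxGenSec {E : Type v} [NormedAddCommGroup E] [NormedSpace ℂ E] {H : Type w}
    [TopologicalSpace H] {I : ModelWithCorners ℂ E H} {X : Type u} [TopologicalSpace X]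
    [ChartedSpace H X] {n : ℕ} {P : Fin n → PresheafOfModules.{u} (preD I X)}
    {U : Opens (Fin n → X)} (m : SecFam P U) : Sec (preBoxO P) U := boxGen m

/-- The generators `⊠ mᵢ` depend multilinearly on `mᵢ`. -/
def boxGenMul (U : Opens (Fin n → X)) :
    MultilinearMap ℂ (fun i => Sec (P i) (prImage i U)) (Sec (preBoxO P) U) where
  toFun m := boxGenSec m
  map_update_add' := by
    intro dec m i a b
    obtain rfl : dec = instDecidableEqFin n := Subsingleton.elim _ _
    exact boxGen_add m i a b
  map_update_smul' := by
    intro dec m i c a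
    obtain rfl : dec = instDecidableEqFin n := Subsingleton.elim _ _
    have := boxGen_act (Function.update m i a) i _ _ (isLift_algebraMap i (prImage i U) U c)
    rw [Function.update_idem, Function.update_self] at this
    exact this

/-- The data for the wedge product of sections of `preDR (P i)`. -/
def boxDatum (U : Opens (Fin n → X)) :
    BoxDatum (fun i => Holo 𝓘(ℂ, E) (prImage i U)) (fun i => VF 𝓘(ℂ, E) (prImage i U))
      (fun i => Sec (P i) (prImage i U)) (Holo (powModel 𝓘(ℂ, E) n) U) (VF (powModel 𝓘(ℂ, E) n) U)
      (Sec (preBoxO P) U) where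
  ρ' i := secAction (P i) (prImage i U)
  ρ := secAction (preBoxO P) U
  a i := prComap i (mem_prImage_of_mem U i)
  l i := liftVF i (mem_prImage_of_mem U i)
  l_lie i x y := liftVF_lie i _ x y
  l_lie_ne _ _ hij x y := liftVF_lie_of_ne hij _ _ x y
  b := boxGenMul P U
  b_smul i f m := boxGen_act m i _ _ (isLift_holo (mem_prImage_of_mem U i) f)
  b_act i x m := boxGen_act m i _ _ (isLift_liftVF (mem_prImage_of_mem U i) x)

/-- The wedge product `⊠ (mᵢ ⊗ ηᵢ) ↦ (⊠ mᵢ) ⊗ (pr₁* η₁ ∧ ⋯ ∧ prₙ* ηₙ)`, for `ηᵢ` of degree `kᵢ`;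
it is zero unless `r = k₁ + ⋯ + kₙ`. -/
def preMul (k : Fin n → ℕ) (r : ℕ) (U : Opens (Fin n → X)) :
    MultilinearMap ℂ (fun i => (preDR 𝓘(ℂ, E) X (P i) (k i)).obj (op (prImage i U)))
      ((preDR (powModel 𝓘(ℂ, E) n) (Fin n → X) (preBoxO P) r).obj (op U)) :=
  (LinearMap.proj r).compMultilinearMap ((boxDatum P U).boxMul k)

lemma preMul_pv (k : Fin n → ℕ) (U : Opens (Fin n → X)) (m : SecFam P U)
    (v : ∀ i, Fin (k i) → VF 𝓘(ℂ, E) (prImage i U)) :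
    preMul P k (∑ i, k i) U (fun i => pv (Holo 𝓘(ℂ, E) (prImage i U)) (m i) (v i)) =
      pv (Holo (powModel 𝓘(ℂ, E) n) U) (boxGenSec m) fun a =>
        liftVF (finSigmaFinEquiv.symm a).1 (mem_prImage_of_mem U _)
          (v (finSigmaFinEquiv.symm a).1 (finSigmaFinEquiv.symm a).2) := by
  change (boxDatum P U).boxMul k (fun i => pv (Holo 𝓘(ℂ, E) (prImage i U)) (m i) (v i)) _ = _
  rw [BoxDatum.boxMul_pv, BoxDatum.blockOp_eq]
  have := ofFn_finSigmaFinEquiv (k := k)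
    (fun i a => (liftVF i (mem_prImage_of_mem U i) (v i a) : VF (powModel 𝓘(ℂ, E) n) U))
  have e : ((List.finRange n).map fun i => (List.ofFn (v i)).map ((boxDatum P U).l i)) =
      (List.finRange n).map fun i => List.ofFn
        fun a => (liftVF i (mem_prImage_of_mem U i) (v i a) : VF (powModel 𝓘(ℂ, E) n) U) := by
    refine congrArg (fun f => (List.finRange n).map f) (funext fun i => ?_)
    rw [List.map_ofFn]; rfl
  rw [e, ← this, wedgeList_ofFn]
  exact Pi.single_eq_same _ _

/-- Both sides are multilinear, so decomposables suffice; there it is the compatibility of `⊠` and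
of lifts of vector fields with restriction. -/
lemma preRes_preMul (k : Fin n → ℕ) (r : ℕ) {U V : Opens (Fin n → X)} (h : V ≤ U)
    (t : ∀ i, (preDR 𝓘(ℂ, E) X (P i) (k i)).obj (op (prImage i U))) :
    preRes (preDR (powModel 𝓘(ℂ, E) n) (Fin n → X) (preBoxO P) r) h (preMul P k r U t) =
      preMul P k r V fun i => preRes (preDR 𝓘(ℂ, E) X (P i) (k i)) (prImage_mono i h) (t i) := by
  have : (preRes (preDR (powModel 𝓘(ℂ, E) n) (Fin n → X) (preBoxO P) r) h).compMultilinearMap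
      (preMul P k r U) = (preMul P k r V).compLinearMap
        fun i => preRes (preDR 𝓘(ℂ, E) X (P i) (k i)) (prImage_mono i h) := by
    refine multilinear_ext_of_span
      (S := fun i => Sec (P i) (prImage i U) × (Fin (k i) → VF 𝓘(ℂ, E) (prImage i U)))
      (fun i s => pv (Holo 𝓘(ℂ, E) (prImage i U)) s.1 s.2) (fun i => span_pv _) fun s => ?_
    have e1 (i : Fin n) : preRes (preDR 𝓘(ℂ, E) X (P i) (k i)) (prImage_mono i h)
        (pv (Holo 𝓘(ℂ, E) (prImage i U)) (s i).1 (s i).2) = pv (Holo 𝓘(ℂ, E) (prImage i V))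
          (secRes (P i) (prImage_mono i h) (s i).1) (vfRes (prImage_mono i h) ∘ (s i).2) :=
      polyvecMap_pv _ _ _ _ _
    refine Eq.trans ?_ (congrArg (preMul P k r V) (funext e1)).symm
    change polyAllMap (secRes (preBoxO P) h) (vfRes h) ((boxDatum P U).boxMul k fun i =>
      pv (Holo 𝓘(ℂ, E) (prImage i U)) (s i).1 (s i).2) r = (boxDatum P V).boxMul k _ r
    rw [BoxDatum.boxMul_pv, BoxDatum.boxMul_pv, BoxDatum.blockOp_eq, BoxDatum.blockOp_eq,
      polyAllMap_wedgeList, polyAllMap_embZero]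
    have e2 : secRes (preBoxO P) h ((boxDatum P U).b fun i => (s i).1) =
        (boxDatum P V).b fun i => secRes (P i) (prImage_mono i h) (s i).1 :=
      boxRes_gen h _
    have e3 (i : Fin n) : ((List.ofFn (s i).2).map ((boxDatum P U).l i)).map (vfRes h) =
        (List.ofFn (vfRes (prImage_mono i h) ∘ (s i).2)).map ((boxDatum P V).l i) := by
      rw [List.map_map, List.map_ofFn, List.map_ofFn]
      refine congrArg List.ofFn (funext fun a => ?_)
      exact vfRes_liftVF i _ _ h (prImage_mono i h) _
    have e4 : List.map (vfRes h) (((List.finRange n).map fun i =>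
        (List.ofFn (s i).2).map ((boxDatum P U).l i)).flatten) =
        ((List.finRange n).map fun i =>
        (List.ofFn (vfRes (prImage_mono i h) ∘ (s i).2)).map ((boxDatum P V).l i)).flatten := by
      rw [List.map_flatten, List.map_map]
      exact congrArg (fun f => ((List.finRange n).map f).flatten) (funext e3)
    rw [e2, e4]
  exact congr($this t)

end BoxMul

/-! ### The canonical morphism for single modules -/

section DeRhamBox

/-- The map of multigraded pieces which is the differential in the `i`-th entry and the identity in
the other ones. -/
def stepD {C : Type*} [Category C] [HasZeroMorphisms C] {n : ℕ} (K : Fin n → ChainComplex C ℕ)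
    (i : Fin n) (k k' : Fin n → ℕ) :
    (fun l => (K l).X (k l) : Fin n → C) ⟶ (fun l => (K l).X (k' l)) :=
  fun l => if l = i then (K l).d (k l) (k' l) else
    if h : k l = k' l then ((K l).XIsoOfEq h).hom else 0

section

variable {E : Type v} [NormedAddCommGroup E] [NormedSpace ℂ E] {H : Type w} [TopologicalSpace H]
  {I : ModelWithCorners ℂ E H} {Y : Type u} [TopologicalSpace Y] [ChartedSpace H Y]

/-- The section of `M ⊗ ⋀ᵏ Θ` given by an element of `M(U) ⊗ ⋀ᵏ Θ(U)`. -/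
abbrev toDR (M : RightDMod I Y) (k : ℕ) (U : Opens Y) :
    Polyvec (Holo I U) (VF I U) (SecD M U) k →ₗ[ℂ] SecC (((deRham I Y).obj M).X k) U :=
  toShC (preDR I Y ((toPre I Y).obj M) k) U

lemma mapC_deRham_map {M N : RightDMod I Y} (f : M ⟶ N) (k : ℕ) (U : Opens Y)
    (t : Polyvec (Holo I U) (VF I U) (SecD M U) k) :
    mapC (((deRham I Y).map f).f k) U (toDR M k U t) =
      toDR N k U (polyvecMap (secMapO ((toPre I Y).map f) U) (vfId U) k t) :=
  mapC_toShC (preDRMap I Y ((toPre I Y).map f) k) U t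

lemma mapC_deRham_map_pv {M N : RightDMod I Y} (f : M ⟶ N) (k : ℕ) (U : Opens Y)
    (m : SecD M U) (v : Fin k → VF I U) :
    mapC (((deRham I Y).map f).f k) U (toDR M k U (pv _ m v)) =
      toDR N k U (pv _ (mapD f U m) v) :=
  (mapC_deRham_map f k U _).trans (congrArg (toDR N k U) (polyvecMap_pv _ _ _ _ _))

/-- Formulated for arbitrary degrees `a` and `b`, with a component of `koszulAll`, so that it also
covers `b + 1 ≠ a`, where both sides vanish. This matches the truncated degrees in `stepMap`. -/
lemma mapC_deRham_d (M : RightDMod I Y) (a b : ℕ) (U : Opens Y)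
    (t : Polyvec (Holo I U) (VF I U) (SecD M U) a) :
    mapC (((deRham I Y).obj M).d a b) U (toDR M a U t) =
      toDR M b U (koszulAll (secAction ((toPre I Y).obj M) U) (Pi.single a t) b) := by
  by_cases h : b + 1 = a
  · subst h
    have e : (preDRComplex I Y ((toPre I Y).obj M)).d (b + 1) b =
        { app := fun U => ModuleCat.ofHom (koszul (secAction ((toPre I Y).obj M) U.unop) b)
          naturality := fun U V f => by
            ext t
            exact (polyvecMap_koszul _ _ _ _ (fun _ _ => rfl)
              (fun ξ m => secRes_smul _ f.unop.le (vfToD _ ξ) m) b t).symm } :=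
      by simp only [preDRComplex, ChainComplex.of_d]
    refine (mapC_toShC ((preDRComplex I Y ((toPre I Y).obj M)).d (b + 1) b) U t).trans ?_
    refine congrArg (toShC (preDR I Y ((toPre I Y).obj M) b) U) ?_
    rw [e]
    change koszul _ b t = koszul _ b (Pi.single (b + 1) t (b + 1))
    rw [Pi.single_eq_same]
  · rw [HomologicalComplex.shape _ _ _ h]
    have : koszulAll (secAction ((toPre I Y).obj M) U) (Pi.single a t) b = 0 := by
      change koszul _ b (Pi.single a t (b + 1)) = 0
      rw [Pi.single_eq_of_ne h, map_zero]
    rw [this, map_zero]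
    rfl

lemma mapC_deRham_XIso (M : RightDMod I Y) {a b : ℕ} (h : a = b) (U : Opens Y)
    (t : Polyvec (Holo I U) (VF I U) (SecD M U) a) :
    mapC (((deRham I Y).obj M).XIsoOfEq h).hom U (toDR M a U t) =
      toDR M b U ((Pi.single a t : PolyAll (Holo I U) (VF I U) (SecD M U)) b) := by
  subst h
  rw [Pi.single_eq_same, HomologicalComplex.XIsoOfEq_rfl]
  rfl

lemma deRham_ext {M : RightDMod I Y} {k : ℕ} {G : ModSheaf Y} {f g : ((deRham I Y).obj M).X k ⟶ G}
    (h : ∀ U (m : SecD M U) (v : Fin k → VF I U), mapC f U (toDR M k U (pv _ m v)) =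
      mapC g U (toDR M k U (pv _ m v))) : f = g := by
  refine sheafify_ext (P := preDR I Y ((toPre I Y).obj M) k) fun U s => ?_
  have : mapC f U ∘ₗ toShC (preDR I Y ((toPre I Y).obj M) k) U =
    mapC g U ∘ₗ toShC (preDR I Y ((toPre I Y).obj M) k) U := polyvec_hom_ext fun m v => h U m v
  exact LinearMap.congr_fun this s

end

variable {E : Type v} [NormedAddCommGroup E] [NormedSpace ℂ E] [FiniteDimensional ℂ E]
  {X : Type u} [TopologicalSpace X] [ChartedSpace E X] [IsManifold 𝓘(ℂ, E) ω X] {n : ℕ}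
  (M : Fin n → RightDMod 𝓘(ℂ, E) X)

/-- The canonical map from `preBoxO` to the associated module. -/
def boxUnit {E : Type v} [NormedAddCommGroup E] [NormedSpace ℂ E] {H : Type w}
    [TopologicalSpace H] {I : ModelWithCorners ℂ E H} {X : Type u} [TopologicalSpace X]
    [ChartedSpace H X] {n : ℕ} (M : Fin n → RightDMod I X) :
    preBoxO (fun i => (toPre I X).obj (M i)) ⟶
      (toPre (powModel I n) (Fin n → X)).obj ((boxOFunctor I X n).obj M) :=
  (PresheafOfModules.sheafificationAdjunction (toShD (powModel I n) (Fin n → X))).unit.app _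

/-- Sheafification in each factor, the tensor product, and the span by decomposables are removed in
turn; what remains is to compare values on `⊠ (mᵢ ⊗ ηᵢ)`. -/
lemma boxC_deRham_ext {k : Fin n → ℕ} {G : ModSheaf (Fin n → X)}
    {f g : (boxCFunctor X n).obj (fun i => ((deRham 𝓘(ℂ, E) X).obj (M i)).X (k i)) ⟶ G}
    (h : ∀ U (m : ∀ i, SecD (M i) (prImage i U)) (v : ∀ i, Fin (k i) → VF 𝓘(ℂ, E) (prImage i U)),
      mapC f U (boxSec _ U fun i => toDR (M i) (k i) _ (pv _ (m i) (v i))) =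
        mapC g U (boxSec _ U fun i => toDR (M i) (k i) _ (pv _ (m i) (v i)))) : f = g := by
  refine boxC_sheafify_ext (P := fun i => preDR 𝓘(ℂ, E) X ((toPre 𝓘(ℂ, E) X).obj (M i)) (k i))
    fun U s => ?_
  let T : MultilinearMap ℂ (fun i => Polyvec (Holo 𝓘(ℂ, E) (prImage i U))
      (VF 𝓘(ℂ, E) (prImage i U)) (SecD (M i) (prImage i U)) (k i))
      (⨂[ℂ] i, SecC (((deRham 𝓘(ℂ, E) X).obj (M i)).X (k i)) (prImage i U)) :=
    (PiTensorProduct.tprod ℂ).compLinearMap fun i =>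
      toShC (preDR 𝓘(ℂ, E) X ((toPre 𝓘(ℂ, E) X).obj (M i)) (k i)) (prImage i U)
  have : (mapC f U ∘ₗ toShC (preBoxC _) U).compMultilinearMap T =
      (mapC g U ∘ₗ toShC (preBoxC _) U).compMultilinearMap T :=
    multilinear_ext_of_span
      (S := fun i => SecD (M i) (prImage i U) × (Fin (k i) → VF 𝓘(ℂ, E) (prImage i U)))
      (fun i s => pv (Holo 𝓘(ℂ, E) (prImage i U)) s.1 s.2) (fun i => span_pv _)
      fun s => h U _ _
  exact congr($this s)

lemma exists_boxDR (k : Fin n → ℕ) (r : ℕ) :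
    ∃ f : (boxCFunctor X n).obj (fun i => ((deRham 𝓘(ℂ, E) X).obj (M i)).X (k i)) ⟶
        ((deRham (powModel 𝓘(ℂ, E) n) (Fin n → X)).obj ((boxOFunctor 𝓘(ℂ, E) X n).obj M)).X r,
      ∀ U (t : ∀ i, Polyvec (Holo 𝓘(ℂ, E) (prImage i U)) (VF 𝓘(ℂ, E) (prImage i U))
        (SecD (M i) (prImage i U)) (k i)),
        mapC f U (boxSec _ U fun i => toDR (M i) (k i) _ (t i)) =
          toDR ((boxOFunctor 𝓘(ℂ, E) X n).obj M) r U (polyvecMap (secMapO (boxUnit M) U) (vfId U) r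
            (preMul (fun i => (toPre 𝓘(ℂ, E) X).obj (M i)) k r U t)) := by
  let P (i : Fin n) := (toPre 𝓘(ℂ, E) X).obj (M i)
  let g : preDR (powModel 𝓘(ℂ, E) n) (Fin n → X) (preBoxO P) r ⟶
      (((deRham (powModel 𝓘(ℂ, E) n) (Fin n → X)).obj
        ((boxOFunctor 𝓘(ℂ, E) X n).obj M)).X r).obj :=
    preDRMap _ _ (boxUnit M) r ≫ toSheafify _ _
  exact exists_boxC_desc (fun i => preDR 𝓘(ℂ, E) X (P i) (k i)) _
    (fun U => (g.app (op U)).hom.compMultilinearMap (preMul P k r U)) fun U V h t =>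
      (preRes_nat g h _).trans (congrArg (g.app (op V)).hom (preRes_preMul P k r h t))

/-- The canonical morphism `⊠ (Mᵢ ⊗ ⋀^{kᵢ} Θ) → (⊠ Mᵢ) ⊗ ⋀ʳ Θ`. It is zero unless
`r = k₁ + ⋯ + kₙ`. -/
def boxDR (k : Fin n → ℕ) (r : ℕ) :
    (boxCFunctor X n).obj (fun i => ((deRham 𝓘(ℂ, E) X).obj (M i)).X (k i)) ⟶
      ((deRham (powModel 𝓘(ℂ, E) n) (Fin n → X)).obj ((boxOFunctor 𝓘(ℂ, E) X n).obj M)).X r :=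
  (exists_boxDR M k r).choose

lemma mapC_boxDR (k : Fin n → ℕ) (r : ℕ) (U : Opens (Fin n → X))
    (t : ∀ i, Polyvec (Holo 𝓘(ℂ, E) (prImage i U)) (VF 𝓘(ℂ, E) (prImage i U))
        (SecD (M i) (prImage i U)) (k i)) :
    mapC (boxDR M k r) U (boxSec _ U fun i => toDR (M i) (k i) _ (t i)) =
      toDR ((boxOFunctor 𝓘(ℂ, E) X n).obj M) r U (polyvecMap (secMapO (boxUnit M) U) (vfId U) r
        (preMul (fun i => (toPre 𝓘(ℂ, E) X).obj (M i)) k r U t)) :=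
  (exists_boxDR M k r).choose_spec U t

/-- The section `⊠ mᵢ`. -/
def boxMSec {E : Type v} [NormedAddCommGroup E] [NormedSpace ℂ E] {H : Type w}
    [TopologicalSpace H] {I : ModelWithCorners ℂ E H} {X : Type u} [TopologicalSpace X]
    [ChartedSpace H X] {n : ℕ} (M : Fin n → RightDMod I X) (U : Opens (Fin n → X))
    (m : ∀ i, SecD (M i) (prImage i U)) : SecD ((boxOFunctor I X n).obj M) U :=
  secMap (boxUnit M) U (boxGenSec m)

lemma mapC_boxDR_pv (k : Fin n → ℕ) (U : Opens (Fin n → X)) (m : ∀ i, SecD (M i) (prImage i U))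
    (v : ∀ i, Fin (k i) → VF 𝓘(ℂ, E) (prImage i U)) :
    mapC (boxDR M k (∑ i, k i)) U (boxSec _ U fun i => toDR (M i) (k i) _ (pv _ (m i) (v i))) =
      toDR ((boxOFunctor 𝓘(ℂ, E) X n).obj M) _ U (pv _ (boxMSec M U m) fun a =>
        liftVF (finSigmaFinEquiv.symm a).1 (mem_prImage_of_mem U _)
          (v (finSigmaFinEquiv.symm a).1 (finSigmaFinEquiv.symm a).2)) := by
  rw [mapC_boxDR]
  refine congrArg (toDR _ _ U) ?_
  rw [preMul_pv]
  exact polyvecMap_pv _ _ _ _ _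

lemma boxDR_of_ne {k : Fin n → ℕ} {r : ℕ} (h : r ≠ ∑ i, k i) : boxDR M k r = 0 := by
  refine boxC_deRham_ext M fun U m v => ?_
  rw [mapC_boxDR]
  have : preMul (fun i => (toPre 𝓘(ℂ, E) X).obj (M i)) k r U
      (fun i => pv (Holo 𝓘(ℂ, E) (prImage i U)) (m i) (v i)) = 0 :=
    BoxDatum.boxMul_apply_of_ne _ _ _ h
  refine (congrArg (fun t => toDR _ r U (polyvecMap (secMapO (boxUnit M) U) (vfId U) r t))
    this).trans ?_
  exact (congrArg (toDR _ r U) (map_zero (polyvecMap (secMapO (boxUnit M) U) (vfId U) r))).trans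
    (map_zero (toDR _ r U))

lemma mapC_stepD (k : Fin n → ℕ) (i j : Fin n) (U : Opens (Fin n → X))
    (t : Polyvec (Holo 𝓘(ℂ, E) (prImage j U)) (VF 𝓘(ℂ, E) (prImage j U))
        (SecD (M j) (prImage j U)) (k j)) :
    mapC (stepD (fun i => (deRham 𝓘(ℂ, E) X).obj (M i)) i k (Function.update k i (k i - 1)) j)
      (prImage j U) (toDR (M j) (k j) _ t) =
    toDR (M j) _ _ ((boxDatum (fun i => (toPre 𝓘(ℂ, E) X).obj (M i)) U).stepMap k i j t) := by
  rw [stepD, BoxDatum.stepMap]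
  by_cases h : j = i
  · rw [if_pos h, if_pos h]
    exact mapC_deRham_d _ _ _ _ _
  · have e : k j = Function.update k i (k i - 1) j := (Function.update_of_ne h _ _).symm
    rw [if_neg h, if_neg h, dif_pos e]
    exact mapC_deRham_XIso _ e _ _

lemma mapC_sum {Y : Type u} [TopologicalSpace Y] {F G : ModSheaf Y} {ι : Type*} (s : Finset ι)
    (f : ι → (F ⟶ G)) (U : Opens Y) (t : SecC F U) :
    mapC (∑ i ∈ s, f i) U t = ∑ i ∈ s, mapC (f i) U t := by
  classical
  induction s using Finset.induction_on with
  | empty => rfl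
  | insert a s ha ih => rw [Finset.sum_insert ha, Finset.sum_insert ha, ← ih]; rfl

lemma mapC_zsmul {Y : Type u} [TopologicalSpace Y] {F G : ModSheaf Y} (c : ℤ)
    (f : F ⟶ G) (U : Opens Y) (t : SecC F U) : mapC (c • f) U t = c • mapC f U t := by
  let T : (F ⟶ G) →+ SecC G U := AddMonoidHom.mk' (fun f => mapC f U t) fun _ _ => rfl
  exact map_zsmul T c f

/-- The compatibility of `boxDR` with the differentials. -/
lemma boxDR_d (k : Fin n → ℕ) (r : ℕ) :
    boxDR M k (r + 1) ≫ ((deRham (powModel 𝓘(ℂ, E) n) (Fin n → X)).obj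
      ((boxOFunctor 𝓘(ℂ, E) X n).obj M)).d (r + 1) r =
    ∑ i, (-1 : ℤ) ^ (∑ j with j < i, k j) •
      ((boxCFunctor X n).map (stepD (fun i => (deRham 𝓘(ℂ, E) X).obj (M i)) i k
        (Function.update k i (k i - 1))) ≫ boxDR M (Function.update k i (k i - 1)) r) := by
  refine boxC_deRham_ext M fun U m v => ?_
  rw [mapC_comp, mapC_boxDR, mapC_deRham_d]
  let P (i : Fin n) := (toPre 𝓘(ℂ, E) X).obj (M i)
  let T : PolyAll (Holo (powModel 𝓘(ℂ, E) n) U) (VF (powModel 𝓘(ℂ, E) n) U)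
      (Sec (preBoxO P) U) →ₗ[ℂ]
      SecC (((deRham (powModel 𝓘(ℂ, E) n) (Fin n → X)).obj
        ((boxOFunctor 𝓘(ℂ, E) X n).obj M)).X r) U :=
    toDR ((boxOFunctor 𝓘(ℂ, E) X n).obj M) r U ∘ₗ
      polyvecMap (secMapO (boxUnit M) U) (vfId U) r ∘ₗ LinearMap.proj r
  -- The identity of morphisms is the Leibniz rule for `boxMul`, pushed forward along the linear map
  -- `T` to sections of the sheaf.
  have h1 := congrArg T (BoxDatum.koszulAll_boxMul (boxDatum P U) k
    (fun i => pv (Holo 𝓘(ℂ, E) (prImage i U)) (m i) (v i)))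
  refine Eq.trans ?_ (h1.trans ?_)
  · refine congrArg (toDR _ r U) ?_
    change koszul _ r (Pi.single (r + 1) _ (r + 1)) = _
    rw [Pi.single_eq_same]
    exact (polyvecMap_koszul _ _ _ _ (fun _ _ => rfl)
      (fun ξ m => (secMap (boxUnit M) U).map_smul (MulOpposite.op (vfToD _ ξ)) m) r _).symm
  · rw [map_sum, mapC_sum]
    refine Finset.sum_congr rfl fun i _ => ?_
    rw [map_zsmul, mapC_zsmul, mapC_comp, mapC_boxSec]
    simp only [mapC_stepD]
    rw [mapC_boxDR]
    rfl

lemma mapD_boxMSec {E : Type v} [NormedAddCommGroup E] [NormedSpace ℂ E] {H : Type w}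
    [TopologicalSpace H] {I : ModelWithCorners ℂ E H} {X : Type u} [TopologicalSpace X]
    [ChartedSpace H X] {n : ℕ} {M N : Fin n → RightDMod I X} (f : M ⟶ N) (U : Opens (Fin n → X))
    (m : ∀ i, SecD (M i) (prImage i U)) : mapD ((boxOFunctor I X n).map f) U (boxMSec M U m) =
      boxMSec N U fun i => mapD (f i) _ (m i) := by
  have h1 := (PresheafOfModules.sheafificationAdjunction
    (toShD (powModel I n) (Fin n → X))).unit.naturality
      ((preBoxOFunctor I X n).map ((Functor.pi (fun _ => toPre I X)).map f))
  have h2 := congrArg (fun g => secMap g U (boxGenSec m)) h1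
  refine h2.symm.trans (congrArg (secMap (boxUnit N) U) ?_)
  have := boxMap_smul_gen ((Functor.pi fun _ => toPre I X).map f) U 1 m
  rw [MulOpposite.op_one, one_smul, one_smul] at this
  exact this

/-- The naturality of `boxDR`. -/
lemma boxDR_naturality {M N : Fin n → RightDMod 𝓘(ℂ, E) X} (f : M ⟶ N) (k : Fin n → ℕ) (r : ℕ) :
    boxDR M k r ≫ ((deRham (powModel 𝓘(ℂ, E) n) (Fin n → X)).map
        ((boxOFunctor 𝓘(ℂ, E) X n).map f)).f r =
      (boxCFunctor X n).map (fun i => ((deRham 𝓘(ℂ, E) X).map (f i)).f (k i)) ≫ boxDR N k r := by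
  -- The explicit formula is available in the degree `∑ k i` only; in every other degree both
  -- morphisms are zero.
  by_cases hr : r = ∑ i, k i
  · subst hr
    refine boxC_deRham_ext M fun U m v => ?_
    rw [mapC_comp, mapC_boxDR_pv, mapC_comp, mapC_boxSec]
    simp only [mapC_deRham_map_pv]
    rw [mapC_boxDR_pv, mapD_boxMSec]
  · rw [boxDR_of_ne M hr, boxDR_of_ne N hr, comp_zero, zero_comp]

end DeRhamBox

/-! ### Functors additive in each variable, and finite direct sums -/

section MultiAdditive

variable {C : Type*} [Category C] [Preadditive C] {D : Type*} [Category D] [Preadditive D] {n : ℕ}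

/-- A functor in `n` variables which is additive in each variable. -/
structure MultiAdditive (F : (Fin n → C) ⥤ D) : Prop where
  map_add : ∀ ⦃A B : Fin n → C⦄ (f g h : A ⟶ B) (i : Fin n), f i = g i + h i →
    (∀ l, l ≠ i → f l = g l) → (∀ l, l ≠ i → f l = h l) → F.map f = F.map g + F.map h

namespace MultiAdditive

variable {F : (Fin n → C) ⥤ D} (hF : MultiAdditive F)
include hF

lemma map_zero ⦃A B : Fin n → C⦄ (f : A ⟶ B) (i : Fin n) (h : f i = 0) : F.map f = 0 := by
  have := hF.map_add f f f i (by rw [h, add_zero]) (fun _ _ => rfl) (fun _ _ => rfl)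
  rwa [left_eq_add] at this

/-- With all entries but the `i`-th frozen at those of `f`, the functor is a homomorphism of groups
in the `i`-th entry, so it respects integral multiples. -/
lemma map_add_zsmul ⦃A B : Fin n → C⦄ (f g h : A ⟶ B) (i : Fin n) (c : ℤ)
    (e : f i = g i + c • h i) (hg : ∀ l, l ≠ i → f l = g l) (hh : ∀ l, l ≠ i → f l = h l) :
    F.map f = F.map g + c • F.map h := by
  let T : (A i ⟶ B i) →+ (F.obj A ⟶ F.obj B) := AddMonoidHom.mk'
    (fun a => F.map (Function.update (f : ∀ l, A l ⟶ B l) i a : A ⟶ B)) fun a b =>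
      hF.map_add _ _ _ i (by simp) (fun l hl => by simp [hl]) (fun l hl => by simp [hl])
  have h1 := T.map_add (g i) (c • h i)
  rw [T.map_zsmul, ← e] at h1
  have h2 (g : A ⟶ B) (hg : ∀ l, l ≠ i → f l = g l) : T (g i) = F.map g := by
    refine congrArg (fun u => F.map (u : A ⟶ B)) (funext fun l => ?_)
    by_cases hl : l = i
    · subst hl; simp
    · simp [hl, hg l hl]
  rwa [h2 f fun _ _ => rfl, h2 g hg, h2 h hh] at h1

/-- The multilinear map given by a functor which is additive in each variable. -/
def multi (A B : Fin n → C) : MultilinearMap ℤ (fun i => A i ⟶ B i) (F.obj A ⟶ F.obj B) where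
  toFun f := F.map (f : A ⟶ B)
  map_update_add' := by
    intro dec m i a b
    obtain rfl : dec = instDecidableEqFin n := Subsingleton.elim _ _
    exact hF.map_add _ _ _ i (by simp) (fun l hl => by simp [hl]) (fun l hl => by simp [hl])
  map_update_smul' := by
    intro dec m i c a
    obtain rfl : dec = instDecidableEqFin n := Subsingleton.elim _ _
    have h0 : F.map (Function.update m i 0 : A ⟶ B) = 0 := hF.map_zero _ i (by simp)
    have := hF.map_add_zsmul (Function.update m i (c • a)) (Function.update m i 0)
      (Function.update m i a) i c (by simp) (fun l hl => by simp [hl]) (fun l hl => by simp [hl])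
    rwa [h0, zero_add] at this

lemma map_sum {A B : Fin n → C} (f : ∀ i, ℕ → (A i ⟶ B i)) (S : Fin n → Finset ℕ) :
    F.map (fun i => ∑ s ∈ S i, f i s : A ⟶ B) =
      ∑ r ∈ Fintype.piFinset S, F.map (fun i => f i (r i) : A ⟶ B) :=
  (hF.multi A B).map_sum_finset f S

end MultiAdditive

/-- The object `A` is the direct sum of the objects `B k`, of which only finitely many are nonzero,
with the inclusions `inj`. -/
def IsFiniteSum {A : C} {B : ℕ → C} (inj : ∀ k, B k ⟶ A) : Prop :=
  ∃ (proj : ∀ k, A ⟶ B k) (N : ℕ), ∑ k ∈ Finset.range N, proj k ≫ inj k = 𝟙 A ∧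
    (∀ k, inj k ≫ proj k = 𝟙 (B k)) ∧ (∀ k l, k ≠ l → inj k ≫ proj l = 0) ∧
    ∀ k, N ≤ k → inj k = 0

variable {F : (Fin n → C) ⥤ D} (hF : MultiAdditive F) {A : Fin n → C} {B : Fin n → ℕ → C}
  {inj : ∀ i k, B i k ⟶ A i} (h : ∀ i, IsFiniteSum (inj i))
include hF h

/-- Expand the identity of each `A i` as a finite sum of projections and inclusions, and then the
functor on the family of identities by multilinearity. -/
lemma MultiAdditive.hom_ext {Z : D} {f g : F.obj A ⟶ Z}
    (hfg : ∀ r : Fin n → ℕ, F.map (fun i => inj i (r i) : (fun i => B i (r i)) ⟶ A) ≫ f =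
      F.map (fun i => inj i (r i) : (fun i => B i (r i)) ⟶ A) ≫ g) : f = g := by
  choose proj N h1 h2 h3 h4 using h
  have e : 𝟙 (F.obj A) = ∑ r ∈ Fintype.piFinset fun i => Finset.range (N i),
      F.map (fun i => proj i (r i) : A ⟶ fun i => B i (r i)) ≫
        F.map (fun i => inj i (r i) : (fun i => B i (r i)) ⟶ A) := by
    rw [← F.map_id]
    have : 𝟙 A = (fun i => ∑ s ∈ Finset.range (N i), proj i s ≫ inj i s) :=
      funext fun i => (h1 i).symm
    rw [this, hF.map_sum (fun i s => proj i s ≫ inj i s)]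
    refine Finset.sum_congr rfl fun r _ => ?_
    rw [← F.map_comp]
    rfl
  rw [← Category.id_comp f, ← Category.id_comp g, e, Preadditive.sum_comp, Preadditive.sum_comp]
  simp only [Category.assoc, hfg]

/-- The morphism is the sum of the `φ r` precomposed with projections. By orthogonality of the
projections only the summand with the given index survives. -/
lemma MultiAdditive.exists_desc {Z : D} (φ : ∀ r : Fin n → ℕ, F.obj (fun i => B i (r i)) ⟶ Z) :
    ∃ f : F.obj A ⟶ Z, ∀ r : Fin n → ℕ,
      F.map (fun i => inj i (r i) : (fun i => B i (r i)) ⟶ A) ≫ f = φ r := by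
  choose proj N h1 h2 h3 h4 using h
  refine ⟨∑ r ∈ Fintype.piFinset fun i => Finset.range (N i),
      F.map (fun i => proj i (r i) : A ⟶ fun i => B i (r i)) ≫ φ r, fun r => ?_⟩
  rw [Preadditive.comp_sum]
  simp only [← Category.assoc, ← F.map_comp]
  have hne (r' : Fin n → ℕ) (hr : r' ≠ r) : F.map ((fun i => inj i (r i) :
      (fun i => B i (r i)) ⟶ A) ≫ (fun i => proj i (r' i) : A ⟶ fun i => B i (r' i))) = 0 := by
    obtain ⟨i, hi⟩ := Function.ne_iff.1 hr
    exact hF.map_zero _ i (h3 i _ _ hi.symm)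
  have hid : F.map ((fun i => inj i (r i) : (fun i => B i (r i)) ⟶ A) ≫
      (fun i => proj i (r i) : A ⟶ fun i => B i (r i))) = 𝟙 _ := by
    rw [← F.map_id]
    exact congrArg F.map (funext fun i => h2 i (r i))
  by_cases hr : ∀ i, r i < N i
  · rw [Finset.sum_eq_single r]
    · rw [hid, Category.id_comp]
    · intro r' _ hr'
      rw [hne r' hr', zero_comp]
    · intro h
      exact absurd (Fintype.mem_piFinset.2 fun i => Finset.mem_range.2 (hr i)) h
  -- An index outside the finite range: one of the objects `B i (r i)` is zero, hence so is the
  -- value of `F`, and there is nothing to check.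
  · push Not at hr
    obtain ⟨i, hi⟩ := hr
    have h0 : 𝟙 (F.obj fun i => B i (r i)) = 0 := by
      rw [← hid]
      refine hF.map_zero _ i ?_
      change inj i (r i) ≫ proj i (r i) = 0
      rw [h4 i _ hi, zero_comp]
    exact ((IsZero.iff_id_eq_zero _).2 h0).eq_of_src _ _

end MultiAdditive

/-! ### Additivity of the external product over `ℂ` -/

section BoxCAdditive

variable {X : Type u} [TopologicalSpace X] {n : ℕ}

/-- `boxSec` as a multilinear map. -/
def boxSecMul (A : Fin n → ModSheaf X) (U : Opens (Fin n → X)) :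
    MultilinearMap ℂ (fun i => SecC (A i) (prImage i U)) (SecC ((boxCFunctor X n).obj A) U) :=
  (toShC (preBoxC A) U).compMultilinearMap (PiTensorProduct.tprod ℂ)

lemma multiAdditive_boxCFunctor : MultiAdditive (boxCFunctor X n) := by
  refine ⟨fun A B f g h i e hg hh => boxC_ext fun U s => ?_⟩
  change _ = mapC ((boxCFunctor X n).map g) U _ + mapC ((boxCFunctor X n).map h) U _
  rw [mapC_boxSec, mapC_boxSec, mapC_boxSec]
  have key := (boxSecMul B U).map_update_add (fun l => mapC (f l) _ (s l)) i
    (mapC (g i) _ (s i)) (mapC (h i) _ (s i))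
  have e1 (u : A ⟶ B) (hu : ∀ l, l ≠ i → f l = u l) :
      Function.update (fun l => mapC (f l) _ (s l)) i (mapC (u i) _ (s i)) =
        fun l => mapC (u l) (prImage l U) (s l) := by
    funext l
    by_cases hl : l = i
    · subst hl; rw [Function.update_self]
    · rw [Function.update_of_ne hl, hu l hl]
  have e2 : mapC (g i) (prImage i U) (s i) + mapC (h i) _ (s i) = mapC (f i) _ (s i) := by
    rw [e]; rfl
  rw [e1 g hg, e1 h hh, e2, Function.update_eq_self] at key
  exact key

end BoxCAdditive

/-! ### Summands of the total complex of a double complex -/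

section TotalPieces

variable {C : Type*} [Category C] [Preadditive C] [HasCoproducts.{0} C]
  (K : HomologicalComplex₂ C (ComplexShape.up ℤ) (ComplexShape.down ℕ))

/-- For `k = 0` the truncated `k - 1` is `0` and the differential from degree `0` to degree `0`
vanishes, so the formula needs no case distinction. -/
lemma ιTotalOrZero_d {p : ℤ} {k : ℕ} {j : ℤ} (h : p - k = j) :
    K.ιTotalOrZero (ComplexShape.up ℤ) p k j ≫ (K.total (ComplexShape.up ℤ)).d j (j + 1) =
      (K.d p (p + 1)).f k ≫ K.ιTotalOrZero (ComplexShape.up ℤ) (p + 1) k (j + 1) +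
      (Int.negOnePow p : ℤ) • ((K.X p).d k (k - 1) ≫
        K.ιTotalOrZero (ComplexShape.up ℤ) p (k - 1) (j + 1)) := by
  have e1 : K.d₁ (ComplexShape.up ℤ) p k (j + 1) =
      (K.d p (p + 1)).f k ≫ K.ιTotalOrZero (ComplexShape.up ℤ) (p + 1) k (j + 1) :=
    (HomologicalComplex₂.d₁_eq' K (ComplexShape.up ℤ) (i₁' := p + 1) rfl k (j + 1)).trans
      (one_smul _ _)
  have e2 : K.d₂ (ComplexShape.up ℤ) p k (j + 1) =
      (Int.negOnePow p : ℤ) • ((K.X p).d k (k - 1) ≫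
        K.ιTotalOrZero (ComplexShape.up ℤ) p (k - 1) (j + 1)) := by
    cases k with
    | zero =>
      rw [HomologicalComplex₂.d₂_eq_zero _ _ _ _ _ (by simp),
        HomologicalComplex.shape _ _ _ (by simp), zero_comp, smul_zero]
    | succ k =>
      exact HomologicalComplex₂.d₂_eq' K (ComplexShape.up ℤ) p (i₂' := k) rfl (j + 1)
  rw [HomologicalComplex₂.ιTotalOrZero_eq _ _ _ _ _ h, ← e1, ← e2, HomologicalComplex₂.total_d,
    Preadditive.comp_add]
  exact congrArg₂ (· + ·) (HomologicalComplex₂.ι_D₁ ..) (HomologicalComplex₂.ι_D₂ ..)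

/-- In total degree `j` the summands are indexed by `k` with `p = j + k`. An upper bound on `p`
therefore leaves finitely many of them, although `k` itself is not bounded. -/
lemma isFiniteSum_ιTotalOrZero (b : ℤ) (hK : ∀ p, b < p → ∀ k, IsZero ((K.X p).X k)) (j : ℤ) :
    IsFiniteSum fun k : ℕ => K.ιTotalOrZero (ComplexShape.up ℤ) (j + k) k j := by
  let proj (k : ℕ) : (K.total (ComplexShape.up ℤ)).X j ⟶ (K.X (j + k)).X k :=
    K.totalDesc fun p l _ => if e : p = j + k ∧ l = k then
      (K.XXIsoOfEq _ _ _ e.1 e.2).hom else 0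
  have hproj (p : ℤ) (l k : ℕ) (h : p - l = j) : K.ιTotalOrZero (ComplexShape.up ℤ) p l j ≫ proj k =
      if e : p = j + k ∧ l = k then (K.XXIsoOfEq _ _ _ e.1 e.2).hom else 0 := by
    rw [HomologicalComplex₂.ιTotalOrZero_eq _ _ _ _ _ h]
    exact HomologicalComplex₂.ι_totalDesc _ _ _ _ _
  -- From `k = b - j + 1` on, `p = j + k` exceeds `b` and the summand is zero.
  refine ⟨proj, (b - j + 1).toNat,
    HomologicalComplex₂.total.hom_ext (ComplexShape.up ℤ) fun p l h => ?_, fun k => ?_,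
    fun k l hkl => ?_, fun k hk => ?_⟩
  · replace h : p - l = j := h
    rw [Preadditive.comp_sum, Category.comp_id, ← HomologicalComplex₂.ιTotalOrZero_eq _ _ _ _ _ h]
    obtain rfl : p = j + l := by omega
    by_cases hl : l < (b - j + 1).toNat
    · rw [Finset.sum_eq_single l]
      · rw [← Category.assoc, hproj _ _ _ (by ring), dif_pos ⟨rfl, rfl⟩]
        simp
      · intro l' _ hl'
        rw [← Category.assoc, hproj _ _ _ (by ring), dif_neg (fun e => hl' e.2.symm), zero_comp]
      · exact fun h => absurd (Finset.mem_range.2 hl) h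
    · exact (hK _ (by omega) l).eq_of_src _ _
  · rw [hproj _ _ _ (by ring), dif_pos ⟨rfl, rfl⟩]
    simp
  · rw [hproj _ _ _ (by ring), dif_neg (fun e => hkl e.2)]
  · exact (hK _ (by omega) k).eq_of_src _ _

end TotalPieces

/-! ### Summands of the de Rham complex -/

section DRPieces

variable {E : Type v} [NormedAddCommGroup E] [NormedSpace ℂ E] {H : Type w} [TopologicalSpace H]
  {I : ModelWithCorners ℂ E H} {Y : Type u} [TopologicalSpace Y] [ChartedSpace H Y]

instance : (deRham I Y).Additive where
  map_add {M N f g} := by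
    ext k : 1
    refine deRham_ext fun U m v => ?_
    change mapC _ U _ = mapC (((deRham I Y).map f).f k) U _ + mapC (((deRham I Y).map g).f k) U _
    rw [mapC_deRham_map_pv, mapC_deRham_map_pv, mapC_deRham_map_pv, ← map_add]
    refine congrArg (toDR N k U) ?_
    exact TensorProduct.add_tmul _ _ _

/-- The double complex of which `DR(M)` is the total complex. -/
abbrev deRham₂ (M : CochainComplex (RightDMod I Y) ℤ) :
    HomologicalComplex₂ (ModSheaf Y) (ComplexShape.up ℤ) (ComplexShape.down ℕ) :=
  ((deRham I Y).mapHomologicalComplex (ComplexShape.up ℤ)).obj M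

variable (M : CochainComplex (RightDMod I Y) ℤ)

/-- The inclusion of `Mᵖ ⊗ ⋀ᵏ Θ` into `DR(M)ʲ`; zero unless `p - k = j`. -/
def drι (p : ℤ) (k : ℕ) (j : ℤ) : ((deRham I Y).obj (M.X p)).X k ⟶ ((DR I Y).obj M).X j :=
  (deRham₂ M).ιTotalOrZero (ComplexShape.up ℤ) p k j

lemma drι_eq {p : ℤ} {k : ℕ} {j : ℤ} (h : p - k = j) :
    drι M p k j = (deRham₂ M).ιTotal (ComplexShape.up ℤ) p k j h :=
  HomologicalComplex₂.ιTotalOrZero_eq _ _ _ _ _ _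

lemma DR_hom_ext {j : ℤ} {Z : ModSheaf Y} {f g : ((DR I Y).obj M).X j ⟶ Z}
    (h : ∀ (p : ℤ) (k : ℕ), p - k = j → drι M p k j ≫ f = drι M p k j ≫ g) : f = g := by
  refine HomologicalComplex₂.total.hom_ext (K := deRham₂ M) (ComplexShape.up ℤ) fun p k hpk => ?_
  have := h p k hpk
  rwa [drι_eq M hpk] at this

lemma drι_map {M N : CochainComplex (RightDMod I Y) ℤ} (f : M ⟶ N) (p : ℤ) (k : ℕ) (j : ℤ) :
    drι M p k j ≫ ((DR I Y).map f).f j = ((deRham I Y).map (f.f p)).f k ≫ drι N p k j :=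
  HomologicalComplex₂.ιTotalOrZero_map (deRham₂ M) (deRham₂ N)
    (((deRham I Y).mapHomologicalComplex (ComplexShape.up ℤ)).map f) (ComplexShape.up ℤ) p k j

lemma drι_d {p : ℤ} {k : ℕ} {j : ℤ} (h : p - k = j) :
    drι M p k j ≫ ((DR I Y).obj M).d j (j + 1) =
      ((deRham I Y).map (M.d p (p + 1))).f k ≫ drι M (p + 1) k (j + 1) +
      (Int.negOnePow p : ℤ) • (((deRham I Y).obj (M.X p)).d k (k - 1) ≫
        drι M p (k - 1) (j + 1)) :=
  ιTotalOrZero_d (deRham₂ M) h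

lemma isFiniteSum_drι {b : ℤ} (hM : M.IsStrictlyLE b) (j : ℤ) :
    IsFiniteSum fun k : ℕ => drι M (j + k) k j :=
  isFiniteSum_ιTotalOrZero (deRham₂ M) b (fun p hp k => (HomologicalComplex.eval _ _ k).map_isZero
    ((deRham I Y).map_isZero (M.isZero_of_isStrictlyLE b p hp))) j

end DRPieces

/-! ### Signs in the canonical morphism -/

section Signs

variable {n : ℕ}

/-- The sign `(-1)^{∑_{i > j} pᵢ kⱼ}`. -/
def crossSign (p : Fin n → ℤ) (k : Fin n → ℕ) : ℤˣ :=
  Int.negOnePow (∑ i, ∑ j ∈ Finset.Iio i, p i * k j)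

lemma coe_negOnePow_natCast (m : ℕ) : ((Int.negOnePow m : ℤˣ) : ℤ) = (-1) ^ m := by
  simp [Int.negOnePow_def]

lemma negOnePow_congr {a b : ℤ} (c : ℤ) (h : a - b = 2 * c) : a.negOnePow = b.negOnePow := by
  rw [Int.negOnePow_eq_iff, h]
  exact even_two_mul c

/-- The sign rule for the part `d` of the differential: raising `p i` adds `∑_{j<i} k j` to the
exponent of `crossSign`, which is also the difference between the Koszul exponents of `p` and of `q
= p - k`. -/
lemma crossSign_bump (p q : Fin n → ℤ) (k : Fin n → ℕ) (h : ∀ i, p i - k i = q i) (i : Fin n) :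
    crossSign p k * koszulSign p i = koszulSign q i * crossSign (bump p i) k := by
  have e : ∑ l, ∑ j ∈ Finset.Iio l, bump p i l * (k j : ℤ) =
      ∑ l, ∑ j ∈ Finset.Iio l, p l * (k j : ℤ) + ∑ j ∈ Finset.Iio i, (k j : ℤ) := by
    simp only [bump, Pi.add_apply, add_mul, Finset.sum_add_distrib]
    congr 1
    rw [Finset.sum_eq_single i]
    · simp
    · intro l _ hl; simp [hl]
    · simp
  rw [crossSign, crossSign, koszulSign, koszulSign, e, ← Int.negOnePow_add, ← Int.negOnePow_add]
  refine negOnePow_congr 0 ?_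
  simp only [← h, Finset.sum_sub_distrib]
  ring

/-- The sign rule for the part `δ`. On the left are the sign of `δ` in the total complex on the
power and that of the Leibniz rule; on the right, the Koszul sign in `⊠ DR(M i)` and the sign of `δ`
in the `i`-th factor. -/
lemma crossSign_update (p q : Fin n → ℤ) (k : Fin n → ℕ) (h : ∀ i, p i - k i = q i) (i : Fin n)
    (hi : k i ≠ 0) : crossSign p k * (Int.negOnePow (∑ l, p l) *
      Int.negOnePow (∑ j ∈ Finset.Iio i, (k j : ℤ))) =
    koszulSign q i * (Int.negOnePow (p i) * crossSign p (Function.update k i (k i - 1))) := by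
  have e0 (j : Fin n) : ((Function.update k i (k i - 1) j : ℕ) : ℤ) = k j - if j = i then 1 else 0 := by
    by_cases hj : j = i
    · subst hj; rw [Function.update_self, if_pos rfl]; omega
    · rw [Function.update_of_ne hj, if_neg hj, sub_zero]
  have e : ∑ l, ∑ j ∈ Finset.Iio l, p l * ((Function.update k i (k i - 1) j : ℕ) : ℤ) =
      ∑ l, ∑ j ∈ Finset.Iio l, p l * (k j : ℤ) - ∑ l ∈ Finset.Ioi i, p l := by
    simp only [e0, mul_sub, Finset.sum_sub_distrib]
    congr 1
    rw [← Finset.filter_lt_eq_Ioi, Finset.sum_filter]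
    exact Finset.sum_congr rfl fun l _ => by simp
  have e2 : ∑ l, p l = ∑ l ∈ Finset.Iio i, p l + (p i + ∑ l ∈ Finset.Ioi i, p l) := by
    rw [← Finset.filter_lt_eq_Ioi, ← Finset.filter_gt_eq_Iio, Finset.sum_filter, Finset.sum_filter,
      ← Fintype.sum_ite_eq' i p, ← Finset.sum_add_distrib, ← Finset.sum_add_distrib]
    refine Finset.sum_congr rfl fun l _ => ?_
    rcases lt_trichotomy l i with hl | rfl | hl
    · simp [hl, hl.ne, hl.not_gt]
    · simp
    · simp [hl, hl.ne', hl.not_gt]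
  simp only [crossSign, koszulSign, e, e2, ← Int.negOnePow_add]
  -- Half the difference of the exponents: lowering `k i` removes the `p l` with `l > i`, and
  -- passing from `p` to `q` removes the `k j` with `j < i`; each of these sums occurs twice.
  refine negOnePow_congr (∑ j ∈ Finset.Iio i, (k j : ℤ) + ∑ l ∈ Finset.Ioi i, p l) ?_
  simp only [← h, Finset.sum_sub_distrib]
  ring

end Signs

/-! ### Morphisms out of the total complex of a multicomplex -/

section MultiTotal

variable {C : Type*} [Category C] [Preadditive C] {D : Type*} [Category D] [Preadditive D]
  [HasCoproducts.{0} D] {n : ℕ} {F : (Fin n → C) ⥤ D}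
  {hF : ∀ ⦃A B : Fin n → C⦄ (f : A ⟶ B) (i : Fin n), f i = 0 → F.map f = 0}
  (K : Fin n → CochainComplex C ℤ)

lemma multiι_d (p : Fin n → ℤ) {j : ℤ} (h : ∑ i, p i = j) :
    multiι F hF K p j h ≫ (multiTotal F hF K).d j (j + 1) =
      ∑ i, (koszulSign p i : ℤ) • (F.map (slotD K i p (bump p i)) ≫
        multiι F hF K (bump p i) (j + 1) (by rw [sum_bump, h])) := by
  refine (Sigma.ι_desc _ _).trans ?_
  rw [dif_pos rfl]
  rfl

lemma multiTotal_ext {j : ℤ} {Z : D} {f g : (multiTotal F hF K).X j ⟶ Z}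
    (h : ∀ (p : Fin n → ℤ) (hp : ∑ i, p i = j),
      multiι F hF K p j hp ≫ f = multiι F hF K p j hp ≫ g) : f = g :=
  Sigma.hom_ext _ _ fun p => h p.1 p.2

variable {K} in
lemma exists_multiTotal_desc {L : CochainComplex D ℤ}
    (Φ : ∀ (p : Fin n → ℤ) (j : ℤ), F.obj (fun i => (K i).X (p i)) ⟶ L.X j)
    (hΦ : ∀ (p : Fin n → ℤ) (j : ℤ), ∑ i, p i = j → Φ p j ≫ L.d j (j + 1) =
      ∑ i, (koszulSign p i : ℤ) • (F.map (slotD K i p (bump p i)) ≫ Φ (bump p i) (j + 1))) :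
    ∃ c : multiTotal F hF K ⟶ L, ∀ p j h, multiι F hF K p j h ≫ c.f j = Φ p j := by
  obtain ⟨f, e⟩ : ∃ f : ∀ j, (multiTotal F hF K).X j ⟶ L.X j,
      ∀ p j h, multiι F hF K p j h ≫ f j = Φ p j :=
    ⟨fun j => Sigma.desc fun p => Φ p.1 j, fun p j h =>
      Sigma.ι_desc (fun p : {p : Fin n → ℤ // ∑ i, p i = j} => Φ p.1 j) ⟨p, h⟩⟩
  refine ⟨{ f := f, comm' := ?_ }, e⟩
  rintro j _ rfl
  refine multiTotal_ext K fun p hp => ?_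
  rw [← Category.assoc, e, hΦ p j hp, ← Category.assoc, multiι_d, Preadditive.sum_comp]
  refine Finset.sum_congr rfl fun i _ => ?_
  rw [Preadditive.zsmul_comp, Category.assoc, e]

end MultiTotal

/-! ### Construction of the canonical morphism for complexes -/

section Canonical

variable {E : Type v} [NormedAddCommGroup E] [NormedSpace ℂ E] [FiniteDimensional ℂ E]
  {X : Type u} [TopologicalSpace X] [ChartedSpace E X] [IsManifold 𝓘(ℂ, E) ω X] {n : ℕ}

/-- The inclusion of a piece of the external product of complexes of right `𝒟`-modules. -/
abbrev boxOι {E : Type v} [NormedAddCommGroup E] [NormedSpace ℂ E] {H : Type w}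
    [TopologicalSpace H] {I : ModelWithCorners ℂ E H} {X : Type u} [TopologicalSpace X]
    [ChartedSpace H X] {n : ℕ} (M : Fin n → CochainComplex (RightDMod I X) ℤ) (p : Fin n → ℤ)
    (j : ℤ) (h : ∑ i, p i = j) :
    (boxOFunctor I X n).obj (fun i => (M i).X (p i)) ⟶ (boxO M).X j :=
  multiι (boxOFunctor I X n) boxOFunctor_map_zero M p j h

/-- The inclusion of a piece of the external product of complexes of sheaves. -/
abbrev boxCι {X : Type u} [TopologicalSpace X] {n : ℕ}
    (K : Fin n → CochainComplex (ModSheaf X) ℤ) (p : Fin n → ℤ) (j : ℤ)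
    (h : ∑ i, p i = j) : (boxCFunctor X n).obj (fun i => (K i).X (p i)) ⟶ (boxC K).X j :=
  multiι (boxCFunctor X n) boxCFunctor_map_zero K p j h

variable (M : Fin n → CochainComplex (RightDMod 𝓘(ℂ, E) X) ℤ)

/-- The component of the canonical morphism on `⊠ (Mᵢ^{pᵢ} ⊗ ⋀^{kᵢ} Θ)`, up to sign. -/
def boxDRι (p : Fin n → ℤ) {P : ℤ} (hP : ∑ i, p i = P) (k : Fin n → ℕ) (r : ℕ) (j : ℤ) :
    (boxCFunctor X n).obj (fun i => ((deRham 𝓘(ℂ, E) X).obj ((M i).X (p i))).X (k i)) ⟶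
      ((DR (powModel 𝓘(ℂ, E) n) (Fin n → X)).obj (boxO M)).X j :=
  boxDR (fun i => (M i).X (p i)) k r ≫
    ((deRham (powModel 𝓘(ℂ, E) n) (Fin n → X)).map (boxOι M p P hP)).f r ≫ drι (boxO M) P r j

/-- The inclusion of `⊠ (Mᵢ^{pᵢ} ⊗ ⋀^{kᵢ} Θ)` in `⊠ DR(Mᵢ)^{qᵢ}`. -/
def boxDrι (p : Fin n → ℤ) (k : Fin n → ℕ) (q : Fin n → ℤ) :
    (boxCFunctor X n).obj (fun i => ((deRham 𝓘(ℂ, E) X).obj ((M i).X (p i))).X (k i)) ⟶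
      (boxCFunctor X n).obj (fun i => ((DR 𝓘(ℂ, E) X).obj (M i)).X (q i)) :=
  (boxCFunctor X n).map fun i => drι (M i) (p i) (k i) (q i)

lemma deRham_map_sum_zsmul {Y : Type u} [TopologicalSpace Y] {H : Type w} [TopologicalSpace H]
    {E : Type v} [NormedAddCommGroup E] [NormedSpace ℂ E]
    {I : ModelWithCorners ℂ E H} [ChartedSpace H Y] {A B : RightDMod I Y} (c : Fin n → ℤ)
    (f : Fin n → (A ⟶ B)) (r : ℕ) : ((deRham I Y).map (∑ i, c i • f i)).f r =
      ∑ i, c i • ((deRham I Y).map (f i)).f r := by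
  let T : (A ⟶ B) →+ (((deRham I Y).obj A).X r ⟶ ((deRham I Y).obj B).X r) :=
    AddMonoidHom.mk' (fun f => ((deRham I Y).map f).f r) fun f g => by
      rw [Functor.map_add]; rfl
  have := map_sum T (fun i => c i • f i) Finset.univ
  simp only [map_zsmul] at this
  exact this

/-- If `r = 0`, all `k i` are `0`, and both sides vanish because no differential leaves degree `0`;
otherwise this is `boxDR_d`. -/
lemma boxDR_d_pred (M : Fin n → RightDMod 𝓘(ℂ, E) X) (k : Fin n → ℕ) (r : ℕ) (hr : ∑ i, k i = r) :
    boxDR M k r ≫ ((deRham (powModel 𝓘(ℂ, E) n) (Fin n → X)).obj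
      ((boxOFunctor 𝓘(ℂ, E) X n).obj M)).d r (r - 1) =
    ∑ i, (-1 : ℤ) ^ (∑ j with j < i, k j) •
      ((boxCFunctor X n).map (stepD (fun i => (deRham 𝓘(ℂ, E) X).obj (M i)) i k
        (Function.update k i (k i - 1))) ≫ boxDR M (Function.update k i (k i - 1)) (r - 1)) := by
  cases r with
  | succ r => exact boxDR_d M k r
  | zero =>
    rw [HomologicalComplex.shape _ _ _ (by simp), comp_zero, Finset.sum_eq_zero]
    intro i _
    have hi : k i = 0 := Finset.sum_eq_zero_iff.1 hr i (Finset.mem_univ i)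
    rw [boxCFunctor_map_zero _ i, zero_comp, smul_zero]
    rw [stepD, if_pos rfl]
    refine HomologicalComplex.shape _ _ _ ?_
    simp [hi]

/-- The differential on the power splits. The part `d` is moved to the left of `boxDR` by
naturality, the part `δ` by the Leibniz rule. -/
lemma boxDRι_d (p : Fin n → ℤ) {P : ℤ} (hP : ∑ i, p i = P) (k : Fin n → ℕ) {r : ℕ}
    (hr : ∑ i, k i = r) {j : ℤ} (hj : P - r = j) :
    boxDRι M p hP k r j ≫ ((DR (powModel 𝓘(ℂ, E) n) (Fin n → X)).obj (boxO M)).d j (j + 1) =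
      ∑ i, (koszulSign p i : ℤ) • ((boxCFunctor X n).map
        (fun l => ((deRham 𝓘(ℂ, E) X).map (slotD M i p (bump p i) l)).f (k l)) ≫
          boxDRι M (bump p i) (by rw [sum_bump, hP] : _ = P + 1) k r (j + 1)) +
      (Int.negOnePow P : ℤ) • ∑ i, (-1 : ℤ) ^ (∑ j with j < i, k j) • ((boxCFunctor X n).map
        (stepD (fun i => (deRham 𝓘(ℂ, E) X).obj ((M i).X (p i))) i k
          (Function.update k i (k i - 1))) ≫
          boxDRι M p hP (Function.update k i (k i - 1)) (r - 1) (j + 1)) := by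
  have e1 : ((deRham (powModel 𝓘(ℂ, E) n) (Fin n → X)).map (boxOι M p P hP)).f r ≫
      ((deRham (powModel 𝓘(ℂ, E) n) (Fin n → X)).map ((boxO M).d P (P + 1))).f r =
      ∑ i, (koszulSign p i : ℤ) •
        (((deRham (powModel 𝓘(ℂ, E) n) (Fin n → X)).map ((boxOFunctor 𝓘(ℂ, E) X n).map
          (slotD M i p (bump p i)))).f r ≫ ((deRham (powModel 𝓘(ℂ, E) n) (Fin n → X)).map
          (boxOι M (bump p i) (P + 1) (by rw [sum_bump, hP]))).f r) := by
    rw [← HomologicalComplex.comp_f, ← Functor.map_comp]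
    have := multiι_d (F := boxOFunctor 𝓘(ℂ, E) X n) (hF := boxOFunctor_map_zero) M p hP
    refine (congrArg (fun f => ((deRham (powModel 𝓘(ℂ, E) n) (Fin n → X)).map f).f r) this).trans ?_
    refine (deRham_map_sum_zsmul _ _ r).trans ?_
    refine Finset.sum_congr rfl fun i _ => ?_
    rw [Functor.map_comp, HomologicalComplex.comp_f]
    rfl
  rw [boxDRι, Category.assoc, Category.assoc, drι_d _ hj, Preadditive.comp_add,
    Preadditive.comp_add, ← Category.assoc (HomologicalComplex.Hom.f _ _), e1]
  congr 1
  · rw [Preadditive.sum_comp, Preadditive.comp_sum]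
    refine Finset.sum_congr rfl fun i _ => ?_
    rw [Preadditive.zsmul_comp, Preadditive.comp_zsmul, boxDRι, Category.assoc,
      ← Category.assoc (boxDR _ _ _), boxDR_naturality, Category.assoc]
  · rw [Preadditive.comp_zsmul, Preadditive.comp_zsmul, HomologicalComplex.Hom.comm_assoc,
      ← Category.assoc (boxDR _ _ _), boxDR_d_pred _ _ _ hr, Preadditive.sum_comp]
    congr 1
    refine Finset.sum_congr rfl fun i _ => ?_
    rw [Preadditive.zsmul_comp, boxDRι, Category.assoc]

/-- The differential of the `i`-th factor restricted to a summand is `d` plus a sign times `δ`;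
additivity in the `i`-th entry splits the external product accordingly. -/
lemma boxDrι_slotD (p : Fin n → ℤ) (k : Fin n → ℕ) (q : Fin n → ℤ) (h : ∀ i, p i - k i = q i)
    (i : Fin n) :
    boxDrι M p k q ≫ (boxCFunctor X n).map
        (slotD (fun i => (DR 𝓘(ℂ, E) X).obj (M i)) i q (bump q i)) =
      (boxCFunctor X n).map
        (fun l => ((deRham 𝓘(ℂ, E) X).map (slotD M i p (bump p i) l)).f (k l)) ≫
        boxDrι M (bump p i) k (bump q i) +
      (Int.negOnePow (p i) : ℤ) • ((boxCFunctor X n).map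
        (stepD (fun i => (deRham 𝓘(ℂ, E) X).obj ((M i).X (p i))) i k
          (Function.update k i (k i - 1))) ≫
        boxDrι M p (Function.update k i (k i - 1)) (bump q i)) := by
  -- The degrees occurring in `bump` and `Function.update` are replaced by variables with equations,
  -- so that the equations can be eliminated by substitution instead of transport.
  have key (P P' : ℤ) (hP : P + 1 = P') (K K' : ℕ) (hK : K' = K - 1) (Q Q' : ℤ) (hQ : Q + 1 = Q')
      (hh : P - K = Q) : drι (M i) P K Q ≫ ((DR 𝓘(ℂ, E) X).obj (M i)).d Q Q' =
        ((deRham 𝓘(ℂ, E) X).map ((M i).d P P')).f K ≫ drι (M i) P' K Q' +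
        (Int.negOnePow P : ℤ) • (((deRham 𝓘(ℂ, E) X).obj ((M i).X P)).d K K' ≫
          drι (M i) P K' Q') := by
    subst hP hK hQ
    exact drι_d _ hh
  have key1 (l : Fin n) (P P' : ℤ) (hP : P = P') (K : ℕ) (Q Q' : ℤ) (hQ : Q = Q') :
      drι (M l) P K Q ≫ (((DR 𝓘(ℂ, E) X).obj (M l)).XIsoOfEq hQ).hom =
        ((deRham 𝓘(ℂ, E) X).map (((M l).XIsoOfEq hP).hom)).f K ≫ drι (M l) P' K Q' := by
    subst hP hQ
    simp [HomologicalComplex.XIsoOfEq_rfl]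
  have key2 (l : Fin n) (P : ℤ) (K K' : ℕ) (hK : K = K') (Q Q' : ℤ) (hQ : Q = Q') :
      drι (M l) P K Q ≫ (((DR 𝓘(ℂ, E) X).obj (M l)).XIsoOfEq hQ).hom =
        (((deRham 𝓘(ℂ, E) X).obj ((M l).X P)).XIsoOfEq hK).hom ≫ drι (M l) P K' Q' := by
    subst hK hQ
    simp [HomologicalComplex.XIsoOfEq_rfl]
  let S (l : Fin n) := slotD (fun i => (DR 𝓘(ℂ, E) X).obj (M i)) i q (bump q i) l
  let T (l : Fin n) := ((deRham 𝓘(ℂ, E) X).map (slotD M i p (bump p i) l)).f (k l)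
  let R (l : Fin n) := stepD (fun i => (deRham 𝓘(ℂ, E) X).obj ((M i).X (p i))) i k
    (Function.update k i (k i - 1)) l
  simp only [boxDrι, ← Functor.map_comp]
  refine multiAdditive_boxCFunctor.map_add_zsmul _ _ _ i _ ?_ (fun l hl => ?_) (fun l hl => ?_)
  · have hS : S i = ((DR 𝓘(ℂ, E) X).obj (M i)).d _ _ := slotD_self _ _ _ _
    have hT : T i = ((deRham 𝓘(ℂ, E) X).map ((M i).d _ _)).f (k i) :=
      congrArg (fun f => ((deRham 𝓘(ℂ, E) X).map f).f (k i)) (slotD_self M i p (bump p i))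
    have hR : R i = ((deRham 𝓘(ℂ, E) X).obj ((M i).X (p i))).d _ _ := if_pos rfl
    change drι (M i) (p i) (k i) (q i) ≫ S i = T i ≫ drι (M i) _ _ _ + _ • (R i ≫ drι (M i) _ _ _)
    rw [hS, hT, hR]
    exact key _ _ (bump_self p i).symm _ _ (Function.update_self ..) _ _ (bump_self q i).symm (h i)
  · have hS : S l = (((DR 𝓘(ℂ, E) X).obj (M l)).XIsoOfEq (bump_ne q hl).symm).hom :=
      slotD_ne _ _ _ hl _
    have hT : T l = ((deRham 𝓘(ℂ, E) X).map ((M l).XIsoOfEq (bump_ne p hl).symm).hom).f (k l) :=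
      congrArg (fun f => ((deRham 𝓘(ℂ, E) X).map f).f (k l)) (slotD_ne M _ _ hl (bump_ne p hl).symm)
    change drι (M l) (p l) (k l) (q l) ≫ S l = T l ≫ drι (M l) _ _ _
    rw [hS, hT]
    exact key1 ..
  · have hS : S l = (((DR 𝓘(ℂ, E) X).obj (M l)).XIsoOfEq (bump_ne q hl).symm).hom :=
      slotD_ne _ _ _ hl _
    have e : k l = Function.update k i (k i - 1) l := (Function.update_of_ne hl _ _).symm
    have hR : R l = (((deRham 𝓘(ℂ, E) X).obj ((M l).X (p l))).XIsoOfEq e).hom :=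
      (if_neg hl).trans (dif_pos e)
    change drι (M l) (p l) (k l) (q l) ≫ S l = R l ≫ drι (M l) _ _ _
    rw [hS, hR]
    exact key2 ..

/-- Boundedness from above makes every `DR(M i)` a finite direct sum in each degree, which is what
an additive functor respects. -/
lemma boxDR_hom_ext (hM : ∀ i, ∃ b : ℤ, (M i).IsStrictlyLE b) {q : Fin n → ℤ}
    {Z : ModSheaf (Fin n → X)}
    {f g : (boxCFunctor X n).obj (fun i => ((DR 𝓘(ℂ, E) X).obj (M i)).X (q i)) ⟶ Z}
    (h : ∀ (p : Fin n → ℤ) (k : Fin n → ℕ), (∀ i, p i - k i = q i) →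
      boxDrι M p k q ≫ f = boxDrι M p k q ≫ g) : f = g := by
  choose b hb using hM
  refine multiAdditive_boxCFunctor.hom_ext (fun i => isFiniteSum_drι (M i) (hb i) (q i)) fun k => ?_
  exact h (fun i => q i + k i) k fun i => by ring

/-- The construction of the canonical morphism. -/
theorem exists_canonical (hM : ∀ i, ∃ b : ℤ, (M i).IsStrictlyLE b) :
    ∃ c : boxC (fun i => (DR 𝓘(ℂ, E) X).obj (M i)) ⟶
        (DR (powModel 𝓘(ℂ, E) n) (Fin n → X)).obj (boxO M),
      ∀ (p : Fin n → ℤ) (k : Fin n → ℕ) (q : Fin n → ℤ), (∀ i, p i - k i = q i) → ∀ j hj,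
        boxDrι M p k q ≫ boxCι _ q j hj ≫ c.f j =
          (crossSign p k : ℤ) • boxDRι M p rfl k (∑ i, k i) j := by
  -- For fixed `q` the summands are indexed by `k` alone, because `p = q + k`.
  have hΦ (q : Fin n → ℤ) (j : ℤ) : ∃ Φ : (boxCFunctor X n).obj
      (fun i => ((DR 𝓘(ℂ, E) X).obj (M i)).X (q i)) ⟶
        ((DR (powModel 𝓘(ℂ, E) n) (Fin n → X)).obj (boxO M)).X j,
      ∀ (p : Fin n → ℤ) (k : Fin n → ℕ), (∀ i, p i - k i = q i) → ∀ (P : ℤ) (hP : ∑ i, p i = P)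
        (r : ℕ), ∑ i, k i = r →
        boxDrι M p k q ≫ Φ = (crossSign p k : ℤ) • boxDRι M p hP k r j := by
    choose b hb using hM
    obtain ⟨Φ, h⟩ := multiAdditive_boxCFunctor.exists_desc
      (fun i => isFiniteSum_drι (M i) (hb i) (q i)) fun k =>
        (crossSign (fun i => q i + k i) k : ℤ) • boxDRι M (fun i => q i + k i) rfl k (∑ i, k i) j
    refine ⟨Φ, fun p k hpk P hP r hr => ?_⟩
    obtain rfl : p = fun i => q i + k i := funext fun i => by linarith [hpk i]
    subst hP hr
    exact h k
  choose Φ hΦ using hΦ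
  obtain ⟨c, hc⟩ := exists_multiTotal_desc (F := boxCFunctor X n) (hF := boxCFunctor_map_zero)
    (K := fun i => (DR 𝓘(ℂ, E) X).obj (M i)) Φ fun q j hq => boxDR_hom_ext M hM fun p k hpk => by
      have hj : ∑ i, p i - ((∑ i, k i : ℕ) : ℤ) = j := by
        rw [← hq, Nat.cast_sum, ← Finset.sum_sub_distrib]
        exact Finset.sum_congr rfl fun i _ => hpk i
      rw [← Category.assoc, hΦ q j p k hpk _ rfl _ rfl, Preadditive.zsmul_comp,
        boxDRι_d M p rfl k rfl hj, Preadditive.comp_sum, Finset.smul_sum, smul_add, Finset.smul_sum,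
        Finset.smul_sum, ← Finset.sum_add_distrib]
      refine Finset.sum_congr rfl fun i _ => ?_
      rw [Preadditive.comp_zsmul, ← Category.assoc, boxDrι_slotD M p k q hpk, Preadditive.add_comp,
        Category.assoc, Preadditive.zsmul_comp, Category.assoc, smul_add]
      have h1 (l : Fin n) : bump p i l - k l = bump q i l := by
        by_cases hl : l = i
        · subst hl; rw [bump_self, bump_self, ← hpk l]; ring
        · rw [bump_ne _ hl, bump_ne _ hl, hpk]
      congr 1
      · rw [hΦ _ _ _ _ h1 _ (sum_bump p i) _ rfl, Preadditive.comp_zsmul, smul_smul, smul_smul]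
        congr 1
        exact_mod_cast congrArg Units.val (crossSign_bump p q k hpk i)
      -- If `k i = 0`, the factor `i` has no term `δ` and both sides vanish. Only for `k i ≠ 0` do
      -- the truncated degrees satisfy the equations needed to apply `hΦ` again.
      · by_cases hk : k i = 0
        · rw [boxCFunctor_map_zero (X := X) (stepD (fun i => (deRham 𝓘(ℂ, E) X).obj
              ((M i).X (p i))) i k (Function.update k i (k i - 1))) i ((if_pos rfl).trans
              (HomologicalComplex.shape _ _ _ (by simp [hk]))), zero_comp, zero_comp, smul_zero,
            smul_zero, smul_zero, smul_zero, smul_zero]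
        · have h2 (l : Fin n) :
              p l - (Function.update k i (k i - 1) l : ℕ) = bump q i l := by
            by_cases hl : l = i
            · subst hl; rw [bump_self, ← hpk l, Function.update_self]; omega
            · rw [bump_ne _ hl, Function.update_of_ne hl, hpk]
          have h3 : ∑ l, Function.update k i (k i - 1) l = ∑ l, k l - 1 := by
            rw [Finset.sum_update_of_mem (Finset.mem_univ i),
              ← Finset.add_sum_erase _ _ (Finset.mem_univ i), Finset.sdiff_singleton_eq_erase]
            omega
          rw [hΦ _ _ _ _ h2 _ rfl _ h3, Preadditive.comp_zsmul, smul_smul, smul_smul, smul_smul,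
            smul_smul]
          congr 1
          have h4 := congrArg Units.val (crossSign_update p q k hpk i hk)
          have h5 : ((Int.negOnePow (∑ j ∈ Finset.Iio i, (k j : ℤ)) : ℤˣ) : ℤ) =
              (-1) ^ (∑ j with j < i, k j) := by
            rw [← coe_negOnePow_natCast, Nat.cast_sum, Finset.filter_gt_eq_Iio]
          rw [← h5]
          push_cast at h4
          rw [← mul_assoc, ← mul_assoc] at h4
          exact h4
  refine ⟨c, fun p k q hpk j hj => ?_⟩
  exact (congrArg (boxDrι M p k q ≫ ·) (hc q j hj)).trans (hΦ q j p k hpk _ rfl _ rfl)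

end Canonical

/-! ### Sections of the de Rham complex -/

section DRSections

variable {E : Type v} [NormedAddCommGroup E] [NormedSpace ℂ E] {H : Type w} [TopologicalSpace H]
  {I : ModelWithCorners ℂ E H} {Y : Type u} [TopologicalSpace Y] [ChartedSpace H Y]

lemma drSec_eq (M : CochainComplex (RightDMod I Y) ℤ) {p : ℤ} {k : ℕ} {j : ℤ} (h : p - k = j)
    {U : Opens Y} (m : SecD (M.X p) U) (v : Fin k → VF I U) :
    drSec M p k j h m v = mapC (drι M p k j) U (toDR (M.X p) k U (pv _ m v)) := by
  rw [drι_eq M h]; rfl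

lemma preRes_toDR (M : RightDMod I Y) {k : ℕ} {U V : Opens Y} (h : V ≤ U) (m : SecD M U)
    (v : Fin k → VF I U) : preRes (((deRham I Y).obj M).X k).obj h (toDR M k U (pv _ m v)) =
      toDR M k V (pv _ (secRes ((toPre I Y).obj M) h m) (vfRes h ∘ v)) :=
  (preRes_nat (toSheafify _ (preDR I Y ((toPre I Y).obj M) k)) h _).trans
    (congrArg (toDR M k V) (polyvecMap_pv _ _ _ _ _))

lemma preRes_drSec (M : CochainComplex (RightDMod I Y) ℤ) {p : ℤ} {k : ℕ} {j : ℤ} (h : p - k = j)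
    {U V : Opens Y} (hV : V ≤ U) (m : SecD (M.X p) U) (v : Fin k → VF I U) :
    preRes (((DR I Y).obj M).X j).obj hV (drSec M p k j h m v) =
      drSec M p k j h (secRes ((toPre I Y).obj (M.X p)) hV m) (vfRes hV ∘ v) := by
  rw [drSec_eq, drSec_eq]
  exact (preRes_nat (drι M p k j).hom hV _).trans
    (congrArg (mapC (drι M p k j) V) (preRes_toDR (M.X p) hV m v))

end DRSections

/-! ### Characterization and uniqueness of the canonical morphism -/

section Canonical

variable {E : Type v} [NormedAddCommGroup E] [NormedSpace ℂ E] [FiniteDimensional ℂ E]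
  {X : Type u} [TopologicalSpace X] [ChartedSpace E X] [IsManifold 𝓘(ℂ, E) ω X] {n : ℕ}
  (M : Fin n → CochainComplex (RightDMod 𝓘(ℂ, E) X) ℤ)

lemma mapC_boxDRι (p : Fin n → ℤ) {P : ℤ} (hP : ∑ i, p i = P) (k : Fin n → ℕ) (j : ℤ)
    (U : Opens (Fin n → X)) (m : ∀ i, SecD ((M i).X (p i)) (prImage i U))
    (v : ∀ i, Fin (k i) → VF 𝓘(ℂ, E) (prImage i U)) :
    mapC (boxDRι M p hP k (∑ i, k i) j) U
      (boxSec _ U fun i => toDR ((M i).X (p i)) (k i) _ (pv _ (m i) (v i))) =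
      mapC (drι (boxO M) P (∑ i, k i) j) U (toDR _ _ U
        (pv _ (mapD (boxOι M p P hP) U (boxMSec _ U m)) fun a =>
        liftVF (finSigmaFinEquiv.symm a).1 (mem_prImage_of_mem U _)
          (v (finSigmaFinEquiv.symm a).1 (finSigmaFinEquiv.symm a).2))) := by
  rw [boxDRι, mapC_comp, mapC_comp, mapC_boxDR_pv]
  exact congrArg (mapC (drι (boxO M) P (∑ i, k i) j) U) (mapC_deRham_map_pv _ _ _ _ _)

lemma mapC_boxDrι (p : Fin n → ℤ) (k : Fin n → ℕ) (q : Fin n → ℤ) (h : ∀ i, p i - k i = q i)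
    (U : Opens (Fin n → X)) (m : ∀ i, SecD ((M i).X (p i)) (prImage i U))
    (v : ∀ i, Fin (k i) → VF 𝓘(ℂ, E) (prImage i U)) :
    mapC (boxDrι M p k q) U
      (boxSec _ U fun i => toDR ((M i).X (p i)) (k i) _ (pv _ (m i) (v i))) =
      boxSec _ U fun i => drSec (M i) (p i) (k i) (q i) (h i) (m i) (v i) := by
  rw [boxDrι, mapC_boxSec]
  exact congrArg (boxSec _ U) (funext fun i => (drSec_eq _ _ _ _).symm)

/-- Turns the formula on local sections into identities of morphisms. In one direction the given `V
i` are cut down to the projections of `U`, where the lifts `ξ'` are unique; in the other, these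
projections and the constructed lifts are a special case. -/
lemma isCanonical_iff (c : boxC (fun i => (DR 𝓘(ℂ, E) X).obj (M i)) ⟶
      (DR (powModel 𝓘(ℂ, E) n) (Fin n → X)).obj (boxO M)) :
    IsCanonical M c ↔ ∀ (p : Fin n → ℤ) (k : Fin n → ℕ),
      boxDrι M p k (fun i => p i - k i) ≫ boxCι _ (fun i => p i - k i) _ rfl ≫ c.f _ =
        (crossSign p k : ℤ) • boxDRι M p rfl k (∑ i, k i) (∑ i, (p i - k i)) := by
  have key (p : Fin n → ℤ) (k : Fin n → ℕ) (U : Opens (Fin n → X))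
      (m : ∀ i, SecD ((M i).X (p i)) (prImage i U))
      (v : ∀ i, Fin (k i) → VF 𝓘(ℂ, E) (prImage i U)) :
      mapC (boxDrι M p k (fun i => p i - k i) ≫ boxCι _ (fun i => p i - k i) _ rfl ≫ c.f _) U
        (boxSec _ U fun i => toDR ((M i).X (p i)) (k i) _ (pv _ (m i) (v i))) =
      mapC (c.f (∑ i, (p i - k i))) U
        (mapC (boxCι (fun i => (DR 𝓘(ℂ, E) X).obj (M i)) (fun i => p i - k i) _ rfl) U
          (boxSec _ U fun i => drSec (M i) (p i) (k i) _ rfl (m i) (v i))) := by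
    rw [mapC_comp, mapC_comp, mapC_boxDrι M p k _ (fun _ => rfl)]
  have key2 (p : Fin n → ℤ) (k : Fin n → ℕ) (U : Opens (Fin n → X))
      (m : ∀ i, SecD ((M i).X (p i)) (prImage i U))
      (v : ∀ i, Fin (k i) → VF 𝓘(ℂ, E) (prImage i U)) :
      mapC ((crossSign p k : ℤ) • boxDRι M p rfl k (∑ i, k i) (∑ i, (p i - k i))) U
        (boxSec _ U fun i => toDR ((M i).X (p i)) (k i) _ (pv _ (m i) (v i))) =
      (crossSign p k : ℤ) • drSec (boxO M) (∑ i, p i) (∑ i, k i) _ (by simp)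
        (mapD (boxOι M p _ rfl) U (boxMSec _ U m)) fun a =>
        liftVF (finSigmaFinEquiv.symm a).1 (mem_prImage_of_mem U _)
          (v (finSigmaFinEquiv.symm a).1 (finSigmaFinEquiv.symm a).2) := by
    rw [mapC_zsmul, mapC_boxDRι, drSec_eq]
  constructor
  · intro hc p k
    refine boxC_deRham_ext _ fun U m v => ?_
    rw [key, key2]
    -- The projections of `U` are the universal choice of the open sets `V i`.
    have := hc p k U (fun i => prImage i U) (fun x hx i => mem_prImage hx i) m v
      (fun i a => liftVF i (mem_prImage_of_mem U i) (v i a))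
      (fun i a => isLift_liftVF (mem_prImage_of_mem U i) (v i a))
    refine Eq.trans (congrArg (mapC (c.f (∑ i, (p i - k i))) U) ?_) (this.trans ?_)
    · refine congrArg (mapC _ U) (congrArg (boxSec _ U) (funext fun i => ?_))
      exact (preRes_refl _ _ _).symm
    · refine congrArg (fun m' => (crossSign p k : ℤ) • drSec (boxO M) (∑ i, p i) (∑ i, k i) _
        (by simp) (mapD (boxOι M p _ rfl) U (boxMSec _ U m')) _) (funext fun i => ?_)
      exact secRes_refl _ _ _
  · intro hc p k U V hV m v v' hv'
    have e1 := congrArg (fun f => mapC f U (boxSec _ U fun i => toDR ((M i).X (p i)) (k i) _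
      (pv _ (secRes _ (prImage_le hV i) (m i)) (vfRes (prImage_le hV i) ∘ v i)))) (hc p k)
    rw [key, key2] at e1
    refine Eq.trans (congrArg (mapC (c.f (∑ i, (p i - k i))) U) ?_) (e1.trans ?_)
    · refine congrArg (mapC _ U) (congrArg (boxSec _ U) (funext fun i => ?_))
      exact preRes_drSec (M i) rfl (prImage_le hV i) (m i) (v i)
    · refine congrArg (fun w => (crossSign p k : ℤ) • drSec (boxO M) (∑ i, p i) (∑ i, k i) _
        (by simp) _ w) (funext fun a => ?_)
      refine (IsLift.eq_liftVF _ ?_).symm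
      exact (hv' _ _).res (prImage_le hV _) le_rfl

theorem existsUnique_isCanonical (hM : ∀ i, ∃ b : ℤ, (M i).IsStrictlyLE b) :
    ∃! c : boxC (fun i => (DR 𝓘(ℂ, E) X).obj (M i)) ⟶
        (DR (powModel 𝓘(ℂ, E) n) (Fin n → X)).obj (boxO M), IsCanonical M c := by
  obtain ⟨c, hc⟩ := exists_canonical M hM
  refine ⟨c, (isCanonical_iff M c).2 fun p k => hc p k _ (fun _ => rfl) _ rfl, fun c' hc' => ?_⟩
  replace hc' := (isCanonical_iff M c').1 hc'
  ext j : 1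
  refine multiTotal_ext _ fun q hq => boxDR_hom_ext M hM fun p k hpk => ?_
  obtain rfl : (fun i => p i - k i) = q := funext hpk
  subst hq
  exact (hc' p k).trans (hc p k _ (fun _ => rfl) _ rfl).symm

end Canonical

/-! ### The Koszul sign of a permutation under a change of degree -/

section PermSign

variable {n : ℕ}

lemma permSign_exp (σ : Equiv.Perm (Fin n)) (p : Fin n → ℤ) :
    ∑ i, ∑ j ∈ Finset.Ioi i with σ j < σ i, p (σ i) * p (σ j) =
      ∑ i, ∑ j, if i < j ∧ σ j < σ i then p (σ i) * p (σ j) else 0 := by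
  refine Finset.sum_congr rfl fun i _ => ?_
  rw [← Finset.filter_lt_eq_Ioi, Finset.filter_filter, Finset.sum_filter]

/-- The sign identity that makes `σ^#` commute with the differentials: the `a`-th term of the
differential after reordering corresponds to the `σ a`-th term before. -/
lemma koszulSign_permSign (σ : Equiv.Perm (Fin n)) (p : Fin n → ℤ) (a : Fin n) :
    koszulSign p (σ a) * permSign σ (bump p (σ a)) =
      permSign σ p * koszulSign (fun i => p (σ i)) a := by
  have hb (i : Fin n) : bump p (σ a) (σ i) = p (σ i) + if i = a then 1 else 0 := by
    by_cases h : i = a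
    · subst h; rw [bump_self, if_pos rfl]
    · rw [bump_ne _ (σ.injective.ne h), if_neg h, add_zero]
  -- Raising the degree at `σ a` affects only the inversions in which `a` takes part, as the first
  -- or as the second position.
  have h1 : ∑ i, ∑ j, (if i < j ∧ σ j < σ i then bump p (σ a) (σ i) * bump p (σ a) (σ j) else 0) =
      ∑ i, ∑ j, (if i < j ∧ σ j < σ i then p (σ i) * p (σ j) else 0) +
      ((∑ j, if a < j ∧ σ j < σ a then p (σ j) else 0) +
      ∑ i, if i < a ∧ σ a < σ i then p (σ i) else 0) := by
    have e1 : (∑ j, if a < j ∧ σ j < σ a then p (σ j) else 0) =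
        ∑ i, ∑ j, if i = a then (if i < j ∧ σ j < σ i then p (σ j) else 0) else 0 := by
      refine Eq.symm ((Finset.sum_eq_single a (fun i _ hi => ?_) (by simp)).trans ?_)
      · simp [hi]
      · simp
    have e2 : (∑ i, if i < a ∧ σ a < σ i then p (σ i) else 0) =
        ∑ i, ∑ j, if j = a then (if i < j ∧ σ j < σ i then p (σ i) else 0) else 0 := by
      refine Finset.sum_congr rfl fun i _ => ?_
      refine Eq.symm ((Finset.sum_eq_single a (fun j _ hj => ?_) (by simp)).trans ?_)
      · simp [hj]
      · simp
    rw [e1, e2, ← Finset.sum_add_distrib, ← Finset.sum_add_distrib]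
    refine Finset.sum_congr rfl fun i _ => ?_
    rw [← Finset.sum_add_distrib, ← Finset.sum_add_distrib]
    refine Finset.sum_congr rfl fun j _ => ?_
    rw [hb, hb]
    by_cases h : i < j ∧ σ j < σ i
    · have hij : i ≠ j := h.1.ne
      by_cases hi : i = a
      · have hj : j ≠ a := fun hj => hij (hi.trans hj.symm)
        simp only [if_pos h, if_pos hi, if_neg hj]
        ring
      · simp only [if_pos h, if_neg hi]
        split_ifs <;> ring
    · simp [h]
  have h2 : ∑ l ∈ Finset.Iio (σ a), p l = ∑ j, if σ j < σ a then p (σ j) else 0 := by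
    rw [← Finset.filter_gt_eq_Iio, Finset.sum_filter]
    exact (Equiv.sum_comp σ fun l => if l < σ a then p l else 0).symm
  have h3 : ∑ l ∈ Finset.Iio a, p (σ l) = ∑ j, if j < a then p (σ j) else 0 := by
    rw [← Finset.filter_gt_eq_Iio, Finset.sum_filter]
  rw [koszulSign, koszulSign, permSign, permSign, permSign_exp, permSign_exp, h1, h2, h3,
    ← Int.negOnePow_add, ← Int.negOnePow_add]
  -- The exponents differ by twice the sum over the `j` after `a` with `σ j` before `σ a`: once from
  -- the changed inversions, once from comparing the two Koszul signs (`h4`).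
  refine negOnePow_congr (∑ j, if a < j ∧ σ j < σ a then p (σ j) else 0) ?_
  have h4 : (∑ j, if σ j < σ a then p (σ j) else 0) +
      (∑ i, if i < a ∧ σ a < σ i then p (σ i) else 0) -
      (∑ j, if j < a then p (σ j) else 0) = ∑ j, if a < j ∧ σ j < σ a then p (σ j) else 0 := by
    rw [← Finset.sum_add_distrib, ← Finset.sum_sub_distrib]
    refine Finset.sum_congr rfl fun j _ => ?_
    rcases lt_trichotomy j a with h | rfl | h
    · rcases lt_or_gt_of_ne (σ.injective.ne h.ne) with h' | h' <;>
        simp [h, h.not_gt, h', h'.not_gt]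
    · simp
    · rcases lt_or_gt_of_ne (σ.injective.ne h.ne') with h' | h' <;>
        simp [h, h.not_gt, h', h'.not_gt]
  linarith

end PermSign

/-! ### The reordering isomorphism for total complexes -/

section Sharp

variable {C : Type*} [Category C] [Preadditive C] {D : Type*} [Category D] [Preadditive D]
  [HasCoproducts.{0} D] {n : ℕ} {F : (Fin n → C) ⥤ D}
  {hF : ∀ ⦃A B : Fin n → C⦄ (f : A ⟶ B) (i : Fin n), f i = 0 → F.map f = 0}
  (K : Fin n → CochainComplex C ℤ)

/-- The isomorphism `c • e` for a sign `c`. -/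
def signIso {A B : D} (c : ℤˣ) (e : A ≅ B) : A ≅ B where
  hom := (c : ℤ) • e.hom
  inv := (c : ℤ) • e.inv
  hom_inv_id := by
    rw [Preadditive.zsmul_comp, Preadditive.comp_zsmul, smul_smul, e.hom_inv_id]
    simp [← Units.val_mul]
  inv_hom_id := by
    rw [Preadditive.zsmul_comp, Preadditive.comp_zsmul, smul_smul, e.inv_hom_id]
    simp [← Units.val_mul]

/-- The reindexing of degrees by a permutation. -/
def permDeg (σ : Equiv.Perm (Fin n)) (j : ℤ) :
    {p : Fin n → ℤ // ∑ i, p i = j} ≃ {p : Fin n → ℤ // ∑ i, p i = j} where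
  toFun p := ⟨fun i => p.1 (σ i), (Equiv.sum_comp σ p.1).trans p.2⟩
  invFun p := ⟨fun i => p.1 (σ.symm i), (Equiv.sum_comp σ.symm p.1).trans p.2⟩
  left_inv p := by ext i; simp
  right_inv p := by ext i; simp

lemma slotD_perm (σ : Equiv.Perm (Fin n)) (a : Fin n) (p q : Fin n → ℤ) :
    (fun l => slotD K (σ a) p q (σ l)) =
      slotD (fun i => K (σ i)) a (fun i => p (σ i)) (fun i => q (σ i)) := by
  funext l
  by_cases h : l = a
  · subst h
    rw [slotD_self, slotD_self (fun i => K (σ i))]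
  · exact (if_neg (σ.injective.ne h)).trans (if_neg h).symm

/-- Raising the `σ a`-th degree and reindexing agrees with reindexing and raising the `a`-th degree,
but not by definition; the proof generalizes over the index to avoid transport. -/
lemma map_slotD_perm (σ : Equiv.Perm (Fin n)) (a : Fin n) (p : Fin n → ℤ) {j : ℤ}
    (h : ∑ i, p (σ i) = j) (h' : ∑ i, bump p (σ a) (σ i) = j + 1) :
    F.map (fun l => slotD K (σ a) p (bump p (σ a)) (σ l)) ≫
      multiι F hF (fun i => K (σ i)) (fun i => bump p (σ a) (σ i)) (j + 1) h' =
    F.map (slotD (fun i => K (σ i)) a (fun i => p (σ i)) (bump (fun i => p (σ i)) a)) ≫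
      multiι F hF (fun i => K (σ i)) (bump (fun i => p (σ i)) a) (j + 1) (by rw [sum_bump, h]) := by
  have e : (fun i => bump p (σ a) (σ i)) = bump (fun i => p (σ i)) a := by
    funext i
    by_cases hi : i = a
    · subst hi; rw [bump_self, bump_self]
    · rw [bump_ne _ hi, bump_ne _ (σ.injective.ne hi)]
  have key : ∀ q (hq : (fun i => bump p (σ a) (σ i)) = q) (hq' : ∑ i, q i = j + 1),
      F.map (fun l => slotD K (σ a) p (bump p (σ a)) (σ l)) ≫
        multiι F hF (fun i => K (σ i)) (fun i => bump p (σ a) (σ i)) (j + 1) h' =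
      F.map (slotD (fun i => K (σ i)) a (fun i => p (σ i)) q) ≫
        multiι F hF (fun i => K (σ i)) q (j + 1) hq' := by
    rintro _ rfl _
    rw [← slotD_perm]
  exact key _ e _

/-- A common construction for both versions of `σ^#`: permute the summands, insert the isomorphisms
`τ` with their Koszul signs, and commute the equivalence `G` with the direct sum. -/
theorem exists_sharp (σ : Equiv.Perm (Fin n)) (G : D ⥤ D) [G.PreservesZeroMorphisms] [G.Additive]
    [G.IsEquivalence] (τ : ∀ A : Fin n → C, F.obj A ≅ G.obj (F.obj fun i => A (σ i)))
    (hτ : ∀ ⦃A B : Fin n → C⦄ (f : A ⟶ B),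
      F.map f ≫ (τ B).hom = (τ A).hom ≫ G.map (F.map fun i => f (σ i))) :
    ∃ s : multiTotal F hF K ≅ (G.mapHomologicalComplex (ComplexShape.up ℤ)).obj
        (multiTotal F hF fun i => K (σ i)),
      ∀ p j h, multiι F hF K p j h ≫ s.hom.f j = (permSign σ p : ℤ) •
        ((τ fun i => (K i).X (p i)).hom ≫ G.map (multiι F hF (fun i => K (σ i))
          (fun i => p (σ i)) j ((Equiv.sum_comp σ p).trans h))) := by
  obtain ⟨f, hf⟩ : ∃ f : ∀ j, (multiTotal F hF K).X j ≅
        G.obj ((multiTotal F hF fun i => K (σ i)).X j),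
      ∀ p j h, multiι F hF K p j h ≫ (f j).hom = (permSign σ p : ℤ) •
        ((τ fun i => (K i).X (p i)).hom ≫ G.map (multiι F hF (fun i => K (σ i))
          (fun i => p (σ i)) j ((Equiv.sum_comp σ p).trans h))) := by
    refine ⟨fun j => Sigma.whiskerEquiv (permDeg σ j) (fun p =>
        (signIso (permSign σ p.1) (τ fun i => (K i).X (p.1 i))).symm) ≪≫
      (PreservesCoproduct.iso G fun q : {q : Fin n → ℤ // ∑ i, q i = j} =>
        F.obj fun i => (K (σ i)).X (q.1 i)).symm, fun p j h => ?_⟩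
    have h1 : multiι F hF K p j h ≫ (Sigma.whiskerEquiv
        (f := fun p : {q : Fin n → ℤ // ∑ i, q i = j} => F.obj fun i => (K i).X (p.1 i))
        (g := fun q : {q : Fin n → ℤ // ∑ i, q i = j} =>
          G.obj (F.obj fun i => (K (σ i)).X (q.1 i))) (permDeg σ j) (fun p =>
        (signIso (permSign σ p.1) (τ fun i => (K i).X (p.1 i))).symm)).hom =
        (signIso (permSign σ p) (τ fun i => (K i).X (p i))).hom ≫
        Sigma.ι (fun q : {q : Fin n → ℤ // ∑ i, q i = j} =>
          G.obj (F.obj fun i => (K (σ i)).X (q.1 i))) (permDeg σ j ⟨p, h⟩) :=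
      Sigma.ι_comp_map' _ _ _
    have h2 := ι_comp_sigmaComparison G (fun q : {q : Fin n → ℤ // ∑ i, q i = j} =>
        F.obj fun i => (K (σ i)).X (q.1 i)) (permDeg σ j ⟨p, h⟩)
    rw [← PreservesCoproduct.inv_hom] at h2
    refine (Category.assoc _ _ _).symm.trans ((congrArg (· ≫ (PreservesCoproduct.iso G
      fun q : {q : Fin n → ℤ // ∑ i, q i = j} => F.obj fun i => (K (σ i)).X (q.1 i)).inv) h1).trans
      ?_)
    refine (Category.assoc _ _ _).trans ((congrArg
      ((signIso (permSign σ p) (τ fun i => (K i).X (p i))).hom ≫ ·) h2).trans ?_)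
    exact Preadditive.zsmul_comp _ _ _
  refine ⟨HomologicalComplex.Hom.isoOfComponents f ?_, hf⟩
  rintro j _ rfl
  refine multiTotal_ext K fun p hp => ?_
  have hp' := (Equiv.sum_comp σ p).trans hp
  have e1 := multiι_d (F := F) (hF := hF) (fun i => K (σ i)) (fun i => p (σ i)) hp'
  change multiι F hF K p j hp ≫ (f j).hom ≫
    G.map ((multiTotal F hF fun i => K (σ i)).d j (j + 1)) =
      multiι F hF K p j hp ≫ (multiTotal F hF K).d j (j + 1) ≫ (f (j + 1)).hom
  rw [← Category.assoc, hf, Preadditive.zsmul_comp, Category.assoc, ← G.map_comp, e1,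
    ← Category.assoc, multiι_d, Preadditive.sum_comp, G.map_sum, Preadditive.comp_sum,
    Finset.smul_sum]
  -- The sum over the entries of the original family is reindexed by `σ`, so that it can be compared
  -- term by term with the differential of the permuted family.
  refine Eq.trans ?_ (Equiv.sum_comp σ _)
  refine Finset.sum_congr rfl fun a _ => ?_
  rw [Preadditive.zsmul_comp, Category.assoc, hf, G.map_zsmul, Preadditive.comp_zsmul, smul_smul,
    Preadditive.comp_zsmul, smul_smul, ← Category.assoc, hτ, Category.assoc, ← G.map_comp,
    map_slotD_perm K σ a p hp']
  congr 1
  exact_mod_cast congrArg Units.val (koszulSign_permSign σ p a).symm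

end Sharp

/-! ### Permanence properties of local bijectivity -/

section Bijective

variable {Y : Type u} [TopologicalSpace Y] {A : Type*} [Category A] {FA : A → A → Type*}
  {CA : A → Type*} [∀ S T, FunLike (FA S T) (CA S) (CA T)] [ConcreteCategory A FA]
  {P Q R : (Opens Y)ᵒᵖ ⥤ A}

lemma isLocallyBijective_of_bijective (φ : P ⟶ Q)
    (h : ∀ U : Opens Y, Function.Bijective (φ.app (op U))) : IsLocallyBijective φ := by
  refine ⟨fun U s x hx => ?_, fun U s t e x hx => ⟨U, le_rfl, hx, ?_⟩⟩
  · obtain ⟨p, hp⟩ := (h U).2 s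
    exact ⟨U, le_rfl, hx, p, hp.trans (congr($(Q.map_id (op U)) s).trans
      (ConcreteCategory.id_apply s)).symm⟩
  · rw [(h U).1 e]

lemma IsLocallyBijective.comp [(Opens.grothendieckTopology Y).WEqualsLocallyBijective A]
    {φ : P ⟶ Q} {ψ : Q ⟶ R} (hφ : IsLocallyBijective φ)
    (hψ : IsLocallyBijective ψ) : IsLocallyBijective (φ ≫ ψ) := by
  rw [isLocallyBijective_iff] at hφ hψ ⊢
  exact MorphismProperty.comp_mem _ _ _ hφ hψ

end Bijective

/-! ### The isomorphism `σ^#` for complexes of sheaves -/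

section PermC

variable {E : Type v} [NormedAddCommGroup E] [NormedSpace ℂ E] {H : Type w} [TopologicalSpace H]
  (I : ModelWithCorners ℂ E H) {X : Type u} [TopologicalSpace X] [ChartedSpace H X] {n : ℕ}

/-- Together with `le_prImage_permPreim` this is an equality of open sets; it is kept as two
inclusions so that sections are compared by restriction and not by transport. -/
lemma prImage_permPreim_le (σ : Equiv.Perm (Fin n)) (U : Opens (Fin n → X)) (i : Fin n) :
    prImage i (permPreim I σ U) ≤ prImage (σ i) U := by
  rintro _ ⟨x, hx, rfl⟩
  exact permPreim_le (I := I) (fun x hx i => mem_prImage (U := U) hx i) x hx i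

lemma le_prImage_permPreim (σ : Equiv.Perm (Fin n)) (U : Opens (Fin n → X)) (i : Fin n) :
    prImage (σ i) U ≤ prImage i (permPreim I σ U) := by
  rintro _ ⟨x, hx, rfl⟩
  refine ⟨fun i => x (σ i), ?_, rfl⟩
  change (fun j => x (σ (σ⁻¹ j))) ∈ U
  simpa using hx

/-- The restriction between equal open subsets. -/
def preResEquiv (P : (Opens X)ᵒᵖ ⥤ ModuleCat.{u} ℂ) {U V : Opens X} (h : V ≤ U) (h' : U ≤ V) :
    P.obj (op U) ≃ₗ[ℂ] P.obj (op V) :=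
  LinearEquiv.ofLinearMap (preRes P h) (preRes P h')
    (LinearMap.ext fun s => (preRes_trans P h' h s).trans (preRes_refl P _ s))
    (LinearMap.ext fun s => (preRes_trans P h h' s).trans (preRes_refl P _ s))

/-- The reordering of the factors of `preBoxC` on sections over `U`. -/
def preBoxCPermEquiv (σ : Equiv.Perm (Fin n)) (A : Fin n → ModSheaf X) (U : Opens (Fin n → X)) :
    (preBoxC A).obj (op U) ≃ₗ[ℂ] (preBoxC fun i => A (σ i)).obj (op (permPreim I σ U)) :=
  (PiTensorProduct.reindex ℂ (fun i => SecC (A i) (prImage i U)) σ.symm).trans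
    (PiTensorProduct.congr fun i => preResEquiv (A (σ i)).obj (prImage_permPreim_le I σ U i)
      (le_prImage_permPreim I σ U i))

lemma preBoxCPermEquiv_tprod (σ : Equiv.Perm (Fin n)) (A : Fin n → ModSheaf X)
    (U : Opens (Fin n → X)) (s : ∀ i, SecC (A i) (prImage i U)) :
    preBoxCPermEquiv I σ A U (PiTensorProduct.tprod ℂ s) =
      PiTensorProduct.tprod ℂ fun i => preRes (A (σ i)).obj (prImage_permPreim_le I σ U i)
        (s (σ i)) := by
  refine (congrArg (PiTensorProduct.congr _) (PiTensorProduct.reindex_tprod σ.symm s)).trans ?_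
  exact PiTensorProduct.congr_tprod _ _

/-- The reordering of the factors of `preBoxC`. -/
def preBoxCPerm (σ : Equiv.Perm (Fin n)) (A : Fin n → ModSheaf X) :
    preBoxC A ⟶ (preim (permDiffeo I X σ).toHomeomorph).op ⋙ preBoxC fun i => A (σ i) where
  app U := ModuleCat.ofHom (preBoxCPermEquiv I σ A U.unop).toLinearMap
  naturality U V f := by
    refine ModuleCat.hom_ext (PiTensorProduct.ext (MultilinearMap.ext fun s => ?_))
    change preBoxCPermEquiv I σ A V.unop (PiTensorProduct.map _ (PiTensorProduct.tprod ℂ s)) =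
      PiTensorProduct.map _ (preBoxCPermEquiv I σ A U.unop (PiTensorProduct.tprod ℂ s))
    rw [PiTensorProduct.map_tprod, preBoxCPermEquiv_tprod, preBoxCPermEquiv_tprod,
      PiTensorProduct.map_tprod]
    refine congrArg (PiTensorProduct.tprod ℂ) (funext fun i => ?_)
    exact (preRes_trans (A (σ i)).obj _ _ _).trans (preRes_trans (A (σ i)).obj _ _ _).symm

/-- Reordering the tensor factors is bijective on sections of the presheaves, so its composite with
the canonical map to the direct image of the associated sheaf is locally bijective. -/
lemma exists_boxCPerm (σ : Equiv.Perm (Fin n)) (A : Fin n → ModSheaf X) :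
    ∃ τ : (boxCFunctor X n).obj A ≅
        (pushC (permDiffeo I X σ).toHomeomorph).obj ((boxCFunctor X n).obj fun i => A (σ i)),
      ∀ U s, mapC τ.hom U (boxSec A U s) =
        (boxSec (fun i => A (σ i)) (permPreim I σ U) fun i =>
          preRes (A (σ i)).obj (prImage_permPreim_le I σ U i) (s (σ i))) := by
  let f : preBoxC A ⟶ ((pushC (permDiffeo I X σ).toHomeomorph).obj
      ((boxCFunctor X n).obj fun i => A (σ i))).obj := preBoxCPerm I σ A ≫
    Functor.whiskerLeft (preim (permDiffeo I X σ).toHomeomorph).op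
      (toSheafify (Opens.grothendieckTopology (Fin n → X)) (preBoxC fun i => A (σ i)))
  have hf : IsLocallyBijective f :=
    (isLocallyBijective_of_bijective _ fun U => (preBoxCPermEquiv I σ A U).bijective).comp
      (isLocallyBijective_whisker _ (isLocallyBijective_toSheafify _))
  refine ⟨@asIso _ _ _ _ (sheafifyDesc f) (isIso_sheafifyDesc f hf), fun U s => ?_⟩
  refine (mapC_sheafifyDesc f U _).trans ?_
  exact congrArg (toShC (preBoxC fun i => A (σ i)) (permPreim I σ U))
    (preBoxCPermEquiv_tprod I σ A U s)

/-- The canonical isomorphism `⊠ Aᵢ ≅ σ_*(⊠ A_{σ(i)})` for sheaves of `ℂ`-modules. -/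
def boxCPerm (σ : Equiv.Perm (Fin n)) (A : Fin n → ModSheaf X) : (boxCFunctor X n).obj A ≅
    (pushC (permDiffeo I X σ).toHomeomorph).obj ((boxCFunctor X n).obj fun i => A (σ i)) :=
  (exists_boxCPerm I σ A).choose

lemma mapC_boxCPerm (σ : Equiv.Perm (Fin n)) (A : Fin n → ModSheaf X) (U : Opens (Fin n → X))
    (s : ∀ i, SecC (A i) (prImage i U)) : mapC (boxCPerm I σ A).hom U (boxSec A U s) =
      (boxSec (fun i => A (σ i)) (permPreim I σ U) fun i =>
        preRes (A (σ i)).obj (prImage_permPreim_le I σ U i) (s (σ i))) :=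
  (exists_boxCPerm I σ A).choose_spec U s

lemma boxCPerm_naturality (σ : Equiv.Perm (Fin n)) {A B : Fin n → ModSheaf X} (f : A ⟶ B) :
    (boxCFunctor X n).map f ≫ (boxCPerm I σ B).hom = (boxCPerm I σ A).hom ≫
      (pushC (permDiffeo I X σ).toHomeomorph).map
        ((boxCFunctor X n).map (fun i => f (σ i) : (fun i => A (σ i)) ⟶ fun i => B (σ i))) := by
  refine boxC_ext fun U s => ?_
  rw [mapC_comp, mapC_boxSec, mapC_boxCPerm, mapC_comp, mapC_boxCPerm]
  refine Eq.trans ?_ (mapC_boxSec (A := fun i => A (σ i)) (B := fun i => B (σ i))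
    (fun i => f (σ i)) (permPreim I σ U) _).symm
  refine congrArg (boxSec (fun i => B (σ i)) (permPreim I σ U)) (funext fun i => ?_)
  exact preRes_nat (f (σ i)).hom _ _

instance {Y : Type u} [TopologicalSpace Y] (Φ : Y ≃ₜ Y) : (pushC Φ).Additive where
  map_add := rfl

lemma isSharpC_iff (σ : Equiv.Perm (Fin n)) (K : Fin n → CochainComplex (ModSheaf X) ℤ)
    (s : boxC K ≅ (permPushC I X σ).obj (boxC fun i => K (σ i))) :
    IsSharpC σ K s ↔ ∀ (p : Fin n → ℤ) (j : ℤ) (h : ∑ i, p i = j),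
      boxCι K p j h ≫ s.hom.f j = (permSign σ p : ℤ) •
        ((boxCPerm I σ fun i => (K i).X (p i)).hom ≫
          (pushC (permDiffeo I X σ).toHomeomorph).map (boxCι (fun i => K (σ i))
            (fun i => p (σ i)) j ((Equiv.sum_comp σ p).trans h))) := by
  have key (p : Fin n → ℤ) (j : ℤ) (h : ∑ i, p i = j) (U : Opens (Fin n → X))
      (m : ∀ i, SecC ((K i).X (p i)) (prImage i U)) :
      mapC ((permSign σ p : ℤ) • ((boxCPerm I σ fun i => (K i).X (p i)).hom ≫
          (pushC (permDiffeo I X σ).toHomeomorph).map (boxCι (fun i => K (σ i))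
            (fun i => p (σ i)) j ((Equiv.sum_comp σ p).trans h)))) U (boxSec _ U m) =
      (permSign σ p : ℤ) • (mapC (boxCι (fun i => K (σ i))
            (fun i => p (σ i)) j ((Equiv.sum_comp σ p).trans h)) (permPreim I σ U)
          (boxSec (fun i => (K (σ i)).X (p (σ i))) (permPreim I σ U) fun i =>
            preRes ((K (σ i)).X (p (σ i))).obj (prImage_permPreim_le I σ U i) (m (σ i))) :
              SecC _ (permPreim I σ U)) := by
    rw [mapC_zsmul, mapC_comp, mapC_boxCPerm]
    rfl
  constructor
  · intro hs p j h
    refine boxC_ext fun U m => ?_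
    refine Eq.trans ?_ (key p j h U m).symm
    refine Eq.trans (congrArg (mapC (s.hom.f j) U) ?_) (hs p j h U (fun i => prImage i U)
      (fun x hx i => mem_prImage hx i) m)
    refine congrArg (mapC (boxCι K p j h) U) (congrArg (boxSec _ U) (funext fun i => ?_))
    exact (preRes_refl _ _ _).symm
  · intro hs p j h U V hV m
    have e := congrArg (fun f => mapC f U (boxSec _ U fun i =>
      preRes ((K i).X (p i)).obj (prImage_le hV i) (m i))) (hs p j h)
    refine (e.trans (key p j h U _)).trans ?_
    refine congrArg ((permSign σ p : ℤ) • ·) (congrArg (mapC (boxCι (fun i => K (σ i))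
      (fun i => p (σ i)) j ((Equiv.sum_comp σ p).trans h)) (permPreim I σ U))
      (congrArg (boxSec _ _) (funext fun i => ?_)))
    exact preRes_trans _ _ _ _

theorem existsUnique_isSharpC (σ : Equiv.Perm (Fin n)) (K : Fin n → CochainComplex (ModSheaf X) ℤ) :
    ∃! s : boxC K ≅ (permPushC I X σ).obj (boxC fun i => K (σ i)), IsSharpC σ K s := by
  obtain ⟨s, hs⟩ := exists_sharp (hF := boxCFunctor_map_zero) K σ
    (pushC (permDiffeo I X σ).toHomeomorph) (boxCPerm I σ)
    (fun A B f => boxCPerm_naturality I σ f)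
  refine ⟨s, (isSharpC_iff I σ K s).2 hs, fun s' hs' => ?_⟩
  replace hs' := (isSharpC_iff I σ K s').1 hs'
  ext j : 2
  exact multiTotal_ext _ fun p h => (hs' p j h).trans (hs p j h).symm

end PermC

/-! ### Reordering the generators of an external product of `𝒟`-modules -/

section PermO

variable {E : Type v} [NormedAddCommGroup E] [NormedSpace ℂ E] {H : Type w} [TopologicalSpace H]
  {I : ModelWithCorners ℂ E H} {X : Type u} [TopologicalSpace X] [ChartedSpace H X] {n : ℕ}

lemma secRes_bijective (P : PresheafOfModules.{u} (preD I X)) {U V : Opens X} (h : V ≤ U)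
    (h' : U ≤ V) : Function.Bijective (secRes P h) := by
  refine Function.bijective_iff_has_inverse.2 ⟨secRes P h', fun m => ?_, fun m => ?_⟩
  · rw [secRes_trans, secRes_refl]
  · rw [secRes_trans, secRes_refl]

/-- The semilinear map on `BoxO P U` which is given by a map on the generators. -/
def boxSemi {P Q : Fin n → PresheafOfModules.{u} (preD I X)} {U U' : Opens (Fin n → X)}
    (ρ : DiffOp (powModel I n) U →ₐ[ℂ] DiffOp (powModel I n) U') (θ : SecFam P U → SecFam Q U')
    (hadd : ∀ (m : SecFam P U) (i : Fin n) (a a' : Sec (P i) (prImage i U)),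
      boxGen (θ (Function.update m i (a + a'))) =
        boxGen (θ (Function.update m i a)) + boxGen (θ (Function.update m i a')))
    (hact : ∀ (m : SecFam P U) (i : Fin n) (T : DiffOp I (prImage i U))
      (T' : DiffOp (powModel I n) U), IsLift i T T' →
      boxGen (θ (Function.update m i (MulOpposite.op T • m i))) =
        MulOpposite.op (ρ T') • boxGen (θ m)) :
    BoxO P U →ₛₗ[ρ.toRingHom.op] BoxO Q U' :=
  letI : Module (DiffOp (powModel I n) U)ᵐᵒᵖ (BoxO Q U') := Module.compHom _ ρ.toRingHom.op
  let f : BoxO P U →ₗ[(DiffOp (powModel I n) U)ᵐᵒᵖ] BoxO Q U' :=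
    boxDesc (fun m => boxGen (θ m)) hadd hact
  { toFun := f, map_add' := f.map_add, map_smul' := f.map_smul }

lemma boxSemi_smul_gen {P Q : Fin n → PresheafOfModules.{u} (preD I X)} {U U' : Opens (Fin n → X)}
    (ρ : DiffOp (powModel I n) U →ₐ[ℂ] DiffOp (powModel I n) U') (θ : SecFam P U → SecFam Q U')
    (hadd) (hact) (T : DiffOp (powModel I n) U) (m : SecFam P U) :
    boxSemi ρ θ hadd hact (MulOpposite.op T • boxGen m) = MulOpposite.op (ρ T) • boxGen (θ m) := by
  rw [LinearMap.map_smulₛₗ]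
  refine congrArg (MulOpposite.op (ρ T) • ·) ?_
  let _ : Module (DiffOp (powModel I n) U)ᵐᵒᵖ (BoxO Q U') := Module.compHom _ ρ.toRingHom.op
  exact boxDesc_gen (fun m => boxGen (θ m)) hadd hact m

variable (σ : Equiv.Perm (Fin n)) (P : Fin n → PresheafOfModules.{u} (preD I X))
  (U : Opens (Fin n → X))

/-- The family `m_{σ(i)}`. -/
def permFam (m : SecFam P U) : SecFam (fun i => P (σ i)) (permPreim I σ U) :=
  fun i => secRes (P (σ i)) (prImage_permPreim_le I σ U i) (m (σ i))

lemma permFam_update (m : SecFam P U) (i : Fin n) (a : Sec (P (σ i)) (prImage (σ i) U)) :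
    permFam σ P U (Function.update m (σ i) a) = Function.update (permFam σ P U m) i
      (secRes (P (σ i)) (prImage_permPreim_le I σ U i) a) := by
  funext l
  by_cases h : l = i
  · subst h
    rw [permFam, Function.update_self, Function.update_self]
  · rw [permFam, Function.update_of_ne (σ.injective.ne h), Function.update_of_ne h]
    rfl

lemma permFam_bijective : Function.Bijective (permFam σ P U) := by
  have hb (i : Fin n) := secRes_bijective (P (σ i)) (prImage_permPreim_le I σ U i)
    (le_prImage_permPreim I σ U i)
  refine ⟨fun m m' h => funext fun i => ?_, fun m => ?_⟩
  · obtain ⟨i, rfl⟩ := σ.surjective i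
    exact (hb i).1 (congrFun h i)
  · choose s hs using fun i => (hb i).2 (m i)
    refine ⟨Equiv.piCongrLeft (fun j => Sec (P j) (prImage j U)) σ s, funext fun i => ?_⟩
    rw [permFam, Equiv.piCongrLeft_apply_apply, hs]

/-- The map `⊠ mᵢ ↦ ⊠ m_{σ(i)}`. -/
def boxPerm : BoxO P U →ₛₗ[(pullD (permDiffeo I X σ) U).toRingHom.op]
    BoxO (fun i => P (σ i)) (permPreim I σ U) :=
  boxSemi (pullD (permDiffeo I X σ) U) (permFam σ P U)
    (fun m i a a' => by
      obtain ⟨i, rfl⟩ := σ.surjective i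
      rw [permFam_update, permFam_update, permFam_update, map_add, boxGen_add])
    (fun m i T T' hT => by
      obtain ⟨i, rfl⟩ := σ.surjective i
      rw [permFam_update, secRes_smul]
      exact boxGen_act (permFam σ P U m) i _ _ (hT.pullD.res (prImage_permPreim_le I σ U i) le_rfl))

lemma boxPerm_smul_gen (T : DiffOp (powModel I n) U) (m : SecFam P U) :
    boxPerm σ P U (MulOpposite.op T • boxGen m) =
      MulOpposite.op (pullD (permDiffeo I X σ) U T) • boxGen (permFam σ P U m) :=
  boxSemi_smul_gen _ _ _ _ T m

lemma permDiffeo_inv_apply (y : Fin n → X) :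
    permDiffeo I X σ⁻¹ (permDiffeo I X σ y) = y :=
  funext fun i => congrArg y (σ⁻¹.apply_symm_apply i)

lemma permDiffeo_apply_inv (y : Fin n → X) :
    permDiffeo I X σ (permDiffeo I X σ⁻¹ y) = y :=
  funext fun i => congrArg y (σ.apply_symm_apply i)

lemma le_permPreim_permPreim : U ≤ permPreim I σ⁻¹ (permPreim I σ U) := fun y hy => by
  change permDiffeo I X σ (permDiffeo I X σ⁻¹ y) ∈ U
  rwa [permDiffeo_apply_inv]

/-- The transport of differential operators from `σ⁻¹(U)` to `U`. -/
def permPushOp : DiffOp (powModel I n) (permPreim I σ U) →ₐ[ℂ] DiffOp (powModel I n) U :=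
  (diffOpRes (le_permPreim_permPreim σ U)).comp (pullD (permDiffeo I X σ⁻¹) (permPreim I σ U))

lemma permPushOp_pullD (T : DiffOp (powModel I n) U) :
    permPushOp σ U (pullD (permDiffeo I X σ) U T) = T := by
  have hle : permPreim I σ⁻¹ (permPreim I σ U) ≤ U := fun y hy => by
    have : permDiffeo I X σ (permDiffeo I X σ⁻¹ y) ∈ U := hy
    rwa [permDiffeo_apply_inv] at this
  exact congrArg (diffOpRes _) (pullD_pullD (permDiffeo I X σ⁻¹) (permDiffeo I X σ)
    (permDiffeo_apply_inv σ) U T hle)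

lemma pullD_diffOpRes {Y : Type u} [TopologicalSpace Y] [ChartedSpace H Y] (Φ : Y ≃ₘ^ω⟮I, I⟯ Y)
    {U V : Opens Y} (h : V ≤ U) (T : DiffOp I U) : pullD Φ V (diffOpRes h T) =
      diffOpRes ((preim Φ.toHomeomorph).monotone h) (pullD Φ U T) :=
  Subtype.ext (Op.ext fun _ _ _ => rfl)

lemma diffOpRes_diffOpRes {Y : Type u} [TopologicalSpace Y] [ChartedSpace H Y] {U V : Opens Y}
    (h : V ≤ U) (h' : U ≤ V) (T : DiffOp I U) : diffOpRes h' (diffOpRes h T) = T :=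
  Subtype.ext (Op.ext fun _ _ _ => rfl)

lemma pullD_permPushOp (T : DiffOp (powModel I n) (permPreim I σ U)) :
    pullD (permDiffeo I X σ) U (permPushOp σ U T) = T := by
  have hle : permPreim I σ (permPreim I σ⁻¹ (permPreim I σ U)) ≤ permPreim I σ U := fun y hy => by
    have : permDiffeo I X σ (permDiffeo I X σ⁻¹ (permDiffeo I X σ y)) ∈ U := hy
    rwa [permDiffeo_apply_inv] at this
  have h1 := pullD_diffOpRes (permDiffeo I X σ) (le_permPreim_permPreim (I := I) σ U)
    (pullD (permDiffeo I X σ⁻¹) (permPreim I σ U) T)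
  have h2 := pullD_pullD (permDiffeo I X σ) (permDiffeo I X σ⁻¹) (permDiffeo_inv_apply σ)
    (permPreim I σ U) T hle
  have h3 := diffOpRes_diffOpRes hle ((preim (permDiffeo I X σ).toHomeomorph).monotone
    (le_permPreim_permPreim (I := I) σ U)) T
  exact h1.trans ((congrArg _ h2).trans h3)

lemma IsLift.permPushOp {i : Fin n} {T : DiffOp I (prImage i (permPreim I σ U))}
    {T' : DiffOp (powModel I n) (permPreim I σ U)} (h : IsLift i T T') :
    IsLift (σ i) (diffOpRes (le_prImage_permPreim I σ U i) T) (permPushOp σ U T') := by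
  refine IsLift.res (P := T) (IsLift.pullD (σ := σ⁻¹) (j := σ i) ?_) _ _
  simpa using h

/-- The inverse is constructed in the same way as the map itself: invert the bijection of families
of generators, and transport operators along `σ⁻¹`. -/
lemma boxPerm_bijective : Function.Bijective (boxPerm σ P U) := by
  let e := Equiv.ofBijective _ (permFam_bijective σ P U)
  -- The relations are respected because a lift in direction `i` becomes, after transport, a lift in
  -- direction `σ i`.
  let ψ := boxSemi (P := fun i => P (σ i)) (Q := P) (permPushOp σ U) e.symm
      (fun m i a a' => by
        obtain ⟨m, rfl⟩ := e.surjective m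
        obtain ⟨a, rfl⟩ := (secRes_bijective (P (σ i)) (prImage_permPreim_le I σ U i)
          (le_prImage_permPreim I σ U i)).2 a
        obtain ⟨a', rfl⟩ := (secRes_bijective (P (σ i)) (prImage_permPreim_le I σ U i)
          (le_prImage_permPreim I σ U i)).2 a'
        have h (b) : e.symm (Function.update (e m) i
            (secRes (P (σ i)) (prImage_permPreim_le I σ U i) b)) = Function.update m (σ i) b :=
          e.symm_apply_eq.2 (permFam_update σ P U m i b).symm
        rw [← map_add, h, h, h, boxGen_add])
      (fun m i T T' hT => by
        obtain ⟨m, rfl⟩ := e.surjective m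
        have h (b) : e.symm (Function.update (e m) i
            (secRes (P (σ i)) (prImage_permPreim_le I σ U i) b)) = Function.update m (σ i) b :=
          e.symm_apply_eq.2 (permFam_update σ P U m i b).symm
        have h2 : MulOpposite.op T • e m i = secRes (P (σ i)) (prImage_permPreim_le I σ U i)
            (MulOpposite.op (diffOpRes (le_prImage_permPreim I σ U i) T) • m (σ i)) := by
          rw [secRes_smul]; rfl
        rw [h2, h, e.symm_apply_apply]
        exact boxGen_act m (σ i) _ _ (hT.permPushOp σ U))
  refine Function.bijective_iff_has_inverse.2 ⟨ψ, fun t => ?_, fun t => ?_⟩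
  · induction t using box_induction with
    | hg T m =>
      rw [boxPerm_smul_gen]
      refine (boxSemi_smul_gen _ _ _ _ _ _).trans ?_
      rw [permPushOp_pullD]
      exact congrArg (fun m => MulOpposite.op T • boxGen m) (e.symm_apply_apply m)
    | h0 => rw [map_zero, map_zero]
    | ha s t hs ht => rw [map_add, map_add, hs, ht]
  · induction t using box_induction with
    | hg T m =>
      refine (congrArg (boxPerm σ P U) (boxSemi_smul_gen _ _ _ _ T m)).trans ?_
      rw [boxPerm_smul_gen, pullD_permPushOp]
      exact congrArg (fun m => MulOpposite.op T • boxGen m) (e.apply_symm_apply m)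
    | h0 => rw [map_zero, map_zero]
    | ha s t hs ht => rw [map_add, map_add, hs, ht]

lemma boxPerm_boxRes {U V : Opens (Fin n → X)} (h : V ≤ U) (t : BoxO P U) :
    boxPerm σ P V (boxRes P h t) = boxRes (fun i => P (σ i))
      ((preim (permDiffeo I X σ).toHomeomorph).monotone h) (boxPerm σ P U t) := by
  induction t using box_induction with
  | hg T m =>
    rw [boxRes_smul_gen, boxPerm_smul_gen, boxPerm_smul_gen, boxRes_smul_gen]
    refine congrArg (fun m => MulOpposite.op (pullD (permDiffeo I X σ) V (diffOpRes h T)) •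
      boxGen m) (funext fun i => ?_)
    exact (secRes_trans (P (σ i)) _ _ _).trans (secRes_trans (P (σ i)) _ _ _).symm
  | h0 => simp only [map_zero]
  | ha s t hs ht => simp only [map_add, hs, ht]

end PermO

/-! ### The module structure on a direct image -/

section PushD

variable {E : Type v} [NormedAddCommGroup E] [NormedSpace ℂ E] {H : Type w} [TopologicalSpace H]
  {I : ModelWithCorners ℂ E H} {Y : Type u} [TopologicalSpace Y] [ChartedSpace H Y]

/-- Operators act on `Φ_* M` through the map of sheaves of rings `pullShD`, which on sections coming
from the presheaf is `pullD`. -/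
lemma toPushSec_smul (Φ : Y ≃ₘ^ω⟮I, I⟯ Y) (M : RightDMod I Y) {U : Opens Y} (T : DiffOp I U)
    (m : SecD M ((preim Φ.toHomeomorph).obj U)) :
    MulOpposite.op T • toPushSec Φ M m = toPushSec Φ M (MulOpposite.op (pullD Φ U T) • m) :=
  congrArg (fun r : (shD I Y).obj.obj (op ((preim Φ.toHomeomorph).obj U)) =>
    (r • (show M.val.obj (op ((preim Φ.toHomeomorph).obj U)) from m) :
      M.val.obj (op ((preim Φ.toHomeomorph).obj U)))) (pullShD_toShD Φ U T)

instance (Φ : Y ≃ₘ^ω⟮I, I⟯ Y) : (pushD Φ).Additive where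
  map_add := rfl

end PushD

/-! ### The isomorphism `σ^#` for complexes of right `𝒟`-modules -/

section PermO

variable {E : Type v} [NormedAddCommGroup E] [NormedSpace ℂ E] {H : Type w} [TopologicalSpace H]
  {I : ModelWithCorners ℂ E H} {X : Type u} [TopologicalSpace X] [ChartedSpace H X] {n : ℕ}

lemma secMap_secRes {Y : Type u} [TopologicalSpace Y] [ChartedSpace H Y]
    {P Q : PresheafOfModules.{u} (preD I Y)} (f : P ⟶ Q) {U V : Opens Y} (h : V ≤ U)
    (m : Sec P U) : secMap f V (secRes P h m) = secRes Q h (secMap f U m) :=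
  PresheafOfModules.naturality_apply f (homOfLE h).op m

/-- By the sheafification adjunction a morphism is determined on the presheaf `preBoxO`, which is
generated by the `⊠ mᵢ` under differential operators. -/
lemma boxOHom_ext {M : Fin n → RightDMod I X} {N : RightDMod (powModel I n) (Fin n → X)}
    {f g : (boxOFunctor I X n).obj M ⟶ N}
    (h : ∀ U m, mapD f U (boxMSec M U m) = mapD g U (boxMSec M U m)) : f = g := by
  suffices key : boxUnit M ≫ (toPre _ _).map f = boxUnit M ≫ (toPre _ _).map g from
    ((PresheafOfModules.sheafificationAdjunction (toShD (powModel I n) (Fin n → X))).homEquiv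
      (preBoxO fun i => (toPre I X).obj (M i)) N).injective
      ((Adjunction.homEquiv_unit _ _ _ _).trans
        (key.trans (Adjunction.homEquiv_unit _ _ _ _).symm))
  have key (U : Opens (Fin n → X)) (t : BoxO (fun i => (toPre I X).obj (M i)) U) :
      secMap (boxUnit M ≫ (toPre _ _).map f) U t = secMap (boxUnit M ≫ (toPre _ _).map g) U t := by
    induction t using box_induction with
    | hg T m =>
      exact ((secMap (boxUnit M ≫ (toPre _ _).map f) U).map_smul
        (MulOpposite.op T) (boxGenSec m)).trans ((congrArg (MulOpposite.op T • ·) (h U m)).trans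
        ((secMap (boxUnit M ≫ (toPre _ _).map g) U).map_smul
        (MulOpposite.op T) (boxGenSec m)).symm)
    | h0 =>
      exact (map_zero (secMap (boxUnit M ≫ (toPre _ _).map f) U)).trans
        (map_zero (secMap (boxUnit M ≫ (toPre _ _).map g) U)).symm
    | ha s t hs ht =>
      exact (map_add (secMap (boxUnit M ≫ (toPre _ _).map f) U) _ _).trans
        ((congrArg₂ (· + ·) hs ht).trans
        (map_add (secMap (boxUnit M ≫ (toPre _ _).map g) U) _ _).symm)
  exact PresheafOfModules.hom_ext fun U => ModuleCat.hom_ext (LinearMap.ext fun t => key U.unop t)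

variable (σ : Equiv.Perm (Fin n)) (M : Fin n → RightDMod I X)

/-- The reordering of the factors of `preBoxO`, as a map of presheaves of abelian groups. -/
def preBoxOPermAb : (preBoxO fun i => (toPre I X).obj (M i)).presheaf ⟶
    (preim (permDiffeo I X σ).toHomeomorph).op ⋙
      (preBoxO fun i => (toPre I X).obj (M (σ i))).presheaf where
  app U := AddCommGrpCat.ofHom (boxPerm σ (fun i => (toPre I X).obj (M i)) U.unop).toAddMonoidHom
  naturality U V f := by
    ext t
    exact boxPerm_boxRes σ _ f.unop.le t

/-- The map `⊠ mᵢ ↦ σ_*(⊠ m_{σ(i)})`. -/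
def preBoxOPerm : (preBoxO fun i => (toPre I X).obj (M i)) ⟶
    (toPre (powModel I n) (Fin n → X)).obj ((pushD (permDiffeo I X σ)).obj
      ((boxOFunctor I X n).obj fun i => M (σ i))) :=
  PresheafOfModules.homMk
    (preBoxOPermAb σ M ≫ Functor.whiskerLeft (preim (permDiffeo I X σ).toHomeomorph).op
      ((PresheafOfModules.toPresheaf _).map (boxUnit fun i => M (σ i))))
    fun U r t => by
      refine (congrArg (secMap (boxUnit fun i => M (σ i)) (permPreim I σ U.unop))
        ((boxPerm σ (fun i => (toPre I X).obj (M i)) U.unop).map_smulₛₗ r t)).trans ?_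
      refine ((secMap (boxUnit fun i => M (σ i)) (permPreim I σ U.unop)).map_smul _ _).trans ?_
      exact (toPushSec_smul (permDiffeo I X σ) _ (MulOpposite.unop r) _).symm

lemma toPresheaf_boxUnit : (PresheafOfModules.toPresheaf _).map (boxUnit M) =
    toSheafify (Opens.grothendieckTopology (Fin n → X))
      (preBoxO fun i => (toPre I X).obj (M i)).presheaf :=
  PresheafOfModules.toPresheaf_map_sheafificationAdjunction_unit_app _ _

/-- The morphism comes from the adjunction; that it is invertible is seen on the underlying
presheaves of abelian groups, where reordering is bijective and the canonical maps are locally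
bijective. -/
lemma exists_boxOPerm : ∃ τ : (boxOFunctor I X n).obj M ≅ (pushD (permDiffeo I X σ)).obj
      ((boxOFunctor I X n).obj fun i => M (σ i)),
    ∀ U m, mapD τ.hom U (boxMSec M U m) = toPushSec (permDiffeo I X σ) _
      (boxMSec (fun i => M (σ i)) (permPreim I σ U)
        (permFam σ (fun i => (toPre I X).obj (M i)) U m)) := by
  let f := ((PresheafOfModules.sheafificationAdjunction
    (toShD (powModel I n) (Fin n → X))).homEquiv _ _).symm (preBoxOPerm σ M)
  have hf : boxUnit M ≫ (toPre (powModel I n) (Fin n → X)).map f = preBoxOPerm σ M :=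
    (Adjunction.homEquiv_unit _ _ _ _).symm.trans (Equiv.apply_symm_apply _ _)
  have hW : (Opens.grothendieckTopology (Fin n → X)).W
      ((PresheafOfModules.toPresheaf _).map (preBoxOPerm σ M)) := by
    rw [← isLocallyBijective_iff]
    have e : (PresheafOfModules.toPresheaf _).map (preBoxOPerm σ M) = preBoxOPermAb σ M ≫
      Functor.whiskerLeft (preim (permDiffeo I X σ).toHomeomorph).op
      ((PresheafOfModules.toPresheaf _).map (boxUnit fun i => M (σ i))) := rfl
    rw [e]
    refine IsLocallyBijective.comp (isLocallyBijective_of_bijective _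
      fun U => boxPerm_bijective σ (fun i => (toPre I X).obj (M i)) U) ?_
    refine isLocallyBijective_whisker _ ?_
    rw [toPresheaf_boxUnit]
    exact isLocallyBijective_toSheafify _
  have : IsIso f := by
    -- The forgetful functor to sheaves of abelian groups reflects isomorphisms; there, two out of
    -- three applies to the canonical map followed by `f`.
    have h1 : IsIso ((SheafOfModules.toSheaf _).map f) := by
      rw [← GrothendieckTopology.W_sheafToPresheaf_map_iff_isIso]
      refine MorphismProperty.of_precomp _ (W' := (Opens.grothendieckTopology (Fin n → X)).W)
        ((PresheafOfModules.toPresheaf _).map (boxUnit M)) _ ?_ ?_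
      · rw [toPresheaf_boxUnit]
        exact GrothendieckTopology.W_toSheafify _ _
      · rw [← hf] at hW
        exact hW
    exact isIso_of_reflects_iso f (SheafOfModules.toSheaf _)
  refine ⟨@asIso _ _ _ _ f this, fun U m => ?_⟩
  refine (congrArg (fun g => secMap g U (boxGenSec m)) hf).trans ?_
  refine congrArg (secMap (boxUnit fun i => M (σ i)) (permPreim I σ U)) ?_
  have := boxPerm_smul_gen σ (fun i => (toPre I X).obj (M i)) U 1 m
  rw [map_one, MulOpposite.op_one, MulOpposite.op_one, one_smul, one_smul] at this
  exact this

/-- The canonical isomorphism `⊠ Mᵢ ≅ σ_*(⊠ M_{σ(i)})` for right `𝒟`-modules. -/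
def boxOPerm : (boxOFunctor I X n).obj M ≅ (pushD (permDiffeo I X σ)).obj
    ((boxOFunctor I X n).obj fun i => M (σ i)) :=
  (exists_boxOPerm σ M).choose

lemma mapD_boxOPerm (U : Opens (Fin n → X)) (m : ∀ i, SecD (M i) (prImage i U)) :
    mapD (boxOPerm σ M).hom U (boxMSec M U m) = toPushSec (permDiffeo I X σ) _
      (boxMSec (fun i => M (σ i)) (permPreim I σ U)
        (permFam σ (fun i => (toPre I X).obj (M i)) U m)) :=
  (exists_boxOPerm σ M).choose_spec U m

lemma mapD_comp {Y : Type u} [TopologicalSpace Y] [ChartedSpace H Y] {M N P : RightDMod I Y}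
    (f : M ⟶ N) (g : N ⟶ P) (U : Opens Y) (m : SecD M U) :
    mapD (f ≫ g) U m = mapD g U (mapD f U m) := rfl

lemma mapD_zsmul {Y : Type u} [TopologicalSpace Y] [ChartedSpace H Y] {M N : RightDMod I Y}
    (c : ℤ) (f : M ⟶ N) (U : Opens Y) (m : SecD M U) : mapD (c • f) U m = c • mapD f U m := by
  let T : (M ⟶ N) →+ SecD N U := AddMonoidHom.mk' (fun f => mapD f U m) fun _ _ => rfl
  exact map_zsmul T c f

lemma mapD_pushD {Y : Type u} [TopologicalSpace Y] [ChartedSpace H Y] (Φ : Y ≃ₘ^ω⟮I, I⟯ Y)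
    {M N : RightDMod I Y} (f : M ⟶ N) (U : Opens Y) (m : SecD M ((preim Φ.toHomeomorph).obj U)) :
    mapD ((pushD Φ).map f) U (toPushSec Φ M m) = toPushSec Φ N (mapD f _ m) := rfl

variable {M} in
lemma boxOPerm_naturality {N : Fin n → RightDMod I X} (f : M ⟶ N) :
    (boxOFunctor I X n).map f ≫ (boxOPerm σ N).hom = (boxOPerm σ M).hom ≫
      (pushD (permDiffeo I X σ)).map ((boxOFunctor I X n).map
        (fun i => f (σ i) : (fun i => M (σ i)) ⟶ fun i => N (σ i))) := by
  refine boxOHom_ext fun U m => ?_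
  rw [mapD_comp, mapD_boxMSec, mapD_boxOPerm, mapD_comp, mapD_boxOPerm]
  refine Eq.trans ?_ (congrArg (toPushSec (permDiffeo I X σ) _)
    (mapD_boxMSec (M := fun i => M (σ i)) (N := fun i => N (σ i))
    (fun i => f (σ i)) (permPreim I σ U) _)).symm
  refine congrArg (fun m => toPushSec (permDiffeo I X σ) _
    (boxMSec (fun i => N (σ i)) (permPreim I σ U) m)) (funext fun i => ?_)
  exact (secMap_secRes ((toPre I X).map (f (σ i))) _ _).symm

lemma isSharpO_iff (M : Fin n → CochainComplex (RightDMod I X) ℤ)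
    (t : boxO M ≅ (permPushD I X σ).obj (boxO fun i => M (σ i))) :
    IsSharpO σ M t ↔ ∀ (p : Fin n → ℤ) (j : ℤ) (h : ∑ i, p i = j),
      boxOι M p j h ≫ t.hom.f j = (permSign σ p : ℤ) •
        ((boxOPerm σ fun i => (M i).X (p i)).hom ≫
          (pushD (permDiffeo I X σ)).map (boxOι (fun i => M (σ i))
            (fun i => p (σ i)) j ((Equiv.sum_comp σ p).trans h))) := by
  have key (p : Fin n → ℤ) (j : ℤ) (h : ∑ i, p i = j) (U : Opens (Fin n → X))
      (m : ∀ i, SecD ((M i).X (p i)) (prImage i U)) :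
      mapD ((permSign σ p : ℤ) • ((boxOPerm σ fun i => (M i).X (p i)).hom ≫
          (pushD (permDiffeo I X σ)).map (boxOι (fun i => M (σ i))
            (fun i => p (σ i)) j ((Equiv.sum_comp σ p).trans h)))) U (boxMSec _ U m) =
      (permSign σ p : ℤ) • toPushSec (permDiffeo I X σ) _ (mapD (boxOι (fun i => M (σ i))
            (fun i => p (σ i)) j ((Equiv.sum_comp σ p).trans h)) (permPreim I σ U)
          (boxMSec (fun i => (M (σ i)).X (p (σ i))) (permPreim I σ U)
            (permFam σ (fun i => (toPre I X).obj ((M i).X (p i))) U m))) := by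
    rw [mapD_zsmul, mapD_comp, mapD_boxOPerm, mapD_pushD]
  constructor
  · intro ht p j h
    refine boxOHom_ext fun U m => ?_
    refine Eq.trans ?_ (key p j h U m).symm
    refine Eq.trans (congrArg (mapD (t.hom.f j) U) ?_) (ht p j h U (fun i => prImage i U)
      (fun x hx i => mem_prImage hx i) m)
    refine congrArg (mapD (boxOι M p j h) U) (congrArg (boxMSec _ U) (funext fun i => ?_))
    exact (secRes_refl _ _ _).symm
  · intro ht p j h U V hV m
    have e := congrArg (fun f => mapD f U (boxMSec _ U fun i =>
      secRes ((toPre I X).obj ((M i).X (p i))) (prImage_le hV i) (m i))) (ht p j h)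
    refine (e.trans (key p j h U _)).trans ?_
    refine congrArg ((permSign σ p : ℤ) • ·) (congrArg (toPushSec (permDiffeo I X σ) _)
      (congrArg (mapD (boxOι (fun i => M (σ i))
      (fun i => p (σ i)) j ((Equiv.sum_comp σ p).trans h)) (permPreim I σ U))
      (congrArg (boxMSec _ _) (funext fun i => ?_))))
    exact secRes_trans _ _ _ _

theorem existsUnique_isSharpO (M : Fin n → CochainComplex (RightDMod I X) ℤ) :
    ∃! t : boxO M ≅ (permPushD I X σ).obj (boxO fun i => M (σ i)), IsSharpO σ M t := by
  obtain ⟨t, ht⟩ := exists_sharp (hF := boxOFunctor_map_zero) M σ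
    (pushD (permDiffeo I X σ)) (boxOPerm σ)
    (fun A B f => boxOPerm_naturality σ f)
  refine ⟨t, (isSharpO_iff σ M t).2 ht, fun t' ht' => ?_⟩
  replace ht' := (isSharpO_iff σ M t').1 ht'
  ext j : 2
  exact multiTotal_ext _ fun p h => (ht' p j h).trans (ht p j h).symm

end PermO

/-! ### Total complexes and equivalences -/

section Total

variable {C : Type*} [Category C] [Preadditive C] [HasCoproducts.{0} C]

/-- The equivalence `G` commutes with the direct sums, and `ε` matches both differentials without a
sign, so the signs in the two total complexes agree. -/
theorem exists_totalIso (G : C ⥤ C) [G.PreservesZeroMorphisms] [G.Additive] [G.IsEquivalence]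
    (K L : HomologicalComplex₂ C (ComplexShape.up ℤ) (ComplexShape.down ℕ))
    (ε : ∀ p k, (K.X p).X k ≅ G.obj ((L.X p).X k))
    (h₁ : ∀ p k, (K.d p (p + 1)).f k ≫ (ε (p + 1) k).hom =
      (ε p k).hom ≫ G.map ((L.d p (p + 1)).f k))
    (h₂ : ∀ p k l, (K.X p).d k l ≫ (ε p l).hom = (ε p k).hom ≫ G.map ((L.X p).d k l)) :
    ∃ e : K.total (ComplexShape.up ℤ) ≅
        (G.mapHomologicalComplex (ComplexShape.up ℤ)).obj (L.total (ComplexShape.up ℤ)),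
      ∀ p k j, K.ιTotalOrZero (ComplexShape.up ℤ) p k j ≫ e.hom.f j =
        (ε p k).hom ≫ G.map (L.ιTotalOrZero (ComplexShape.up ℤ) p k j) := by
  let π := ComplexShape.π (ComplexShape.up ℤ) (ComplexShape.down ℕ) (ComplexShape.up ℤ)
  obtain ⟨f, hf⟩ : ∃ f : ∀ j, (K.total (ComplexShape.up ℤ)).X j ≅
        G.obj ((L.total (ComplexShape.up ℤ)).X j),
      ∀ p k j, K.ιTotalOrZero (ComplexShape.up ℤ) p k j ≫ (f j).hom =
        (ε p k).hom ≫ G.map (L.ιTotalOrZero (ComplexShape.up ℤ) p k j) := by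
    refine ⟨fun j => Sigma.mapIso (fun x : π ⁻¹' {j} => ε x.1.1 x.1.2) ≪≫
      (PreservesCoproduct.iso G (L.toGradedObject.mapObjFun π j)).symm, fun p k j => ?_⟩
    by_cases h : π (p, k) = j
    · have h1 : K.ιTotal (ComplexShape.up ℤ) p k j h ≫
          (Sigma.mapIso (fun x : π ⁻¹' {j} => ε x.1.1 x.1.2)).hom = (ε p k).hom ≫
          Sigma.ι (fun x : π ⁻¹' {j} => G.obj ((L.X x.1.1).X x.1.2)) ⟨(p, k), h⟩ :=
        Sigma.ι_map (fun x : π ⁻¹' {j} => (ε x.1.1 x.1.2).hom) _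
      have h2 := ι_comp_sigmaComparison G (L.toGradedObject.mapObjFun π j) ⟨(p, k), h⟩
      rw [← PreservesCoproduct.inv_hom] at h2
      rw [HomologicalComplex₂.ιTotalOrZero_eq _ _ _ _ _ h,
        HomologicalComplex₂.ιTotalOrZero_eq _ _ _ _ _ h]
      refine (Category.assoc _ _ _).symm.trans ((congrArg (· ≫ (PreservesCoproduct.iso G
        (L.toGradedObject.mapObjFun π j)).inv) h1).trans ?_)
      exact (Category.assoc _ _ _).trans (congrArg ((ε p k).hom ≫ ·) h2)
    · rw [HomologicalComplex₂.ιTotalOrZero_eq_zero _ _ _ _ _ h,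
        HomologicalComplex₂.ιTotalOrZero_eq_zero _ _ _ _ _ h, zero_comp, G.map_zero, comp_zero]
  refine ⟨HomologicalComplex.Hom.isoOfComponents f ?_, hf⟩
  rintro j _ rfl
  refine HomologicalComplex₂.total.hom_ext (ComplexShape.up ℤ) fun p k hpk => ?_
  replace hpk : p - k = j := hpk
  rw [← HomologicalComplex₂.ιTotalOrZero_eq _ _ _ _ _ hpk]
  change K.ιTotalOrZero (ComplexShape.up ℤ) p k j ≫ (f j).hom ≫
      G.map ((L.total (ComplexShape.up ℤ)).d j (j + 1)) =
    K.ιTotalOrZero (ComplexShape.up ℤ) p k j ≫ (K.total (ComplexShape.up ℤ)).d j (j + 1) ≫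
      (f (j + 1)).hom
  rw [← Category.assoc, hf, Category.assoc, ← G.map_comp, ιTotalOrZero_d L hpk, ← Category.assoc,
    ιTotalOrZero_d K hpk, Preadditive.add_comp, Category.assoc, hf, Preadditive.zsmul_comp,
    Category.assoc, hf, G.map_add, G.map_zsmul, G.map_comp, G.map_comp, Preadditive.comp_add,
    Preadditive.comp_zsmul, ← Category.assoc, ← Category.assoc, ← h₁, ← h₂, Category.assoc,
    Category.assoc]

end Total

/-! ### Bijectivity of maps of polyvector fields -/

section PolyvecBijective

variable {A L M A' L' M' : Type*}
  [CommRing A] [Algebra ℂ A] [LieRing L] [LieAlgebra ℂ L] [Module A L]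
  [IsScalarTower ℂ A L] [LieRingModule L A] [LieRinehartRing A L]
  [CommRing A'] [Algebra ℂ A'] [LieRing L'] [LieAlgebra ℂ L'] [Module A' L']
  [IsScalarTower ℂ A' L'] [LieRingModule L' A'] [LieRinehartRing A' L']
  [AddCommGroup M'] [Module ℂ M'] [Module A' M'] [IsScalarTower ℂ A' M']
  [AddCommGroup M] [Module ℂ M] [Module A M] [IsScalarTower ℂ A M]

lemma polyvecMap_bijective {σ : A →ₐ[ℂ] A'} {τ : A' →ₐ[ℂ] A} (h : M →ₛₗ[σ.toRingHom] M')
    (g : L →ₛₗ[σ.toRingHom] L') (h' : M' →ₛₗ[τ.toRingHom] M) (g' : L' →ₛₗ[τ.toRingHom] L)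
    (h1 : ∀ m, h' (h m) = m) (h2 : ∀ m, h (h' m) = m) (g1 : ∀ x, g' (g x) = x)
    (g2 : ∀ x, g (g' x) = x) (k : ℕ) : Function.Bijective (polyvecMap h g k) := by
  refine Function.bijective_iff_has_inverse.2 ⟨polyvecMap h' g' k, fun t => ?_, fun t => ?_⟩
  · induction t using pv_induction with
    | h0 => simp
    | h1 m v =>
      rw [polyvecMap_pv, polyvecMap_pv, h1]
      exact congrArg (pv A m) (funext fun i => g1 _)
    | h2 s t hs ht => rw [map_add, map_add, hs, ht]
  · induction t using pv_induction with
    | h0 => simp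
    | h1 m v =>
      rw [polyvecMap_pv, polyvecMap_pv, h2]
      exact congrArg (pv A' m) (funext fun i => g2 _)
    | h2 s t hs ht => rw [map_add, map_add, hs, ht]

end PolyvecBijective

/-! ### De Rham complex and direct image under a biholomorphic map -/

section PushDR

variable {E : Type v} [NormedAddCommGroup E] [NormedSpace ℂ E] {H : Type w} [TopologicalSpace H]
  {I : ModelWithCorners ℂ E H} {Y : Type u} [TopologicalSpace Y] [ChartedSpace H Y]
  (Φ : Y ≃ₘ^ω⟮I, I⟯ Y)

/-- `f ↦ f ∘ Φ`, from functions on `U` to functions on `Φ⁻¹(U)`. -/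
def pullHolo (U : Opens Y) : Holo I U →ₐ[ℂ] Holo I ((preim Φ.toHomeomorph).obj U) :=
  holoComap Φ Φ.contMDiff fun _ hy => hy

lemma pullOp_mulOp (U : Opens Y) (f : Holo I U) :
    pullOp Φ U (mulOp U f) = mulOp _ (pullHolo Φ U f) := by
  ext1 V h g
  rw [pullOp_app, mulOp_app, mulOp_app, map_mul, comapFwd_comapBwd]
  rfl

lemma pullD_holoToD (U : Opens Y) (f : Holo I U) :
    pullD Φ U (holoToD U f) = holoToD _ (pullHolo Φ U f) :=
  Subtype.ext (pullOp_mulOp Φ U f)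

/-- The transport of vector fields from `U` to `Φ⁻¹(U)`, as a semilinear map. -/
def pullVFₗ (U : Opens Y) :
    VF I U →ₛₗ[(pullHolo Φ U).toRingHom] VF I ((preim Φ.toHomeomorph).obj U) where
  toFun := pullVF Φ U
  map_add' ξ η := Subtype.ext (map_add (pullOp Φ U) ξ.1 η.1)
  map_smul' f ξ := Subtype.ext <| by
    refine (map_mul (pullOp Φ U) (mulOp U f) ξ.1).trans ?_
    rw [pullOp_mulOp]
    rfl

lemma pullVF_lie (U : Opens Y) (ξ η : VF I U) :
    pullVF Φ U ⁅ξ, η⁆ = ⁅pullVF Φ U ξ, pullVF Φ U η⁆ :=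
  Subtype.ext (by
    refine (map_sub (pullOp Φ U) (ξ.1 * η.1) (η.1 * ξ.1)).trans ?_
    rw [map_mul, map_mul]; rfl)

/-- The transport of functions from `Φ⁻¹(U)` to `U`. -/
def pushHolo (U : Opens Y) : Holo I ((preim Φ.toHomeomorph).obj U) →ₐ[ℂ] Holo I U :=
  holoComap Φ.symm Φ.symm.contMDiff fun y hy => by
    change Φ (Φ.symm y) ∈ U
    rwa [Φ.apply_symm_apply]

lemma le_preim_symm_preim (U : Opens Y) :
    U ≤ (preim Φ.symm.toHomeomorph).obj ((preim Φ.toHomeomorph).obj U) := fun y hy => by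
  change Φ (Φ.symm y) ∈ U
  rwa [Φ.apply_symm_apply]

/-- The transport of vector fields from `Φ⁻¹(U)` to `U`. -/
def pushVFₗ (U : Opens Y) :
    VF I ((preim Φ.toHomeomorph).obj U) →ₛₗ[(pushHolo Φ U).toRingHom] VF I U where
  toFun ξ := vfRes (le_preim_symm_preim Φ U) (pullVFₗ Φ.symm _ ξ)
  map_add' ξ η := by rw [map_add, map_add]
  map_smul' f ξ := by
    rw [LinearMap.map_smulₛₗ, LinearMap.map_smulₛₗ]
    rfl

lemma pushVF_pullVF (U : Opens Y) (ξ : VF I U) : pushVFₗ Φ U (pullVFₗ Φ U ξ) = ξ := by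
  have hle : (preim Φ.symm.toHomeomorph).obj ((preim Φ.toHomeomorph).obj U) ≤ U := fun y hy => by
    have : Φ (Φ.symm y) ∈ U := hy
    rwa [Φ.apply_symm_apply] at this
  refine vfToD_injective ?_
  exact (congrArg (diffOpRes (le_preim_symm_preim Φ U))
    (pullD_pullD Φ.symm Φ Φ.apply_symm_apply U (vfToD U ξ) hle)).trans
      (diffOpRes_diffOpRes hle _ _)

lemma pullVF_pushVF (U : Opens Y) (ξ : VF I ((preim Φ.toHomeomorph).obj U)) :
    pullVFₗ Φ U (pushVFₗ Φ U ξ) = ξ := by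
  have hle : (preim Φ.toHomeomorph).obj ((preim Φ.symm.toHomeomorph).obj
      ((preim Φ.toHomeomorph).obj U)) ≤ (preim Φ.toHomeomorph).obj U := fun y hy => by
    have : Φ (Φ.symm (Φ y)) ∈ U := hy
    rwa [Φ.apply_symm_apply] at this
  refine vfToD_injective ?_
  have h1 := pullD_diffOpRes Φ (le_preim_symm_preim Φ U) (pullD Φ.symm _ (vfToD _ ξ))
  have h2 := pullD_pullD Φ Φ.symm Φ.symm_apply_apply _ (vfToD _ ξ) hle
  exact h1.trans ((congrArg _ h2).trans (diffOpRes_diffOpRes hle _ _))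

variable (M : RightDMod I Y)

/-- The identity, from sections of `Φ_* M` over `U` to sections of `M` over `Φ⁻¹(U)`. -/
def ofPushSec (U : Opens Y) : SecD ((pushD Φ).obj M) U →ₛₗ[(pullHolo Φ U).toRingHom]
    SecD M ((preim Φ.toHomeomorph).obj U) where
  toFun m := m
  map_add' _ _ := rfl
  map_smul' f m := by
    refine (toPushSec_smul Φ M (holoToD U f) m).trans ?_
    rw [pullD_holoToD]
    rfl

/-- The identity, from sections of `M` over `Φ⁻¹(U)` to sections of `Φ_* M` over `U`. -/
def toPushSecₗ (U : Opens Y) : SecD M ((preim Φ.toHomeomorph).obj U) →ₛₗ[(pushHolo Φ U).toRingHom]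
    SecD ((pushD Φ).obj M) U where
  toFun m := toPushSec Φ M m
  map_add' _ _ := rfl
  map_smul' f m := by
    have h := (ofPushSec Φ M U).map_smul' (pushHolo Φ U f) (toPushSec Φ M m)
    have e : pullHolo Φ U (pushHolo Φ U f) = f := by
      ext x
      exact congrArg f.1 (Subtype.ext (Φ.symm_apply_apply x.1))
    refine Eq.trans ?_ h.symm
    exact congrArg (fun f => toPushSec Φ M (f • m)) e.symm

/-- `m ⊗ (v₁ ∧ ⋯ ∧ vₖ) ↦ m ⊗ (v'₁ ∧ ⋯ ∧ v'ₖ)`, where `v'` is the vector field on `Φ⁻¹(U)` which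
corresponds to the vector field `v` on `U`. -/
def pushPoly (k : ℕ) (U : Opens Y) : Polyvec (Holo I U) (VF I U) (SecD ((pushD Φ).obj M) U) k →ₗ[ℂ]
    Polyvec (Holo I ((preim Φ.toHomeomorph).obj U)) (VF I ((preim Φ.toHomeomorph).obj U))
      (SecD M ((preim Φ.toHomeomorph).obj U)) k :=
  polyvecMap (ofPushSec Φ M U) (pullVFₗ Φ U) k

lemma pushPoly_bijective (k : ℕ) (U : Opens Y) : Function.Bijective (pushPoly Φ M k U) :=
  polyvecMap_bijective _ _ (toPushSecₗ Φ M U) (pushVFₗ Φ U) (fun _ => rfl) (fun _ => rfl)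
    (pushVF_pullVF Φ U) (pullVF_pushVF Φ U) k

/-- The maps `pushPoly` as a map of presheaves. -/
def prePushDR (k : ℕ) : preDR I Y ((toPre I Y).obj ((pushD Φ).obj M)) k ⟶
    (preim Φ.toHomeomorph).op ⋙ preDR I Y ((toPre I Y).obj M) k where
  app U := ModuleCat.ofHom (pushPoly Φ M k U.unop)
  naturality U V f := by
    refine ModuleCat.hom_ext (polyvec_hom_ext fun m v => ?_)
    change pushPoly Φ M k V.unop (polyvecMap (secRes _ f.unop.le) (vfRes f.unop.le) k
      (pv (Holo I U.unop) m v)) = polyvecMap (secRes ((toPre I Y).obj M)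
        ((preim Φ.toHomeomorph).monotone f.unop.le))
        (vfRes ((preim Φ.toHomeomorph).monotone f.unop.le)) k (pushPoly Φ M k U.unop (pv _ m v))
    rw [polyvecMap_pv, pushPoly, pushPoly, polyvecMap_pv, polyvecMap_pv, polyvecMap_pv]
    rfl

/-- Transport of sections and vector fields has an explicit inverse over every open set, so the
isomorphism exists already for the presheaves. -/
lemma exists_pushDR (k : ℕ) : ∃ ε : ((deRham I Y).obj ((pushD Φ).obj M)).X k ≅
      (pushC Φ.toHomeomorph).obj (((deRham I Y).obj M).X k), ∀ U t,
    mapC ε.hom U (toDR ((pushD Φ).obj M) k U t) =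
      (toDR M k ((preim Φ.toHomeomorph).obj U) (pushPoly Φ M k U t)) := by
  let f : preDR I Y ((toPre I Y).obj ((pushD Φ).obj M)) k ⟶
      ((pushC Φ.toHomeomorph).obj (shC (preDR I Y ((toPre I Y).obj M) k))).obj :=
    prePushDR Φ M k ≫ Functor.whiskerLeft (preim Φ.toHomeomorph).op
      (toSheafify (Opens.grothendieckTopology Y) (preDR I Y ((toPre I Y).obj M) k))
  have hf : IsLocallyBijective f :=
    (isLocallyBijective_of_bijective _ fun U => pushPoly_bijective Φ M k U).comp
      (isLocallyBijective_whisker _ (isLocallyBijective_toSheafify _))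
  exact ⟨@asIso _ _ _ _ (sheafifyDesc f) (isIso_sheafifyDesc f hf), fun U t =>
    mapC_sheafifyDesc f U t⟩

/-- The canonical isomorphism `(Φ_* M) ⊗ ⋀ᵏ Θ ≅ Φ_* (M ⊗ ⋀ᵏ Θ)`. -/
def pushDR (k : ℕ) : ((deRham I Y).obj ((pushD Φ).obj M)).X k ≅
    (pushC Φ.toHomeomorph).obj (((deRham I Y).obj M).X k) :=
  (exists_pushDR Φ M k).choose

lemma mapC_pushDR (k : ℕ) (U : Opens Y)
    (t : Polyvec (Holo I U) (VF I U) (SecD ((pushD Φ).obj M) U) k) :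
    mapC (pushDR Φ M k).hom U (toDR ((pushD Φ).obj M) k U t) =
      (toDR M k ((preim Φ.toHomeomorph).obj U) (pushPoly Φ M k U t)) :=
  (exists_pushDR Φ M k).choose_spec U t

lemma mapC_pushDR_pv (k : ℕ) (U : Opens Y) (m : SecD M ((preim Φ.toHomeomorph).obj U))
    (v : Fin k → VF I U) :
    mapC (pushDR Φ M k).hom U (toDR ((pushD Φ).obj M) k U (pv _ (toPushSec Φ M m) v)) =
      (toDR M k ((preim Φ.toHomeomorph).obj U) (pv _ m fun a => pullVF Φ U (v a))) :=
  (mapC_pushDR Φ M k U _).trans (congrArg (toDR M k _) (polyvecMap_pv _ _ _ _ _))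

lemma mapC_deRham_d_succ (k : ℕ) (U : Opens Y)
    (t : Polyvec (Holo I U) (VF I U) (SecD M U) (k + 1)) :
    mapC (((deRham I Y).obj M).d (k + 1) k) U (toDR M (k + 1) U t) =
      toDR M k U (koszul (secAction ((toPre I Y).obj M) U) k t) := by
  refine (mapC_deRham_d M (k + 1) k U t).trans (congrArg (toDR M k U) ?_)
  change koszul _ k (Pi.single (k + 1) t (k + 1)) = _
  rw [Pi.single_eq_same]

lemma pushPoly_koszul (k : ℕ) (U : Opens Y)
    (t : Polyvec (Holo I U) (VF I U) (SecD ((pushD Φ).obj M) U) (k + 1)) :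
    pushPoly Φ M k U (koszul (secAction ((toPre I Y).obj ((pushD Φ).obj M)) U) k t) =
      koszul (secAction ((toPre I Y).obj M) ((preim Φ.toHomeomorph).obj U)) k
        (pushPoly Φ M (k + 1) U t) :=
  polyvecMap_koszul (secAction ((toPre I Y).obj ((pushD Φ).obj M)) U)
    (secAction ((toPre I Y).obj M) ((preim Φ.toHomeomorph).obj U)) (ofPushSec Φ M U)
    (pullVFₗ Φ U) (pullVF_lie Φ U) (fun ξ m => toPushSec_smul Φ M (vfToD U ξ) m) k t

/-- The Koszul differential is natural for maps compatible with the brackets and with the action of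
vector fields; transport along `Φ` is of this kind. -/
lemma pushDR_d (k l : ℕ) : ((deRham I Y).obj ((pushD Φ).obj M)).d k l ≫ (pushDR Φ M l).hom =
    (pushDR Φ M k).hom ≫ (pushC Φ.toHomeomorph).map (((deRham I Y).obj M).d k l) := by
  by_cases h : l + 1 = k
  · subst h
    refine deRham_ext fun U m v => ?_
    have h1 := mapC_deRham_d_succ ((pushD Φ).obj M) l U (pv _ m v)
    have h2 := mapC_pushDR Φ M l U (koszul (secAction _ U) l (pv _ m v))
    have h3 := mapC_pushDR Φ M (l + 1) U (pv _ m v)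
    have h4 := mapC_deRham_d_succ M l _ (pushPoly Φ M (l + 1) U (pv _ m v))
    refine ((congrArg (mapC (pushDR Φ M l).hom U) h1).trans h2).trans (Eq.trans ?_
      ((congrArg (mapC (((deRham I Y).obj M).d (l + 1) l) _) h3).trans h4).symm)
    exact congrArg (toDR M l ((preim Φ.toHomeomorph).obj U)) (pushPoly_koszul Φ M l U _)
  · rw [HomologicalComplex.shape _ _ _ h, HomologicalComplex.shape _ _ _ h, zero_comp,
      Functor.map_zero, comp_zero]

variable {M} in
lemma pushDR_naturality {N : RightDMod I Y} (f : M ⟶ N) (k : ℕ) :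
    ((deRham I Y).map ((pushD Φ).map f)).f k ≫ (pushDR Φ N k).hom =
      (pushDR Φ M k).hom ≫ (pushC Φ.toHomeomorph).map (((deRham I Y).map f).f k) := by
  refine deRham_ext fun U m v => ?_
  rw [mapC_comp, mapC_deRham_map_pv, mapC_comp]
  refine (mapC_pushDR_pv Φ N k U (mapD f _ m) v).trans ?_
  refine Eq.trans ?_ (congrArg (mapC (((deRham I Y).map f).f k) ((preim Φ.toHomeomorph).obj U))
    (mapC_pushDR_pv Φ M k U m v)).symm
  exact (mapC_deRham_map_pv f k ((preim Φ.toHomeomorph).obj U) m _).symm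

lemma isComm_iff (N : CochainComplex (RightDMod I Y) ℤ)
    (e : (DR I Y).obj (((pushD Φ).mapHomologicalComplex _).obj N) ≅
      ((pushC Φ.toHomeomorph).mapHomologicalComplex _).obj ((DR I Y).obj N)) :
    IsComm Φ N e ↔ ∀ (p : ℤ) (k : ℕ) (j : ℤ), p - k = j →
      drι (((pushD Φ).mapHomologicalComplex _).obj N) p k j ≫ e.hom.f j =
        (pushDR Φ (N.X p) k).hom ≫ (pushC Φ.toHomeomorph).map (drι N p k j) := by
  have key (p : ℤ) (k : ℕ) (j : ℤ) (U : Opens Y) (m : SecD (N.X p) ((preim Φ.toHomeomorph).obj U))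
      (v : Fin k → VF I U) : mapC ((pushDR Φ (N.X p) k).hom ≫
        (pushC Φ.toHomeomorph).map (drι N p k j)) U (toDR ((pushD Φ).obj (N.X p)) k U
          (pv _ (toPushSec Φ (N.X p) m) v)) = (mapC (drι N p k j) ((preim Φ.toHomeomorph).obj U)
        (toDR (N.X p) k _ (pv _ m fun a => pullVF Φ U (v a)))) :=
    congrArg (mapC (drι N p k j) ((preim Φ.toHomeomorph).obj U)) (mapC_pushDR_pv Φ _ k U m v)
  constructor
  · intro he p k j h
    refine deRham_ext fun U m v => ?_
    have h1 := drSec_eq (((pushD Φ).mapHomologicalComplex (ComplexShape.up ℤ)).obj N) h m v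
    exact ((congrArg (mapC (e.hom.f j) U) h1).symm.trans ((he p k j h U m v).trans
      (drSec_eq N h _ _))).trans (key p k j U m v).symm
  · intro he p k j h U m v
    have h1 := drSec_eq (((pushD Φ).mapHomologicalComplex (ComplexShape.up ℤ)).obj N) h
      (toPushSec Φ (N.X p) m) v
    exact (congrArg (mapC (e.hom.f j) U) h1).trans (congr(mapC $(he p k j h) U _).trans
      ((key p k j U m v).trans (drSec_eq N h _ _).symm))

theorem existsUnique_isComm (N : CochainComplex (RightDMod I Y) ℤ) :
    ∃! e : (DR I Y).obj (((pushD Φ).mapHomologicalComplex _).obj N) ≅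
      ((pushC Φ.toHomeomorph).mapHomologicalComplex _).obj ((DR I Y).obj N), IsComm Φ N e := by
  obtain ⟨e, he⟩ := exists_totalIso (pushC Φ.toHomeomorph)
    (deRham₂ (((pushD Φ).mapHomologicalComplex _).obj N)) (deRham₂ N)
    (fun p k => pushDR Φ (N.X p) k) (fun p k => pushDR_naturality Φ (N.d p (p + 1)) k)
    (fun p k l => pushDR_d Φ (N.X p) k l)
  refine ⟨e, (isComm_iff Φ N e).2 fun p k j _ => he p k j, fun e' he' => ?_⟩
  replace he' := (isComm_iff Φ N e').1 he'
  ext j : 2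
  exact DR_hom_ext _ fun p k h => (he' p k j h).trans (he p k j).symm

end PushDR

/-! ### The sign identity of the commutative diagram -/

section Signs

variable {n : ℕ}

lemma crossSign_exp (p : Fin n → ℤ) (k : Fin n → ℕ) :
    ∑ i, ∑ j ∈ Finset.Iio i, p i * (k j : ℤ) = ∑ i, ∑ j, if j < i then p i * (k j : ℤ) else 0 := by
  refine Finset.sum_congr rfl fun i _ => ?_
  rw [← Finset.filter_gt_eq_Iio, Finset.sum_filter]

/-- The left side collects the signs of `σ^#` on the de Rham complexes, of the canonical morphism of
the permuted family and of the permuted blocks of vector fields; the right side, those of the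
canonical morphism and of `σ^#` on the modules. -/
lemma crossSign_permSign (σ : Equiv.Perm (Fin n)) (p : Fin n → ℤ) (k : Fin n → ℕ) :
    permSign σ (fun i => p i - k i) * (crossSign (fun i => p (σ i)) (fun i => k (σ i)) *
      permSign σ (fun i => (k i : ℤ))) = crossSign p k * permSign σ p := by
  have e1 : ∑ i, ∑ j, (if j < i then p i * (k j : ℤ) else 0) =
      ∑ i, ∑ j, if σ j < σ i then p (σ i) * (k (σ j) : ℤ) else 0 := by
    rw [← Equiv.sum_comp σ]
    exact Finset.sum_congr rfl fun i _ =>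
      (Equiv.sum_comp σ fun j => if j < σ i then p (σ i) * (k j : ℤ) else 0).symm
  -- An antisymmetric double sum vanishes. After reindexing by `σ`, the difference of the exponents
  -- minus twice the witness below is of this form.
  have e2 (f : Fin n → Fin n → ℤ) (hf : ∀ i j, f i j + f j i = 0) : ∑ i, ∑ j, f i j = 0 := by
    have : ∑ i, ∑ j, f i j + ∑ i, ∑ j, f i j = 0 := by
      nth_rewrite 1 [Finset.sum_comm]
      simp only [← Finset.sum_add_distrib]
      exact Finset.sum_eq_zero fun i _ => Finset.sum_eq_zero fun j _ => hf j i
    omega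
  have e3 (p : Fin n → ℤ) : permSign σ p = _ := congrArg Int.negOnePow (permSign_exp σ p)
  have e4 (p : Fin n → ℤ) (k : Fin n → ℕ) : crossSign p k = _ := congrArg Int.negOnePow (crossSign_exp p k)
  rw [e3, e3, e3, e4, e4, e1, ← Int.negOnePow_add, ← Int.negOnePow_add, ← Int.negOnePow_add]
  -- Over the inversions: the products of the `k` occur twice, and the mixed terms from expanding
  -- `(p - k)(p - k)` cancel against the two cross signs up to this even correction.
  refine negOnePow_congr (∑ i, ∑ j, if i < j ∧ σ j < σ i then
    (k (σ i) : ℤ) * k (σ j) - p (σ i) * k (σ j) else 0) ?_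
  rw [← sub_eq_zero, Finset.mul_sum]
  simp only [Finset.mul_sum, ← Finset.sum_add_distrib, ← Finset.sum_sub_distrib]
  refine e2 _ fun i j => ?_
  rcases lt_trichotomy i j with h | rfl | h
  · rcases lt_or_gt_of_ne (σ.injective.ne h.ne) with h' | h' <;>
      simp only [h, h', h.not_gt, h'.not_gt, true_and, false_and, if_true, if_false] <;> ring
  · simp
  · rcases lt_or_gt_of_ne (σ.injective.ne h.ne) with h' | h' <;>
      simp only [h, h', h.not_gt, h'.not_gt, true_and, false_and, if_true, if_false] <;> ring

end Signs

/-! ### Transport of blocks of vector fields -/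

section PushDR

variable {E : Type v} [NormedAddCommGroup E] [NormedSpace ℂ E] {H : Type w} [TopologicalSpace H]
  {I : ModelWithCorners ℂ E H} {Y : Type u} [TopologicalSpace Y] [ChartedSpace H Y]

lemma mapC_pushDR_wedgeList (Φ : Y ≃ₘ^ω⟮I, I⟯ Y) {A B : RightDMod I Y} (f : A ⟶ (pushD Φ).obj B)
    (r : ℕ) (U : Opens Y) (l : List (VF I U)) (m : SecD A U) :
    mapC (pushDR Φ B r).hom U (mapC (((deRham I Y).map f).f r) U
      (toDR A r U (wedgeList l (embZero (Holo I U) (VF I U) m) r))) =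
    (toDR B r ((preim Φ.toHomeomorph).obj U) (wedgeList (l.map (pullVF Φ U)) (embZero _ _
      (ofPushSec Φ B U (mapD f U m))) r)) := by
  rw [mapC_deRham_map, mapC_pushDR]
  have e := polyAllMap_wedgeList (secMapO ((toPre I Y).map f) U) (vfId U) l
    (embZero (Holo I U) (VF I U) m)
  rw [polyAllMap_embZero, show l.map (vfId U) = l from List.map_id l] at e
  have e' := polyAllMap_wedgeList (ofPushSec Φ B U) (pullVFₗ Φ U) l
    (embZero (Holo I U) (VF I U) (secMapO ((toPre I Y).map f) U m))
  rw [polyAllMap_embZero, ← e] at e'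
  exact congrArg (toDR B r ((preim Φ.toHomeomorph).obj U)) (congrFun e' r)

end PushDR

/-! ### The canonical morphism and permutations on a single piece -/

section Components

variable {E : Type v} [NormedAddCommGroup E] [NormedSpace ℂ E] [FiniteDimensional ℂ E]
  {X : Type u} [TopologicalSpace X] [ChartedSpace E X] [IsManifold 𝓘(ℂ, E) ω X] {n : ℕ}

lemma mapC_boxDR_wedgeList (A : Fin n → RightDMod 𝓘(ℂ, E) X) (k : Fin n → ℕ) (r : ℕ)
    (U : Opens (Fin n → X)) (m : ∀ i, SecD (A i) (prImage i U))
    (v : ∀ i, Fin (k i) → VF 𝓘(ℂ, E) (prImage i U)) :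
    mapC (boxDR A k r) U (boxSec _ U fun i => toDR (A i) (k i) _ (pv _ (m i) (v i))) =
      toDR ((boxOFunctor 𝓘(ℂ, E) X n).obj A) r U
        (wedgeList ((List.finRange n).map fun i =>
          List.ofFn fun a => (liftVF i (mem_prImage_of_mem U i) (v i a) :
            VF (powModel 𝓘(ℂ, E) n) U)).flatten
          (embZero (Holo (powModel 𝓘(ℂ, E) n) U) (VF (powModel 𝓘(ℂ, E) n) U)
            (boxMSec A U m)) r) := by
  refine (mapC_boxDR A k r U fun i => pv _ (m i) (v i)).trans (congrArg (toDR _ r U) ?_)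
  change polyAllMap (secMapO (boxUnit A) U) (vfId U)
    ((boxDatum (fun i => (toPre 𝓘(ℂ, E) X).obj (A i)) U).boxMul k fun i =>
      pv (Holo 𝓘(ℂ, E) (prImage i U)) (m i) (v i)) r = _
  rw [BoxDatum.boxMul_pv, BoxDatum.blockOp_eq, polyAllMap_wedgeList, polyAllMap_embZero]
  have e : ((List.finRange n).map fun i => (List.ofFn (v i)).map
      ((boxDatum (fun i => (toPre 𝓘(ℂ, E) X).obj (A i)) U).l i)).flatten.map (vfId U) =
      ((List.finRange n).map fun i => List.ofFn fun a =>
        (liftVF i (mem_prImage_of_mem U i) (v i a) : VF (powModel 𝓘(ℂ, E) n) U)).flatten := by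
    refine (List.map_id _).trans (congrArg List.flatten (List.map_congr_left fun i _ => ?_))
    rw [List.map_ofFn]; rfl
  rw [e]
  rfl

-- Both composites send `⊠ (mᵢ ⊗ ηᵢ)` to the same element of the module wedged with the same blocks
-- of transported vector fields, but in the orders `σ(1), …, σ(n)` and `1, …, n`. The difference is
-- the block sign of `wedgeList_perm`.
set_option maxHeartbeats 1000000 in
lemma boxCPerm_boxDR (σ : Equiv.Perm (Fin n)) (A : Fin n → RightDMod 𝓘(ℂ, E) X) (k : Fin n → ℕ)
    (r : ℕ) :
    (boxCPerm 𝓘(ℂ, E) σ fun i => ((deRham 𝓘(ℂ, E) X).obj (A i)).X (k i)).hom ≫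
      (pushC (permDiffeo 𝓘(ℂ, E) X σ).toHomeomorph).map
        (boxDR (fun i => A (σ i)) (fun i => k (σ i)) r) =
    (permSign σ (fun i => (k i : ℤ)) : ℤ) • (boxDR A k r ≫
      ((deRham (powModel 𝓘(ℂ, E) n) (Fin n → X)).map (boxOPerm σ A).hom).f r ≫
      (pushDR (permDiffeo 𝓘(ℂ, E) X σ)
        ((boxOFunctor 𝓘(ℂ, E) X n).obj fun i => A (σ i)) r).hom) := by
  refine boxC_deRham_ext _ fun U m v => ?_
  let b (i : Fin n) : List (VF (powModel 𝓘(ℂ, E) n) (permPreim 𝓘(ℂ, E) σ U)) :=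
    List.ofFn fun a => pullVF (permDiffeo 𝓘(ℂ, E) X σ) U (liftVF i (mem_prImage_of_mem U i) (v i a))
  let m' := boxMSec (fun i => A (σ i)) (permPreim 𝓘(ℂ, E) σ U)
    (permFam σ (fun i => (toPre 𝓘(ℂ, E) X).obj (A i)) U m)
  have hl : mapC ((boxCPerm 𝓘(ℂ, E) σ fun i => ((deRham 𝓘(ℂ, E) X).obj (A i)).X (k i)).hom ≫
      (pushC (permDiffeo 𝓘(ℂ, E) X σ).toHomeomorph).map
        (boxDR (fun i => A (σ i)) (fun i => k (σ i)) r)) U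
      (boxSec _ U fun i => toDR (A i) (k i) _ (pv _ (m i) (v i))) =
      (toDR ((boxOFunctor 𝓘(ℂ, E) X n).obj fun i => A (σ i)) r (permPreim 𝓘(ℂ, E) σ U)
        (wedgeList ((List.finRange n).map fun i => b (σ i)).flatten (embZero _ _ m') r)) := by
    rw [mapC_comp, mapC_boxCPerm]
    have e (i : Fin n) := preRes_toDR (A (σ i)) (prImage_permPreim_le 𝓘(ℂ, E) σ U i)
      (m (σ i)) (v (σ i))
    refine Eq.trans (congrArg (fun s => mapC (boxDR (fun i => A (σ i)) (fun i => k (σ i)) r)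
      (permPreim 𝓘(ℂ, E) σ U) (boxSec _ (permPreim 𝓘(ℂ, E) σ U) s)) (funext e)) ?_
    refine (mapC_boxDR_wedgeList (fun i => A (σ i)) (fun i => k (σ i)) r _ _ _).trans ?_
    have e' (i : Fin n) : (List.ofFn fun a =>
        (liftVF i (mem_prImage_of_mem (permPreim 𝓘(ℂ, E) σ U) i)
          ((vfRes (prImage_permPreim_le 𝓘(ℂ, E) σ U i) ∘ v (σ i)) a) :
          VF (powModel 𝓘(ℂ, E) n) (permPreim 𝓘(ℂ, E) σ U))) = b (σ i) := by
      refine congrArg List.ofFn (funext fun a => ?_)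
      refine (IsLift.eq_liftVF _ ?_).symm
      have := ((isLift_liftVF (mem_prImage_of_mem U (σ i)) (v (σ i) a)).pullVF)
      exact this.res (prImage_permPreim_le 𝓘(ℂ, E) σ U i) le_rfl
    exact congrArg (fun l => toDR ((boxOFunctor 𝓘(ℂ, E) X n).obj fun i => A (σ i)) r
      (permPreim 𝓘(ℂ, E) σ U) (wedgeList ((List.finRange n).map l).flatten
        (embZero _ _ m') r)) (funext e')
  have hr : mapC (boxDR A k r ≫
      ((deRham (powModel 𝓘(ℂ, E) n) (Fin n → X)).map (boxOPerm σ A).hom).f r ≫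
      (pushDR (permDiffeo 𝓘(ℂ, E) X σ)
        ((boxOFunctor 𝓘(ℂ, E) X n).obj fun i => A (σ i)) r).hom) U
      (boxSec _ U fun i => toDR (A i) (k i) _ (pv _ (m i) (v i))) =
      (toDR ((boxOFunctor 𝓘(ℂ, E) X n).obj fun i => A (σ i)) r (permPreim 𝓘(ℂ, E) σ U)
        (wedgeList ((List.finRange n).map b).flatten (embZero _ _ m') r)) := by
    rw [mapC_comp, mapC_comp, mapC_boxDR_wedgeList]
    refine (mapC_pushDR_wedgeList (permDiffeo 𝓘(ℂ, E) X σ) (boxOPerm σ A).hom r U _ _).trans ?_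
    have e1 : ((List.finRange n).map fun i => List.ofFn fun a =>
        (liftVF i (mem_prImage_of_mem U i) (v i a) : VF (powModel 𝓘(ℂ, E) n) U)).flatten.map
        (pullVF (permDiffeo 𝓘(ℂ, E) X σ) U) = ((List.finRange n).map b).flatten := by
      rw [List.map_flatten, List.map_map]
      refine congrArg List.flatten (List.map_congr_left fun i _ => ?_)
      rw [Function.comp_apply, List.map_ofFn]
      rfl
    rw [e1]
    exact congrArg (fun m => toDR ((boxOFunctor 𝓘(ℂ, E) X n).obj fun i => A (σ i)) r
      (permPreim 𝓘(ℂ, E) σ U) (wedgeList ((List.finRange n).map b).flatten (embZero _ _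
      (ofPushSec (permDiffeo 𝓘(ℂ, E) X σ) _ U m)) r)) (mapD_boxOPerm σ A U m)
  rw [mapC_zsmul, hr]
  refine hl.trans ?_
  have hb := wedgeList_perm b σ (embZero (Holo (powModel 𝓘(ℂ, E) n) (permPreim 𝓘(ℂ, E) σ U)) _ m')
  have hk : (fun i => ((b i).length : ℤ)) = fun i => (k i : ℤ) :=
    funext fun i => congrArg Nat.cast List.length_ofFn
  rw [hk] at hb
  refine (congrArg (fun t => toDR _ r (permPreim 𝓘(ℂ, E) σ U) (t r)) hb).trans ?_
  exact map_zsmul (toDR ((boxOFunctor 𝓘(ℂ, E) X n).obj fun i => A (σ i)) r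
    (permPreim 𝓘(ℂ, E) σ U)) _ _

variable (M : Fin n → CochainComplex (RightDMod 𝓘(ℂ, E) X) ℤ)

variable {M} in
-- The characterization with all degrees as free variables, so that it applies to permuted families,
-- whose sums are only propositionally the original ones.
lemma IsCanonical.comp {c : boxC (fun i => (DR 𝓘(ℂ, E) X).obj (M i)) ⟶
      (DR (powModel 𝓘(ℂ, E) n) (Fin n → X)).obj (boxO M)} (hc : IsCanonical M c)
    {p : Fin n → ℤ} {k : Fin n → ℕ} {q : Fin n → ℤ} (h : ∀ i, p i - k i = q i) {j P : ℤ} {r : ℕ}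
    (hj : ∑ i, q i = j) (hP : ∑ i, p i = P) (hr : ∑ i, k i = r) :
    boxDrι M p k q ≫ boxCι _ q j hj ≫ c.f j = (crossSign p k : ℤ) • boxDRι M p hP k r j := by
  obtain rfl : (fun i => p i - k i) = q := funext h
  subst hj hP hr
  exact (isCanonical_iff M c).1 hc p k

end Components

/-! ### Composition of squares that commute up to an integer factor -/

section Category

variable {C : Type*} [Category C] [Preadditive C] (G : C ⥤ C) [G.Additive]

/-- This and the next two lemmas isolate the diagram chase in an abstract additive category, where
associativity and scalars can be rewritten on plain variables. -/
lemma comp_map_comp_of_eq_zsmul {A B B' Z V W : C} {τ : A ⟶ G.obj B} {β : B ⟶ B'} {d : ℤ}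
    {x : A ⟶ Z} {y : Z ⟶ V} {z : V ⟶ G.obj B'} (h : τ ≫ G.map β = d • (x ≫ y ≫ z))
    {W' : C} (w : B' ⟶ W) (u : W ⟶ W') :
    τ ≫ G.map (β ≫ w ≫ u) = d • (x ≫ y ≫ z ≫ G.map (w ≫ u)) := by
  rw [Functor.map_comp, ← Category.assoc, h, Preadditive.zsmul_comp]
  simp only [Category.assoc]

lemma comp_map_eq_of_zsmul {A B S A' B' S' T : C} {x : A ⟶ B} {y : B ⟶ S} {s : S ⟶ G.obj S'}
    {c : S' ⟶ T} {τ : B ⟶ G.obj B'} {y' : B' ⟶ S'} {τ' : A ⟶ G.obj A'} {x' : A' ⟶ B'}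
    {β : A' ⟶ T} {γ : A ⟶ G.obj T} {a b d : ℤ} (h1 : y ≫ s = a • (τ ≫ G.map y'))
    (h2 : x ≫ τ = τ' ≫ G.map x') (h3 : x' ≫ y' ≫ c = b • β) (h4 : τ' ≫ G.map β = d • γ) :
    x ≫ y ≫ s ≫ G.map c = (a * (b * d)) • γ := by
  rw [← Category.assoc y, h1, Preadditive.zsmul_comp, Preadditive.comp_zsmul, Category.assoc,
    ← Category.assoc x, h2, Category.assoc, ← Functor.map_comp, ← Functor.map_comp, h3,
    Functor.map_zsmul, Preadditive.comp_zsmul, h4, smul_smul, smul_smul, mul_assoc]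

lemma comp_comp_eq_of_zsmul {A B S T T' W N N' N'' Q R V : C} {x : A ⟶ B} {y : B ⟶ S}
    {c : S ⟶ T} {t : T ⟶ T'} {e : T' ⟶ G.obj W} {β : A ⟶ N} {w : N ⟶ N'} {ι : N' ⟶ T}
    {t' : N' ⟶ N''} {ι' : N'' ⟶ T'} {τ : N ⟶ Q} {w' : Q ⟶ N''} {π : N'' ⟶ G.obj R} {u : R ⟶ W}
    {π' : Q ⟶ G.obj V} {w'' : V ⟶ R} {a b : ℤ} (h1 : x ≫ y ≫ c = a • (β ≫ w ≫ ι))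
    (h2 : ι ≫ t = t' ≫ ι') (h3 : w ≫ t' = b • (τ ≫ w')) (h4 : ι' ≫ e = π ≫ G.map u)
    (h5 : w' ≫ π = π' ≫ G.map w'') :
    x ≫ y ≫ c ≫ t ≫ e = (a * b) • (β ≫ τ ≫ π' ≫ G.map (w'' ≫ u)) := by
  have e1 : x ≫ y ≫ c ≫ t ≫ e = (x ≫ y ≫ c) ≫ t ≫ e := by simp only [Category.assoc]
  have e2 : (β ≫ w ≫ ι) ≫ t ≫ e = β ≫ (w ≫ t') ≫ ι' ≫ e := by
    simp only [Category.assoc, reassoc_of% h2]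
  have e3 : (τ ≫ w') ≫ π ≫ G.map u = τ ≫ (w' ≫ π) ≫ G.map u := by simp only [Category.assoc]
  rw [e1, h1, Preadditive.zsmul_comp, e2, h3, h4, Preadditive.zsmul_comp, e3, h5,
    Preadditive.comp_zsmul, smul_smul, Functor.map_comp, Category.assoc]

end Category

/-! ### Commutativity of the diagram -/

section Diagram

variable {E : Type v} [NormedAddCommGroup E] [NormedSpace ℂ E]

lemma deRham_map_comp_zsmul {H : Type w} [TopologicalSpace H] {I : ModelWithCorners ℂ E H}
    {Y : Type u} [TopologicalSpace Y] [ChartedSpace H Y] {A B B' D : RightDMod I Y} {c : ℤ}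
    {f : A ⟶ B} {g : B ⟶ D} {f' : A ⟶ B'} {g' : B' ⟶ D} (h : f ≫ g = c • (f' ≫ g')) (r : ℕ) :
    ((deRham I Y).map f).f r ≫ ((deRham I Y).map g).f r =
      c • (((deRham I Y).map f').f r ≫ ((deRham I Y).map g').f r) := by
  have := congrArg (fun f => ((deRham I Y).map f).f r) h
  simpa only [Functor.map_zsmul, Functor.map_comp, HomologicalComplex.comp_f,
    HomologicalComplex.zsmul_f_apply] using this

variable [FiniteDimensional ℂ E]
  {X : Type u} [TopologicalSpace X] [ChartedSpace E X] [IsManifold 𝓘(ℂ, E) ω X] {n : ℕ}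
  {M : Fin n → CochainComplex (RightDMod 𝓘(ℂ, E) X) ℤ}

variable (M) in
/-- The component on `⊠ (Mᵢ^{pᵢ} ⊗ ⋀^{kᵢ} Θ)` of both composites in the diagram which compares
the canonical morphism for `M` and for the family `M_{σ(i)}`, up to sign. -/
def boxDRPermι (σ : Equiv.Perm (Fin n))
    (p : Fin n → ℤ) {P : ℤ} (hP : ∑ i, p i = P) (k : Fin n → ℕ) (r : ℕ) (j : ℤ) :
    (boxCFunctor X n).obj (fun i => ((deRham 𝓘(ℂ, E) X).obj ((M i).X (p i))).X (k i)) ⟶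
      (pushC (permDiffeo 𝓘(ℂ, E) X σ).toHomeomorph).obj
        (((DR (powModel 𝓘(ℂ, E) n) (Fin n → X)).obj (boxO fun i => M (σ i))).X j) :=
  boxDR (fun i => (M i).X (p i)) k r ≫
    ((deRham (powModel 𝓘(ℂ, E) n) (Fin n → X)).map
      (boxOPerm σ fun i => (M i).X (p i)).hom).f r ≫
    (pushDR (permDiffeo 𝓘(ℂ, E) X σ) _ r).hom ≫
    (pushC (permDiffeo 𝓘(ℂ, E) X σ).toHomeomorph).map
      (((deRham (powModel 𝓘(ℂ, E) n) (Fin n → X)).map (boxOι (fun i => M (σ i))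
        (fun i => p (σ i)) P ((Equiv.sum_comp σ p).trans hP))).f r ≫
        drι (boxO fun i => M (σ i)) P r j)

lemma boxCPerm_boxDRι (σ : Equiv.Perm (Fin n)) (p : Fin n → ℤ) {P : ℤ} (hP : ∑ i, p i = P)
    (k : Fin n → ℕ) (r : ℕ) (j : ℤ) :
    (boxCPerm 𝓘(ℂ, E) σ fun i => ((deRham 𝓘(ℂ, E) X).obj ((M i).X (p i))).X (k i)).hom ≫
      (pushC (permDiffeo 𝓘(ℂ, E) X σ).toHomeomorph).map
        (boxDRι (fun i => M (σ i)) (fun i => p (σ i)) ((Equiv.sum_comp σ p).trans hP)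
          (fun i => k (σ i)) r j) =
      (permSign σ (fun i => (k i : ℤ)) : ℤ) • boxDRPermι M σ p hP k r j :=
  comp_map_comp_of_eq_zsmul _ (boxCPerm_boxDR σ (fun i => (M i).X (p i)) k r) _ _

/-- One composite on a piece: reorder with the sign for `q`, apply the canonical morphism of the
permuted family, and return to the original order of the blocks at the cost of the sign for `k`. -/
lemma boxDrι_sharpC_canonical {σ : Equiv.Perm (Fin n)}
    {s : boxC (fun i => (DR 𝓘(ℂ, E) X).obj (M i)) ≅
      (permPushC 𝓘(ℂ, E) X σ).obj (boxC fun i => (DR 𝓘(ℂ, E) X).obj (M (σ i)))}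
    (hs : IsSharpC σ (fun i => (DR 𝓘(ℂ, E) X).obj (M i)) s)
    {c' : boxC (fun i => (DR 𝓘(ℂ, E) X).obj (M (σ i))) ⟶
      (DR (powModel 𝓘(ℂ, E) n) (Fin n → X)).obj (boxO fun i => M (σ i))}
    (hc' : IsCanonical (fun i => M (σ i)) c')
    {p : Fin n → ℤ} {k : Fin n → ℕ} {q : Fin n → ℤ} (h : ∀ i, p i - k i = q i) {j P : ℤ} {r : ℕ}
    (hj : ∑ i, q i = j) (hP : ∑ i, p i = P) (hr : ∑ i, k i = r) :
    boxDrι M p k q ≫ boxCι _ q j hj ≫ s.hom.f j ≫ ((permPushC 𝓘(ℂ, E) X σ).map c').f j =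
      ((permSign σ q * (crossSign (fun i => p (σ i)) (fun i => k (σ i)) *
        permSign σ (fun i => (k i : ℤ))) : ℤˣ) : ℤ) • boxDRPermι M σ p hP k r j := by
  rw [Units.val_mul, Units.val_mul]
  exact comp_map_eq_of_zsmul (pushC (permDiffeo 𝓘(ℂ, E) X σ).toHomeomorph)
    ((isSharpC_iff 𝓘(ℂ, E) σ _ s).1 hs q j hj)
    (boxCPerm_naturality 𝓘(ℂ, E) σ fun i => drι (M i) (p i) (k i) (q i))
    (hc'.comp (p := fun i => p (σ i)) (k := fun i => k (σ i)) (q := fun i => q (σ i))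
      (fun i => h (σ i)) ((Equiv.sum_comp σ q).trans hj) ((Equiv.sum_comp σ p).trans hP)
      ((Equiv.sum_comp σ k).trans hr))
    (boxCPerm_boxDRι σ p hP k r j)

/-- The other composite on a piece: the canonical morphism with its cross sign, then the reordering
of the modules with the sign for `p`; the comparison `e` contributes no sign. -/
lemma boxDrι_canonical_sharpO {σ : Equiv.Perm (Fin n)}
    {c : boxC (fun i => (DR 𝓘(ℂ, E) X).obj (M i)) ⟶
      (DR (powModel 𝓘(ℂ, E) n) (Fin n → X)).obj (boxO M)} (hc : IsCanonical M c)
    {t : boxO M ≅ (permPushD 𝓘(ℂ, E) X σ).obj (boxO fun i => M (σ i))} (ht : IsSharpO σ M t)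
    {e : (DR (powModel 𝓘(ℂ, E) n) (Fin n → X)).obj
        ((permPushD 𝓘(ℂ, E) X σ).obj (boxO fun i => M (σ i))) ≅
      (permPushC 𝓘(ℂ, E) X σ).obj
        ((DR (powModel 𝓘(ℂ, E) n) (Fin n → X)).obj (boxO fun i => M (σ i)))}
    (he : IsComm (permDiffeo 𝓘(ℂ, E) X σ) (boxO fun i => M (σ i)) e)
    {p : Fin n → ℤ} {k : Fin n → ℕ} {q : Fin n → ℤ} (h : ∀ i, p i - k i = q i) {j P : ℤ} {r : ℕ}
    (hj : ∑ i, q i = j) (hP : ∑ i, p i = P) (hr : ∑ i, k i = r) (hPr : P - r = j) :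
    boxDrι M p k q ≫ boxCι _ q j hj ≫ c.f j ≫
      ((DR (powModel 𝓘(ℂ, E) n) (Fin n → X)).map t.hom).f j ≫ e.hom.f j =
      ((crossSign p k * permSign σ p : ℤˣ) : ℤ) • boxDRPermι M σ p hP k r j := by
  rw [Units.val_mul]
  exact comp_comp_eq_of_zsmul (pushC (permDiffeo 𝓘(ℂ, E) X σ).toHomeomorph)
    (hc.comp h hj hP hr) (drι_map t.hom P r j)
    (deRham_map_comp_zsmul ((isSharpO_iff σ M t).1 ht p P hP) r)
    ((isComm_iff (permDiffeo 𝓘(ℂ, E) X σ) (boxO fun i => M (σ i)) e).1 he P r j hPr)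
    (pushDR_naturality (permDiffeo 𝓘(ℂ, E) X σ) (boxOι (fun i => M (σ i))
        (fun i => p (σ i)) P ((Equiv.sum_comp σ p).trans hP)) r)

theorem sharpC_canonical_comm (hM : ∀ i, ∃ b : ℤ, (M i).IsStrictlyLE b) {σ : Equiv.Perm (Fin n)}
    {c : boxC (fun i => (DR 𝓘(ℂ, E) X).obj (M i)) ⟶
      (DR (powModel 𝓘(ℂ, E) n) (Fin n → X)).obj (boxO M)} (hc : IsCanonical M c)
    {c' : boxC (fun i => (DR 𝓘(ℂ, E) X).obj (M (σ i))) ⟶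
      (DR (powModel 𝓘(ℂ, E) n) (Fin n → X)).obj (boxO fun i => M (σ i))}
    (hc' : IsCanonical (fun i => M (σ i)) c')
    {s : boxC (fun i => (DR 𝓘(ℂ, E) X).obj (M i)) ≅
      (permPushC 𝓘(ℂ, E) X σ).obj (boxC fun i => (DR 𝓘(ℂ, E) X).obj (M (σ i)))}
    (hs : IsSharpC σ (fun i => (DR 𝓘(ℂ, E) X).obj (M i)) s)
    {t : boxO M ≅ (permPushD 𝓘(ℂ, E) X σ).obj (boxO fun i => M (σ i))} (ht : IsSharpO σ M t)
    {e : (DR (powModel 𝓘(ℂ, E) n) (Fin n → X)).obj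
        ((permPushD 𝓘(ℂ, E) X σ).obj (boxO fun i => M (σ i))) ≅
      (permPushC 𝓘(ℂ, E) X σ).obj
        ((DR (powModel 𝓘(ℂ, E) n) (Fin n → X)).obj (boxO fun i => M (σ i)))}
    (he : IsComm (permDiffeo 𝓘(ℂ, E) X σ) (boxO fun i => M (σ i)) e) :
    s.hom ≫ (permPushC 𝓘(ℂ, E) X σ).map c' ≫ e.inv =
      c ≫ (DR (powModel 𝓘(ℂ, E) n) (Fin n → X)).map t.hom := by
  -- Composing with `e` removes the inverse, so that the explicit formula for `e` can be used.
  rw [← Category.assoc, Iso.comp_inv_eq, Category.assoc]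
  ext j : 1
  refine multiTotal_ext _ fun q hq => boxDR_hom_ext M hM fun p k hpk => ?_
  have hPr : ∑ i, p i - (∑ i, k i : ℕ) = j := by
    rw [← hq, ← funext hpk, Finset.sum_sub_distrib, Nat.cast_sum]
  have h1 := boxDrι_sharpC_canonical hs hc' hpk hq rfl rfl
  have h2 := boxDrι_canonical_sharpO hc ht he hpk hq rfl rfl hPr
  -- Both composites are now multiples of `boxDRPermι`, and the two signs are identified.
  rw [← crossSign_permSign, funext hpk] at h2
  exact h1.trans h2.symm

end Diagram

end

end DRSym

theorem proposition1p5 {E : Type*} [NormedAddCommGroup E] [NormedSpace ℂ E]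
    [FiniteDimensional ℂ E] {X : Type*} [TopologicalSpace X] [ChartedSpace E X]
    [IsManifold 𝓘(ℂ, E) ω X] (n : ℕ) (M : Fin n → CochainComplex (DRSym.RightDMod 𝓘(ℂ, E) X) ℤ)
    (hM : ∀ i, (∃ a : ℤ, (M i).IsStrictlyGE a) ∧ ∃ b : ℤ, (M i).IsStrictlyLE b) :
    (∃! c : DRSym.boxC (fun i => (DRSym.DR 𝓘(ℂ, E) X).obj (M i)) ⟶
        (DRSym.DR (DRSym.powModel 𝓘(ℂ, E) n) (Fin n → X)).obj (DRSym.boxO M),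
      DRSym.IsCanonical M c) ∧
    ∀ σ : Equiv.Perm (Fin n),
      (∃! s : DRSym.boxC (fun i => (DRSym.DR 𝓘(ℂ, E) X).obj (M i)) ≅
          (DRSym.permPushC 𝓘(ℂ, E) X σ).obj
            (DRSym.boxC fun i => (DRSym.DR 𝓘(ℂ, E) X).obj (M (σ i))),
        DRSym.IsSharpC σ (fun i => (DRSym.DR 𝓘(ℂ, E) X).obj (M i)) s) ∧
      (∃! t : DRSym.boxO M ≅ (DRSym.permPushD 𝓘(ℂ, E) X σ).obj (DRSym.boxO fun i => M (σ i)),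
        DRSym.IsSharpO σ M t) ∧
      (∃! e : (DRSym.DR (DRSym.powModel 𝓘(ℂ, E) n) (Fin n → X)).obj
            ((DRSym.permPushD 𝓘(ℂ, E) X σ).obj (DRSym.boxO fun i => M (σ i))) ≅
          (DRSym.permPushC 𝓘(ℂ, E) X σ).obj
            ((DRSym.DR (DRSym.powModel 𝓘(ℂ, E) n) (Fin n → X)).obj
              (DRSym.boxO fun i => M (σ i))),
        DRSym.IsComm (DRSym.permDiffeo 𝓘(ℂ, E) X σ) (DRSym.boxO fun i => M (σ i)) e) ∧
      ∀ c c' s t e,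
        DRSym.IsCanonical M c → DRSym.IsCanonical (fun i => M (σ i)) c' →
        DRSym.IsSharpC σ (fun i => (DRSym.DR 𝓘(ℂ, E) X).obj (M i)) s →
        DRSym.IsSharpO σ M t →
        DRSym.IsComm (DRSym.permDiffeo 𝓘(ℂ, E) X σ) (DRSym.boxO fun i => M (σ i)) e →
        s.hom ≫ (DRSym.permPushC 𝓘(ℂ, E) X σ).map c' ≫ e.inv =
          c ≫ (DRSym.DR (DRSym.powModel 𝓘(ℂ, E) n) (Fin n → X)).map t.hom := by
  refine ⟨DRSym.existsUnique_isCanonical M fun i => (hM i).2, fun σ =>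
    ⟨DRSym.existsUnique_isSharpC 𝓘(ℂ, E) σ _, DRSym.existsUnique_isSharpO σ M,
      DRSym.existsUnique_isComm _ _, fun c c' s t e hc hc' hs ht he =>
        DRSym.sharpC_canonical_comm (fun i => (hM i).2) hc hc' hs ht he⟩⟩
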